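/- **Setting.** Let $d=6$. *Random walk.* Let $\mathbf p^1(o,\cdot)$ be a symmetric probability distribution on $\mathbb Z^d$ whose support generates $\mathbb Z^d$ as a group and which satisfies $\sum_x e^{b|x|}\mathbf p^1(o,x)<\infty$ for some $b>0$; let $\mathbf p^n$ be the $n$-step transition probabilities, $Q_{ij}=\sum_x x_ix_j\mathbf p^1(o,x)$, $D=\det(Q)^{1/(2d)}$, $\|x\|=\sqrt{\frac1d\sum_{i,j}x_iQ^{-1}_{ij}x_j}$, and let $\kappa\in\{1,2\}$ be the period of the walk. Write $g_n=\kappa(2\pi)^{-d/2}D^{-d}n^{-d/2}$. Let $n_1\ge1$ be the least integer such that $\mathbf p^n(o,y)\le 2g_n$ for all $n\ge n_1$ and all $y$, and let $n_2\ge1$ be the least integer such that for all $n\ge n_2$ and all $y$ with $\|y\|\le\sqrt n$ one has $\mathbf p^n(o,y)\le\frac32 g_ne^{-d\|y\|^2/(2n)}$ and, if $y$ can be reached from $o$ at some time of the same parity as $n$, $\mathbf p^n(o,y)\ge\frac12 g_ne^{-d\|y\|^2/(2n)}$. Fix an integer $n^*\ge\max\{n_1,n_2\}$, depending only on $\mathbf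 p^1$. *Trees.* Let $p$ be a probability distribution on $\{0,\dots,M\}$ with $\sum_k kp(k)=1$, $\sum_k k(k-1)p(k)=\sigma^2>0$ and $\sum_k k^3p(k)\le C_3$; put $\widetilde p(k)=(k+1)p(k+1)$. For $m\ge 2n$ the tree $\mathcal T_{n,m}$ consists of a backbone $V_0,\dots,V_n$ with root $V_0$, to each $V_i$ of which is attached, independently, a branching tree with offspring law $\widetilde p$ in the first generation and $p$ afterwards, conditioned to have no vertex in generation $m-i$. It is embedded at random in the infinite $M$-ary tree $T_M$ with root $\rho$: the root goes to $\rho$, and the edges from a vertex to its children go to uniformly chosen distinct child edges, independently at different vertices. Let $\mathcal V_n$ be the image of $V_n$. The integer $N$ below is the quantity $\delta n$ of the block construction. Let $(\mathcal T_1,\mathcal V_1)$ and $(\mathcal T_2,\mathcal V_2)$ be independent copies of $(\mathcal T_{N,2N},\mathcal V_N)$, embedded in $T_M$. Independently of these, let $\Phi_1,\Phi_2$ be independent random walk mappings of $T_M$ to $\mathbb Z^d\times\mathbb Z_+$ (i.i.d. displacements with law $\mathbf p^1(o,\cdot)$ along edges; the second coordinate is the height $h$) with $\Phi_1(\rho)=(o,0)$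 and $\Phi_2(\rho)=(x,0)$. Write $\mathcal{TS}_j(A,B)$ if the spatial locations $a,b$ of $A,B$ under $\Phi_j$ satisfy $\|a-b\|\le\sqrt{h(B)-h(A)}$. *Intersections.* For $U_j\in\mathcal T_j$ let $Z_j$ be the highest common ancestor of $U_j$ and $\mathcal V_j$, and $Z_j^+$ the child of $Z_j$ leading to $U_j$. The pair $(U_1,U_2)$ *intersects well* if $\Phi_1(U_1)=\Phi_2(U_2)$, $\frac56N\le h(U_1)=h(U_2)\le N$, and for $j=1,2$: $\frac12N\le h(Z_j)\le\frac46N$, $\mathcal{TS}_j(\rho,Z_j)$ and $\mathcal{TS}_j(Z_j^+,U_j)$. It belongs to $\mathcal I'$ if in addition $h(U_1)\le\frac{11}{12}N$ and the spatial locations satisfy $\|z_j^+-u_j\|\le\frac12\sqrt{h(U_j)-h(Z_j^+)}$ for $j=1,2$. For fixed vertices $V_1,V_2,U_1,U_2$ of $T_M$ let $$\mathcal{IW}'=\mathcal{IW}'(V_1,V_2,U_1,U_2)=\{\mathcal V_1=V_1,\ \mathcal V_2=V_2,\ (U_1,U_2)\in\mathcal I'\}.$$ On $\mathcal{IW}'$,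 a pair $(Y_1,Y_2)$ is a *good extra intersection* if it intersects well, $h(Y_1)=h(Y_2)\ge h(U_1)$, and for $j=1,2$: $Y_j$ is a vertex of $\mathcal T_j$, is $Z_j^+$ or a descendant of it, is not a strict descendant of $U_j$, and the last vertex on the path from $Z_j^+$ to $U_j$ that is an ancestor of $Y_j$ has height $r_j$ with $\frac9{12}N\le r_j\le h(U_j)-n^*$. Let $\widehat I_{V,U}$ be the set of good extra intersections on $\mathcal{IW}'$, and $\emptyset$ otherwise. **Theorem.** There are universal constants $c'>0$ and $C'<\infty$ such that the following holds. For every $\mathbf p^1$ and $n^*$ as above, and all $\sigma_0>0$ and $C_3<\infty$, there is $n_9'$, depending only on these, such that for every $M$, every $p$ as above with $\sigma\ge\sigma_0$, every integer $N\ge n_9'$, every $x\in\mathbb Z^6$ with $\|x\|\le\sqrt N$, and all vertices $V_1,V_2,U_1,U_2$ of $T_M$ with $\mathbf P(\mathcal{IW}')>0$, $$\mathbf E\big[|\widehat I_{V,U}|\,\big|\,\mathcal{IW}'\big]\ge\frac{c'\sigma^4}{D^6}\log N,\qquad \mathbf E\big[|\widehat I_{V,U}|^2\,\big|\,\mathcal{IW}'\big]\le\frac{C'\sigma^8}{D^{12}}\log^2N,$$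 and, with $c'_0=\frac12c'$, $$\mathbf P\Big(|\widehat I_{V,U}|\ge c_0'\frac{\sigma^4}{D^6}\log N\,\Big|\,\mathcal{IW}'\Big)\ge\frac{4(c')^2}{C'}>0 .$$ -/

import Mathlib

open MeasureTheory ProbabilityTheory
open scoped ENNReal

namespace BRW

noncomputable section

/-! ### Random walk on `ℤ^d` -/

/-- The hypotheses on the step law `𝐩¹(o, ·)`: exponential tails (for the Euclidean length),
the possible steps generate `ℤ^d` as a group, and symmetry. -/
structure IsAdmissibleStep {d : ℕ} (P : PMF (Fin d → ℤ)) : Prop where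
  exp_tail : ∃ b : ℝ, 0 < b ∧
    Summable fun x : Fin d → ℤ => Real.exp (b * √(∑ i, (x i : ℝ) ^ 2)) * (P x).toReal
  generates : AddSubgroup.closure {x : Fin d → ℤ | P x ≠ 0} = ⊤
  symm : ∀ x, P x = P (-x)

/-- The law `𝐩ⁿ(o, ·)` of the walk started at the origin after `n` steps. -/
def nStep {d : ℕ} (P : PMF (Fin d → ℤ)) : ℕ → PMF (Fin d → ℤ)
  | 0 => PMF.pure 0
  | n + 1 => (nStep P n).bind fun x => P.map fun y => x + y

/-- The covariance matrix `Q` of the step law. -/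
def covMatrix {d : ℕ} (P : PMF (Fin d → ℤ)) : Matrix (Fin d) (Fin d) ℝ :=
  fun i j => ∑' x : Fin d → ℤ, (x i : ℝ) * (x j : ℝ) * (P x).toReal

/-- `‖x‖ = √((1/d) ∑ᵢⱼ xᵢ Q⁻¹ᵢⱼ xⱼ)`. -/
def wnorm {d : ℕ} (P : PMF (Fin d → ℤ)) (x : Fin d → ℤ) : ℝ :=
  √((1 / (d : ℝ)) * ∑ i, ∑ j, (x i : ℝ) * (covMatrix P)⁻¹ i j * (x j : ℝ))

/-- `D = det(Q)^{1/(2d)}`. -/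
def scaleD {d : ℕ} (P : PMF (Fin d → ℤ)) : ℝ :=
  (covMatrix P).det ^ (1 / (2 * (d : ℝ)))

open Classical in
/-- The period of the walk (for a symmetric step law it is `1` or `2`). -/
def period {d : ℕ} (P : PMF (Fin d → ℤ)) : ℕ :=
  if ∃ n, Odd n ∧ nStep P n 0 ≠ 0 then 1 else 2

/-- The leading term `period · (2π)^{-d/2} / (D^d n^{d/2})` of the local central limit theorem. -/
def lcltPrefactor {d : ℕ} (P : PMF (Fin d → ℤ)) (n : ℕ) : ℝ :=
  (period P : ℝ) * (2 * Real.pi) ^ (-(d : ℝ) / 2) / (scaleD P ^ d * (n : ℝ) ^ ((d : ℝ) / 2))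

/-- From time `n₁` on, all `n`-step probabilities are at most twice the leading term. -/
def IsUpperThreshold {d : ℕ} (P : PMF (Fin d → ℤ)) (n₁ : ℕ) : Prop :=
  ∀ n, n₁ ≤ n → ∀ y, (nStep P n y).toReal ≤ 2 * lcltPrefactor P n

/-- From time `n₂` on, the local central limit theorem holds within factors `1 ± ε` at all `y` with
`‖y‖ ≤ L √n`. The lower bound is for the `y` which the walk can reach at a time of the same
parity as `n` (all `y`, if the period is `1`). -/
def IsLocalThreshold {d : ℕ} (P : PMF (Fin d → ℤ)) (ε L : ℝ) (n₂ : ℕ) : Prop :=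
  ∀ n, n₂ ≤ n → ∀ y, wnorm P y ≤ L * √(n : ℝ) →
    (nStep P n y).toReal
        ≤ (1 + ε) * lcltPrefactor P n * Real.exp (-(d : ℝ) * wnorm P y ^ 2 / (2 * n)) ∧
    ((∃ m, m % 2 = n % 2 ∧ nStep P m y ≠ 0) →
      (1 - ε) * lcltPrefactor P n * Real.exp (-(d : ℝ) * wnorm P y ^ 2 / (2 * n))
        ≤ (nStep P n y).toReal)

/-- The least admissible value of `n* = max {n₁, n₂(ε = 1/2, L = 1)}`. -/
def leastNStar {d : ℕ} (P : PMF (Fin d → ℤ)) : ℕ :=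
  max (sInf {n₁ | IsUpperThreshold P n₁}) (sInf {n₂ | IsLocalThreshold P (1 / 2) 1 n₂})

/-! ### Progeny distributions -/

/-- The progeny distribution has mean `1`. -/
def IsCritical (p : PMF ℕ) : Prop := ∑' k : ℕ, (k : ℝ≥0∞) * p k = 1

/-- `σ = √(∑ k (k - 1) p(k))`. -/
def sigma (p : PMF ℕ) : ℝ := √(∑' k : ℕ, (k : ℝ) * ((k : ℝ) - 1) * (p k).toReal)

/-- `∑ k³ p(k)`. -/
def thirdMoment (p : PMF ℕ) : ℝ := ∑' k : ℕ, (k : ℝ) ^ 3 * (p k).toReal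

/-- The size-biased law `p̃(k) = (k + 1) p(k + 1)`. -/
def sizeBiased (p : PMF ℕ) (hp : IsCritical p) : PMF ℕ :=
  ⟨fun k => ((k + 1 : ℕ) : ℝ≥0∞) * p (k + 1), by
    have h : ∑' k : ℕ, ((k + 1 : ℕ) : ℝ≥0∞) * p (k + 1) = 1 := by
      have h0 := tsum_eq_zero_add' (f := fun k : ℕ => (k : ℝ≥0∞) * p k) ENNReal.summable
      rw [IsCritical] at hp
      rw [hp] at h0
      simpa using h0.symm
    rw [← h]
    exact ENNReal.summable.hasSum⟩

/-! ### The infinite `M`-ary tree `T_M`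

Vertices are words over `Fin M`; the root is `[]` and the children of `u` are the `u ++ [a]`.
The height is the length, and `u` is an ancestor of `v` (or equal to it) if `u <+: v`. -/

/-- The highest common ancestor (longest common prefix) of two vertices. -/
def hca {M : ℕ} : List (Fin M) → List (Fin M) → List (Fin M)
  | a :: u, b :: v => if a = b then a :: hca u v else []
  | _, _ => []

/-- The vertex following `hca U V` on the path towards `U`. -/
def hcaPlus {M : ℕ} (U V : List (Fin M)) : List (Fin M) := U.take ((hca U V).length + 1)

/-! ### The random tree `𝒯_{n,m}`, randomly embedded in `T_M` -/

/-- The positions in `Fin M` of the children of an ordinary vertex: a number `k` of children with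
law `p`, and a uniformly random choice of `k` of the `M` positions
(`min` is only there to make this total: `k ≤ M` for the laws considered). -/
def offspringLaw (M : ℕ) (p : PMF ℕ) : PMF (Finset (Fin M)) :=
  p.bind fun k =>
    PMF.uniformOfFinset (Finset.powersetCard (min k M) (Finset.univ : Finset (Fin M)))
      (Finset.powersetCard_nonempty.2 (by simp))

/-- The positions of the children of a backbone vertex: the edge along the backbone gets a uniform
position `a`, and the other `k` edges, where `k` has law `p̃`, get a uniformly random set `A` of
`k` of the remaining `M - 1` positions. -/
def backboneOffspringLaw (M : ℕ) [NeZero M] (p : PMF ℕ) (hp : IsCritical p) :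
    PMF (Fin M × Finset (Fin M)) :=
  (PMF.uniformOfFintype (Fin M)).bind fun a =>
    (sizeBiased p hp).bind fun k =>
      (PMF.uniformOfFinset
        (Finset.powersetCard (min k (M - 1)) ((Finset.univ : Finset (Fin M)).erase a))
        (Finset.powersetCard_nonempty.2 (by simp))).map fun A => (a, A)

/-- The data `((a, A), ω)` of a bush attached to a backbone vertex `V`: the position `a` of the
backbone child of `V`, the positions `A` of the other children of `V`, and the positions `ω w` of
the children of the vertex `V ++ w`, for `w ≠ []`. -/
abbrev BushSample (M : ℕ) : Type := (Fin M × Finset (Fin M)) × (List (Fin M) → Finset (Fin M))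

/-- The vertices of the bush, as words relative to its root. -/
def bush {M : ℕ} (b : BushSample M) : Set (List (Fin M)) :=
  {w | ∀ (u : List (Fin M)) (a : Fin M), (u ++ [a]) <+: w →
    a ∈ (if u = [] then b.1.2 else b.2 u)}

/-- The law of a critical bush with first generation `p̃` and later offspring `p`. -/
def bushLaw (M : ℕ) [NeZero M] (p : PMF ℕ) (hp : IsCritical p) : Measure (BushSample M) :=
  (backboneOffspringLaw M p hp).toMeasure.prod
    (Measure.infinitePi fun _ : List (Fin M) => (offspringLaw M p).toMeasure)

/-- The bush has no vertex in generation `t`, i.e. it dies out by time `t`. -/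
def diesOutBy {M : ℕ} (t : ℕ) : Set (BushSample M) := {b | ∀ w ∈ bush b, w.length < t}

/-- The data of the tree `𝒯_{n,m}`: one bush for each of the backbone vertices `V_0, …, V_n`. -/
abbrev TreeSample (M n : ℕ) : Type := Fin (n + 1) → BushSample M

/-- The law of `𝒯_{n,m}`: independent bushes, the `i`-th one conditioned to die out by
time `m - i`. -/
def treeLaw (M : ℕ) [NeZero M] (p : PMF ℕ) (hp : IsCritical p) (n m : ℕ) :
    Measure (TreeSample M n) :=
  Measure.pi fun i : Fin (n + 1) => (bushLaw M p hp)[|diesOutBy (m - (i : ℕ))]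

/-- The backbone vertex `V_i`, for `i ≤ n`. -/
def backbone {M n : ℕ} (s : TreeSample M n) (i : ℕ) : List (Fin M) :=
  (List.ofFn fun j : Fin (n + 1) => (s j).1.1).take i

/-- The vertex set of the tree `𝒯_{n,m}` in `T_M`. -/
def treeSet {M n : ℕ} (s : TreeSample M n) : Set (List (Fin M)) :=
  {v | ∃ i : Fin (n + 1), ∃ w ∈ bush (s i), v = backbone s i ++ w}

/-! ### The random walk mappings and the pair of trees -/

/-- The displacements along the edges of `T_M`: `ξ v` belongs to the edge between `v ≠ []` and
its parent. -/
abbrev Displacements (M d : ℕ) : Type := List (Fin M) → (Fin d → ℤ)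

/-- The spatial location of the vertex `v`, if the root is mapped to `x`. -/
def location {M d : ℕ} (x : Fin d → ℤ) (ξ : Displacements M d) (v : List (Fin M)) : Fin d → ℤ :=
  x + ∑ j ∈ Finset.range v.length, ξ (v.take (j + 1))

/-- A tree together with a random walk mapping. -/
abbrev WalkSample (M d N : ℕ) : Type := TreeSample M N × Displacements M d

/-- The law of `𝒯_{N,2N}` together with an independent random walk mapping of `T_M`, whose
displacements along edges are i.i.d. with law `P`. -/
def walkLaw (M : ℕ) [NeZero M] {d : ℕ} (p : PMF ℕ) (hp : IsCritical p)
    (P : PMF (Fin d → ℤ)) (N : ℕ) : Measure (WalkSample M d N) :=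
  (treeLaw M p hp N (2 * N)).prod (Measure.infinitePi fun _ : List (Fin M) => P.toMeasure)

/-- The law of two independent copies. -/
def pairLaw (M : ℕ) [NeZero M] {d : ℕ} (p : PMF ℕ) (hp : IsCritical p)
    (P : PMF (Fin d → ℤ)) (N : ℕ) : Measure (WalkSample M d N × WalkSample M d N) :=
  (walkLaw M p hp P N).prod (walkLaw M p hp P N)

/-- The part of intersecting well that concerns one of the two trees (with root at `x`, and `V` the
last backbone vertex): `U` is in the tree, has the right height, branches off the path from the
root to `V` at a vertex `Z` of the right height, and root and `Z`, as well as `Z⁺` and `U`, are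
typically spaced. The last bound is taken with the factor `a`. -/
def SpacedWell {M d N : ℕ} (P : PMF (Fin d → ℤ)) (x : Fin d → ℤ) (a : ℝ)
    (s : WalkSample M d N) (U : List (Fin M)) : Prop :=
  let V := backbone s.1 N
  let Z := hca U V
  let Zp := hcaPlus U V
  U ∈ treeSet s.1 ∧
  (5 / 6 : ℝ) * N ≤ U.length ∧ U.length ≤ N ∧
  (1 / 2 : ℝ) * N ≤ Z.length ∧ (Z.length : ℝ) ≤ (4 / 6) * N ∧
  wnorm P (location x s.2 Z - x) ≤ √(Z.length : ℝ) ∧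
  wnorm P (location x s.2 U - location x s.2 Zp) ≤ a * √((U.length : ℝ) - Zp.length)

/-- `U₁` and `U₂` intersect well, if the roots are at `o` and `x`. -/
def IntersectWell {M d N : ℕ} (P : PMF (Fin d → ℤ)) (x : Fin d → ℤ)
    (ω : WalkSample M d N × WalkSample M d N) (U₁ U₂ : List (Fin M)) : Prop :=
  SpacedWell P 0 1 ω.1 U₁ ∧ SpacedWell P x 1 ω.2 U₂ ∧ U₁.length = U₂.length ∧
  location 0 ω.1.2 U₁ = location x ω.2.2 U₂

/-- `(U₁, U₂) ∈ ℐ'`: intersecting well, with the stronger height and distance restrictions. -/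
def IntersectWell' {M d N : ℕ} (P : PMF (Fin d → ℤ)) (x : Fin d → ℤ)
    (ω : WalkSample M d N × WalkSample M d N) (U₁ U₂ : List (Fin M)) : Prop :=
  IntersectWell P x ω U₁ U₂ ∧ (U₁.length : ℝ) ≤ (11 / 12) * N ∧
  SpacedWell P 0 (1 / 2) ω.1 U₁ ∧ SpacedWell P x (1 / 2) ω.2 U₂

/-- The event `ℐ𝒲'(V₁, V₂, U₁, U₂)`. -/
def eventIW {M d : ℕ} (N : ℕ) (P : PMF (Fin d → ℤ)) (x : Fin d → ℤ)
    (V₁ V₂ U₁ U₂ : List (Fin M)) : Set (WalkSample M d N × WalkSample M d N) :=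
  {ω | backbone ω.1.1 N = V₁ ∧ backbone ω.2.1 N = V₂ ∧ IntersectWell' P x ω U₁ U₂}

/-- The part of being a good extra intersection that concerns one of the two trees: `Y` is in
`𝒯^B`, the part of the tree consisting of the descendants of `Z⁺` that are not (strict)
descendants of `U`; it branches off the path from `Z⁺` to `U` at height `r` with
`(9/12) N ≤ r ≤ h(U) - n*`; and `h(U) ≤ h(Y)`. Here `W^{(r)} = U.take r`. -/
def GoodBranch {M n : ℕ} (N nstar : ℕ) (s : TreeSample M n) (V U Y : List (Fin M)) : Prop :=
  Y ∈ treeSet s ∧ hcaPlus U V <+: Y ∧ (U <+: Y → Y = U) ∧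
  (∃ r : ℕ, (9 / 12 : ℝ) * N ≤ r ∧ r + nstar ≤ U.length ∧
    U.take r <+: Y ∧ ¬ U.take (r + 1) <+: Y) ∧
  U.length ≤ Y.length

/-- The random set `Î_{V,U}` of good extra intersections. -/
def goodExtra {M d N : ℕ} (nstar : ℕ) (P : PMF (Fin d → ℤ)) (x : Fin d → ℤ)
    (V₁ V₂ U₁ U₂ : List (Fin M)) (ω : WalkSample M d N × WalkSample M d N) :
    Set (List (Fin M) × List (Fin M)) :=
  {Y | ω ∈ eventIW N P x V₁ V₂ U₁ U₂ ∧
    GoodBranch N nstar ω.1.1 V₁ U₁ Y.1 ∧ GoodBranch N nstar ω.2.1 V₂ U₂ Y.2 ∧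
    IntersectWell P x ω Y.1 Y.2}

end

end BRW

/-! The number of good extra intersections is a sum of indicators over pairs of vertices. Its
conditional moments are computed by separating genealogy from displacements, which are independent.

Genealogy. In each tree only the subtree above `Z⁺` matters, a Galton–Watson tree that has to die
out by a given time. The rest of the tree contributes a factor that does not depend on which
vertices are demanded (`treeLaw_event`), and this factor disappears on conditioning. Demanding one
more vertex, which leaves the already demanded subtree at a vertex with `c` demanded children,
multiplies the probability, summed over all such vertices of a generation, by a generation mean and
by the ratio of the derivatives of orders `c + 1` and `c` of the generating function, taken at an
extinction probability (`sum_gwProb_attach`). Survival up to time `t` has probability of order at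
most `1/t` (`survival_mul_le`), so this argument is close to `1`, the generation mean is of order
one, and for `c = 1` the ratio is comparable with `σ²`.

Displacements. Two new branches with `m` fresh edges in all meet with probability at most the
maximal `m`-step probability, of order `D⁻⁶ m⁻³` (`meet_paths_le`). Conversely, for branches leaving
`a₁ ≤ a₂` generations before `U₁`, `U₂` and ending `t` generations after them, the conditional
meeting probability is at least of order `D⁻⁶ (a₂ + t)⁻³`: conditioning on the meeting of `U₁` and
`U₂` changes the law of the last `a₁` and `a₂` steps only by a bounded factor (`bridge_lower`,
`paths_lower`). The sum of this kernel over the three indices is a logarithm, and the two trees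
contribute `σ²` each; hence the first moment.

For the second moment, two extra pairs are ordered by height, and the higher one is attached to the
subtrees spanned by `U` and the lower one, so that each pair costs one factor of first-moment order
(`sum_pair_branch_le`). Leaves and the branch point of a spanned subtree have a worse weight, but
there are at most three of them; using one removes a free index, and the kernel sum is then bounded.
A Paley–Zygmund type inequality (`half_le_of_moments`) concludes.

The input on the walk is a local central limit theorem uniform in the position, proved by Fourier
inversion. -/

namespace BRW

/-! ### Convolution powers of the step law and Fourier inversion on the torus. -/

section Walk

variable {d : ℕ} {P : PMF (Fin d → ℤ)}

theorem map_add_left_apply (P : PMF (Fin d → ℤ)) (x z : Fin d → ℤ) :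
    (P.map fun y => x + y) z = P (z - x) := by
  rw [PMF.map_apply, tsum_eq_single (z - x)]
  · simp
  · intro y hy
    rw [if_neg]
    rintro rfl
    exact hy (by abel)

theorem nStep_succ_apply (P : PMF (Fin d → ℤ)) (n : ℕ) (z : Fin d → ℤ) :
    nStep P (n + 1) z = ∑' x, nStep P n x * P (z - x) := by
  simp only [nStep, PMF.bind_apply, map_add_left_apply]

theorem nStep_zero_apply (P : PMF (Fin d → ℤ)) (z : Fin d → ℤ) :
    nStep P 0 z = if z = 0 then 1 else 0 := by
  simp [nStep, PMF.pure_apply]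

theorem nStep_one (P : PMF (Fin d → ℤ)) : nStep P 1 = P := by
  ext z
  rw [nStep_succ_apply, tsum_eq_single 0]
  · simp [nStep_zero_apply]
  · intro x hx
    simp [nStep_zero_apply, hx]

/-- Chapman–Kolmogorov. -/
theorem nStep_add_apply (P : PMF (Fin d → ℤ)) (m n : ℕ) (z : Fin d → ℤ) :
    nStep P (m + n) z = ∑' x, nStep P m x * nStep P n (z - x) := by
  induction n generalizing z with
  | zero =>
    rw [tsum_eq_single z]
    · simp [nStep_zero_apply]
    · intro x hx
      rw [nStep_zero_apply, if_neg, mul_zero]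
      exact fun h => hx (sub_eq_zero.1 h).symm
  | succ n ih =>
    rw [← add_assoc, nStep_succ_apply]
    simp_rw [ih, nStep_succ_apply P n, ← ENNReal.tsum_mul_right, ← ENNReal.tsum_mul_left]
    rw [ENNReal.tsum_comm]
    refine tsum_congr fun x => ?_
    rw [← (Equiv.addRight x).tsum_eq]
    refine tsum_congr fun y => ?_
    simp only [Equiv.coe_addRight, add_sub_cancel_right, mul_assoc]
    congr 3
    abel_nf

theorem nStep_neg (hs : ∀ x, P x = P (-x)) (n : ℕ) (z : Fin d → ℤ) :
    nStep P n (-z) = nStep P n z := by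
  induction n generalizing z with
  | zero => simp [nStep_zero_apply]
  | succ n ih =>
    rw [nStep_succ_apply, nStep_succ_apply, ← (Equiv.neg (Fin d → ℤ)).tsum_eq]
    refine tsum_congr fun x => ?_
    simp only [Equiv.neg_apply]
    rw [ih, hs (-z - -x)]
    congr 2
    abel

theorem nStep_add_ne_zero {m n : ℕ} {x y : Fin d → ℤ} (hx : nStep P m x ≠ 0)
    (hy : nStep P n y ≠ 0) : nStep P (m + n) (x + y) ≠ 0 := by
  rw [nStep_add_apply]
  intro h
  rw [ENNReal.tsum_eq_zero] at h
  have := h x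
  simp_all

theorem tsum_toReal_eq_one {α : Type*} (p : PMF α) : ∑' x, (p x).toReal = 1 := by
  rw [← ENNReal.tsum_toReal_eq fun x => p.apply_ne_top x, p.tsum_coe, ENNReal.toReal_one]

theorem summable_toReal {α : Type*} (p : PMF α) : Summable fun x => (p x).toReal :=
  ENNReal.summable_toReal (by simp [p.tsum_coe])

theorem summable_toReal_mul_of_bounded {α : Type*} (p : PMF α) {f : α → ℝ} {C : ℝ}
    (hf : ∀ x, |f x| ≤ C) : Summable fun x => (p x).toReal * f x := by
  refine Summable.of_norm_bounded ((summable_toReal p).mul_right C) fun x => ?_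
  rw [Real.norm_eq_abs, abs_mul, abs_of_nonneg ENNReal.toReal_nonneg]
  exact mul_le_mul_of_nonneg_left (hf x) ENNReal.toReal_nonneg

/-- A shear of the plane is a bijection, so this is a summable product family in disguise. It
licenses the exchange of sums in `tsum_convolution_mul`. -/
theorem summable_mul_shift {p q : (Fin d → ℤ) → ℝ} (hp : Summable p) (hq : Summable q)
    (hp0 : ∀ x, 0 ≤ p x) (hq0 : ∀ x, 0 ≤ q x) :
    Summable fun z : (Fin d → ℤ) × (Fin d → ℤ) => p z.1 * q (z.2 - z.1) := by
  let e : (Fin d → ℤ) × (Fin d → ℤ) ≃ (Fin d → ℤ) × (Fin d → ℤ) :=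
    ⟨fun z => (z.1, z.2 - z.1), fun z => (z.1, z.2 + z.1), fun z => by simp, fun z => by simp⟩
  exact (e.summable_iff (f := fun z : (Fin d → ℤ) × (Fin d → ℤ) => p z.1 * q z.2)).2
    (hp.mul_of_nonneg hq hp0 hq0)

theorem tsum_convolution_mul {p q f : (Fin d → ℤ) → ℝ} (hp : Summable p) (hq : Summable q)
    (hp0 : ∀ x, 0 ≤ p x) (hq0 : ∀ x, 0 ≤ q x) {C : ℝ} (hf : ∀ x, |f x| ≤ C) :
    ∑' z, (∑' x, p x * q (z - x)) * f z = ∑' x, p x * ∑' y, q y * f (x + y) := by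
  have hsum : Summable fun z : (Fin d → ℤ) × (Fin d → ℤ) => p z.1 * q (z.2 - z.1) * f z.2 := by
    refine Summable.of_norm_bounded ((summable_mul_shift hp hq hp0 hq0).mul_right C) fun z => ?_
    have h0 : 0 ≤ p z.1 * q (z.2 - z.1) := mul_nonneg (hp0 _) (hq0 _)
    rw [Real.norm_eq_abs, abs_mul, abs_of_nonneg h0]
    exact mul_le_mul_of_nonneg_left (hf _) h0
  calc ∑' z, (∑' x, p x * q (z - x)) * f z
      = ∑' z, ∑' x, p x * q (z - x) * f z := tsum_congr fun z => tsum_mul_right.symm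
    _ = ∑' x, ∑' z, p x * q (z - x) * f z := hsum.tsum_comm
    _ = _ := by
        refine tsum_congr fun x => ?_
        rw [← (Equiv.addRight x).tsum_eq, ← tsum_mul_left]
        refine tsum_congr fun y => ?_
        simp [mul_assoc, add_comm]

theorem tsum_nStep_succ_mul (P : PMF (Fin d → ℤ)) (n : ℕ) {f : (Fin d → ℤ) → ℝ} {C : ℝ}
    (hf : ∀ x, |f x| ≤ C) :
    ∑' z, (nStep P (n + 1) z).toReal * f z
      = ∑' x, (nStep P n x).toReal * ∑' y, (P y).toReal * f (x + y) := by
  rw [← tsum_convolution_mul (summable_toReal _) (summable_toReal P)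
    (fun _ => ENNReal.toReal_nonneg) (fun _ => ENNReal.toReal_nonneg) hf]
  refine tsum_congr fun z => ?_
  rw [nStep_succ_apply, ENNReal.tsum_toReal_eq]
  · simp
  · exact fun x => ENNReal.mul_ne_top (PMF.apply_ne_top _ _) (PMF.apply_ne_top _ _)

/-! ### The characteristic function -/

/-- The pairing of a frequency with a lattice point. -/
def pairing (θ : Fin d → ℝ) (x : Fin d → ℤ) : ℝ := ∑ i, θ i * x i

theorem pairing_add (θ : Fin d → ℝ) (x y : Fin d → ℤ) :
    pairing θ (x + y) = pairing θ x + pairing θ y := by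
  simp [pairing, mul_add, Finset.sum_add_distrib]

theorem pairing_neg (θ : Fin d → ℝ) (x : Fin d → ℤ) : pairing θ (-x) = -pairing θ x := by
  simp [pairing]

theorem pairing_zero (θ : Fin d → ℝ) : pairing θ (0 : Fin d → ℤ) = 0 := by simp [pairing]

theorem pairing_smul (c : ℝ) (θ : Fin d → ℝ) (x : Fin d → ℤ) :
    pairing (c • θ) x = c * pairing θ x := by
  simp [pairing, Finset.mul_sum, mul_assoc]

@[fun_prop]
theorem continuous_pairing (x : Fin d → ℤ) : Continuous fun θ : Fin d → ℝ => pairing θ x := by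
  unfold pairing
  fun_prop

/-- The characteristic function of a symmetric step law. -/
noncomputable def stepChar (P : PMF (Fin d → ℤ)) (θ : Fin d → ℝ) : ℝ :=
  ∑' x, (P x).toReal * Real.cos (2 * Real.pi * pairing θ x)

/-- By symmetry the sum equals its own negative. Hence characteristic functions are real and cosines
suffice throughout. -/
theorem tsum_sin_eq_zero (hs : ∀ x, P x = P (-x)) (θ : Fin d → ℝ) :
    ∑' x, (P x).toReal * Real.sin (2 * Real.pi * pairing θ x) = 0 := by
  have h : ∑' x, (P x).toReal * Real.sin (2 * Real.pi * pairing θ x)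
      = -∑' x, (P x).toReal * Real.sin (2 * Real.pi * pairing θ x) := by
    conv_lhs => rw [← (Equiv.neg (Fin d → ℤ)).tsum_eq]
    rw [← tsum_neg]
    refine tsum_congr fun x => ?_
    simp [pairing_neg, ← hs x]
  linarith

/-- Multiplicativity under convolution: in the addition formula for the cosine the sine part drops
out by symmetry. -/
theorem tsum_nStep_mul_cos (hs : ∀ x, P x = P (-x)) (n : ℕ) (θ : Fin d → ℝ) :
    ∑' x, (nStep P n x).toReal * Real.cos (2 * Real.pi * pairing θ x) = stepChar P θ ^ n := by
  induction n with
  | zero =>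
    rw [tsum_eq_single 0]
    · simp [nStep_zero_apply, pairing_zero]
    · intro x hx
      simp [nStep_zero_apply, hx]
  | succ n ih =>
    rw [tsum_nStep_succ_mul P n (C := 1) fun x => Real.abs_cos_le_one _, pow_succ, ← ih,
      ← tsum_mul_right]
    refine tsum_congr fun x => ?_
    rw [mul_assoc]
    congr 1
    have h : ∀ y, (P y).toReal * Real.cos (2 * Real.pi * pairing θ (x + y))
        = (P y).toReal * Real.cos (2 * Real.pi * pairing θ y) *
            Real.cos (2 * Real.pi * pairing θ x)
          - (P y).toReal * Real.sin (2 * Real.pi * pairing θ y) *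
            Real.sin (2 * Real.pi * pairing θ x) := by
      intro y
      rw [pairing_add, mul_add, Real.cos_add]
      ring
    simp_rw [h]
    rw [Summable.tsum_sub, tsum_mul_right, tsum_mul_right, tsum_sin_eq_zero hs, stepChar]
    · ring
    · exact (summable_toReal_mul_of_bounded P fun x => Real.abs_cos_le_one _).mul_right _
    · exact (summable_toReal_mul_of_bounded P fun x => Real.abs_sin_le_one _).mul_right _

theorem continuous_stepChar (P : PMF (Fin d → ℤ)) : Continuous (stepChar P) := by
  refine continuous_tsum (u := fun x => (P x).toReal) (fun x => by fun_prop) (summable_toReal P) ?_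
  intro x θ
  rw [Real.norm_eq_abs, abs_mul, abs_of_nonneg ENNReal.toReal_nonneg]
  exact mul_le_of_le_one_right ENNReal.toReal_nonneg (Real.abs_cos_le_one _)

theorem abs_stepChar_le_one (P : PMF (Fin d → ℤ)) (θ : Fin d → ℝ) : |stepChar P θ| ≤ 1 := by
  rw [← tsum_toReal_eq_one P, stepChar, ← Real.norm_eq_abs]
  refine tsum_of_norm_bounded (summable_toReal P).hasSum fun x => ?_
  rw [Real.norm_eq_abs, abs_mul, abs_of_nonneg ENNReal.toReal_nonneg]
  exact mul_le_of_le_one_right ENNReal.toReal_nonneg (Real.abs_cos_le_one _)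

theorem hasSum_one_sub_stepChar (P : PMF (Fin d → ℤ)) (θ : Fin d → ℝ) :
    HasSum (fun x => (P x).toReal * (1 - Real.cos (2 * Real.pi * pairing θ x)))
      (1 - stepChar P θ) := by
  have h1 := (summable_toReal P).hasSum
  rw [tsum_toReal_eq_one] at h1
  have h2 := (summable_toReal_mul_of_bounded P fun x =>
    Real.abs_cos_le_one (2 * Real.pi * pairing θ x)).hasSum
  simpa [mul_sub, stepChar] using h1.sub h2

/-- The half-open unit cube centred at the origin. -/
def unitCube (d : ℕ) : Set (Fin d → ℝ) := Set.univ.pi fun _ => Set.Ioc (-(1 / 2) : ℝ) (1 / 2)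

theorem measurableSet_unitCube : MeasurableSet (unitCube d) :=
  MeasurableSet.univ_pi fun _ => measurableSet_Ioc

theorem volume_unitCube : volume (unitCube d) = 1 := by
  simp only [unitCube, volume_pi_pi, Real.volume_Ioc]
  norm_num

theorem integral_cexp_Ioc (k : ℤ) :
    ∫ t in Set.Ioc (-(1 / 2) : ℝ) (1 / 2), Complex.exp (2 * Real.pi * Complex.I * (t * k))
      = if k = 0 then 1 else 0 := by
  rw [← intervalIntegral.integral_of_le (by norm_num)]
  split_ifs with h
  · subst h
    simp only [Int.cast_zero, mul_zero, Complex.exp_zero, intervalIntegral.integral_const]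
    norm_num
  · have hc : (2 * Real.pi * Complex.I * k : ℂ) ≠ 0 := by
      simp [h, Real.pi_ne_zero]
    have : ∀ t : ℝ, (2 * Real.pi * Complex.I * (t * k) : ℂ) = (2 * Real.pi * Complex.I * k) * t :=
      fun t => by ring
    simp_rw [this]
    rw [integral_exp_mul_complex hc]
    have h2 : Complex.exp (2 * Real.pi * Complex.I * k * ((1 / 2 : ℝ) : ℂ))
        = Complex.exp (2 * Real.pi * Complex.I * k * ((-(1 / 2) : ℝ) : ℂ)) := by
      rw [Complex.exp_eq_exp_iff_exists_int]
      refine ⟨k, ?_⟩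
      push_cast
      ring
    rw [h2]
    simp

/-- Orthogonality of characters, factorised over coordinates; with the factor `2π` in the
frequencies the torus is a cube of volume one. -/
theorem integral_cos_unitCube (m : Fin d → ℤ) :
    ∫ θ in unitCube d, Real.cos (2 * Real.pi * pairing θ m) = if m = 0 then 1 else 0 := by
  have h1 : ∫ θ in unitCube d, Complex.exp (2 * Real.pi * Complex.I * (pairing θ m : ℝ))
      = if m = 0 then 1 else 0 := by
    have : ∀ θ : Fin d → ℝ, Complex.exp (2 * Real.pi * Complex.I * (pairing θ m : ℝ))
        = ∏ i, Complex.exp (2 * Real.pi * Complex.I * ((θ i : ℂ) * (m i : ℂ))) := by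
      intro θ
      rw [← Complex.exp_sum, pairing, ← Finset.mul_sum]
      push_cast
      rfl
    simp_rw [this]
    rw [unitCube, volume_pi, Measure.restrict_pi_pi,
      integral_fintype_prod_eq_prod (f := fun i (t : ℝ) =>
        Complex.exp (2 * Real.pi * Complex.I * ((t : ℂ) * (m i : ℂ))))]
    simp_rw [integral_cexp_Ioc]
    split_ifs with h
    · simp [h]
    · obtain ⟨i, hi⟩ := Function.ne_iff.1 h
      exact Finset.prod_eq_zero (Finset.mem_univ i) (by simpa using hi)
  have h2 : Integrable (fun θ => Complex.exp (2 * Real.pi * Complex.I * (pairing θ m : ℝ)))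
      (volume.restrict (unitCube d)) := by
    have : IsFiniteMeasure ((volume : Measure (Fin d → ℝ)).restrict (unitCube d)) :=
      ⟨by simp [volume_unitCube]⟩
    refine Integrable.of_bound (C := 1) (by
      apply Continuous.aestronglyMeasurable; fun_prop) (ae_of_all _ fun θ => ?_)
    have : (2 * Real.pi * Complex.I * (pairing θ m : ℝ) : ℂ)
      = ((2 * Real.pi * pairing θ m : ℝ) : ℂ) * Complex.I := by push_cast; ring
    rw [this, Complex.norm_exp_ofReal_mul_I]
  have h3 := integral_re h2
  have : ∀ θ : Fin d → ℝ, RCLike.re (Complex.exp (2 * Real.pi * Complex.I * (pairing θ m : ℝ)))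
      = Real.cos (2 * Real.pi * pairing θ m) := by
    intro θ
    have : (2 * Real.pi * Complex.I * (pairing θ m : ℝ) : ℂ)
      = ((2 * Real.pi * pairing θ m : ℝ) : ℂ) * Complex.I := by push_cast; ring
    rw [this]
    exact Complex.exp_ofReal_mul_I_re _
  simp_rw [this] at h3
  rw [h3, h1]
  split_ifs <;> simp

theorem isFiniteMeasure_unitCube :
    IsFiniteMeasure ((volume : Measure (Fin d → ℝ)).restrict (unitCube d)) :=
  ⟨by simp [volume_unitCube]⟩

/-- Fourier inversion for the `n`-step law. -/
theorem nStep_toReal_eq_integral (hs : ∀ x, P x = P (-x)) (n : ℕ) (y : Fin d → ℤ) :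
    (nStep P n y).toReal
      = ∫ θ in unitCube d, stepChar P θ ^ n * Real.cos (2 * Real.pi * pairing θ y) := by
  have := isFiniteMeasure_unitCube (d := d)
  set F : (Fin d → ℤ) → (Fin d → ℝ) → ℝ := fun x θ => (nStep P n x).toReal *
    (Real.cos (2 * Real.pi * pairing θ x) * Real.cos (2 * Real.pi * pairing θ y)) with hF
  have hb : ∀ x θ, ‖F x θ‖ ≤ (nStep P n x).toReal := by
    intro x θ
    rw [hF, Real.norm_eq_abs, abs_mul, abs_of_nonneg ENNReal.toReal_nonneg, abs_mul]
    refine mul_le_of_le_one_right ENNReal.toReal_nonneg ?_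
    exact mul_le_one₀ (Real.abs_cos_le_one _) (abs_nonneg _) (Real.abs_cos_le_one _)
  have hint : ∀ x, Integrable (F x) (volume.restrict (unitCube d)) := fun x =>
    Integrable.of_bound (C := (nStep P n x).toReal)
      (by apply Continuous.aestronglyMeasurable; fun_prop) (ae_of_all _ (hb x))
  have hsum : Summable fun x => ∫ θ in unitCube d, ‖F x θ‖ := by
    refine Summable.of_nonneg_of_le (fun x => integral_nonneg fun _ => norm_nonneg _) (fun x => ?_)
      (summable_toReal (nStep P n))
    calc ∫ θ in unitCube d, ‖F x θ‖ ≤ ∫ θ in unitCube d, (nStep P n x).toReal :=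
          integral_mono (hint x).norm (integrable_const _) (hb x)
      _ = _ := by simp [measureReal_def, volume_unitCube]
  have h1 := integral_tsum_of_summable_integral_norm hint hsum
  have h2 : ∀ θ, ∑' x, F x θ = stepChar P θ ^ n * Real.cos (2 * Real.pi * pairing θ y) := by
    intro θ
    rw [← tsum_nStep_mul_cos hs, ← tsum_mul_right]
    exact tsum_congr fun x => by simp only [hF]; ring
  simp_rw [h2] at h1
  rw [← h1]
  -- A product of cosines is half the sum of the cosines of the difference and of the sum, so `x =
  -- y` and `x = -y` contribute one half each; symmetry of the `n`-step law recombines them.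
  have h3 : ∀ x, ∫ θ in unitCube d, F x θ
      = (nStep P n x).toReal *
        (((if x - y = 0 then 1 else 0) + if x + y = 0 then 1 else 0) / 2) := by
    intro x
    rw [← integral_cos_unitCube, ← integral_cos_unitCube, ← integral_add, ← integral_div,
      ← integral_const_mul]
    · refine integral_congr_ae (ae_of_all _ fun θ => ?_)
      simp only [hF]
      rw [sub_eq_add_neg, pairing_add, pairing_add, pairing_neg, mul_add, mul_add, Real.cos_add,
        Real.cos_add, mul_neg, Real.cos_neg, Real.sin_neg]
      ring
    all_goals
      refine Integrable.of_bound (C := 1) (by apply Continuous.aestronglyMeasurable; fun_prop)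
        (ae_of_all _ fun θ => Real.abs_cos_le_one _)
  simp_rw [h3]
  have h4 : ∀ x, (nStep P n x).toReal *
      (((if x - y = 0 then (1 : ℝ) else 0) + if x + y = 0 then 1 else 0) / 2)
      = (if x = y then (nStep P n y).toReal / 2 else 0)
        + if x = -y then (nStep P n y).toReal / 2 else 0 := by
    intro x
    simp only [sub_eq_zero, add_eq_zero_iff_eq_neg]
    by_cases h : x = y <;> by_cases h' : x = -y
    · have h'' : y = -y := h ▸ h'
      rw [if_pos h, if_pos h', if_pos h, if_pos h', h]
      ring
    · simp [h, show ¬ y = -y from h ▸ h']; ring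
    · simp [h', show ¬ -y = y from h' ▸ h, nStep_neg hs]; ring
    · simp [h, h']
  simp_rw [h4]
  rw [((hasSum_ite_eq y _).add (hasSum_ite_eq (-y) _)).tsum_eq]
  ring

end Walk


/-! ### Moments of the step law and bounds on its characteristic function. -/

section Covariance

variable {d : ℕ} {P : PMF (Fin d → ℤ)}

/-- The quadratic form of the covariance matrix. -/
noncomputable def covQuad (P : PMF (Fin d → ℤ)) (θ : Fin d → ℝ) : ℝ :=
  ∑' x, (P x).toReal * pairing θ x ^ 2

/-- The fourth moments of the step law. -/
noncomputable def fourthMoment (P : PMF (Fin d → ℤ)) (θ : Fin d → ℝ) : ℝ :=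
  ∑' x, (P x).toReal * pairing θ x ^ 4

theorem IsAdmissibleStep.summable_pow (hP : IsAdmissibleStep P) (k : ℕ) :
    Summable fun x : Fin d → ℤ => (P x).toReal * √(∑ i, (x i : ℝ) ^ 2) ^ k := by
  obtain ⟨b, hb, hs⟩ := hP.exp_tail
  refine Summable.of_nonneg_of_le (fun x => by positivity) (fun x => ?_)
    (hs.mul_left (k.factorial / b ^ k))
  have h1 := Real.pow_div_factorial_le_exp (b * √(∑ i, (x i : ℝ) ^ 2)) (by positivity) k
  rw [mul_pow, div_le_iff₀ (by positivity)] at h1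
  have h2 : √(∑ i, (x i : ℝ) ^ 2) ^ k
      ≤ k.factorial / b ^ k * Real.exp (b * √(∑ i, (x i : ℝ) ^ 2)) := by
    rw [div_mul_eq_mul_div, le_div_iff₀ (by positivity)]
    linarith
  calc (P x).toReal * √(∑ i, (x i : ℝ) ^ 2) ^ k
      ≤ (P x).toReal * (k.factorial / b ^ k * Real.exp (b * √(∑ i, (x i : ℝ) ^ 2))) :=
        mul_le_mul_of_nonneg_left h2 ENNReal.toReal_nonneg
    _ = _ := by ring

theorem abs_pairing_le (θ : Fin d → ℝ) (x : Fin d → ℤ) :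
    |pairing θ x| ≤ √(∑ i, θ i ^ 2) * √(∑ i, (x i : ℝ) ^ 2) := by
  rw [← Real.sqrt_mul (Finset.sum_nonneg fun i _ => sq_nonneg _)]
  exact Real.abs_le_sqrt (Finset.sum_mul_sq_le_sq_mul_sq _ _ _)

theorem IsAdmissibleStep.summable_pairing_pow (hP : IsAdmissibleStep P) (θ : Fin d → ℝ) {k : ℕ}
    (hk : Even k) : Summable fun x : Fin d → ℤ => (P x).toReal * pairing θ x ^ k := by
  refine Summable.of_nonneg_of_le (fun x => mul_nonneg ENNReal.toReal_nonneg (hk.pow_nonneg _))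
    (fun x => ?_) ((hP.summable_pow k).mul_left (√(∑ i, θ i ^ 2) ^ k))
  calc (P x).toReal * pairing θ x ^ k
      ≤ (P x).toReal * (√(∑ i, θ i ^ 2) * √(∑ i, (x i : ℝ) ^ 2)) ^ k := by
        refine mul_le_mul_of_nonneg_left ?_ ENNReal.toReal_nonneg
        rw [← hk.pow_abs]
        exact pow_le_pow_left₀ (abs_nonneg _) (abs_pairing_le _ _) _
    _ = _ := by rw [mul_pow]; ring

theorem IsAdmissibleStep.summable_mul (hP : IsAdmissibleStep P) (i j : Fin d) :
    Summable fun x : Fin d → ℤ => (x i : ℝ) * (x j : ℝ) * (P x).toReal := by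
  refine Summable.of_norm_bounded (hP.summable_pow 2) fun x => ?_
  have h : ∀ i, |(x i : ℝ)| ≤ √(∑ i, (x i : ℝ) ^ 2) := fun i =>
    Real.abs_le_sqrt (Finset.single_le_sum (f := fun i => (x i : ℝ) ^ 2)
      (fun _ _ => sq_nonneg _) (Finset.mem_univ i))
  rw [Real.norm_eq_abs, abs_mul, abs_mul, abs_of_nonneg ENNReal.toReal_nonneg, mul_comm, pow_two]
  gcongr
  · exact h i
  · exact h j

theorem IsAdmissibleStep.covQuad_eq (hP : IsAdmissibleStep P) (θ : Fin d → ℝ) :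
    covQuad P θ = ∑ i, ∑ j, θ i * covMatrix P i j * θ j := by
  have h : ∀ x : Fin d → ℤ, (P x).toReal * pairing θ x ^ 2
      = ∑ i, ∑ j, θ i * θ j * ((x i : ℝ) * (x j : ℝ) * (P x).toReal) := by
    intro x
    rw [pairing, pow_two, Finset.sum_mul_sum, Finset.mul_sum]
    refine Finset.sum_congr rfl fun i _ => ?_
    rw [Finset.mul_sum]
    exact Finset.sum_congr rfl fun j _ => by ring
  simp_rw [covQuad, h]
  rw [Summable.tsum_finsetSum fun i _ => summable_sum fun j _ => (hP.summable_mul i j).mul_left _]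
  refine Finset.sum_congr rfl fun i _ => ?_
  rw [Summable.tsum_finsetSum fun j _ => (hP.summable_mul i j).mul_left _]
  refine Finset.sum_congr rfl fun j _ => ?_
  rw [tsum_mul_left, covMatrix]
  ring

theorem covQuad_nonneg (P : PMF (Fin d → ℤ)) (θ : Fin d → ℝ) : 0 ≤ covQuad P θ :=
  tsum_nonneg fun x => by positivity

theorem covQuad_smul (P : PMF (Fin d → ℤ)) (c : ℝ) (θ : Fin d → ℝ) :
    covQuad P (c • θ) = c ^ 2 * covQuad P θ := by
  simp_rw [covQuad, pairing_smul, ← tsum_mul_left]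
  exact tsum_congr fun x => by ring

theorem fourthMoment_smul (P : PMF (Fin d → ℤ)) (c : ℝ) (θ : Fin d → ℝ) :
    fourthMoment P (c • θ) = c ^ 4 * fourthMoment P θ := by
  simp_rw [fourthMoment, pairing_smul, ← tsum_mul_left]
  exact tsum_congr fun x => by ring

theorem pairing_single (θ : Fin d → ℝ) (i : Fin d) : pairing θ (Pi.single i 1) = θ i := by
  rw [pairing, Finset.sum_eq_single i]
  · simp
  · intro j _ hj
    simp [hj]
  · simp

/-- If the form vanishes at `θ`, pairing with `θ` vanishes on all possible steps, hence on the group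
they generate, hence on the unit vectors. -/
theorem IsAdmissibleStep.covQuad_pos (hP : IsAdmissibleStep P) {θ : Fin d → ℝ} (hθ : θ ≠ 0) :
    0 < covQuad P θ := by
  refine lt_of_le_of_ne (covQuad_nonneg _ _) fun h => hθ ?_
  have hsum := (hP.summable_pairing_pow θ even_two).hasSum
  rw [← covQuad, ← h, hasSum_zero_iff_of_nonneg fun x => by positivity] at hsum
  let H : AddSubgroup (Fin d → ℤ) :=
    { carrier := {x | pairing θ x = 0}
      zero_mem' := pairing_zero θ
      add_mem' := fun {x y} hx hy => by
        simp only [Set.mem_ofPred_eq] at *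
        rw [pairing_add, hx, hy, add_zero]
      neg_mem' := fun {x} hx => by
        simp only [Set.mem_ofPred_eq] at *
        rw [pairing_neg, hx, neg_zero] }
  have hH : AddSubgroup.closure {x : Fin d → ℤ | P x ≠ 0} ≤ H := by
    rw [AddSubgroup.closure_le]
    intro x hx
    have := congrFun hsum x
    simp only [Pi.zero_apply, mul_eq_zero, ENNReal.toReal_eq_zero_iff] at this
    rcases this with (h | h) | h
    · exact absurd h hx
    · exact absurd h (PMF.apply_ne_top _ _)
    · exact pow_eq_zero_iff (by norm_num) |>.1 h
  rw [hP.generates] at hH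
  funext i
  have : Pi.single i 1 ∈ H := hH trivial
  rw [← pairing_single θ i]
  exact this

theorem covMatrix_isHermitian (P : PMF (Fin d → ℤ)) : (covMatrix P).IsHermitian := by
  refine Matrix.IsHermitian.ext fun i j => ?_
  rw [star_trivial]
  exact tsum_congr fun x => by ring

theorem IsAdmissibleStep.posDef (hP : IsAdmissibleStep P) : (covMatrix P).PosDef := by
  refine Matrix.PosDef.of_dotProduct_mulVec_pos (covMatrix_isHermitian P) fun θ hθ => ?_
  have := hP.covQuad_pos hθ
  rw [hP.covQuad_eq] at this
  refine this.trans_eq ?_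
  simp only [dotProduct, Matrix.mulVec, Finset.mul_sum, mul_assoc, Pi.star_apply, star_trivial]

theorem IsAdmissibleStep.continuous_covQuad (hP : IsAdmissibleStep P) :
    Continuous (covQuad P) := by
  have : covQuad P = fun θ => ∑ i, ∑ j, θ i * covMatrix P i j * θ j := funext hP.covQuad_eq
  rw [this]
  fun_prop

/-- Minimum over the compact unit sphere, extended by homogeneity. The sphere is empty for `d = 0`,
hence the case split. -/
theorem IsAdmissibleStep.exists_covQuad_ge (hP : IsAdmissibleStep P) :
    ∃ c : ℝ, 0 < c ∧ ∀ θ, c * ∑ i, θ i ^ 2 ≤ covQuad P θ := by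
  have hcomp : IsCompact {θ : Fin d → ℝ | ∑ i, θ i ^ 2 = 1} := by
    refine Metric.isCompact_of_isClosed_isBounded (isClosed_eq (by fun_prop) continuous_const) ?_
    refine (Metric.isBounded_closedBall (x := (0 : Fin d → ℝ)) (r := 1)).subset fun θ hθ => ?_
    rw [mem_closedBall_zero_iff, pi_norm_le_iff_of_nonneg zero_le_one]
    intro i
    rw [Real.norm_eq_abs, ← sq_le_one_iff_abs_le_one]
    have hθ' : ∑ i, θ i ^ 2 = 1 := hθ
    rw [← hθ']
    exact Finset.single_le_sum (f := fun i => θ i ^ 2) (fun _ _ => sq_nonneg _) (Finset.mem_univ i)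
  have hmin : ∃ c : ℝ, 0 < c ∧ ∀ θ : Fin d → ℝ, ∑ i, θ i ^ 2 = 1 → c ≤ covQuad P θ := by
    by_cases hne : {θ : Fin d → ℝ | ∑ i, θ i ^ 2 = 1}.Nonempty
    · obtain ⟨θ₀, h₀, hm⟩ := hcomp.exists_isMinOn hne hP.continuous_covQuad.continuousOn
      refine ⟨covQuad P θ₀, hP.covQuad_pos ?_, fun θ hθ => hm hθ⟩
      rintro rfl
      simp at h₀
    · exact ⟨1, one_pos, fun θ hθ => absurd ⟨θ, hθ⟩ hne⟩
  obtain ⟨c, hc, hmin⟩ := hmin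
  refine ⟨c, hc, fun θ => ?_⟩
  have hnn : 0 ≤ ∑ i, θ i ^ 2 := Finset.sum_nonneg fun i _ => sq_nonneg _
  rcases hnn.eq_or_lt with h | h
  · rw [← h, mul_zero]
    exact covQuad_nonneg _ _
  · have h1 := hmin ((√(∑ i, θ i ^ 2))⁻¹ • θ) (by
      simp only [Pi.smul_apply, smul_eq_mul, mul_pow, ← Finset.mul_sum, inv_pow,
        Real.sq_sqrt hnn]
      exact inv_mul_cancel₀ h.ne')
    rw [covQuad_smul, inv_pow, Real.sq_sqrt hnn, inv_mul_eq_div, le_div_iff₀ h] at h1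
    exact h1

/-- The generous quartic coefficient makes the bound global: for `|u| > 1` the left side is
negative. So it can be summed against the step law without truncation. -/
theorem half_sq_sub_le_one_sub_cos (u : ℝ) : u ^ 2 / 2 - u ^ 4 / 2 ≤ 1 - Real.cos u := by
  by_cases hu : |u| ≤ 1
  · have := (abs_le.1 (Real.cos_bound hu)).2
    have h4 : |u| ^ 4 = u ^ 4 := by rw [pow_abs, abs_of_nonneg (by positivity)]
    rw [h4] at this
    nlinarith [show 0 ≤ u ^ 4 by positivity]
  · have h1 : 1 ≤ u ^ 2 := by
      rw [← sq_abs]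
      nlinarith [not_le.1 hu]
    have := Real.cos_le_one u
    nlinarith

theorem IsAdmissibleStep.one_sub_stepChar_le (hP : IsAdmissibleStep P) (θ : Fin d → ℝ) :
    1 - stepChar P θ ≤ 2 * Real.pi ^ 2 * covQuad P θ := by
  refine hasSum_le (fun x => ?_) (hasSum_one_sub_stepChar P θ)
    ((hP.summable_pairing_pow θ even_two).hasSum.mul_left _)
  have := Real.one_sub_sq_div_two_le_cos (x := 2 * Real.pi * pairing θ x)
  calc (P x).toReal * (1 - Real.cos (2 * Real.pi * pairing θ x))
      ≤ (P x).toReal * ((2 * Real.pi * pairing θ x) ^ 2 / 2) :=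
        mul_le_mul_of_nonneg_left (by linarith) ENNReal.toReal_nonneg
    _ = _ := by ring

theorem IsAdmissibleStep.le_one_sub_stepChar (hP : IsAdmissibleStep P) (θ : Fin d → ℝ) :
    2 * Real.pi ^ 2 * covQuad P θ - 8 * Real.pi ^ 4 * fourthMoment P θ ≤ 1 - stepChar P θ := by
  refine hasSum_le (fun x => ?_) (((hP.summable_pairing_pow θ even_two).hasSum.mul_left _).sub
    ((hP.summable_pairing_pow θ (by decide : Even 4)).hasSum.mul_left _))
    (hasSum_one_sub_stepChar P θ)
  have := half_sq_sub_le_one_sub_cos (2 * Real.pi * pairing θ x)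
  calc _ = (P x).toReal * ((2 * Real.pi * pairing θ x) ^ 2 / 2
          - (2 * Real.pi * pairing θ x) ^ 4 / 2) := by ring
    _ ≤ _ := mul_le_mul_of_nonneg_left this ENNReal.toReal_nonneg

theorem IsAdmissibleStep.fourthMoment_le (hP : IsAdmissibleStep P) :
    ∃ C : ℝ, 0 ≤ C ∧ ∀ θ, fourthMoment P θ ≤ C * (∑ i, θ i ^ 2) ^ 2 := by
  refine ⟨∑' x, (P x).toReal * √(∑ i, (x i : ℝ) ^ 2) ^ 4, tsum_nonneg fun x => by positivity,
    fun θ => ?_⟩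
  rw [mul_comm, ← tsum_mul_left]
  refine (hP.summable_pairing_pow θ (by decide : Even 4)).tsum_le_tsum (fun x => ?_)
    ((hP.summable_pow 4).mul_left _)
  have h2 : (∑ i, θ i ^ 2) ^ 2 = √(∑ i, θ i ^ 2) ^ 4 := by
    rw [show 4 = 2 * 2 from rfl, pow_mul, Real.sq_sqrt (Finset.sum_nonneg fun i _ => sq_nonneg _)]
  calc (P x).toReal * pairing θ x ^ 4
      ≤ (P x).toReal * (√(∑ i, θ i ^ 2) * √(∑ i, (x i : ℝ) ^ 2)) ^ 4 := by
        refine mul_le_mul_of_nonneg_left ?_ ENNReal.toReal_nonneg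
        rw [← (by decide : Even 4).pow_abs]
        exact pow_le_pow_left₀ (abs_nonneg _) (abs_pairing_le _ _) _
    _ = _ := by rw [mul_pow, h2]; ring

/-- Equality would make the pairing with `θ` an integer on all possible steps, hence on the whole
lattice; each coordinate of `θ` would then be an integer in `[-1/2, 1/2]`. -/
theorem IsAdmissibleStep.stepChar_lt_one (hP : IsAdmissibleStep P) {θ : Fin d → ℝ}
    (hc : ∀ i, |θ i| ≤ 1 / 2) (hθ : θ ≠ 0) : stepChar P θ < 1 := by
  refine lt_of_le_of_ne (abs_le.1 (abs_stepChar_le_one P θ)).2 fun h => hθ ?_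
  have hsum := hasSum_one_sub_stepChar P θ
  rw [h, sub_self, hasSum_zero_iff_of_nonneg] at hsum
  swap
  · exact fun x => mul_nonneg ENNReal.toReal_nonneg (sub_nonneg.2 (Real.cos_le_one _))
  let H : AddSubgroup (Fin d → ℤ) :=
    { carrier := {x | ∃ k : ℤ, pairing θ x = k}
      zero_mem' := ⟨0, by simp [pairing_zero]⟩
      add_mem' := by
        rintro x y ⟨k, hk⟩ ⟨l, hl⟩
        exact ⟨k + l, by rw [pairing_add, hk, hl]; push_cast; ring⟩
      neg_mem' := by
        rintro x ⟨k, hk⟩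
        exact ⟨-k, by rw [pairing_neg, hk]; push_cast; ring⟩ }
  have hH : AddSubgroup.closure {x : Fin d → ℤ | P x ≠ 0} ≤ H := by
    rw [AddSubgroup.closure_le]
    intro x hx
    have := congrFun hsum x
    simp only [Pi.zero_apply, mul_eq_zero, ENNReal.toReal_eq_zero_iff] at this
    rcases this with (h | h) | h
    · exact absurd h hx
    · exact absurd h (PMF.apply_ne_top _ _)
    · obtain ⟨k, hk⟩ := (Real.cos_eq_one_iff _).1 (sub_eq_zero.1 h).symm
      refine ⟨k, ?_⟩
      have hpi := Real.pi_pos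
      have : 2 * Real.pi * (pairing θ x - k) = 0 := by linarith
      rcases mul_eq_zero.1 this with h | h
      · exact absurd h (by positivity)
      · linarith
  rw [hP.generates] at hH
  funext i
  have : Pi.single i 1 ∈ H := hH trivial
  obtain ⟨k, hk⟩ := this
  rw [pairing_single] at hk
  have h1 := abs_le.1 (hc i)
  rw [hk] at h1 ⊢
  have h2 : -1 < k := by
    have : (-1 : ℝ) < k := by linarith
    exact_mod_cast this
  have h3 : k < 1 := by
    have : (k : ℝ) < 1 := by linarith
    exact_mod_cast this
  have : k = 0 := by omega
  simp [this]

theorem IsAdmissibleStep.exists_stepChar_le (hP : IsAdmissibleStep P) :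
    ∃ c : ℝ, 0 < c ∧ ∀ θ : Fin d → ℝ, (∀ i, |θ i| ≤ 1 / 2) →
      stepChar P θ ≤ Real.exp (-(c * ∑ i, θ i ^ 2)) := by
  obtain ⟨c₀, hc₀, hq⟩ := hP.exists_covQuad_ge
  obtain ⟨C, hC, hf⟩ := hP.fourthMoment_le
  have hpi := Real.pi_pos
  -- Below this value of `∑ θ i ^ 2` the fourth-moment error is at most half of the quadratic term;
  -- above it, compactness gives a gap `η`, and `d + 1` bounds `∑ θ i ^ 2` on the cube.
  set δ : ℝ := c₀ / (8 * Real.pi ^ 2 * (C + 1)) with hδ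
  have hδ0 : 0 < δ := by positivity
  have hcomp : IsCompact {θ : Fin d → ℝ | (∀ i, |θ i| ≤ 1 / 2) ∧ δ ≤ ∑ i, θ i ^ 2} := by
    refine Metric.isCompact_of_isClosed_isBounded ?_ ?_
    · have h1 : IsClosed {θ : Fin d → ℝ | ∀ i, |θ i| ≤ 1 / 2} := by
        have : {θ : Fin d → ℝ | ∀ i, |θ i| ≤ 1 / 2} = ⋂ i, {θ | |θ i| ≤ 1 / 2} := by
          ext
          simp
        rw [this]
        exact isClosed_iInter fun i => isClosed_le (continuous_apply i).abs continuous_const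
      have h2 : Continuous fun θ : Fin d → ℝ => ∑ i, θ i ^ 2 := by fun_prop
      exact h1.inter (isClosed_le continuous_const h2)
    · refine (Metric.isBounded_closedBall (x := (0 : Fin d → ℝ)) (r := 1 / 2)).subset fun θ hθ => ?_
      rw [mem_closedBall_zero_iff, pi_norm_le_iff_of_nonneg (by norm_num)]
      exact hθ.1
  have hη : ∃ η : ℝ, 0 < η ∧ ∀ θ : Fin d → ℝ, (∀ i, |θ i| ≤ 1 / 2) → δ ≤ ∑ i, θ i ^ 2 →
      η ≤ 1 - stepChar P θ := by
    by_cases hne : {θ : Fin d → ℝ | (∀ i, |θ i| ≤ 1 / 2) ∧ δ ≤ ∑ i, θ i ^ 2}.Nonempty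
    · obtain ⟨θ₀, h₀, hm⟩ := hcomp.exists_isMinOn hne
        (continuous_const.sub (continuous_stepChar P)).continuousOn
      refine ⟨1 - stepChar P θ₀, sub_pos.2 (hP.stepChar_lt_one h₀.1 ?_),
        fun θ h1 h2 => hm ⟨h1, h2⟩⟩
      rintro rfl
      have := h₀.2
      simp at this
      linarith
    · exact ⟨1, one_pos, fun θ h1 h2 => absurd ⟨θ, h1, h2⟩ hne⟩
  obtain ⟨η, hη0, hη⟩ := hη
  refine ⟨min (Real.pi ^ 2 * c₀) (η / (d + 1)), by positivity, fun θ hθ => ?_⟩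
  have hs0 : 0 ≤ ∑ i, θ i ^ 2 := Finset.sum_nonneg fun i _ => sq_nonneg _
  suffices h : min (Real.pi ^ 2 * c₀) (η / (d + 1)) * ∑ i, θ i ^ 2 ≤ 1 - stepChar P θ by
    have := Real.add_one_le_exp (-(min (Real.pi ^ 2 * c₀) (η / (d + 1)) * ∑ i, θ i ^ 2))
    linarith
  rcases le_total δ (∑ i, θ i ^ 2) with h | h
  · have h1 : ∑ i, θ i ^ 2 ≤ d + 1 := by
      calc ∑ i, θ i ^ 2 ≤ ∑ _i : Fin d, (1 : ℝ) := Finset.sum_le_sum fun i _ => by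
            rw [sq_le_one_iff_abs_le_one]
            linarith [hθ i]
        _ ≤ d + 1 := by simp
    calc _ ≤ η / (d + 1) * (d + 1) := by gcongr; exact min_le_right _ _
      _ = η := by field_simp
      _ ≤ _ := hη θ hθ h
  · have h1 := hP.le_one_sub_stepChar θ
    have h2 := hq θ
    have h3 := hf θ
    have h4 : 8 * Real.pi ^ 4 * fourthMoment P θ ≤ Real.pi ^ 2 * c₀ * ∑ i, θ i ^ 2 := by
      calc 8 * Real.pi ^ 4 * fourthMoment P θ
          ≤ 8 * Real.pi ^ 4 * ((C + 1) * (δ * ∑ i, θ i ^ 2)) := by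
            gcongr
            refine h3.trans ?_
            rw [pow_two]
            gcongr
            linarith
        _ = Real.pi ^ 2 * c₀ * ∑ i, θ i ^ 2 := by
            rw [hδ]
            field_simp
    calc _ ≤ Real.pi ^ 2 * c₀ * ∑ i, θ i ^ 2 := by gcongr; exact min_le_left _ _
      _ ≤ _ := by nlinarith [mul_le_mul_of_nonneg_left h2 (by positivity : 0 ≤ 2 * Real.pi ^ 2)]

end Covariance


/-! ### Gaussian limit for the positive part of the characteristic function. -/

section LocalLimit

open Filter Topology

variable {d : ℕ} {P : PMF (Fin d → ℤ)}

/-- The positive part of the characteristic function. -/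
noncomputable def posChar (P : PMF (Fin d → ℤ)) (θ : Fin d → ℝ) : ℝ := max (stepChar P θ) 0

/-- The negative part of the characteristic function. -/
noncomputable def negChar (P : PMF (Fin d → ℤ)) (θ : Fin d → ℝ) : ℝ := max (-stepChar P θ) 0

theorem continuous_posChar (P : PMF (Fin d → ℤ)) : Continuous (posChar P) :=
  (continuous_stepChar P).max continuous_const

theorem continuous_negChar (P : PMF (Fin d → ℤ)) : Continuous (negChar P) :=
  (continuous_stepChar P).neg.max continuous_const

theorem posChar_nonneg (P : PMF (Fin d → ℤ)) (θ : Fin d → ℝ) : 0 ≤ posChar P θ := le_max_right _ _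

theorem negChar_nonneg (P : PMF (Fin d → ℤ)) (θ : Fin d → ℝ) : 0 ≤ negChar P θ := le_max_right _ _

theorem posChar_le_one (P : PMF (Fin d → ℤ)) (θ : Fin d → ℝ) : posChar P θ ≤ 1 :=
  max_le (abs_le.1 (abs_stepChar_le_one P θ)).2 zero_le_one

theorem negChar_le_one (P : PMF (Fin d → ℤ)) (θ : Fin d → ℝ) : negChar P θ ≤ 1 :=
  max_le (by linarith [(abs_le.1 (abs_stepChar_le_one P θ)).1]) zero_le_one

/-- Splitting off the sign isolates periodicity: the positive part yields the Gaussian for every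
`n`, while the negative part is either negligible or, for period two, mirrors the positive one. At
`n = 0` the convention `0 ^ 0 = 1` would spoil the identity. -/
theorem stepChar_pow (P : PMF (Fin d → ℤ)) {n : ℕ} (hn : n ≠ 0) (θ : Fin d → ℝ) :
    stepChar P θ ^ n = posChar P θ ^ n + (-1) ^ n * negChar P θ ^ n := by
  rcases le_total 0 (stepChar P θ) with h | h
  · rw [posChar, negChar, max_eq_left h, max_eq_right (by linarith), zero_pow hn]
    ring
  · rw [posChar, negChar, max_eq_right h, max_eq_left (by linarith), zero_pow hn, ← mul_pow]
    ring

theorem mem_unitCube_abs {θ : Fin d → ℝ} (h : θ ∈ unitCube d) (i : Fin d) : |θ i| ≤ 1 / 2 :=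
  abs_le.2 ⟨(h i trivial).1.le, (h i trivial).2⟩

theorem tendsto_inv_sqrt_smul (θ : Fin d → ℝ) :
    Tendsto (fun n : ℕ => (√(n : ℝ))⁻¹ • θ) atTop (𝓝 0) := by
  have h : Tendsto (fun n : ℕ => (√(n : ℝ))⁻¹) atTop (𝓝 0) :=
    tendsto_inv_atTop_zero.comp (Real.tendsto_sqrt_atTop.comp tendsto_natCast_atTop_atTop)
  simpa using h.smul_const θ

/-- The quadratic and quartic bounds squeeze `n (φ(θ/√n) - 1)`, where `φ` is the characteristic
function; then `(1 + s/n)ⁿ → exp s`. -/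
theorem IsAdmissibleStep.tendsto_posChar_pow (hP : IsAdmissibleStep P) (θ : Fin d → ℝ) :
    Tendsto (fun n : ℕ => posChar P ((√(n : ℝ))⁻¹ • θ) ^ n) atTop
      (𝓝 (Real.exp (-(2 * Real.pi ^ 2 * covQuad P θ)))) := by
  have hone : stepChar P 0 = 1 := by
    simp only [stepChar, pairing, Pi.zero_apply, zero_mul, Finset.sum_const_zero, mul_zero,
      Real.cos_zero, mul_one, tsum_toReal_eq_one]
  have h0 : Tendsto (fun n : ℕ => stepChar P ((√(n : ℝ))⁻¹ • θ)) atTop (𝓝 1) := by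
    rw [← hone]
    exact ((continuous_stepChar P).tendsto 0).comp (tendsto_inv_sqrt_smul θ)
  have h1 : Tendsto (fun n : ℕ => (n : ℝ) * (stepChar P ((√(n : ℝ))⁻¹ • θ) - 1)) atTop
      (𝓝 (-(2 * Real.pi ^ 2 * covQuad P θ))) := by
    have hlim : Tendsto (fun n : ℕ => -(2 * Real.pi ^ 2 * covQuad P θ)
        + 8 * Real.pi ^ 4 * fourthMoment P θ * (n : ℝ)⁻¹) atTop
        (𝓝 (-(2 * Real.pi ^ 2 * covQuad P θ))) := by
      simpa using (tendsto_const_nhds (x := -(2 * Real.pi ^ 2 * covQuad P θ))).add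
        ((tendsto_inv_atTop_nhds_zero_nat (𝕜 := ℝ)).const_mul
          (8 * Real.pi ^ 4 * fourthMoment P θ))
    refine tendsto_of_tendsto_of_tendsto_of_le_of_le' tendsto_const_nhds hlim ?_ ?_
    · filter_upwards [eventually_gt_atTop 0] with n hn
      have hn' : (0 : ℝ) < n := by exact_mod_cast hn
      have := hP.one_sub_stepChar_le ((√(n : ℝ))⁻¹ • θ)
      rw [covQuad_smul, inv_pow, Real.sq_sqrt hn'.le] at this
      have h2 : (n : ℝ) * (1 - stepChar P ((√(n : ℝ))⁻¹ • θ)) ≤ 2 * Real.pi ^ 2 * covQuad P θ := by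
        calc _ ≤ (n : ℝ) * (2 * Real.pi ^ 2 * ((n : ℝ)⁻¹ * covQuad P θ)) := by gcongr
          _ = _ := by field_simp
      linarith
    · filter_upwards [eventually_gt_atTop 0] with n hn
      have hn' : (0 : ℝ) < n := by exact_mod_cast hn
      have := hP.le_one_sub_stepChar ((√(n : ℝ))⁻¹ • θ)
      have h4 : (√(n : ℝ))⁻¹ ^ 4 = (n : ℝ)⁻¹ ^ 2 := by
        rw [show 4 = 2 * 2 from rfl, pow_mul, inv_pow, Real.sq_sqrt hn'.le]
      rw [covQuad_smul, fourthMoment_smul, h4, inv_pow (√(n : ℝ)), Real.sq_sqrt hn'.le] at this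
      have h2 : 2 * Real.pi ^ 2 * covQuad P θ - 8 * Real.pi ^ 4 * fourthMoment P θ * (n : ℝ)⁻¹
          ≤ (n : ℝ) * (1 - stepChar P ((√(n : ℝ))⁻¹ • θ)) := by
        calc _ = (n : ℝ) * (2 * Real.pi ^ 2 * ((n : ℝ)⁻¹ * covQuad P θ)
              - 8 * Real.pi ^ 4 * ((n : ℝ)⁻¹ ^ 2 * fourthMoment P θ)) := by field_simp
          _ ≤ _ := mul_le_mul_of_nonneg_left this hn'.le
      linarith
  have h2 := Real.tendsto_one_add_pow_exp_of_tendsto h1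
  refine h2.congr' ?_
  filter_upwards [h0.eventually (lt_mem_nhds (zero_lt_one' ℝ))] with n hn
  rw [posChar, max_eq_left hn.le]
  ring

theorem integrable_exp_neg_mul_sum_sq {c : ℝ} (hc : 0 < c) :
    Integrable fun θ : Fin d → ℝ => Real.exp (-(c * ∑ i, θ i ^ 2)) := by
  have := (GaussianFourier.integrable_cexp_neg_mul_sum_add (b := (c : ℂ)) (by simpa using hc)
    (fun _ : Fin d => (0 : ℂ))).norm
  refine this.congr (ae_of_all _ fun θ => ?_)
  simp only [Complex.norm_exp]
  congr 1
  have : (-(c : ℂ) * ∑ i, (θ i : ℂ) ^ 2 + ∑ i, (0 : ℂ) * (θ i : ℂ))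
      = ((-(c * ∑ i, θ i ^ 2) : ℝ) : ℂ) := by
    push_cast
    simp
  rw [this, Complex.ofReal_re]

/-- The integrand of the local limit theorem after rescaling. -/
noncomputable def scaledPos (P : PMF (Fin d → ℤ)) (n : ℕ) (θ : Fin d → ℝ) : ℝ :=
  (unitCube d).indicator (fun θ => posChar P θ ^ n) ((√(n : ℝ))⁻¹ • θ)

theorem measurable_scaledPos (P : PMF (Fin d → ℤ)) (n : ℕ) : Measurable (scaledPos P n) :=
  (((continuous_posChar P).pow n).measurable.indicator measurableSet_unitCube).comp
    (measurable_const_smul _)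

theorem IsAdmissibleStep.scaledPos_bound (hP : IsAdmissibleStep P) :
    ∃ c : ℝ, 0 < c ∧ ∀ n : ℕ, n ≠ 0 → ∀ θ : Fin d → ℝ,
      |scaledPos P n θ| ≤ Real.exp (-(c * ∑ i, θ i ^ 2)) := by
  obtain ⟨c, hc, hφ⟩ := hP.exists_stepChar_le
  refine ⟨c, hc, fun n hn θ => ?_⟩
  have hn' : (0 : ℝ) < n := by exact_mod_cast Nat.pos_of_ne_zero hn
  rw [scaledPos]
  by_cases h : (√(n : ℝ))⁻¹ • θ ∈ unitCube d
  · rw [Set.indicator_of_mem h, abs_of_nonneg (pow_nonneg (posChar_nonneg _ _) _)]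
    have h1 : posChar P ((√(n : ℝ))⁻¹ • θ) ≤ Real.exp (-(c * ((n : ℝ)⁻¹ * ∑ i, θ i ^ 2))) := by
      refine max_le ((hφ _ (mem_unitCube_abs h)).trans_eq ?_) (Real.exp_pos _).le
      congr 3
      simp only [Pi.smul_apply, smul_eq_mul, mul_pow, inv_pow, Real.sq_sqrt hn'.le,
        Finset.mul_sum]
    refine (pow_le_pow_left₀ (posChar_nonneg _ _) h1 n).trans_eq ?_
    rw [← Real.exp_nat_mul]
    congr 1
    field_simp
  · rw [Set.indicator_of_notMem h, abs_zero]
    exact (Real.exp_pos _).le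

/-- Dominated convergence. Convergence in `L¹`, rather than of the integrals, is what is needed: as
cosine factors are bounded by one, it gives a limit theorem uniform in the position. -/
theorem IsAdmissibleStep.tendsto_integral_abs (hP : IsAdmissibleStep P) :
    Tendsto (fun n : ℕ => ∫ θ, |scaledPos P n θ - Real.exp (-(2 * Real.pi ^ 2 * covQuad P θ))|)
      atTop (𝓝 0) := by
  obtain ⟨c, hc, hb⟩ := hP.scaledPos_bound
  obtain ⟨c₀, hc₀, hq⟩ := hP.exists_covQuad_ge
  have hpi := Real.pi_pos
  have hmeas : Measurable fun θ => Real.exp (-(2 * Real.pi ^ 2 * covQuad P θ)) :=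
    (by have := hP.continuous_covQuad; fun_prop : Continuous _).measurable
  rw [← integral_zero (Fin d → ℝ) ℝ (μ := volume)]
  refine tendsto_integral_filter_of_dominated_convergence (fun θ => Real.exp (-(c * ∑ i, θ i ^ 2))
    + Real.exp (-(2 * Real.pi ^ 2 * c₀ * ∑ i, θ i ^ 2))) ?_ ?_ ?_ ?_
  · exact Eventually.of_forall fun n =>
      (((measurable_scaledPos P n).sub hmeas).abs).aestronglyMeasurable
  · filter_upwards [eventually_ne_atTop 0] with n hn
    refine ae_of_all _ fun θ => ?_
    rw [Real.norm_eq_abs, abs_abs]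
    refine (abs_sub _ _).trans (add_le_add (hb n hn θ) ?_)
    rw [abs_of_pos (Real.exp_pos _), Real.exp_le_exp, neg_le_neg_iff, mul_assoc]
    exact mul_le_mul_of_nonneg_left (hq θ) (by positivity)
  · exact (integrable_exp_neg_mul_sum_sq hc).add (integrable_exp_neg_mul_sum_sq (by positivity))
  · refine ae_of_all _ fun θ => ?_
    have h1 := hP.tendsto_posChar_pow θ
    have h2 : Tendsto (fun n : ℕ => scaledPos P n θ) atTop
        (𝓝 (Real.exp (-(2 * Real.pi ^ 2 * covQuad P θ)))) := by
      refine h1.congr' ?_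
      have hnhds : unitCube d ∈ 𝓝 (0 : Fin d → ℝ) :=
        set_pi_mem_nhds Set.finite_univ fun i _ => Ioc_mem_nhds (by norm_num) (by norm_num)
      filter_upwards [(tendsto_inv_sqrt_smul θ).eventually hnhds] with n hn
      rw [scaledPos, Set.indicator_of_mem hn]
    have h3 := (h2.sub_const (Real.exp (-(2 * Real.pi ^ 2 * covQuad P θ)))).abs
    rw [sub_self, abs_zero] at h3
    exact h3

/-- The constant `(2π)^{-d/2} det(Q)^{-1/2}`. -/
noncomputable def gaussConst (P : PMF (Fin d → ℤ)) : ℝ :=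
  (2 * Real.pi) ^ (-(d : ℝ) / 2) / √(covMatrix P).det

theorem integral_exp_mul_cos (w : Fin d → ℝ) :
    ∫ η : Fin d → ℝ, Real.exp (-(2 * Real.pi ^ 2 * ∑ i, η i ^ 2))
        * Real.cos (2 * Real.pi * ∑ i, η i * w i)
      = (2 * Real.pi) ^ (-(d : ℝ) / 2) * Real.exp (-(∑ i, w i ^ 2) / 2) := by
  have hpi := Real.pi_pos
  have hb : 0 < ((2 * Real.pi ^ 2 : ℝ) : ℂ).re := by
    rw [Complex.ofReal_re]
    positivity
  have h1 := GaussianFourier.integral_cexp_neg_mul_sum_add hb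
    (fun i : Fin d => (2 * Real.pi * w i : ℝ) * Complex.I)
  have h2 := GaussianFourier.integrable_cexp_neg_mul_sum_add hb
    (fun i : Fin d => (2 * Real.pi * w i : ℝ) * Complex.I)
  have h3 := integral_re h2
  rw [h1] at h3
  have h4 : ∀ η : Fin d → ℝ, (-((2 * Real.pi ^ 2 : ℝ) : ℂ) * ∑ i, (η i : ℂ) ^ 2
      + ∑ i, ((2 * Real.pi * w i : ℝ) : ℂ) * Complex.I * (η i : ℂ))
      = ((-(2 * Real.pi ^ 2 * ∑ i, η i ^ 2) : ℝ) : ℂ)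
        + ((2 * Real.pi * ∑ i, η i * w i : ℝ) : ℂ) * Complex.I := by
    intro η
    push_cast
    rw [neg_mul, Finset.mul_sum (f := fun i => (η i : ℂ) * (w i : ℂ)), Finset.sum_mul]
    congr 1
    exact Finset.sum_congr rfl fun i _ => by ring
  have h5 : ∀ η : Fin d → ℝ, RCLike.re (Complex.exp (-((2 * Real.pi ^ 2 : ℝ) : ℂ)
      * ∑ i, (η i : ℂ) ^ 2 + ∑ i, ((2 * Real.pi * w i : ℝ) : ℂ) * Complex.I * (η i : ℂ)))
      = Real.exp (-(2 * Real.pi ^ 2 * ∑ i, η i ^ 2))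
        * Real.cos (2 * Real.pi * ∑ i, η i * w i) := by
    intro η
    rw [h4, Complex.exp_add, ← Complex.ofReal_exp]
    change ((_ : ℂ) * _).re = _
    rw [Complex.re_ofReal_mul, Complex.exp_ofReal_mul_I_re]
  simp_rw [h5] at h3
  rw [h3]
  have h6 : ((Real.pi : ℂ) / ((2 * Real.pi ^ 2 : ℝ) : ℂ)) ^ ((Fintype.card (Fin d) : ℂ) / 2)
      * Complex.exp ((∑ i, (((2 * Real.pi * w i : ℝ) : ℂ) * Complex.I) ^ 2)
        / (4 * ((2 * Real.pi ^ 2 : ℝ) : ℂ)))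
      = (((2 * Real.pi) ^ (-(d : ℝ) / 2) * Real.exp (-(∑ i, w i ^ 2) / 2) : ℝ) : ℂ) := by
    rw [Complex.ofReal_mul ((2 * Real.pi) ^ (-(d : ℝ) / 2)), Complex.ofReal_exp]
    congr 1
    · rw [Fintype.card_fin, neg_div, Real.rpow_neg (by positivity), ← Real.inv_rpow (by positivity),
        Complex.ofReal_cpow (by positivity)]
      congr 1
      · push_cast
        field_simp
      · push_cast
        rfl
    · congr 1
      simp only [mul_pow, Complex.I_sq]
      push_cast
      simp only [mul_pow, ← Finset.sum_mul, ← Finset.mul_sum]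
      have : (Real.pi : ℂ) ≠ 0 := by exact_mod_cast hpi.ne'
      field_simp
      ring
  rw [h6]
  exact Complex.ofReal_re _

/-- A square root of the covariance matrix, in the form used to change variables. -/
theorem IsAdmissibleStep.exists_factor (hP : IsAdmissibleStep P) :
    ∃ B : Matrix (Fin d) (Fin d) ℝ, covMatrix P = B.transpose * B ∧ B.det ≠ 0 ∧
      |B.det| = √(covMatrix P).det := by
  open scoped MatrixOrder in
  obtain ⟨B, hB⟩ := CStarAlgebra.nonneg_iff_eq_star_mul_self.mp hP.posDef.posSemidef.nonneg
  rw [Matrix.star_eq_conjTranspose, Matrix.conjTranspose_eq_transpose_of_trivial] at hB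
  have hdet : (covMatrix P).det = B.det ^ 2 := by
    rw [hB, Matrix.det_mul, Matrix.det_transpose, pow_two]
  refine ⟨B, hB, ?_, by rw [hdet, Real.sqrt_sq_eq_abs]⟩
  intro h
  have := hP.posDef.det_pos
  rw [hdet, h] at this
  simp at this

theorem sum_sum_mul_mul (c : ℝ) (y : Fin d → ℝ) (f : Fin d → Fin d → ℝ) :
    ∑ i, ∑ j, c * y i * f i j * (c * y j) = c ^ 2 * ∑ i, ∑ j, y i * f i j * y j := by
  simp only [Finset.mul_sum]
  exact Finset.sum_congr rfl fun i _ => Finset.sum_congr rfl fun j _ => by ring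

/-- The quadratic form of the inverse covariance matrix. -/
noncomputable def invQuad (P : PMF (Fin d → ℤ)) (z : Fin d → ℝ) : ℝ :=
  ∑ i, ∑ j, z i * (covMatrix P)⁻¹ i j * z j

theorem invQuad_smul (P : PMF (Fin d → ℤ)) (c : ℝ) (z : Fin d → ℝ) :
    invQuad P (fun i => c * z i) = c ^ 2 * invQuad P z :=
  sum_sum_mul_mul c z _

/-- Substituting `η = B θ`, with `Bᵀ B` the covariance matrix, reduces to the standard Gaussian. The
dual variable `z` is transformed by the inverse transpose, which is how the inverse covariance
enters. -/
theorem IsAdmissibleStep.integral_gauss (hP : IsAdmissibleStep P) (z : Fin d → ℝ) :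
    ∫ θ : Fin d → ℝ, Real.exp (-(2 * Real.pi ^ 2 * covQuad P θ))
        * Real.cos (2 * Real.pi * ∑ i, θ i * z i)
      = gaussConst P * Real.exp (-invQuad P z / 2) := by
  obtain ⟨B, hB, hB0, hBd⟩ := hP.exists_factor
  have hu : IsUnit B.det := isUnit_iff_ne_zero.2 hB0
  set w : Fin d → ℝ := (B⁻¹).transpose.mulVec z with hw
  have hq : ∀ θ, covQuad P θ = ∑ i, (B.mulVec θ) i ^ 2 := by
    intro θ
    rw [hP.covQuad_eq]
    have h1 : ∑ i, ∑ j, θ i * covMatrix P i j * θ j = θ ⬝ᵥ (covMatrix P).mulVec θ := by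
      simp only [dotProduct, Matrix.mulVec, Finset.mul_sum, mul_assoc]
    rw [h1, hB, ← Matrix.mulVec_mulVec, Matrix.dotProduct_mulVec, Matrix.vecMul_transpose]
    simp only [dotProduct, pow_two]
  have hz : ∀ θ, ∑ i, θ i * z i = ∑ i, (B.mulVec θ) i * w i := by
    intro θ
    change θ ⬝ᵥ z = B.mulVec θ ⬝ᵥ w
    rw [hw, Matrix.dotProduct_mulVec, Matrix.vecMul_transpose, Matrix.mulVec_mulVec,
      Matrix.nonsing_inv_mul _ hu, Matrix.one_mulVec]
  have hw2 : ∑ i, w i ^ 2 = invQuad P z := by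
    have h1 : invQuad P z = z ⬝ᵥ ((covMatrix P)⁻¹).mulVec z := by
      unfold invQuad
      simp only [dotProduct, Matrix.mulVec, Finset.mul_sum, mul_assoc]
    rw [h1, hB, Matrix.mul_inv_rev, ← Matrix.mulVec_mulVec, Matrix.dotProduct_mulVec,
      ← Matrix.mulVec_transpose, ← Matrix.transpose_nonsing_inv]
    simp only [dotProduct, pow_two, hw]
  set f : (Fin d → ℝ) → ℝ := fun η => Real.exp (-(2 * Real.pi ^ 2 * ∑ i, η i ^ 2))
        * Real.cos (2 * Real.pi * ∑ i, η i * w i) with hf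
  have hfc : Continuous f := by
    rw [hf]
    fun_prop
  have h1 := Real.map_matrix_volume_pi_eq_smul_volume_pi hB0
  have h2 : ∫ η, f η ∂(Measure.map (Matrix.toLin' B) volume) = ∫ θ, f (B.mulVec θ) := by
    rw [integral_map]
    · rfl
    · exact (LinearMap.continuous_of_finiteDimensional _).aemeasurable
    · exact hfc.aestronglyMeasurable
  rw [h1, integral_smul_measure, hf, integral_exp_mul_cos] at h2
  have h3 : ∫ θ : Fin d → ℝ, Real.exp (-(2 * Real.pi ^ 2 * covQuad P θ))
      * Real.cos (2 * Real.pi * ∑ i, θ i * z i) = ∫ θ, f (B.mulVec θ) :=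
    integral_congr_ae (ae_of_all _ fun θ => by simp only [hf, hq, hz])
  rw [h3, hf, ← h2, hw2, ENNReal.toReal_ofReal (abs_nonneg _), abs_inv, hBd, gaussConst,
    smul_eq_mul]
  ring

/-- The part of the Fourier inversion integral that comes from the positive part. -/
noncomputable def posPart (P : PMF (Fin d → ℤ)) (n : ℕ) (y : Fin d → ℤ) : ℝ :=
  ∫ θ in unitCube d, posChar P θ ^ n * Real.cos (2 * Real.pi * pairing θ y)

/-- The part of the Fourier inversion integral that comes from the negative part. -/
noncomputable def negPart (P : PMF (Fin d → ℤ)) (n : ℕ) (y : Fin d → ℤ) : ℝ :=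
  ∫ θ in unitCube d, negChar P θ ^ n * Real.cos (2 * Real.pi * pairing θ y)

theorem sqrt_pow_mul_posPart (P : PMF (Fin d → ℤ)) (n : ℕ) (y : Fin d → ℤ) :
    √(n : ℝ) ^ d * posPart P n y
      = ∫ θ, scaledPos P n θ * Real.cos (2 * Real.pi * pairing ((√(n : ℝ))⁻¹ • θ) y) := by
  have := Measure.integral_comp_inv_smul_of_nonneg (volume : Measure (Fin d → ℝ))
    ((unitCube d).indicator fun θ => posChar P θ ^ n * Real.cos (2 * Real.pi * pairing θ y))
    (Real.sqrt_nonneg (n : ℝ))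
  rw [integral_indicator measurableSet_unitCube, Module.finrank_fin_fun, smul_eq_mul] at this
  rw [posPart, ← this]
  refine integral_congr_ae (ae_of_all _ fun θ => ?_)
  simp only [scaledPos]
  by_cases h : (√(n : ℝ))⁻¹ • θ ∈ unitCube d
  · simp [Set.indicator_of_mem h]
  · simp [Set.indicator_of_notMem h]

theorem IsAdmissibleStep.posPart_lclt (hP : IsAdmissibleStep P) {ε : ℝ} (hε : 0 < ε) :
    ∀ᶠ n : ℕ in atTop, ∀ y : Fin d → ℤ,
      |√(n : ℝ) ^ d * posPart P n y - gaussConst P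
        * Real.exp (-invQuad P (fun i => (y i : ℝ)) / (2 * n))| ≤ ε := by
  obtain ⟨c, hc, hb⟩ := hP.scaledPos_bound
  obtain ⟨c₀, hc₀, hq⟩ := hP.exists_covQuad_ge
  have hpi := Real.pi_pos
  have hcont : Continuous fun θ => Real.exp (-(2 * Real.pi ^ 2 * covQuad P θ)) := by
    have := hP.continuous_covQuad
    fun_prop
  have hint2 : Integrable fun θ => Real.exp (-(2 * Real.pi ^ 2 * covQuad P θ)) := by
    refine (integrable_exp_neg_mul_sum_sq (d := d) (c := 2 * Real.pi ^ 2 * c₀)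
      (by positivity)).mono hcont.aestronglyMeasurable (ae_of_all _ fun θ => ?_)
    rw [Real.norm_eq_abs, Real.norm_eq_abs, abs_of_pos (Real.exp_pos _),
      abs_of_pos (Real.exp_pos _), Real.exp_le_exp, neg_le_neg_iff, mul_assoc]
    exact mul_le_mul_of_nonneg_left (hq θ) (by positivity)
  filter_upwards [hP.tendsto_integral_abs.eventually (gt_mem_nhds hε), eventually_ne_atTop 0]
    with n hn hn0 y
  have hn' : (0 : ℝ) < n := by exact_mod_cast Nat.pos_of_ne_zero hn0
  have hint1 : Integrable (scaledPos P n) :=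
    (integrable_exp_neg_mul_sum_sq hc).mono (measurable_scaledPos P n).aestronglyMeasurable
      (ae_of_all _ fun θ => by
        rw [Real.norm_eq_abs, Real.norm_eq_abs, abs_of_pos (Real.exp_pos _)]
        exact hb n hn0 θ)
  have hg := hP.integral_gauss (fun i => (√(n : ℝ))⁻¹ * (y i : ℝ))
  have h1 : ∀ θ : Fin d → ℝ, ∑ i, θ i * ((√(n : ℝ))⁻¹ * (y i : ℝ))
      = pairing ((√(n : ℝ))⁻¹ • θ) y := by
    intro θ
    rw [pairing_smul, pairing, Finset.mul_sum]
    exact Finset.sum_congr rfl fun i _ => by ring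
  have h2 : -invQuad P (fun i => (√(n : ℝ))⁻¹ * (y i : ℝ)) / 2
      = -invQuad P (fun i => (y i : ℝ)) / (2 * n) := by
    rw [invQuad_smul P _ (fun i => (y i : ℝ)), inv_pow, Real.sq_sqrt hn'.le]
    field_simp
  simp_rw [h1, h2] at hg
  rw [sqrt_pow_mul_posPart P n, ← hg, ← integral_sub]
  · refine (abs_integral_le_integral_abs).trans (le_trans (integral_mono_of_nonneg
      (ae_of_all _ fun _ => abs_nonneg _) (hint1.sub hint2).abs (ae_of_all _ fun θ => ?_)) hn.le)
    simp only [← sub_mul, abs_mul, Pi.sub_apply]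
    exact mul_le_of_le_one_right (abs_nonneg _) (Real.abs_cos_le_one _)
  · refine hint1.mul_bdd (c := 1) ?_ (ae_of_all _ fun θ => Real.abs_cos_le_one _)
    apply Continuous.aestronglyMeasurable
    fun_prop
  · refine hint2.mul_bdd (c := 1) ?_ (ae_of_all _ fun θ => Real.abs_cos_le_one _)
    apply Continuous.aestronglyMeasurable
    fun_prop

end LocalLimit


/-! ### Periodicity and the local central limit theorem. -/

section LocalLimit

open Filter Topology

variable {d : ℕ} {P : PMF (Fin d → ℤ)}

theorem integrableOn_unitCube {f : (Fin d → ℝ) → ℝ} (hf : Continuous f) {C : ℝ}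
    (hb : ∀ θ, |f θ| ≤ C) : Integrable f (volume.restrict (unitCube d)) :=
  have := isFiniteMeasure_unitCube (d := d)
  Integrable.of_bound hf.aestronglyMeasurable C (ae_of_all _ hb)

theorem abs_integral_unitCube_le {f g : (Fin d → ℝ) → ℝ} (hg : Continuous g) {C : ℝ}
    (hgb : ∀ θ, |g θ| ≤ C) (h : ∀ θ, |f θ| ≤ g θ) :
    |∫ θ in unitCube d, f θ| ≤ ∫ θ in unitCube d, g θ :=
  abs_integral_le_integral_abs.trans (integral_mono_of_nonneg (ae_of_all _ fun _ => abs_nonneg _)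
    (integrableOn_unitCube hg hgb) (ae_of_all _ h))

theorem abs_pow_mul_cos_le {a : ℝ} (h0 : 0 ≤ a) (h1 : a ≤ 1) (n : ℕ) (u : ℝ) :
    |a ^ n * Real.cos u| ≤ 1 := by
  rw [abs_mul, abs_of_nonneg (pow_nonneg h0 n)]
  exact mul_le_one₀ (pow_le_one₀ h0 h1) (abs_nonneg _) (Real.abs_cos_le_one _)

/-- The integral of the `n`-th power of a function over the unit cube. -/
noncomputable def powIntegral (f : (Fin d → ℝ) → ℝ) (n : ℕ) : ℝ := ∫ θ in unitCube d, f θ ^ n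

theorem powIntegral_antitone {f : (Fin d → ℝ) → ℝ} (hf : Continuous f) (h0 : ∀ θ, 0 ≤ f θ)
    (h1 : ∀ θ, f θ ≤ 1) : Antitone (powIntegral f) := by
  refine antitone_nat_of_succ_le fun n => ?_
  have hb : ∀ n θ, |f θ ^ n| ≤ 1 := fun n θ => by
    rw [abs_of_nonneg (pow_nonneg (h0 θ) n)]
    exact pow_le_one₀ (h0 θ) (h1 θ)
  exact integral_mono (integrableOn_unitCube (hf.pow _) (hb _))
    (integrableOn_unitCube (hf.pow _) (hb _))
    fun θ => pow_le_pow_of_le_one (h0 θ) (h1 θ) (Nat.le_succ n)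

/-- Powers of a function with values in `[0, 1]` decrease, so the change over one time step is
largest without the cosine: the increment at the origin controls all positions. -/
theorem abs_integral_pow_sub_le {f : (Fin d → ℝ) → ℝ} (hf : Continuous f) (h0 : ∀ θ, 0 ≤ f θ)
    (h1 : ∀ θ, f θ ≤ 1) (n : ℕ) (y : Fin d → ℤ) :
    |(∫ θ in unitCube d, f θ ^ n * Real.cos (2 * Real.pi * pairing θ y))
      - ∫ θ in unitCube d, f θ ^ (n + 1) * Real.cos (2 * Real.pi * pairing θ y)|
      ≤ powIntegral f n - powIntegral f (n + 1) := by
  have hb : ∀ n θ, |f θ ^ n| ≤ 1 := fun n θ => by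
    rw [abs_of_nonneg (pow_nonneg (h0 θ) n)]
    exact pow_le_one₀ (h0 θ) (h1 θ)
  have hb' : ∀ n θ, |f θ ^ n * Real.cos (2 * Real.pi * pairing θ y)| ≤ 1 := fun n θ =>
    abs_pow_mul_cos_le (h0 θ) (h1 θ) n _
  rw [powIntegral, powIntegral, ← integral_sub (integrableOn_unitCube (by fun_prop) (hb' n))
    (integrableOn_unitCube (by fun_prop) (hb' _)),
    ← integral_sub (integrableOn_unitCube (f := fun θ => f θ ^ n) (hf.pow _) (hb n))
    (integrableOn_unitCube (f := fun θ => f θ ^ (n + 1)) (hf.pow _) (hb _))]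
  refine abs_integral_unitCube_le (C := 2) (by fun_prop) (fun θ => ?_) fun θ => ?_
  · have := abs_sub (f θ ^ n) (f θ ^ (n + 1))
    linarith [hb n θ, hb (n + 1) θ]
  · rw [← sub_mul, abs_mul, abs_of_nonneg (sub_nonneg.2
      (pow_le_pow_of_le_one (h0 θ) (h1 θ) (Nat.le_succ n)))]
    exact mul_le_of_le_one_right (sub_nonneg.2
      (pow_le_pow_of_le_one (h0 θ) (h1 θ) (Nat.le_succ n))) (Real.abs_cos_le_one _)

theorem posPart_zero (P : PMF (Fin d → ℤ)) (n : ℕ) :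
    posPart P n 0 = powIntegral (posChar P) n := by
  simp [posPart, powIntegral, pairing_zero]

theorem negPart_zero (P : PMF (Fin d → ℤ)) (n : ℕ) :
    negPart P n 0 = powIntegral (negChar P) n := by
  simp [negPart, powIntegral, pairing_zero]

theorem nStep_toReal_eq_posPart_add (hs : ∀ x, P x = P (-x)) {n : ℕ} (hn : n ≠ 0)
    (y : Fin d → ℤ) : (nStep P n y).toReal = posPart P n y + (-1) ^ n * negPart P n y := by
  have hp := continuous_posChar P
  have hq := continuous_negChar P
  rw [nStep_toReal_eq_integral hs, posPart, negPart, ← integral_const_mul, ← integral_add]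
  · refine integral_congr_ae (ae_of_all _ fun θ => ?_)
    simp only [stepChar_pow P hn]
    ring
  · exact integrableOn_unitCube (by fun_prop) fun θ =>
      abs_pow_mul_cos_le (posChar_nonneg P θ) (posChar_le_one P θ) n _
  · exact (integrableOn_unitCube (by fun_prop) fun θ =>
      abs_pow_mul_cos_le (negChar_nonneg P θ) (negChar_le_one P θ) n _).const_mul _

theorem tendsto_natCast_add_div_add (j k : ℕ) :
    Tendsto (fun n : ℕ => ((n + j : ℕ) : ℝ) / ((n + k : ℕ) : ℝ)) atTop (𝓝 1) := by
  have h : Tendsto (fun n : ℕ => 1 + ((j : ℝ) - k) * (((n + k : ℕ) : ℝ))⁻¹) atTop (𝓝 1) := by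
    have := ((tendsto_inv_atTop_nhds_zero_nat (𝕜 := ℝ)).comp (tendsto_add_atTop_nat k)).const_mul
      ((j : ℝ) - k)
    simpa [Function.comp_def] using this.const_add 1
  refine h.congr' ?_
  filter_upwards [eventually_gt_atTop 0] with n hn
  have : (0 : ℝ) < ((n + k : ℕ) : ℝ) := by exact_mod_cast Nat.add_pos_left hn k
  rw [eq_div_iff this.ne', add_mul, mul_assoc, inv_mul_cancel₀ this.ne']
  push_cast
  ring

theorem IsAdmissibleStep.tendsto_powIntegral (hP : IsAdmissibleStep P) (j k : ℕ) :
    Tendsto (fun n : ℕ => √((n + j : ℕ) : ℝ) ^ d * powIntegral (posChar P) (n + k)) atTop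
      (𝓝 (gaussConst P)) := by
  have h0 : Tendsto (fun n : ℕ => √(n : ℝ) ^ d * powIntegral (posChar P) n) atTop
      (𝓝 (gaussConst P)) := by
    rw [Metric.tendsto_atTop']
    intro ε hε
    obtain ⟨N, hN⟩ := eventually_atTop.1 (hP.posPart_lclt (half_pos hε))
    refine ⟨N, fun n hn => ?_⟩
    have := hN n hn.le 0
    rw [posPart_zero] at this
    simp only [Pi.zero_apply, Int.cast_zero] at this
    have h1 : invQuad P (fun _ => 0) = 0 := by simp [invQuad]
    rw [h1, neg_zero, zero_div, Real.exp_zero, mul_one] at this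
    rw [Real.dist_eq]
    linarith
  have h1 := ((tendsto_natCast_add_div_add j k).sqrt.pow d).mul
    (h0.comp (tendsto_add_atTop_nat k))
  rw [Real.sqrt_one, one_pow, one_mul] at h1
  refine h1.congr' ?_
  filter_upwards [eventually_gt_atTop 0] with n hn
  have h2 : (0 : ℝ) < ((n + k : ℕ) : ℝ) := by exact_mod_cast Nat.add_pos_left hn k
  have h3 := (Real.sqrt_pos.2 h2).ne'
  simp only [Function.comp_apply]
  rw [Real.sqrt_div (Nat.cast_nonneg _), div_pow]
  field_simp

/-- At a frequency where the characteristic function is `-1`, the law after an odd number of steps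
is carried by points where the cosine is `-1`, and the origin is not one of them. -/
theorem negChar_lt_one_of_odd (hs : ∀ x, P x = P (-x)) {n : ℕ} (hn : Odd n)
    (h : nStep P n 0 ≠ 0) (θ : Fin d → ℝ) : negChar P θ < 1 := by
  refine max_lt (lt_of_le_of_ne (by linarith [(abs_le.1 (abs_stepChar_le_one P θ)).1]) ?_) one_pos
  intro h1
  have h2 : stepChar P θ ^ n = -1 := by
    rw [show stepChar P θ = -1 by linarith, hn.neg_one_pow]
  have h3 : HasSum (fun x => (nStep P n x).toReal * (1 + Real.cos (2 * Real.pi * pairing θ x)))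
      0 := by
    have ha := (summable_toReal (nStep P n)).hasSum
    have hb := (summable_toReal_mul_of_bounded (nStep P n) fun x =>
      Real.abs_cos_le_one (2 * Real.pi * pairing θ x)).hasSum
    rw [tsum_toReal_eq_one] at ha
    rw [tsum_nStep_mul_cos hs, h2] at hb
    simpa [mul_add] using ha.add hb
  rw [hasSum_zero_iff_of_nonneg fun x => mul_nonneg ENNReal.toReal_nonneg
    (by linarith [Real.neg_one_le_cos (2 * Real.pi * pairing θ x)])] at h3
  have h4 := congrFun h3 0
  simp only [pairing_zero, mul_zero, Real.cos_zero, Pi.zero_apply, mul_eq_zero,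
    ENNReal.toReal_eq_zero_iff] at h4
  rcases h4 with (h4 | h4) | h4
  · exact h h4
  · exact PMF.apply_ne_top _ _ h4
  · norm_num at h4

theorem IsAdmissibleStep.tendsto_powIntegral_negChar (hP : IsAdmissibleStep P) {m : ℕ}
    (hm : Odd m) (h : nStep P m 0 ≠ 0) :
    Tendsto (fun n : ℕ => √(n : ℝ) ^ d * powIntegral (negChar P) n) atTop (𝓝 0) := by
  have hcomp : IsCompact (Metric.closedBall (0 : Fin d → ℝ) (1 / 2)) := isCompact_closedBall _ _
  obtain ⟨θ₀, -, hmax⟩ := hcomp.exists_isMaxOn ⟨0, by simp⟩ (continuous_negChar P).continuousOn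
  set ρ := negChar P θ₀ with hρ
  have hρ1 : ρ < 1 := negChar_lt_one_of_odd hP.symm hm h θ₀
  have hρ0 : 0 ≤ ρ := negChar_nonneg _ _
  have hle : ∀ n : ℕ, powIntegral (negChar P) n ≤ ρ ^ n := by
    intro n
    have hfin := isFiniteMeasure_unitCube (d := d)
    calc powIntegral (negChar P) n ≤ ∫ θ in unitCube d, ρ ^ n := by
          refine setIntegral_mono_on (integrableOn_unitCube ((continuous_negChar P).pow n) (C := 1)
            fun θ => ?_) (integrable_const _) measurableSet_unitCube fun θ hθ => ?_
          · rw [abs_of_nonneg (pow_nonneg (negChar_nonneg _ _) _)]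
            exact pow_le_one₀ (negChar_nonneg _ _) (negChar_le_one _ _)
          · refine pow_le_pow_left₀ (negChar_nonneg _ _) (hmax ?_) n
            rw [mem_closedBall_zero_iff, pi_norm_le_iff_of_nonneg (by norm_num)]
            exact mem_unitCube_abs hθ
      _ = ρ ^ n := by simp [measureReal_def, volume_unitCube]
  refine squeeze_zero' (Eventually.of_forall fun n => mul_nonneg (by positivity)
    (integral_nonneg fun θ => pow_nonneg (negChar_nonneg _ _) _)) ?_
    (tendsto_pow_const_mul_const_pow_of_lt_one d hρ0 hρ1)
  filter_upwards [eventually_gt_atTop 0] with n hn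
  have hn' : (1 : ℝ) ≤ n := by exact_mod_cast hn
  refine mul_le_mul (pow_le_pow_left₀ (Real.sqrt_nonneg _) ?_ d) (hle n)
    (integral_nonneg fun θ => pow_nonneg (negChar_nonneg _ _) _) (by positivity)
  exact Real.sqrt_le_iff.2 ⟨by positivity, by nlinarith⟩

/-- If odd returns are impossible, the integrals of the positive and negative parts agree at odd
times. Monotonicity then traps an increment of the latter between two odd times. -/
theorem powIntegral_negChar_sub_le (hs : ∀ x, P x = P (-x))
    (hper : ∀ m, Odd m → nStep P m 0 = 0) (n : ℕ) :
    powIntegral (negChar P) (n + 1) - powIntegral (negChar P) (n + 2)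
      ≤ powIntegral (posChar P) n - powIntegral (posChar P) (n + 3) := by
  have hodd : ∀ m, Odd m → powIntegral (negChar P) m = powIntegral (posChar P) m := by
    intro m hm
    have := nStep_toReal_eq_posPart_add hs (Nat.ne_of_odd_add (by simpa using hm) : m ≠ 0) 0
    rw [hper m hm, posPart_zero, negPart_zero, hm.neg_one_pow] at this
    simp at this
    linarith
  have ap := powIntegral_antitone (continuous_posChar P) (posChar_nonneg P) (posChar_le_one P)
  have an := powIntegral_antitone (continuous_negChar P) (negChar_nonneg P) (negChar_le_one P)
  rcases Nat.even_or_odd n with h | h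
  · have h1 := hodd (n + 1) h.add_one
    have h3 := hodd (n + 3)
      (by rw [show n + 3 = n + 1 + 2 by ring]; exact h.add_one.add_even even_two)
    have := an (show n + 2 ≤ n + 3 by omega)
    have := ap (show n ≤ n + 1 by omega)
    linarith
  · have h1 := hodd n h
    have h3 := hodd (n + 2) (h.add_even even_two)
    have := an (show n ≤ n + 1 by omega)
    have := ap (show n + 2 ≤ n + 3 by omega)
    linarith

/-- The local central limit theorem, uniformly over all positions. -/
theorem IsAdmissibleStep.local_limit (hP : IsAdmissibleStep P) {ε : ℝ} (hε : 0 < ε) :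
    ∀ᶠ n : ℕ in atTop, ∀ y : Fin d → ℤ, (∃ m, m % 2 = n % 2 ∧ nStep P m y ≠ 0) →
      |√(n : ℝ) ^ d * (nStep P n y).toReal - period P * gaussConst P
        * Real.exp (-invQuad P (fun i => (y i : ℝ)) / (2 * n))| ≤ ε := by
  by_cases hper : ∃ m, Odd m ∧ nStep P m 0 ≠ 0
  · obtain ⟨m, hm, hm0⟩ := hper
    have hp1 : period P = 1 := if_pos ⟨m, hm, hm0⟩
    filter_upwards [hP.posPart_lclt (half_pos hε), eventually_ne_atTop 0,
      (hP.tendsto_powIntegral_negChar hm hm0).eventually (gt_mem_nhds (half_pos hε))]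
      with n h1 hn h2 y _
    have h3 := h1 y
    rw [nStep_toReal_eq_posPart_add hP.symm hn, hp1, mul_add]
    have h4 : |√(n : ℝ) ^ d * ((-1) ^ n * negPart P n y)| ≤ ε / 2 := by
      rw [abs_mul, abs_of_nonneg (by positivity : (0 : ℝ) ≤ √(n : ℝ) ^ d), abs_mul, abs_pow,
        abs_neg, abs_one, one_pow, one_mul]
      refine le_trans (mul_le_mul_of_nonneg_left ?_ (by positivity)) h2.le
      refine abs_integral_unitCube_le (C := 1) ((continuous_negChar P).pow n) (fun θ => ?_)
        fun θ => ?_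
      · rw [abs_of_nonneg (pow_nonneg (negChar_nonneg _ _) _)]
        exact pow_le_one₀ (negChar_nonneg _ _) (negChar_le_one _ _)
      · rw [abs_mul, abs_of_nonneg (pow_nonneg (negChar_nonneg _ _) _)]
        exact mul_le_of_le_one_right (pow_nonneg (negChar_nonneg _ _) _) (Real.abs_cos_le_one _)
    rw [abs_le] at *
    push_cast
    constructor <;> linarith
  · have hp2 : period P = 2 := if_neg hper
    push Not at hper
    have hlim : Tendsto (fun n : ℕ => √((n + 1 : ℕ) : ℝ) ^ d * powIntegral (posChar P) n
        - √((n + 1 : ℕ) : ℝ) ^ d * powIntegral (posChar P) (n + 3)) atTop (𝓝 0) := by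
      simpa using (hP.tendsto_powIntegral 1 0).sub (hP.tendsto_powIntegral 1 3)
    have hlim' : Tendsto (fun n : ℕ => √(n : ℝ) ^ d * (powIntegral (posChar P) (n - 1)
        - powIntegral (posChar P) (n + 2))) atTop (𝓝 0) := by
      refine (tendsto_add_atTop_iff_nat 1).1 (hlim.congr fun n => ?_)
      rw [mul_sub]
      rfl
    filter_upwards [hP.posPart_lclt (show 0 < ε / 4 by positivity), eventually_ne_atTop 0,
      hlim'.eventually (gt_mem_nhds (show 0 < ε / 4 by positivity))] with n h1 hn h2 y hy
    obtain ⟨k, rfl⟩ := Nat.exists_eq_succ_of_ne_zero hn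
    obtain ⟨m, hm, hm0⟩ := hy
    -- Reaching `y` at times of both parities would allow an odd return to the origin. So at time `k
    -- + 2` the two parts cancel exactly; as both change little in one step, at time `k + 1` the
    -- probability is nearly twice the positive part. Nothing need be known about the frequencies
    -- where the characteristic function is `-1`.
    have hzero : nStep P (k.succ + 1) y = 0 := by
      by_contra hne
      refine nStep_add_ne_zero hm0 ((nStep_neg hP.symm _ y).symm ▸ hne) ?_
      rw [add_neg_cancel]
      refine hper _ ?_
      rw [Nat.odd_iff]
      omega
    have h3 := h1 y
    have h4 := nStep_toReal_eq_posPart_add hP.symm (Nat.succ_ne_zero k.succ) y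
    have h4' := nStep_toReal_eq_posPart_add hP.symm hn y
    rw [Nat.succ_eq_add_one, hzero, ENNReal.toReal_zero, pow_succ] at h4
    have h5 := abs_integral_pow_sub_le (continuous_posChar P) (posChar_nonneg P)
      (posChar_le_one P) k.succ y
    have h6 := abs_integral_pow_sub_le (continuous_negChar P) (negChar_nonneg P)
      (negChar_le_one P) k.succ y
    have h7 := powIntegral_negChar_sub_le hP.symm hper k
    have ap := powIntegral_antitone (continuous_posChar P) (posChar_nonneg P) (posChar_le_one P)
    have h8 := ap (show k ≤ k + 1 by omega)
    have h9 := ap (show k + 2 ≤ k + 3 by omega)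
    rw [← posPart, ← posPart] at h5
    rw [← negPart, ← negPart] at h6
    simp only [Nat.succ_eq_add_one, Nat.add_sub_cancel] at *
    have h10 : |(nStep P (k + 1) y).toReal - 2 * posPart P (k + 1) y|
        ≤ 2 * (powIntegral (posChar P) k - powIntegral (posChar P) (k + 3)) := by
      have h11 : (nStep P (k + 1) y).toReal - 2 * posPart P (k + 1) y
          = (-1) ^ (k + 1) * (negPart P (k + 1) y - negPart P (k + 1 + 1) y)
            - (posPart P (k + 1) y - posPart P (k + 1 + 1) y) := by
        rw [h4']
        linarith
      rw [h11]
      refine (abs_sub _ _).trans ?_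
      rw [abs_mul, abs_pow, abs_neg, abs_one, one_pow, one_mul]
      have e1 : k + 1 + 1 = k + 2 := rfl
      rw [e1] at h5 h6 ⊢
      linarith
    have h12 : |√((k + 1 : ℕ) : ℝ) ^ d * (nStep P (k + 1) y).toReal
        - 2 * (√((k + 1 : ℕ) : ℝ) ^ d * posPart P (k + 1) y)| ≤ ε / 2 := by
      have : √((k + 1 : ℕ) : ℝ) ^ d * (nStep P (k + 1) y).toReal
        - 2 * (√((k + 1 : ℕ) : ℝ) ^ d * posPart P (k + 1) y)
        = √((k + 1 : ℕ) : ℝ) ^ d * ((nStep P (k + 1) y).toReal - 2 * posPart P (k + 1) y) := by ring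
      rw [this, abs_mul, abs_of_nonneg (by positivity : (0 : ℝ) ≤ √((k + 1 : ℕ) : ℝ) ^ d)]
      have := mul_le_mul_of_nonneg_left h10 (by positivity : (0 : ℝ) ≤ √((k + 1 : ℕ) : ℝ) ^ d)
      have e3 : k + 1 + 2 = k + 3 := rfl
      rw [e3] at h2
      linarith
    rw [hp2]
    rw [abs_le] at *
    push_cast at *
    constructor <;> linarith

end LocalLimit

/-! ### Existence of the threshold times of the walk. -/

section Thresholds

open Filter

variable {d : ℕ} {P : PMF (Fin d → ℤ)}

theorem IsAdmissibleStep.gaussConst_pos (hP : IsAdmissibleStep P) : 0 < gaussConst P :=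
  div_pos (by positivity) (Real.sqrt_pos.2 hP.posDef.det_pos)

theorem IsAdmissibleStep.scaleD_pow (hP : IsAdmissibleStep P) (hd : d ≠ 0) :
    scaleD P ^ d = √(covMatrix P).det := by
  rw [scaleD, ← Real.rpow_natCast, ← Real.rpow_mul hP.posDef.det_pos.le, Real.sqrt_eq_rpow]
  congr 1
  field_simp

theorem IsAdmissibleStep.lcltPrefactor_eq (hP : IsAdmissibleStep P) (hd : d ≠ 0) (n : ℕ) :
    lcltPrefactor P n = period P * gaussConst P / √(n : ℝ) ^ d := by
  have h : (n : ℝ) ^ ((d : ℝ) / 2) = √(n : ℝ) ^ d := by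
    rw [Real.sqrt_eq_rpow, ← Real.rpow_natCast, ← Real.rpow_mul (Nat.cast_nonneg n)]
    congr 1
    ring
  rw [lcltPrefactor, hP.scaleD_pow hd, h, gaussConst]
  ring

theorem period_cases (P : PMF (Fin d → ℤ)) : period P = 1 ∨ period P = 2 := by
  unfold period
  split_ifs <;> simp

theorem period_pos (P : PMF (Fin d → ℤ)) : (0 : ℝ) < period P := by
  rcases period_cases P with h | h <;> rw [h] <;> norm_num

theorem IsAdmissibleStep.invQuad_eq (hP : IsAdmissibleStep P) (hd : d ≠ 0) (y : Fin d → ℤ) :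
    invQuad P (fun i => (y i : ℝ)) = d * wnorm P y ^ 2 := by
  have h0 : 0 ≤ invQuad P (fun i => (y i : ℝ)) := by
    have := hP.posDef.inv.posSemidef.dotProduct_mulVec_nonneg (fun i => (y i : ℝ))
    refine this.trans_eq ?_
    unfold invQuad
    simp only [dotProduct, Matrix.mulVec, Finset.mul_sum, mul_assoc, Pi.star_apply, star_trivial]
  have hd' : (d : ℝ) ≠ 0 := by exact_mod_cast hd
  have h1 : wnorm P y ^ 2 = 1 / (d : ℝ) * invQuad P (fun i => (y i : ℝ)) :=
    Real.sq_sqrt (by positivity)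
  rw [h1]
  field_simp

/-- An additive error as large as the leading constant at worst doubles the leading term. -/
theorem IsAdmissibleStep.eventually_upper (hP : IsAdmissibleStep P) (hd : d ≠ 0) :
    ∀ᶠ n : ℕ in atTop, ∀ y, (nStep P n y).toReal ≤ 2 * lcltPrefactor P n := by
  have hg : 0 < period P * gaussConst P := mul_pos (period_pos P) hP.gaussConst_pos
  filter_upwards [hP.local_limit hg, eventually_gt_atTop 0] with n hn hn0 y
  have hs : 0 < √(n : ℝ) ^ d := by positivity
  rw [hP.lcltPrefactor_eq hd, ← mul_div_assoc, le_div_iff₀ hs]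
  by_cases hy : nStep P n y = 0
  · rw [hy, ENNReal.toReal_zero, zero_mul]
    positivity
  · have h1 := (abs_le.1 (hn y ⟨n, rfl, hy⟩)).2
    have h2 : Real.exp (-invQuad P (fun i => (y i : ℝ)) / (2 * n)) ≤ 1 := by
      rw [Real.exp_le_one_iff, hP.invQuad_eq hd, neg_div]
      exact neg_nonpos.2 (by positivity)
    nlinarith [mul_le_mul_of_nonneg_left h2 hg.le]

/-- In the window the Gaussian factor is at least `exp (-d L² / 2)`, so an additive error small
compared with this value is a relative one. -/
theorem IsAdmissibleStep.exists_isLocalThreshold (hP : IsAdmissibleStep P) (hd : d ≠ 0) {ε : ℝ}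
    (hε : 0 < ε) (L : ℝ) : ∃ n₂, IsLocalThreshold P ε L n₂ := by
  have hg : 0 < period P * gaussConst P := mul_pos (period_pos P) hP.gaussConst_pos
  have hε' : 0 < ε * (period P * gaussConst P * Real.exp (-(d * L ^ 2 / 2))) := by positivity
  obtain ⟨n₂, hn₂⟩ := eventually_atTop.1 ((hP.local_limit hε').and (eventually_gt_atTop 0))
  refine ⟨n₂, fun n hn y hy => ?_⟩
  obtain ⟨h1, hn0⟩ := hn₂ n hn
  have hs : 0 < √(n : ℝ) ^ d := by positivity
  have hn0' : (0 : ℝ) < n := by exact_mod_cast hn0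
  have he : -invQuad P (fun i => (y i : ℝ)) / (2 * n) = -(d : ℝ) * wnorm P y ^ 2 / (2 * n) := by
    rw [hP.invQuad_eq hd]
    ring
  have hexp : Real.exp (-(d * L ^ 2 / 2)) ≤ Real.exp (-(d : ℝ) * wnorm P y ^ 2 / (2 * n)) := by
    rw [Real.exp_le_exp, neg_mul, neg_div, neg_le_neg_iff, div_le_div_iff₀ (by positivity)
      (by norm_num)]
    have h2 : wnorm P y ^ 2 ≤ L ^ 2 * n := by
      have := pow_le_pow_left₀ (Real.sqrt_nonneg _) hy 2
      rwa [mul_pow, Real.sq_sqrt hn0'.le] at this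
    nlinarith [mul_le_mul_of_nonneg_left h2 (Nat.cast_nonneg d : (0 : ℝ) ≤ d)]
  have hmul := mul_le_mul_of_nonneg_left (mul_le_mul_of_nonneg_left hexp hg.le) hε.le
  rw [hP.lcltPrefactor_eq hd]
  constructor
  · by_cases hy0 : nStep P n y = 0
    · rw [hy0, ENNReal.toReal_zero]
      positivity
    · have h3 := (abs_le.1 (h1 y ⟨n, rfl, hy0⟩)).2
      rw [he] at h3
      rw [← mul_div_assoc, div_mul_eq_mul_div, le_div_iff₀ hs]
      nlinarith
  · intro hpar
    have h3 := (abs_le.1 (h1 y hpar)).1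
    rw [he] at h3
    rw [← mul_div_assoc, div_mul_eq_mul_div, div_le_iff₀ hs]
    nlinarith

/-- The infimum in `leastNStar` is attained because the set is nonempty by the limit theorem; for an
empty set of naturals it would be `0` and carry no information. -/
theorem IsAdmissibleStep.isUpperThreshold (hP : IsAdmissibleStep P) (hd : d ≠ 0) {n : ℕ}
    (hn : leastNStar P ≤ n) : IsUpperThreshold P n := by
  obtain ⟨n₁, h₁⟩ := eventually_atTop.1 (hP.eventually_upper hd)
  have hmem : sInf {n₁ | IsUpperThreshold P n₁} ∈ {n₁ | IsUpperThreshold P n₁} :=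
    Nat.sInf_mem ⟨n₁, h₁⟩
  exact fun k hk y => hmem k (((le_max_left _ _).trans hn).trans hk) y

/-- At time `0` the prefactor is a division by zero, hence `0`, whereas the walk is at the origin
with probability one; so `0` is not an upper threshold. -/
theorem IsAdmissibleStep.nStar_pos (hP : IsAdmissibleStep P) (hd : d ≠ 0) {n : ℕ}
    (hn : leastNStar P ≤ n) : 0 < n := by
  by_contra h
  obtain rfl : n = 0 := by omega
  have := hP.isUpperThreshold hd hn 0 le_rfl 0
  rw [hP.lcltPrefactor_eq hd, nStep_zero_apply] at this
  simp [hd] at this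
  linarith

end Thresholds


/-! ### Maximal transition probabilities and second moments in `wnorm`. -/

section Kernel

variable {d : ℕ} {P : PMF (Fin d → ℤ)}

/-- The largest `n`-step probability. -/
noncomputable def maxProb (P : PMF (Fin d → ℤ)) (n : ℕ) : ℝ≥0∞ := ⨆ y, nStep P n y

theorem nStep_le_maxProb (P : PMF (Fin d → ℤ)) (n : ℕ) (y : Fin d → ℤ) :
    nStep P n y ≤ maxProb P n :=
  le_iSup (fun y => nStep P n y) y

theorem maxProb_le_one (P : PMF (Fin d → ℤ)) (n : ℕ) : maxProb P n ≤ 1 :=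
  iSup_le fun y => PMF.coe_le_one _ y

/-- One more step averages the transition probabilities. -/
theorem maxProb_antitone (P : PMF (Fin d → ℤ)) : Antitone (maxProb P) := by
  refine antitone_nat_of_succ_le fun n => iSup_le fun y => ?_
  rw [add_comm, nStep_add_apply]
  calc ∑' x, nStep P 1 x * nStep P n (y - x) ≤ ∑' x, nStep P 1 x * maxProb P n :=
        ENNReal.tsum_le_tsum fun x => mul_le_mul_right (nStep_le_maxProb P n _) _
    _ = maxProb P n := by rw [ENNReal.tsum_mul_right, PMF.tsum_coe, one_mul]

/-- Meeting probability of two independent walks. -/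
theorem tsum_meet (hs : ∀ x, P x = P (-x)) (m n : ℕ) (a b : Fin d → ℤ) :
    ∑' x, ∑' y, nStep P m x * (nStep P n y * if a + x = b + y then 1 else 0)
      = nStep P (m + n) (b - a) := by
  rw [nStep_add_apply]
  refine tsum_congr fun x => ?_
  rw [tsum_eq_single (a + x - b)]
  · rw [if_pos (by abel), mul_one, ← nStep_neg hs n (a + x - b)]
    congr 2
    abel
  · intro y hy
    rw [if_neg, mul_zero, mul_zero]
    rintro h
    exact hy (by rw [h]; abel)

/-- A factor of the inverse covariance matrix embeds the lattice in Euclidean space; triangle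
inequality and parallelogram law are inherited. -/
theorem IsAdmissibleStep.exists_wnorm_eq (hP : IsAdmissibleStep P) :
    ∃ T : (Fin d → ℤ) →+ EuclideanSpace ℝ (Fin d), ∀ y, wnorm P y = ‖T y‖ := by
  open scoped MatrixOrder in
  obtain ⟨C, hC⟩ :=
    CStarAlgebra.nonneg_iff_eq_star_mul_self.mp hP.posDef.inv.posSemidef.nonneg
  rw [Matrix.star_eq_conjTranspose, Matrix.conjTranspose_eq_transpose_of_trivial] at hC
  let T : (Fin d → ℤ) →+ EuclideanSpace ℝ (Fin d) :=
    { toFun := fun y => WithLp.toLp 2 (√(1 / (d : ℝ)) • C.mulVec fun i => (y i : ℝ))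
      map_zero' := by
        ext i
        simp [Matrix.mulVec, dotProduct]
      map_add' := fun x y => by
        ext i
        simp [Matrix.mulVec, dotProduct, mul_add, Finset.sum_add_distrib] }
  refine ⟨T, fun y => ?_⟩
  have h1 : invQuad P (fun i => (y i : ℝ)) = ∑ i, (C.mulVec fun i => (y i : ℝ)) i ^ 2 := by
    have h2 : invQuad P (fun i => (y i : ℝ))
        = (fun i => (y i : ℝ)) ⬝ᵥ ((covMatrix P)⁻¹).mulVec (fun i => (y i : ℝ)) := by
      unfold invQuad
      simp only [dotProduct, Matrix.mulVec, Finset.mul_sum, mul_assoc]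
    rw [h2, hC, ← Matrix.mulVec_mulVec, Matrix.dotProduct_mulVec, Matrix.vecMul_transpose]
    simp only [dotProduct, pow_two]
  rw [EuclideanSpace.norm_eq]
  change √(1 / (d : ℝ) * invQuad P (fun i => (y i : ℝ))) = _
  rw [h1]
  congr 1
  simp only [T, AddMonoidHom.coe_mk, ZeroHom.coe_mk, Pi.smul_apply, smul_eq_mul,
    Real.norm_eq_abs, sq_abs, mul_pow, ← Finset.mul_sum]
  rw [Real.sq_sqrt (by positivity)]

theorem wnorm_nonneg (P : PMF (Fin d → ℤ)) (y : Fin d → ℤ) : 0 ≤ wnorm P y := Real.sqrt_nonneg _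

theorem IsAdmissibleStep.wnorm_add_le (hP : IsAdmissibleStep P) (x y : Fin d → ℤ) :
    wnorm P (x + y) ≤ wnorm P x + wnorm P y := by
  obtain ⟨T, hT⟩ := hP.exists_wnorm_eq
  rw [hT, hT, hT, map_add]
  exact norm_add_le _ _

theorem IsAdmissibleStep.wnorm_neg (hP : IsAdmissibleStep P) (x : Fin d → ℤ) :
    wnorm P (-x) = wnorm P x := by
  obtain ⟨T, hT⟩ := hP.exists_wnorm_eq
  rw [hT, hT, map_neg, norm_neg]

theorem IsAdmissibleStep.wnorm_sub_le (hP : IsAdmissibleStep P) (x y : Fin d → ℤ) :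
    wnorm P (x - y) ≤ wnorm P x + wnorm P y := by
  rw [sub_eq_add_neg, ← hP.wnorm_neg y]
  exact hP.wnorm_add_le _ _

theorem IsAdmissibleStep.wnorm_parallelogram (hP : IsAdmissibleStep P) (x y : Fin d → ℤ) :
    wnorm P (x + y) ^ 2 + wnorm P (x - y) ^ 2 = 2 * (wnorm P x ^ 2 + wnorm P y ^ 2) := by
  obtain ⟨T, hT⟩ := hP.exists_wnorm_eq
  rw [hT, hT, hT, hT, map_add, map_sub]
  simpa [pow_two] using parallelogram_law_with_norm ℝ (T x) (T y)

theorem IsAdmissibleStep.wnorm_zero (hP : IsAdmissibleStep P) : wnorm P 0 = 0 := by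
  obtain ⟨T, hT⟩ := hP.exists_wnorm_eq
  rw [hT, map_zero, norm_zero]

/-- The expectation is `(1/d) tr(Q⁻¹ Q)`; this is the purpose of the normalisation of `wnorm`. -/
theorem IsAdmissibleStep.tsum_wnorm_sq (hP : IsAdmissibleStep P) (hd : d ≠ 0) :
    ∑' x, P x * ENNReal.ofReal (wnorm P x ^ 2) = 1 := by
  have hu : IsUnit (covMatrix P).det := isUnit_iff_ne_zero.2 hP.posDef.det_pos.ne'
  have h1 : HasSum (fun x => (P x).toReal * wnorm P x ^ 2) 1 := by
    have hd' : (d : ℝ) ≠ 0 := by exact_mod_cast hd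
    have h2 : ∀ i j, HasSum (fun x : Fin d → ℤ => 1 / (d : ℝ) * ((covMatrix P)⁻¹ i j *
        ((x i : ℝ) * (x j : ℝ) * (P x).toReal))) (1 / (d : ℝ) * ((covMatrix P)⁻¹ i j *
          covMatrix P i j)) :=
      fun i j => ((hP.summable_mul i j).hasSum.mul_left _).mul_left _
    have h3 := hasSum_sum fun i (_ : i ∈ Finset.univ) => hasSum_sum fun j
      (_ : j ∈ Finset.univ) => h2 i j
    have h4 : ∑ i, ∑ j, 1 / (d : ℝ) * ((covMatrix P)⁻¹ i j * covMatrix P i j) = 1 := by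
      have h5 : ∑ i, ∑ j, (covMatrix P)⁻¹ i j * covMatrix P i j
          = ((covMatrix P)⁻¹ * covMatrix P).trace := by
        simp only [Matrix.trace, Matrix.diag, Matrix.mul_apply]
        refine Finset.sum_congr rfl fun i _ => Finset.sum_congr rfl fun j _ => ?_
        congr 1
        have := (covMatrix_isHermitian P).apply i j
        rw [star_trivial] at this
        exact this.symm
      simp only [← Finset.mul_sum]
      rw [h5, Matrix.nonsing_inv_mul _ hu, Matrix.trace_one, Fintype.card_fin]
      field_simp
    rw [h4] at h3
    refine h3.congr_fun fun x => ?_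
    have h6 := hP.invQuad_eq hd x
    have h7 : wnorm P x ^ 2 = 1 / (d : ℝ) * invQuad P (fun i => (x i : ℝ)) := by
      rw [h6]
      field_simp
    rw [h7]
    simp only [invQuad, Finset.mul_sum]
    exact Finset.sum_congr rfl fun i _ => Finset.sum_congr rfl fun j _ => by ring
  have h8 : ∀ x, P x * ENNReal.ofReal (wnorm P x ^ 2)
      = ENNReal.ofReal ((P x).toReal * wnorm P x ^ 2) := by
    intro x
    rw [ENNReal.ofReal_mul ENNReal.toReal_nonneg, ENNReal.ofReal_toReal (PMF.apply_ne_top _ _)]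
  simp_rw [h8]
  rw [← ENNReal.ofReal_tsum_of_nonneg (fun x => by positivity) h1.summable, h1.tsum_eq,
    ENNReal.ofReal_one]

/-- Orthogonality of increments, in the form of the parallelogram law for the last step and its
negative. No subtraction occurs, so all sums stay in `ℝ≥0∞`. -/
theorem IsAdmissibleStep.tsum_nStep_wnorm_sq (hP : IsAdmissibleStep P) (hd : d ≠ 0) (n : ℕ) :
    ∑' x, nStep P n x * ENNReal.ofReal (wnorm P x ^ 2) = n := by
  induction n with
  | zero =>
    rw [tsum_eq_single 0]
    · simp [hP.wnorm_zero]
    · intro x hx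
      simp [nStep_zero_apply, hx]
  | succ n ih =>
    have h0 : ∀ Q : PMF (Fin d → ℤ), (∀ y, Q y = Q (-y)) → ∀ x : Fin d → ℤ,
        2 * ∑' y, Q y * ENNReal.ofReal (wnorm P (x + y) ^ 2)
        = 2 * (ENNReal.ofReal (wnorm P x ^ 2) + ∑' y, Q y * ENNReal.ofReal (wnorm P y ^ 2)) := by
      intro Q hQ x
      have h1 : ∑' y, Q y * ENNReal.ofReal (wnorm P (x + y) ^ 2)
          = ∑' y, Q y * ENNReal.ofReal (wnorm P (x - y) ^ 2) := by
        rw [← (Equiv.neg (Fin d → ℤ)).tsum_eq]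
        refine tsum_congr fun y => ?_
        rw [Equiv.neg_apply, ← hQ, sub_eq_add_neg]
      rw [two_mul]
      nth_rewrite 2 [h1]
      rw [← ENNReal.tsum_add]
      have h2 : ∀ y, Q y * ENNReal.ofReal (wnorm P (x + y) ^ 2)
          + Q y * ENNReal.ofReal (wnorm P (x - y) ^ 2)
          = 2 * (Q y * ENNReal.ofReal (wnorm P x ^ 2) + Q y * ENNReal.ofReal (wnorm P y ^ 2)) := by
        intro y
        rw [← mul_add, ← mul_add, ← ENNReal.ofReal_add (by positivity) (by positivity),
          hP.wnorm_parallelogram, ENNReal.ofReal_mul (by norm_num),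
          ENNReal.ofReal_add (by positivity) (by positivity), ENNReal.ofReal_ofNat]
        ring
      simp_rw [h2]
      rw [ENNReal.tsum_mul_left, ENNReal.tsum_add, ENNReal.tsum_mul_right, PMF.tsum_coe, one_mul]
    have h1 : ∑' x, nStep P (n + 1) x * ENNReal.ofReal (wnorm P x ^ 2)
        = ∑' x, nStep P n x * ∑' y, P y * ENNReal.ofReal (wnorm P (x + y) ^ 2) := by
      simp_rw [nStep_succ_apply, ← ENNReal.tsum_mul_right, ← ENNReal.tsum_mul_left]
      rw [ENNReal.tsum_comm]
      refine tsum_congr fun x => ?_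
      rw [← (Equiv.addRight x).tsum_eq]
      refine tsum_congr fun y => ?_
      simp only [Equiv.coe_addRight, add_sub_cancel_right, mul_assoc]
      rw [add_comm y x]
    have h2 : ∀ x, ∑' y, P y * ENNReal.ofReal (wnorm P (x + y) ^ 2)
        = ENNReal.ofReal (wnorm P x ^ 2) + 1 := by
      intro x
      have := h0 P hP.symm x
      rw [hP.tsum_wnorm_sq hd] at this
      exact (ENNReal.mul_right_inj (by norm_num) (by norm_num)).1 this
    rw [h1]
    simp_rw [h2, mul_add, mul_one]
    rw [ENNReal.tsum_add, ih, PMF.tsum_coe]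
    push_cast
    rfl

open Classical in
/-- The mass of the `n`-step law within distance `2√n`. -/
noncomputable def typicalProb (P : PMF (Fin d → ℤ)) (n : ℕ) (y : Fin d → ℤ) : ℝ≥0∞ :=
  if wnorm P y ≤ 2 * √(n : ℝ) then nStep P n y else 0

/-- Chebyshev: distances beyond `2√n` have probability at most `n / (4n)`. -/
theorem IsAdmissibleStep.typical_mass (hP : IsAdmissibleStep P) (hd : d ≠ 0) {n : ℕ}
    (hn : n ≠ 0) : (3 / 4 : ℝ≥0∞) ≤ ∑' y, typicalProb P n y := by
  have hn' : (0 : ℝ) < n := by exact_mod_cast Nat.pos_of_ne_zero hn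
  have h1 : (1 : ℝ≥0∞) ≤ ∑' y, typicalProb P n y + 1 / 4 := by
    have h2 : ∀ y, nStep P n y ≤ typicalProb P n y
        + nStep P n y * ENNReal.ofReal (wnorm P y ^ 2) * ENNReal.ofReal (1 / (4 * n)) := by
      intro y
      unfold typicalProb
      split_ifs with h
      · exact le_self_add
      · rw [zero_add, mul_assoc, ← ENNReal.ofReal_mul (by positivity)]
        refine le_mul_of_one_le_right' ?_
        rw [← ENNReal.ofReal_one]
        refine ENNReal.ofReal_le_ofReal ?_
        have h3 : (2 * √(n : ℝ)) ^ 2 ≤ wnorm P y ^ 2 :=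
          pow_le_pow_left₀ (by positivity) (not_le.1 h).le 2
        rw [mul_pow, Real.sq_sqrt hn'.le] at h3
        rw [mul_one_div, le_div_iff₀ (by positivity)]
        linarith
    calc (1 : ℝ≥0∞) = ∑' y, nStep P n y := (PMF.tsum_coe _).symm
      _ ≤ ∑' y, (typicalProb P n y
        + nStep P n y * ENNReal.ofReal (wnorm P y ^ 2) * ENNReal.ofReal (1 / (4 * n))) :=
          ENNReal.tsum_le_tsum h2
      _ = _ := by
        rw [ENNReal.tsum_add, ENNReal.tsum_mul_right, hP.tsum_nStep_wnorm_sq hd]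
        congr 1
        rw [← ENNReal.ofReal_natCast, ← ENNReal.ofReal_mul (by positivity)]
        rw [show (n : ℝ) * (1 / (4 * n)) = 1 / 4 by field_simp]
        rw [ENNReal.ofReal_div_of_pos (by norm_num)]
        simp
  have h3 : (3 / 4 : ℝ≥0∞) + 1 / 4 = 1 := by
    rw [ENNReal.div_add_div_same]
    norm_num
    exact ENNReal.div_self (by norm_num) (by norm_num)
  exact (ENNReal.add_le_add_iff_right (a := 1 / 4) (by simp)).1 (h3.trans_le h1)

end Kernel

/-! ### Dimension six: explicit constants and the comparison of bridges with free walks. -/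

section SixDim

variable {P : PMF (Fin 6 → ℤ)}

theorem IsAdmissibleStep.scaleD_pos (hP : IsAdmissibleStep P) : 0 < scaleD P :=
  Real.rpow_pos_of_pos hP.posDef.det_pos _

theorem prefactor_eq (P : PMF (Fin 6 → ℤ)) (n : ℕ) :
    lcltPrefactor P n = period P / ((2 * Real.pi) ^ 3 * (scaleD P ^ 6 * (n : ℝ) ^ 3)) := by
  have hpi := Real.pi_pos
  have h1 : (2 * Real.pi) ^ (-((6 : ℕ) : ℝ) / 2) = ((2 * Real.pi) ^ 3)⁻¹ := by
    rw [← Real.rpow_natCast (2 * Real.pi) 3, ← Real.rpow_neg (by positivity)]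
    norm_num
  have h2 : (n : ℝ) ^ (((6 : ℕ) : ℝ) / 2) = (n : ℝ) ^ 3 := by
    rw [← Real.rpow_natCast (n : ℝ) 3]
    norm_num
  rw [lcltPrefactor, h1, h2]
  ring

/-- Crude bounds, enough to hide `(2π)³` and the period in universal constants. -/
theorem two_pi_pow_bounds : 8 ≤ (2 * Real.pi) ^ 3 ∧ (2 * Real.pi) ^ 3 ≤ 512 := by
  have h1 := Real.pi_gt_three
  have h2 := Real.pi_le_four
  constructor
  · calc (8 : ℝ) ≤ (2 * 3) ^ 3 := by norm_num
      _ ≤ _ := by gcongr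
  · calc (2 * Real.pi) ^ 3 ≤ (2 * 4) ^ 3 := by gcongr
      _ = 512 := by norm_num

theorem IsAdmissibleStep.maxProb_le (hP : IsAdmissibleStep P) {nstar n : ℕ}
    (hns : leastNStar P ≤ nstar) (hn : nstar ≤ n) :
    maxProb P n ≤ ENNReal.ofReal (1 / (scaleD P ^ 6 * (n : ℝ) ^ 3)) := by
  have hD := hP.scaleD_pos
  have hn0 : 0 < n := (hP.nStar_pos (by norm_num) hns).trans_le hn
  have hn0' : (0 : ℝ) < n := by exact_mod_cast hn0
  refine iSup_le fun y => ?_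
  rw [← ENNReal.ofReal_toReal (PMF.apply_ne_top (nStep P n) y)]
  refine ENNReal.ofReal_le_ofReal
    ((hP.isUpperThreshold (by norm_num) hns n hn y).trans ?_)
  have h1 := two_pi_pow_bounds.1
  have h2 : (period P : ℝ) ≤ 2 := by
    rcases period_cases P with h | h <;> rw [h] <;> norm_num
  rw [prefactor_eq, ← mul_div_assoc, div_le_div_iff₀ (by positivity) (by positivity)]
  have h3 : 0 < scaleD P ^ 6 * (n : ℝ) ^ 3 := by positivity
  nlinarith

theorem IsAdmissibleStep.prefactor_antitone (hP : IsAdmissibleStep P) {m n : ℕ} (hm : 0 < m)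
    (h : m ≤ n) : lcltPrefactor P n ≤ lcltPrefactor P m := by
  have hD := hP.scaleD_pos
  have hpi := Real.pi_pos
  have hm' : (0 : ℝ) < m := by exact_mod_cast hm
  have hmn : (m : ℝ) ≤ n := by exact_mod_cast h
  rw [prefactor_eq, prefactor_eq]
  gcongr

theorem IsAdmissibleStep.le_prefactor (hP : IsAdmissibleStep P) {n : ℕ} (hn : 0 < n) :
    1 / (512 * (scaleD P ^ 6 * (n : ℝ) ^ 3)) ≤ lcltPrefactor P n := by
  have hD := hP.scaleD_pos
  have hpi := Real.pi_pos
  have hn' : (0 : ℝ) < n := by exact_mod_cast hn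
  have h1 : (1 : ℝ) ≤ period P := by
    rcases period_cases P with h | h <;> rw [h] <;> norm_num
  rw [prefactor_eq]
  gcongr
  exact two_pi_pow_bounds.2

/-- Conditioning on the endpoint of a walk changes the law of a short final piece by at most a
constant factor. -/
theorem IsAdmissibleStep.bridge_lower (hP : IsAdmissibleStep P) {n₁ n₂ : ℕ}
    (h₁ : IsUpperThreshold P n₁) (h₂ : IsLocalThreshold P (1 / 2) 1 n₂) {β a : ℕ} (hβ : 0 < β)
    (hβ₁ : n₁ ≤ β) (hβ₂ : n₂ ≤ β) {v s : Fin 6 → ℤ} (hs : nStep P a s ≠ 0)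
    (hvs : wnorm P (v - s) ≤ √(β : ℝ)) :
    ENNReal.ofReal (Real.exp (-3) / 4) * nStep P (β + a) v ≤ nStep P β (v - s) := by
  by_cases hv : nStep P (β + a) v = 0
  · rw [hv, mul_zero]
    exact zero_le
  have hβ' : (0 : ℝ) < β := by exact_mod_cast hβ
  -- A walk to `v` in `β + a` steps followed by the reversal of a walk to `s` in `a` steps reaches
  -- `v - s` at a time of the parity of `β`.
  have hpar : ∃ m, m % 2 = β % 2 ∧ nStep P m (v - s) ≠ 0 := by
    refine ⟨β + a + a, by omega, ?_⟩
    rw [sub_eq_add_neg]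
    exact nStep_add_ne_zero hv (by rwa [nStep_neg hP.symm])
  have h3 := (h₂ β hβ₂ (v - s) (by simpa using hvs)).2 hpar
  have h4 := h₁ (β + a) (by omega) v
  have h5 := hP.prefactor_antitone hβ (Nat.le_add_right β a)
  -- The exponent is at most `6 / 2 = 3` in absolute value. The factor `1/4` in the statement is the
  -- lower constant `1/2` of the local limit divided by the upper constant `2`.
  have h6 : Real.exp (-3) ≤ Real.exp (-((6 : ℕ) : ℝ) * wnorm P (v - s) ^ 2 / (2 * β)) := by
    rw [Real.exp_le_exp, le_div_iff₀ (by positivity)]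
    have := pow_le_pow_left₀ (wnorm_nonneg P _) hvs 2
    rw [Real.sq_sqrt hβ'.le] at this
    push_cast
    linarith
  have h7 : 0 ≤ lcltPrefactor P β := le_trans (by
    have := hP.scaleD_pos
    positivity) (hP.le_prefactor hβ)
  rw [← ENNReal.ofReal_toReal (PMF.apply_ne_top (nStep P (β + a)) v),
    ← ENNReal.ofReal_toReal (PMF.apply_ne_top (nStep P β) (v - s)),
    ← ENNReal.ofReal_mul (by positivity)]
  refine ENNReal.ofReal_le_ofReal (le_trans ?_ h3)
  have h8 := Real.exp_pos (-3)
  calc Real.exp (-3) / 4 * (nStep P (β + a) v).toReal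
      ≤ Real.exp (-3) / 4 * (2 * lcltPrefactor P β) := by
        gcongr
        linarith
    _ = (1 - 1 / 2) * lcltPrefactor P β * Real.exp (-3) := by ring
    _ ≤ _ := by gcongr

theorem IsAdmissibleStep.nStep_lower (hP : IsAdmissibleStep P) {n₂ : ℕ}
    (h₂ : IsLocalThreshold P (1 / 2) 6 n₂) {n : ℕ} (hn0 : 0 < n) (hn : n₂ ≤ n) {y : Fin 6 → ℤ}
    (hy : wnorm P y ≤ 6 * √(n : ℝ)) (hpar : ∃ m, m % 2 = n % 2 ∧ nStep P m y ≠ 0) :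
    ENNReal.ofReal (Real.exp (-108) / (1024 * (scaleD P ^ 6 * (n : ℝ) ^ 3))) ≤ nStep P n y := by
  have hn' : (0 : ℝ) < n := by exact_mod_cast hn0
  have hD := hP.scaleD_pos
  have h3 := (h₂ n hn y hy).2 hpar
  -- The exponent is at most `6 · 6² / 2 = 108`: dimension six, window `L = 6`.
  have h6 : Real.exp (-108) ≤ Real.exp (-((6 : ℕ) : ℝ) * wnorm P y ^ 2 / (2 * n)) := by
    rw [Real.exp_le_exp, le_div_iff₀ (by positivity)]
    have := pow_le_pow_left₀ (wnorm_nonneg P _) hy 2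
    rw [mul_pow, Real.sq_sqrt hn'.le] at this
    push_cast
    linarith
  rw [← ENNReal.ofReal_toReal (PMF.apply_ne_top (nStep P n) y)]
  refine ENNReal.ofReal_le_ofReal (le_trans ?_ h3)
  calc Real.exp (-108) / (1024 * (scaleD P ^ 6 * (n : ℝ) ^ 3))
      = (1 - 1 / 2) * (1 / (512 * (scaleD P ^ 6 * (n : ℝ) ^ 3))) * Real.exp (-108) := by
        field_simp
        norm_num
    _ ≤ _ := by
        have h8 := hP.le_prefactor hn0
        have h9 : 0 ≤ 1 / (512 * (scaleD P ^ 6 * (n : ℝ) ^ 3)) := by positivity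
        gcongr
        exact mul_nonneg (by norm_num) (h9.trans h8)

/-- The universal constant in the spatial lower bound. -/
noncomputable def spatialConst : ℝ :=
  (Real.exp (-3) / 4) ^ 2 * (3 / 4) ^ 3 * (Real.exp (-108) / 1024)

theorem spatialConst_pos : 0 < spatialConst := by unfold spatialConst; positivity

open Classical in
/-- Given the endpoints of two walks, perturbing the final `a₁` resp. `a₂` steps and continuing for
`t` more steps leads to a meeting with probability of order `(a₂ + t)^{-3}`. -/
theorem IsAdmissibleStep.spatial_lower (hP : IsAdmissibleStep P) {n₀ : ℕ}
    (h₁ : IsUpperThreshold P n₀) (h₂ : IsLocalThreshold P (1 / 2) 1 n₀)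
    (h₆ : IsLocalThreshold P (1 / 2) 6 n₀) {β₁ β₂ a₁ a₂ t : ℕ} (ha₁ : 0 < a₁)
    (hn : n₀ ≤ a₁) (ha : a₁ ≤ a₂) (hβ₁ : 100 * a₁ ≤ β₁) (hβ₂ : 100 * a₂ ≤ β₂)
    {v₁ v₂ : Fin 6 → ℤ} (hv₁ : wnorm P v₁ ≤ 1 / 2 * √((β₁ + a₁ : ℕ) : ℝ))
    (hv₂ : wnorm P v₂ ≤ 1 / 2 * √((β₂ + a₂ : ℕ) : ℝ)) :
    ENNReal.ofReal (spatialConst / (scaleD P ^ 6 * ((a₂ + t : ℕ) : ℝ) ^ 3))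
        * (nStep P (β₁ + a₁) v₁ * nStep P (β₂ + a₂) v₂)
      ≤ ∑' s₁, ∑' s₂, ∑' x, nStep P β₁ (v₁ - s₁) * nStep P a₁ s₁ *
          (nStep P β₂ (v₂ - s₂) * nStep P a₂ s₂) * (nStep P (a₁ + t) x *
          nStep P (a₂ + t) (x - s₁ + s₂)) *
          if wnorm P (x - s₁) ≤ 4 * √((a₁ + t : ℕ) : ℝ) then 1 else 0 := by
  have hD := hP.scaleD_pos
  set c₁ := ENNReal.ofReal (Real.exp (-3) / 4) with hc₁
  set c₂ := ENNReal.ofReal (Real.exp (-108) / (1024 * (scaleD P ^ 6 * ((a₂ + t : ℕ) : ℝ) ^ 3)))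
    with hc₂
  have hat : 0 < a₂ + t := by omega
  have hat' : (0 : ℝ) < ((a₂ + t : ℕ) : ℝ) := by exact_mod_cast hat
  -- As `a ≤ β / 100`, the norm of `v - s` is at most `(1/2)(6/5)√β + 2 (1/10)√β`, within the window
  -- of `bridge_lower`.
  have haux : ∀ {β a : ℕ} {v s : Fin 6 → ℤ}, 100 * a ≤ β →
      wnorm P v ≤ 1 / 2 * √((β + a : ℕ) : ℝ) → wnorm P s ≤ 2 * √(a : ℝ) →
      wnorm P (v - s) ≤ √(β : ℝ) := by
    intro β a v s hβ hv hs
    refine (hP.wnorm_sub_le v s).trans ?_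
    have hβ' : 100 * (a : ℝ) ≤ β := by exact_mod_cast hβ
    have h3 : √((β + a : ℕ) : ℝ) ≤ 6 / 5 * √(β : ℝ) := by
      rw [Real.sqrt_le_iff]
      refine ⟨by positivity, ?_⟩
      rw [mul_pow, Real.sq_sqrt (Nat.cast_nonneg β)]
      push_cast
      linarith
    have h4 : √(a : ℝ) ≤ 1 / 10 * √(β : ℝ) := by
      rw [Real.sqrt_le_iff]
      refine ⟨by positivity, ?_⟩
      rw [mul_pow, Real.sq_sqrt (Nat.cast_nonneg β)]
      linarith
    have := Real.sqrt_nonneg (β : ℝ)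
    linarith
  have hterm : ∀ s₁ s₂ x, c₁ * c₁ * c₂ * (nStep P (β₁ + a₁) v₁ * nStep P (β₂ + a₂) v₂) *
      (typicalProb P a₁ s₁ * (typicalProb P a₂ s₂ * typicalProb P (a₁ + t) x))
      ≤ nStep P β₁ (v₁ - s₁) * nStep P a₁ s₁ *
          (nStep P β₂ (v₂ - s₂) * nStep P a₂ s₂) * (nStep P (a₁ + t) x *
          nStep P (a₂ + t) (x - s₁ + s₂)) *
          if wnorm P (x - s₁) ≤ 4 * √((a₁ + t : ℕ) : ℝ) then 1 else 0 := by
    intro s₁ s₂ x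
    by_cases hz : typicalProb P a₁ s₁ * (typicalProb P a₂ s₂ * typicalProb P (a₁ + t) x) = 0
    · rw [hz, mul_zero]
      exact zero_le
    have ht : ∀ {n y}, typicalProb P n y ≠ 0 → wnorm P y ≤ 2 * √(n : ℝ) ∧ nStep P n y ≠ 0 ∧
        typicalProb P n y = nStep P n y := by
      intro n y h
      unfold typicalProb at h ⊢
      split_ifs at h with h1
      · exact ⟨h1, h, if_pos h1⟩
      · exact absurd rfl h
    simp only [mul_eq_zero, not_or] at hz
    obtain ⟨hs₁, hs₁', e₁⟩ := ht hz.1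
    obtain ⟨hs₂, hs₂', e₂⟩ := ht hz.2.1
    obtain ⟨hx, hx', e₃⟩ := ht hz.2.2
    have m₁ : √(a₁ : ℝ) ≤ √((a₁ + t : ℕ) : ℝ) :=
      Real.sqrt_le_sqrt (by exact_mod_cast Nat.le_add_right _ _)
    have m₂ : √((a₁ + t : ℕ) : ℝ) ≤ √((a₂ + t : ℕ) : ℝ) := Real.sqrt_le_sqrt (by
      exact_mod_cast Nat.add_le_add_right ha t)
    have m₃ : √(a₂ : ℝ) ≤ √((a₂ + t : ℕ) : ℝ) :=
      Real.sqrt_le_sqrt (by exact_mod_cast Nat.le_add_right _ _)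
    have hxs := hP.wnorm_sub_le x s₁
    rw [if_pos (by linarith), mul_one, e₁, e₂, e₃]
    have b₁ := hP.bridge_lower h₁ h₂ (by omega) (by omega) (by omega) hs₁' (haux hβ₁ hv₁ hs₁)
    have b₂ := hP.bridge_lower h₁ h₂ (by omega) (by omega) (by omega) hs₂' (haux hβ₂ hv₂ hs₂)
    -- Three typical pieces, each of norm at most `2√(a₂ + t)`, explain the window `L = 6`;
    -- reversing the piece `s₁` gives a time of the right parity.
    have b₃ : c₂ ≤ nStep P (a₂ + t) (x - s₁ + s₂) := by
      refine hP.nStep_lower h₆ hat (by omega) ?_ ⟨a₁ + t + a₁ + a₂, by omega, ?_⟩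
      · have := hP.wnorm_add_le (x - s₁) s₂
        linarith
      · refine nStep_add_ne_zero ?_ hs₂'
        rw [sub_eq_add_neg]
        exact nStep_add_ne_zero hx' (by rwa [nStep_neg hP.symm])
    calc c₁ * c₁ * c₂ * (nStep P (β₁ + a₁) v₁ * nStep P (β₂ + a₂) v₂) *
          (nStep P a₁ s₁ * (nStep P a₂ s₂ * nStep P (a₁ + t) x))
        = (c₁ * nStep P (β₁ + a₁) v₁) * nStep P a₁ s₁ * ((c₁ * nStep P (β₂ + a₂) v₂) *
          nStep P a₂ s₂) * (nStep P (a₁ + t) x * c₂) := by ring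
      _ ≤ _ := by gcongr
  calc ENNReal.ofReal (spatialConst / (scaleD P ^ 6 * ((a₂ + t : ℕ) : ℝ) ^ 3))
        * (nStep P (β₁ + a₁) v₁ * nStep P (β₂ + a₂) v₂)
      = c₁ * c₁ * c₂ * (nStep P (β₁ + a₁) v₁ * nStep P (β₂ + a₂) v₂) *
          (3 / 4 * (3 / 4 * (3 / 4))) := by
        have h34 : (3 / 4 : ℝ≥0∞) = ENNReal.ofReal (3 / 4) := by
          rw [ENNReal.ofReal_div_of_pos (by norm_num)]
          simp
        rw [h34, hc₁, hc₂]
        have : spatialConst / (scaleD P ^ 6 * ((a₂ + t : ℕ) : ℝ) ^ 3)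
          = Real.exp (-3) / 4 * (Real.exp (-3) / 4) *
            (Real.exp (-108) / (1024 * (scaleD P ^ 6 * ((a₂ + t : ℕ) : ℝ) ^ 3))) *
            (3 / 4 * (3 / 4 * (3 / 4))) := by
          unfold spatialConst
          field_simp
        rw [this]
        rw [ENNReal.ofReal_mul (by positivity), ENNReal.ofReal_mul (by positivity),
          ENNReal.ofReal_mul (by positivity), ENNReal.ofReal_mul (by positivity),
          ENNReal.ofReal_mul (by positivity)]
        ring
    _ ≤ c₁ * c₁ * c₂ * (nStep P (β₁ + a₁) v₁ * nStep P (β₂ + a₂) v₂) *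
          ((∑' s₁, typicalProb P a₁ s₁) * ((∑' s₂, typicalProb P a₂ s₂) *
            ∑' x, typicalProb P (a₁ + t) x)) := by
        gcongr
        · exact hP.typical_mass (by norm_num) (by omega)
        · exact hP.typical_mass (by norm_num) (by omega)
        · exact hP.typical_mass (by norm_num) (by omega)
    _ = ∑' s₁, ∑' s₂, ∑' x, c₁ * c₁ * c₂ * (nStep P (β₁ + a₁) v₁ * nStep P (β₂ + a₂) v₂) *
          (typicalProb P a₁ s₁ * (typicalProb P a₂ s₂ * typicalProb P (a₁ + t) x)) := by
        simp_rw [ENNReal.tsum_mul_left, ENNReal.tsum_mul_right]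
    _ ≤ _ := ENNReal.tsum_le_tsum fun s₁ => ENNReal.tsum_le_tsum fun s₂ =>
        ENNReal.tsum_le_tsum fun x => hterm s₁ s₂ x

end SixDim


/-! ### Resampling and splitting of infinite product measures. -/

section Resample

variable {ι E : Type*} [MeasurableSpace E]

theorem measurable_update_prod [DecidableEq ι] (e : ι) :
    Measurable fun q : (ι → E) × E => Function.update q.1 e q.2 := by
  rw [measurable_pi_iff]
  intro i
  by_cases h : i = e
  · subst h
    simpa using measurable_snd
  · simp only [ne_eq, h, not_false_eq_true, Function.update_of_ne]
    exact (measurable_pi_apply i).comp measurable_fst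

variable (ν : Measure E) [IsProbabilityMeasure ν]

/-- Checked on finite boxes, where refreshing a coordinate merely splits off its factor. -/
theorem map_update_infinitePi [DecidableEq ι] (e : ι) :
    ((Measure.infinitePi fun _ : ι => ν).prod ν).map (fun q => Function.update q.1 e q.2)
      = Measure.infinitePi fun _ : ι => ν := by
  have hmeas := measurable_update_prod (E := E) e
  refine Measure.eq_infinitePi _ fun s t ht => ?_
  rw [Measure.map_apply hmeas (MeasurableSet.pi s.countable_toSet fun i _ => ht i)]
  by_cases he : e ∈ s
  · have : (fun q : (ι → E) × E => Function.update q.1 e q.2) ⁻¹' (Set.pi s t)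
        = (Set.pi (s.erase e : Finset ι) t) ×ˢ t e := by
      ext q
      simp only [Set.mem_preimage, Set.mem_pi, Set.mem_prod, Finset.mem_coe, Finset.mem_erase]
      constructor
      · exact fun h => ⟨fun i hi => by simpa [Function.update_of_ne hi.1] using h i hi.2,
          by simpa using h e he⟩
      · rintro ⟨h1, h2⟩ i hi
        by_cases h : i = e
        · subst h
          simpa using h2
        · simpa [Function.update_of_ne h] using h1 i ⟨h, hi⟩
    rw [this, Measure.prod_prod, Measure.infinitePi_pi _ fun i _ => ht i, mul_comm,
      Finset.mul_prod_erase s (fun i => ν (t i)) he]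
  · have : (fun q : (ι → E) × E => Function.update q.1 e q.2) ⁻¹' (Set.pi s t)
        = (Set.pi s t) ×ˢ Set.univ := by
      ext q
      simp only [Set.mem_preimage, Set.mem_pi, Set.mem_prod, Finset.mem_coe, Set.mem_univ, and_true]
      refine forall₂_congr fun i hi => ?_
      rw [Function.update_of_ne]
      rintro rfl
      exact he hi
    rw [this, Measure.prod_prod, Measure.infinitePi_pi _ fun i _ => ht i, measure_univ, mul_one]

theorem lintegral_resample [DecidableEq ι] (e : ι) {F : (ι → E) → ℝ≥0∞} (hF : Measurable F) :
    ∫⁻ ξ, F ξ ∂(Measure.infinitePi fun _ : ι => ν)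
      = ∫⁻ ξ, ∫⁻ z, F (Function.update ξ e z) ∂ν ∂(Measure.infinitePi fun _ : ι => ν) := by
  have hmeas := measurable_update_prod (E := E) e
  conv_lhs => rw [← map_update_infinitePi ν e]
  rw [lintegral_map hF hmeas, 
    lintegral_prod (fun q => F (Function.update q.1 e q.2)) (hF.comp hmeas).aemeasurable]

theorem map_sumElim_infinitePi {κ : Type*} :
    ((Measure.infinitePi fun _ : ι => ν).prod (Measure.infinitePi fun _ : κ => ν)).map
      (fun q => Sum.elim q.1 q.2) = Measure.infinitePi fun _ : ι ⊕ κ => ν := by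
  classical
  have hmeas : Measurable fun q : (ι → E) × (κ → E) => Sum.elim q.1 q.2 := by
    rw [measurable_pi_iff]
    rintro (i | i)
    · exact (measurable_pi_apply i).comp measurable_fst
    · exact (measurable_pi_apply i).comp measurable_snd
  refine Measure.eq_infinitePi _ fun s t ht => ?_
  rw [Measure.map_apply hmeas (MeasurableSet.pi s.countable_toSet fun i _ => ht i)]
  have : (fun q : (ι → E) × (κ → E) => (Sum.elim q.1 q.2 : ι ⊕ κ → E)) ⁻¹' (Set.pi s t)
      = (Set.pi (s.toLeft : Finset ι) fun i => t (Sum.inl i))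
        ×ˢ (Set.pi (s.toRight : Finset κ) fun i => t (Sum.inr i)) := by
    ext q
    simp [Set.mem_pi]
  rw [this, Measure.prod_prod, Measure.infinitePi_pi _ fun i _ => ht _,
    Measure.infinitePi_pi _ fun i _ => ht _]
  conv_rhs => rw [← Finset.toLeft_disjSum_toRight (u := s)]
  rw [Finset.prod_disjSum]

end Resample

/-! ### Sums over fresh edges, independent of everything else. -/

section Fresh

variable {ι : Type*} {d : ℕ}

theorem lintegral_toMeasure {α : Type*} [MeasurableSpace α] [Countable α]
    [MeasurableSingletonClass α] (p : PMF α) (f : α → ℝ≥0∞) :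
    ∫⁻ x, f x ∂p.toMeasure = ∑' x, p x * f x := by
  rw [lintegral_countable']
  refine tsum_congr fun x => ?_
  rw [PMF.toMeasure_apply_singleton _ _ (measurableSet_singleton x), mul_comm]

/-- The law of i.i.d. displacements. -/
noncomputable abbrev dispLaw (ι : Type*) {d : ℕ} (P : PMF (Fin d → ℤ)) :
    Measure (ι → Fin d → ℤ) := Measure.infinitePi fun _ => P.toMeasure

/-- `b` does not depend on the coordinates in `S`. -/
def IndepOf {E B : Type*} (S : Finset ι) (b : (ι → E) → B) : Prop :=
  ∀ ξ ξ' : ι → E, (∀ e, e ∉ S → ξ e = ξ' e) → b ξ = b ξ'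

/-- `X` has weights `w` and is independent of `b`. -/
def HasFreshLaw {Ω B Y : Type*} [MeasurableSpace Ω] (μ : Measure Ω) (b : Ω → B) (X : Ω → Y)
    (w : Y → ℝ≥0∞) : Prop :=
  ∀ G : B → Y → ℝ≥0∞, ∫⁻ ω, G (b ω) (X ω) ∂μ = ∫⁻ ω, ∑' y, w y * G (b ω) y ∂μ

/-- Chain rule: `X'` is sampled first and counts as past for `X`. Iterated, it gives the joint law
of several disjoint pieces without any conditional expectations. -/
theorem HasFreshLaw.pair {Ω B Y Z : Type*} [MeasurableSpace Ω] {μ : Measure Ω} {b : Ω → B}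
    {X : Ω → Y} {X' : Ω → Z} {w : Y → ℝ≥0∞} {w' : Z → ℝ≥0∞}
    (h : HasFreshLaw μ (fun ω => (b ω, X' ω)) X w) (h' : HasFreshLaw μ b X' w') :
    HasFreshLaw μ b (fun ω => (X ω, X' ω)) (fun q => w q.1 * w' q.2) := by
  intro G
  have h1 := h fun q y => G q.1 (y, q.2)
  have h2 := h' fun c z => ∑' y, w y * G c (y, z)
  simp only at h1 h2
  rw [h1, h2]
  refine lintegral_congr fun ω => ?_
  rw [ENNReal.tsum_prod', ENNReal.tsum_comm]
  refine tsum_congr fun z => ?_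
  rw [← ENNReal.tsum_mul_left]
  exact tsum_congr fun y => by ring

@[fun_prop]
theorem measurable_sum_disp (S : Finset ι) :
    Measurable fun ξ : ι → Fin d → ℤ => ∑ e ∈ S, ξ e :=
  Finset.measurable_sum S fun e _ => measurable_pi_apply e

/-- The sum of the displacements over a set of edges has the law of the walk, and is independent of
everything that does not depend on these edges. -/
theorem hasFreshLaw_sum [DecidableEq ι] (P : PMF (Fin d → ℤ)) (S : Finset ι) {B : Type*}
    [MeasurableSpace B] [Countable B] [MeasurableSingletonClass B]
    {b : (ι → Fin d → ℤ) → B} (hb : Measurable b) (hS : IndepOf S b) :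
    HasFreshLaw (dispLaw ι P) b (fun ξ => ∑ e ∈ S, ξ e) (nStep P S.card) := by
  induction S using Finset.induction_on generalizing B with
  | empty =>
    intro G
    simp only [Finset.sum_empty, Finset.card_empty]
    refine lintegral_congr fun ξ => ?_
    rw [tsum_eq_single 0]
    · simp [nStep_zero_apply]
    · intro y hy
      simp [nStep_zero_apply, hy]
  | insert e S he ih =>
    intro G
    -- The displacement on `e` first counts as past, so that the induction hypothesis handles `S`;
    -- afterwards it is resampled.
    have h1 := ih (b := fun ξ => (b ξ, ξ e)) (hb.prodMk (measurable_pi_apply e)) (by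
      intro ξ ξ' h
      simp only [Prod.mk.injEq]
      refine ⟨?_, h e he⟩
      exact hS ξ ξ' fun e' h' => h e' fun h'' => h' (Finset.mem_insert_of_mem h''))
      (fun q y => G q.1 (q.2 + y))
    simp only at h1
    simp_rw [Finset.sum_insert he]
    rw [h1, lintegral_resample _ e]
    swap
    · exact (Measurable.of_discrete (f := fun q : B × (Fin d → ℤ) =>
        ∑' y, nStep P S.card y * G q.1 (q.2 + y))).comp (hb.prodMk (measurable_pi_apply e))
    refine lintegral_congr fun ξ => ?_
    rw [lintegral_toMeasure, Finset.card_insert_of_notMem he]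
    have h2 : ∀ z, b (Function.update ξ e z) = b ξ := fun z =>
      hS _ _ fun e' h' => Function.update_of_ne (by rintro rfl; simp at h') _ _
    simp only [h2, Function.update_self]
    simp_rw [add_comm S.card 1, nStep_add_apply, nStep_one, ← ENNReal.tsum_mul_left,
      ← ENNReal.tsum_mul_right]
    conv_rhs => rw [ENNReal.tsum_comm]
    refine tsum_congr fun z => ?_
    conv_rhs => rw [← (Equiv.addLeft z).tsum_eq]
    refine tsum_congr fun y => ?_
    simp only [Equiv.coe_addLeft, add_sub_cancel_left, mul_assoc]

theorem IndepOf.mono {E B : Type*} {S T : Finset ι} {b : (ι → E) → B} (h : IndepOf T b)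
    (hST : S ⊆ T) : IndepOf S b :=
  fun ξ ξ' hξ => h ξ ξ' fun e he => hξ e fun he' => he (hST he')

theorem IndepOf.prodMk {E B C : Type*} {S : Finset ι} {b : (ι → E) → B} {c : (ι → E) → C}
    (h : IndepOf S b) (h' : IndepOf S c) : IndepOf S fun ξ => (b ξ, c ξ) :=
  fun ξ ξ' hξ => Prod.ext (h ξ ξ' hξ) (h' ξ ξ' hξ)

theorem indepOf_sum {S T : Finset ι} (h : Disjoint S T) :
    IndepOf S fun ξ : ι → Fin d → ℤ => ∑ e ∈ T, ξ e :=
  fun _ _ hξ => Finset.sum_congr rfl fun e he => hξ e fun he' =>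
    Finset.disjoint_left.1 h he' he

theorem measurableSet_preimage_countable {Ω B : Type*} [MeasurableSpace Ω] [MeasurableSpace B]
    [Countable B] [MeasurableSingletonClass B] {b : Ω → B} (hb : Measurable b) (A : Set B) :
    MeasurableSet {ω | b ω ∈ A} :=
  hb (Set.to_countable A).measurableSet

/-- Two fresh walks meet with probability at most the maximal transition probability. -/
theorem meet_le [DecidableEq ι] {P : PMF (Fin d → ℤ)} (hs : ∀ x, P x = P (-x)) {S T : Finset ι}
    (hST : Disjoint S T) {B : Type*} [MeasurableSpace B] [Countable B]
    [MeasurableSingletonClass B] {b : (ι → Fin d → ℤ) → B} (hb : Measurable b)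
    (hbST : IndepOf (S ∪ T) b) (A : Set B) (c c' : B → Fin d → ℤ) :
    dispLaw ι P {ξ | b ξ ∈ A ∧ c (b ξ) + ∑ e ∈ S, ξ e = c' (b ξ) + ∑ e ∈ T, ξ e}
      ≤ maxProb P (S.card + T.card) * dispLaw ι P {ξ | b ξ ∈ A} := by
  classical
  have hT := hasFreshLaw_sum P T hb (hbST.mono Finset.subset_union_right)
  have hS := hasFreshLaw_sum P S (hb.prodMk (measurable_sum_disp T))
    ((hbST.mono Finset.subset_union_left).prodMk (indepOf_sum hST))
  have h1 := hS.pair hT fun β q => if β ∈ A ∧ c β + q.1 = c' β + q.2 then 1 else 0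
  have hm : Measurable fun ξ : ι → Fin d → ℤ => (b ξ, ∑ e ∈ S, ξ e, ∑ e ∈ T, ξ e) :=
    hb.prodMk ((measurable_sum_disp S).prodMk (measurable_sum_disp T))
  have hA : MeasurableSet {ξ : ι → Fin d → ℤ |
      b ξ ∈ A ∧ c (b ξ) + ∑ e ∈ S, ξ e = c' (b ξ) + ∑ e ∈ T, ξ e} :=
    measurableSet_preimage_countable hm
      {q : B × (Fin d → ℤ) × (Fin d → ℤ) | q.1 ∈ A ∧ c q.1 + q.2.1 = c' q.1 + q.2.2}
  rw [← lintegral_indicator_one hA]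
  have h2 : ∫⁻ ξ, Set.indicator {ξ : ι → Fin d → ℤ |
      b ξ ∈ A ∧ c (b ξ) + ∑ e ∈ S, ξ e = c' (b ξ) + ∑ e ∈ T, ξ e} 1 ξ ∂dispLaw ι P
      = ∫⁻ ξ, ∑' q : (Fin d → ℤ) × (Fin d → ℤ), nStep P S.card q.1 * nStep P T.card q.2 *
        (if b ξ ∈ A ∧ c (b ξ) + q.1 = c' (b ξ) + q.2 then 1 else 0) ∂dispLaw ι P := by
    rw [← h1]
    refine lintegral_congr fun ξ => ?_
    simp [Set.indicator_apply]
  rw [h2, ← lintegral_indicator_one (measurableSet_preimage_countable hb A),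
    ← lintegral_const_mul _ (measurable_one.indicator (measurableSet_preimage_countable hb A))]
  refine lintegral_mono fun ξ => ?_
  by_cases h : b ξ ∈ A
  · simp only [h, true_and]
    rw [ENNReal.tsum_prod']
    simp_rw [mul_assoc]
    rw [show ∑' x, ∑' y, nStep P S.card x * (nStep P T.card y *
      if c (b ξ) + x = c' (b ξ) + y then 1 else 0) = _ from tsum_meet hs _ _ _ _]
    simpa [Set.indicator_apply, h] using nStep_le_maxProb P _ _
  · simp [h]

end Fresh


/-! ### A second meeting, given a first one. -/

section DisplacementLower

variable {ι : Type*}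

/-- Change the coordinates in `S` first and the remaining ones in `T` afterwards, through a hybrid
configuration. -/
theorem IndepOf.union {E B : Type*} [DecidableEq ι] {S T : Finset ι} {b : (ι → E) → B}
    (h : IndepOf S b) (h' : IndepOf T b) : IndepOf (S ∪ T) b := by
  intro ξ ξ' hξ
  classical
  refine (h ξ (fun e => if e ∈ S then ξ' e else ξ e) fun e he => by simp [he]).trans
    (h' _ ξ' fun e he => ?_)
  by_cases heS : e ∈ S
  · simp [heS]
  · simpa [heS] using hξ e (by simp [heS, he])

/-- Given that two walks end at the same place, their ends can be replaced by fresh walks which meet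
again, at the expected cost. -/
theorem IsAdmissibleStep.displacement_lower [DecidableEq ι] {P : PMF (Fin 6 → ℤ)}
    (hP : IsAdmissibleStep P) {n₀ : ℕ}
    (h₁ : IsUpperThreshold P n₀) (h₂ : IsLocalThreshold P (1 / 2) 1 n₀)
    (h₆ : IsLocalThreshold P (1 / 2) 6 n₀) {β₁ β₂ a₁ a₂ t : ℕ} (ha₁ : 0 < a₁)
    (hn : n₀ ≤ a₁) (ha : a₁ ≤ a₂) (hβ₁ : 100 * a₁ ≤ β₁) (hβ₂ : 100 * a₂ ≤ β₂)
    {S₁ S₂ s₁ s₂ T₁ T₂ : Finset ι} (hs₁ : s₁ ⊆ S₁) (hs₂ : s₂ ⊆ S₂)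
    (hS₁c : S₁.card = β₁ + a₁) (hS₂c : S₂.card = β₂ + a₂) (hs₁c : s₁.card = a₁)
    (hs₂c : s₂.card = a₂) (hT₁c : T₁.card = a₁ + t) (hT₂c : T₂.card = a₂ + t)
    (hSS : Disjoint S₁ S₂) (hST₁₁ : Disjoint S₁ T₁) (hST₁₂ : Disjoint S₁ T₂)
    (hST₂₁ : Disjoint S₂ T₁) (hST₂₂ : Disjoint S₂ T₂) (hTT : Disjoint T₁ T₂)
    {B : Type*} [MeasurableSpace B] [Countable B]
    [MeasurableSingletonClass B] {b : (ι → Fin 6 → ℤ) → B} (hb : Measurable b)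
    (hbS₁ : IndepOf S₁ b) (hbS₂ : IndepOf S₂ b) (hbT₁ : IndepOf T₁ b) (hbT₂ : IndepOf T₂ b)
    (A : Set B) (c₁ c₂ : B → Fin 6 → ℤ) {ρ₁ ρ₂ : ℝ}
    (hρ₁ : 1 / 2 * √((β₁ + a₁ : ℕ) : ℝ) + 4 * √((a₁ + t : ℕ) : ℝ) ≤ ρ₁)
    (hρ₂ : 1 / 2 * √((β₂ + a₂ : ℕ) : ℝ) + 4 * √((a₁ + t : ℕ) : ℝ) ≤ ρ₂) :
    ENNReal.ofReal (spatialConst / (scaleD P ^ 6 * ((a₂ + t : ℕ) : ℝ) ^ 3)) *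
        dispLaw ι P {ξ | b ξ ∈ A ∧ c₁ (b ξ) + ∑ e ∈ S₁, ξ e = c₂ (b ξ) + ∑ e ∈ S₂, ξ e ∧
          wnorm P (∑ e ∈ S₁, ξ e) ≤ 1 / 2 * √((β₁ + a₁ : ℕ) : ℝ) ∧
          wnorm P (∑ e ∈ S₂, ξ e) ≤ 1 / 2 * √((β₂ + a₂ : ℕ) : ℝ)}
      ≤ dispLaw ι P {ξ | (b ξ ∈ A ∧ c₁ (b ξ) + ∑ e ∈ S₁, ξ e = c₂ (b ξ) + ∑ e ∈ S₂, ξ e ∧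
          wnorm P (∑ e ∈ S₁, ξ e) ≤ 1 / 2 * √((β₁ + a₁ : ℕ) : ℝ) ∧
          wnorm P (∑ e ∈ S₂, ξ e) ≤ 1 / 2 * √((β₂ + a₂ : ℕ) : ℝ)) ∧
          c₁ (b ξ) + (∑ e ∈ S₁ \ s₁, ξ e + ∑ e ∈ T₁, ξ e)
            = c₂ (b ξ) + (∑ e ∈ S₂ \ s₂, ξ e + ∑ e ∈ T₂, ξ e) ∧
          wnorm P (∑ e ∈ S₁ \ s₁, ξ e + ∑ e ∈ T₁, ξ e) ≤ ρ₁ ∧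
          wnorm P (∑ e ∈ S₂ \ s₂, ξ e + ∑ e ∈ T₂, ξ e) ≤ ρ₂} := by
  classical
  let E := Fin 6 → ℤ
  set μ := dispLaw ι P
  have hα₁c : (S₁ \ s₁).card = β₁ := by
    rw [Finset.card_sdiff_of_subset hs₁, hS₁c, hs₁c]; omega
  have hα₂c : (S₂ \ s₂).card = β₂ := by
    rw [Finset.card_sdiff_of_subset hs₂, hS₂c, hs₂c]; omega
  -- the condition on `U`
  set R : B → E → E → Prop := fun β v₁ v₂ => β ∈ A ∧ c₁ β + v₁ = c₂ β + v₂ ∧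
      wnorm P v₁ ≤ 1 / 2 * √((β₁ + a₁ : ℕ) : ℝ) ∧ wnorm P v₂ ≤ 1 / 2 * √((β₂ + a₂ : ℕ) : ℝ)
    with hR
  set R' : B → E → E → Prop := fun β w₁ w₂ => c₁ β + w₁ = c₂ β + w₂ ∧
      wnorm P w₁ ≤ ρ₁ ∧ wnorm P w₂ ≤ ρ₂ with hR'
  have m := fun S : Finset ι => measurable_sum_disp (d := 6) S
  -- the law for `U`
  have hU := (hasFreshLaw_sum P S₁ (hb.prodMk (m S₂)) (hbS₁.prodMk (indepOf_sum hSS))).pair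
    (hasFreshLaw_sum P S₂ hb hbS₂) fun β q => if R β q.1 q.2 then 1 else 0
  have hUm : MeasurableSet {ξ | R (b ξ) (∑ e ∈ S₁, ξ e) (∑ e ∈ S₂, ξ e)} :=
    measurableSet_preimage_countable (hb.prodMk ((m S₁).prodMk (m S₂)))
      {q : B × E × E | R q.1 q.2.1 q.2.2}
  have hUeq : μ {ξ | R (b ξ) (∑ e ∈ S₁, ξ e) (∑ e ∈ S₂, ξ e)}
      = ∫⁻ ξ, ∑' q : E × E, nStep P S₁.card q.1 * nStep P S₂.card q.2 *
        (if R (b ξ) q.1 q.2 then 1 else 0) ∂μ := by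
    rw [← lintegral_indicator_one hUm, ← hU]
    refine lintegral_congr fun ξ => ?_
    simp [Set.indicator_apply]
  -- the law of all pieces
  have d₁ : Disjoint s₁ (S₁ \ s₁) := Finset.disjoint_sdiff
  have d₂ : Disjoint s₂ (S₂ \ s₂) := Finset.disjoint_sdiff
  have f₁ := hasFreshLaw_sum P (S₁ \ s₁) hb (hbS₁.mono Finset.sdiff_subset)
  have f₂ := hasFreshLaw_sum P s₁ (hb.prodMk (m (S₁ \ s₁)))
    ((hbS₁.mono hs₁).prodMk (indepOf_sum d₁))
  have f₃ := hasFreshLaw_sum P (S₂ \ s₂) (hb.prodMk ((m s₁).prodMk (m (S₁ \ s₁))))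
    ((hbS₂.mono Finset.sdiff_subset).prodMk ((indepOf_sum
      (hSS.symm.mono Finset.sdiff_subset hs₁)).prodMk
      (indepOf_sum (hSS.symm.mono Finset.sdiff_subset Finset.sdiff_subset))))
  have f₄ := hasFreshLaw_sum P s₂
    (hb.prodMk ((m (S₂ \ s₂)).prodMk ((m s₁).prodMk (m (S₁ \ s₁)))))
    ((hbS₂.mono hs₂).prodMk ((indepOf_sum d₂).prodMk ((indepOf_sum
      (hSS.symm.mono hs₂ hs₁)).prodMk (indepOf_sum (hSS.symm.mono hs₂ Finset.sdiff_subset)))))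
  have f₅ := hasFreshLaw_sum P T₁
    (hb.prodMk ((m s₂).prodMk ((m (S₂ \ s₂)).prodMk ((m s₁).prodMk (m (S₁ \ s₁))))))
    (hbT₁.prodMk ((indepOf_sum (hST₂₁.symm.mono_right hs₂)).prodMk ((indepOf_sum
      (hST₂₁.symm.mono_right Finset.sdiff_subset)).prodMk ((indepOf_sum
      (hST₁₁.symm.mono_right hs₁)).prodMk
      (indepOf_sum (hST₁₁.symm.mono_right Finset.sdiff_subset))))))
  have f₆ := hasFreshLaw_sum P T₂
    (hb.prodMk ((m T₁).prodMk ((m s₂).prodMk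
      ((m (S₂ \ s₂)).prodMk ((m s₁).prodMk (m (S₁ \ s₁)))))))
    (hbT₂.prodMk ((indepOf_sum hTT.symm).prodMk
      ((indepOf_sum (hST₂₂.symm.mono_right hs₂)).prodMk ((indepOf_sum
      (hST₂₂.symm.mono_right Finset.sdiff_subset)).prodMk ((indepOf_sum
      (hST₁₂.symm.mono_right hs₁)).prodMk
      (indepOf_sum (hST₁₂.symm.mono_right Finset.sdiff_subset)))))))
  have hall := (f₆.pair (f₅.pair (f₄.pair (f₃.pair (f₂.pair f₁)))))
    fun β q => if R β (q.2.2.2.2.2 + q.2.2.2.2.1) (q.2.2.2.1 + q.2.2.1) ∧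
      R' β (q.2.2.2.2.2 + q.2.1) (q.2.2.2.1 + q.1) then 1 else 0
  have hYm : MeasurableSet {ξ | R (b ξ) (∑ e ∈ S₁, ξ e) (∑ e ∈ S₂, ξ e) ∧
      R' (b ξ) (∑ e ∈ S₁ \ s₁, ξ e + ∑ e ∈ T₁, ξ e) (∑ e ∈ S₂ \ s₂, ξ e + ∑ e ∈ T₂, ξ e)} :=
    measurableSet_preimage_countable (hb.prodMk (((m S₁).prodMk (m S₂)).prodMk
      (((m (S₁ \ s₁)).add (m T₁)).prodMk ((m (S₂ \ s₂)).add (m T₂)))))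
      {q : B × (E × E) × E × E | R q.1 q.2.1.1 q.2.1.2 ∧ R' q.1 q.2.2.1 q.2.2.2}
  change _ * μ {ξ | R (b ξ) (∑ e ∈ S₁, ξ e) (∑ e ∈ S₂, ξ e)} ≤ μ {ξ |
    R (b ξ) (∑ e ∈ S₁, ξ e) (∑ e ∈ S₂, ξ e) ∧
      R' (b ξ) (∑ e ∈ S₁ \ s₁, ξ e + ∑ e ∈ T₁, ξ e) (∑ e ∈ S₂ \ s₂, ξ e + ∑ e ∈ T₂, ξ e)}
  have hYeq := Eq.trans (a := μ {ξ | R (b ξ) (∑ e ∈ S₁, ξ e) (∑ e ∈ S₂, ξ e) ∧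
      R' (b ξ) (∑ e ∈ S₁ \ s₁, ξ e + ∑ e ∈ T₁, ξ e) (∑ e ∈ S₂ \ s₂, ξ e + ∑ e ∈ T₂, ξ e)})
    (by
      rw [← lintegral_indicator_one hYm]
      refine lintegral_congr fun ξ => ?_
      simp only [Set.indicator_apply, Set.mem_ofPred_eq, Pi.one_apply, Finset.sum_sdiff hs₁,
        Finset.sum_sdiff hs₂]) hall
  rw [hUeq, hYeq, ← lintegral_const_mul']
  swap
  · exact ENNReal.ofReal_ne_top
  refine lintegral_mono fun ξ => ?_
  simp only [hS₁c, hS₂c, hs₁c, hs₂c, hT₁c, hT₂c, hα₁c, hα₂c]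
  set β := b ξ
  -- The pieces over `T₂`, `T₁`, `s₂`, `S₂ \ s₂`, `s₁`, `S₁ \ s₁`, in this order, in terms of the
  -- old endpoints `v₁`, `v₂`, the discarded ends `s`, `s'` and the first new piece `x`; meeting
  -- again forces the second new piece to be `x - s + s'`. Injectivity suffices for a lower bound.
  let φ : (E × E) × E × E × E → E × E × E × E × E × E := fun q =>
    (q.2.2.2 - q.2.1 + q.2.2.1, q.2.2.2, q.2.2.1, q.1.2 - q.2.2.1, q.2.1, q.1.1 - q.2.1)
  have hφ : Function.Injective φ := by
    rintro ⟨⟨v₁, v₂⟩, s, s', x⟩ ⟨⟨w₁, w₂⟩, u, u', y⟩ h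
    simp only [φ, Prod.mk.injEq] at h
    obtain ⟨-, rfl, rfl, h4, rfl, h6⟩ := h
    simp only [sub_left_inj] at h4 h6
    simp [h4, h6]
  refine le_trans ?_ (ENNReal.tsum_comp_le_tsum_of_injective hφ _)
  rw [← ENNReal.tsum_mul_left, ENNReal.tsum_prod']
  conv_rhs => rw [ENNReal.tsum_prod', ENNReal.tsum_prod']
  refine ENNReal.tsum_le_tsum fun v₁ => ENNReal.tsum_le_tsum fun v₂ => ?_
  by_cases h : R β v₁ v₂
  swap
  · simp [h]
  rw [if_pos h, mul_one]
  refine (hP.spatial_lower (t := t) h₁ h₂ h₆ ha₁ hn ha hβ₁ hβ₂ h.2.2.1 h.2.2.2).trans ?_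
  rw [ENNReal.tsum_prod']
  refine ENNReal.tsum_le_tsum fun s => ?_
  rw [ENNReal.tsum_prod']
  refine ENNReal.tsum_le_tsum fun s' => ENNReal.tsum_le_tsum fun x => ?_
  by_cases hx : wnorm P (x - s) ≤ 4 * √((a₁ + t : ℕ) : ℝ)
  swap
  · rw [if_neg hx, mul_zero]
    exact bot_le
  have hR'' : R' β (v₁ - s + x) (v₂ - s' + (x - s + s')) := by
    refine ⟨?_, ?_, ?_⟩
    · have := h.2.1
      calc c₁ β + (v₁ - s + x) = (c₁ β + v₁) + (x - s) := by abel
        _ = _ := by rw [this]; abel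
    · rw [show v₁ - s + x = v₁ + (x - s) by abel]
      exact (hP.wnorm_add_le _ _).trans ((add_le_add h.2.2.1 hx).trans hρ₁)
    · rw [show v₂ - s' + (x - s + s') = v₂ + (x - s) by abel]
      exact (hP.wnorm_add_le _ _).trans ((add_le_add h.2.2.2 hx).trans hρ₂)
  simp only [φ, sub_add_cancel]
  rw [if_pos hx, if_pos ⟨h, hR''⟩]
  simp only [mul_one]
  refine le_of_eq ?_
  ring

end DisplacementLower


/-! ### The branching property of i.i.d. labels on the `M`-ary tree. -/

section BranchingProperty

variable {M : ℕ}

/-- The subtree at the child `a` of the root. -/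
def subtreeAt {E : Type*} (ω : List (Fin M) → E) (a : Fin M) : List (Fin M) → E :=
  fun u => ω (a :: u)

theorem prod_list_eq {R : Type*} [CommMonoid R] (s : Finset (List (Fin M)))
    (f : List (Fin M) → R) :
    ∏ w ∈ s, f w = (if [] ∈ s then f [] else 1) *
      ∏ a : Fin M, ∏ u ∈ s.preimage (List.cons a) (List.cons_injective.injOn), f (a :: u) := by
  have h1 : ∏ a : Fin M, ∏ u ∈ s.preimage (List.cons a) (List.cons_injective.injOn), f (a :: u)
      = ∏ w ∈ s.erase [], f w := by
    rw [Finset.prod_sigma']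
    refine Finset.prod_bij (fun x _ => x.1 :: x.2) ?_ ?_ ?_ ?_
    · rintro ⟨a, u⟩ h
      simpa using h
    · rintro ⟨a, u⟩ - ⟨b, v⟩ - h
      simp only [List.cons.injEq] at h
      simp [h.1, h.2]
    · rintro (_ | ⟨a, u⟩) h
      · simp at h
      · exact ⟨⟨a, u⟩, by simpa using h, rfl⟩
    · exact fun _ _ => rfl
  rw [h1]
  by_cases h : [] ∈ s
  · rw [if_pos h, Finset.mul_prod_erase s f h]
  · rw [if_neg h, one_mul, Finset.erase_eq_of_notMem h]

/-- The tree with the given root value and subtrees. -/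
def glueTree {E : Type*} (q : E × (Fin M → List (Fin M) → E)) : List (Fin M) → E
  | [] => q.1
  | a :: u => q.2 a u

theorem measurable_glueTree {E : Type*} [MeasurableSpace E] :
    Measurable (glueTree (M := M) (E := E)) := by
  rw [measurable_pi_iff]
  rintro (_ | ⟨a, u⟩)
  · exact measurable_fst
  · exact (measurable_pi_apply u).comp ((measurable_pi_apply a).comp measurable_snd)

/-- The branching property. -/
theorem map_glueTree {E : Type*} [MeasurableSpace E] (ν : Measure E) [IsProbabilityMeasure ν] :
    (ν.prod (Measure.infinitePi fun _ : Fin M => Measure.infinitePi fun _ : List (Fin M) => ν)).map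
      glueTree = Measure.infinitePi fun _ : List (Fin M) => ν := by
  refine Measure.eq_infinitePi _ fun s t ht => ?_
  rw [Measure.map_apply measurable_glueTree (MeasurableSet.pi s.countable_toSet fun i _ => ht i)]
  have : glueTree ⁻¹' (Set.pi s t) = (if [] ∈ s then t [] else Set.univ) ×ˢ
      (Set.pi ((Finset.univ : Finset (Fin M)) : Set (Fin M)) fun a =>
        Set.pi (s.preimage (List.cons a) (List.cons_injective.injOn) : Finset (List (Fin M)))
          fun u => t (a :: u)) := by
    ext q
    simp only [Set.mem_preimage, Set.mem_pi, Finset.mem_coe, Set.mem_prod, Finset.mem_univ,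
      Finset.mem_preimage, forall_true_left]
    constructor
    · intro h
      refine ⟨?_, fun a u hu => h (a :: u) hu⟩
      split_ifs with h0
      · exact h [] h0
      · trivial
    · rintro ⟨h0, h1⟩ (_ | ⟨a, u⟩) hi
      · rw [if_pos hi] at h0
        exact h0
      · exact h1 a u hi
  rw [this, Measure.prod_prod, Measure.infinitePi_pi, prod_list_eq]
  · congr 1
    · split_ifs <;> simp
    · exact Finset.prod_congr rfl fun a _ => Measure.infinitePi_pi _ fun i _ => ht _
  · exact fun a _ => MeasurableSet.pi (Finset.countable_toSet _) fun i _ => ht _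

theorem measurable_subtreeAt {E : Type*} [MeasurableSpace E] (a : Fin M) :
    Measurable fun ω : List (Fin M) → E => subtreeAt ω a :=
  measurable_pi_iff.2 fun u => measurable_pi_apply (a :: u)

theorem infinitePi_subtrees {E : Type*} [MeasurableSpace E] (ν : Measure E)
    [IsProbabilityMeasure ν] (R : Set E) (hR : MeasurableSet R) (A : Finset (Fin M))
    (G : Fin M → Set (List (Fin M) → E)) (hG : ∀ a, MeasurableSet (G a)) :
    Measure.infinitePi (fun _ : List (Fin M) => ν)
        {ω | ω [] ∈ R ∧ ∀ a ∈ A, subtreeAt ω a ∈ G a}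
      = ν R * ∏ a ∈ A, Measure.infinitePi (fun _ : List (Fin M) => ν) (G a) := by
  have hm : MeasurableSet {ω : List (Fin M) → E | ω [] ∈ R ∧ ∀ a ∈ A, subtreeAt ω a ∈ G a} := by
    refine (measurable_pi_apply [] hR).inter ?_
    have : {ω : List (Fin M) → E | ∀ a ∈ A, subtreeAt ω a ∈ G a}
        = ⋂ a ∈ A, (fun ω => subtreeAt ω a) ⁻¹' G a := by
      ext
      simp
    change MeasurableSet {ω : List (Fin M) → E | ∀ a ∈ A, subtreeAt ω a ∈ G a}
    rw [this]
    exact Finset.measurableSet_biInter _ fun a _ => measurable_subtreeAt a (hG a)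
  conv_lhs => rw [← map_glueTree ν]
  rw [Measure.map_apply measurable_glueTree hm, ← Measure.infinitePi_pi _ fun i _ => hG i,
    ← Measure.prod_prod]
  congr 1

end BranchingProperty

/-! ### Galton–Watson trees inside the `M`-ary tree. -/

section GaltonWatson

variable {M : ℕ}

/-- The vertices of the tree in which the children of `u` have the positions `ω u`. -/
def gwTree (ω : List (Fin M) → Finset (Fin M)) : Set (List (Fin M)) :=
  {w | ∀ (u : List (Fin M)) (a : Fin M), (u ++ [a]) <+: w → a ∈ ω u}

theorem nil_mem_gwTree (ω : List (Fin M) → Finset (Fin M)) : [] ∈ gwTree ω := by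
  intro u a h
  simp at h

theorem cons_mem_gwTree {ω : List (Fin M) → Finset (Fin M)} {a : Fin M} {w : List (Fin M)} :
    a :: w ∈ gwTree ω ↔ a ∈ ω [] ∧ w ∈ gwTree (subtreeAt ω a) := by
  constructor
  · intro h
    refine ⟨h [] a (by simp), fun u b hu => h (a :: u) b ?_⟩
    simpa using hu
  · rintro ⟨h0, h⟩ (_ | ⟨c, u⟩) b hu
    · simp only [List.nil_append, List.cons_prefix_cons, List.nil_prefix, and_true] at hu
      rwa [hu]
    · simp only [List.cons_append, List.cons_prefix_cons] at hu
      rw [hu.1]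
      exact h u b hu.2

/-- The law of a tree with offspring law `p`. -/
noncomputable abbrev gwLaw (M : ℕ) (p : PMF ℕ) : Measure (List (Fin M) → Finset (Fin M)) :=
  Measure.infinitePi fun _ => (offspringLaw M p).toMeasure

/-- The tree contains the vertices in `L` and dies out by time `t`. -/
def gwEvent (t : ℕ) (L : Finset (List (Fin M))) : Set (List (Fin M) → Finset (Fin M)) :=
  {ω | (∀ w ∈ L, w ∈ gwTree ω) ∧ ∀ w ∈ gwTree ω, w.length < t}

theorem measurableSet_mem_gwTree (w : List (Fin M)) :
    MeasurableSet {ω : List (Fin M) → Finset (Fin M) | w ∈ gwTree ω} := by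
  have : {ω : List (Fin M) → Finset (Fin M) | w ∈ gwTree ω}
      = ⋂ u : List (Fin M), ⋂ a : Fin M, ⋂ _ : (u ++ [a]) <+: w, {ω | a ∈ ω u} := by
    ext
    simp [gwTree]
  rw [this]
  refine MeasurableSet.iInter fun u => MeasurableSet.iInter fun a =>
    MeasurableSet.iInter fun _ => ?_
  exact measurable_pi_apply (X := fun _ : List (Fin M) => Finset (Fin M)) u
    (MeasurableSet.of_discrete (s := {A : Finset (Fin M) | a ∈ A}))

theorem measurableSet_gwEvent (t : ℕ) (L : Finset (List (Fin M))) :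
    MeasurableSet (gwEvent t L) := by
  have : gwEvent t L = (⋂ w ∈ L, {ω | w ∈ gwTree ω}) ∩
      ⋂ w : List (Fin M), ⋂ _ : ¬ w.length < t, {ω | w ∈ gwTree ω}ᶜ := by
    ext ω
    simp only [gwEvent, Set.mem_ofPred_eq, Set.mem_inter_iff, Set.mem_iInter, Set.mem_compl_iff]
    exact and_congr Iff.rfl ⟨fun h w hw hw' => hw (h w hw'), fun h w hw => not_imp_comm.1 (h w)
      (not_not.2 hw)⟩
  rw [this]
  exact (Finset.measurableSet_biInter _ fun w _ => measurableSet_mem_gwTree w).inter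
    (MeasurableSet.iInter fun w => MeasurableSet.iInter fun _ =>
      (measurableSet_mem_gwTree w).compl)

/-- The first letters of the nonempty words in `L`. -/
def heads (L : Finset (List (Fin M))) : Finset (Fin M) :=
  Finset.univ.filter fun a => ∃ w ∈ L, w.head? = some a

/-- The words following `a` in the words of `L`. -/
noncomputable def tails (L : Finset (List (Fin M))) (a : Fin M) : Finset (List (Fin M)) :=
  L.preimage (List.cons a) List.cons_injective.injOn

theorem mem_heads {L : Finset (List (Fin M))} {a : Fin M} : a ∈ heads L ↔ ∃ w, a :: w ∈ L := by
  simp only [heads, Finset.mem_filter, Finset.mem_univ, true_and]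
  constructor
  · rintro ⟨_ | ⟨b, w⟩, hw, h⟩
    · simp at h
    · simp only [List.head?_cons, Option.some.injEq] at h
      exact ⟨w, h ▸ hw⟩
  · rintro ⟨w, hw⟩
    exact ⟨a :: w, hw, rfl⟩

theorem mem_tails {L : Finset (List (Fin M))} {a : Fin M} {w : List (Fin M)} :
    w ∈ tails L a ↔ a :: w ∈ L := by
  simp [tails]

theorem tails_of_notMem_heads {L : Finset (List (Fin M))} {a : Fin M} (h : a ∉ heads L) :
    tails L a = ∅ := by
  ext w
  simp only [mem_tails, Finset.notMem_empty, iff_false]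
  exact fun hw => h (mem_heads.2 ⟨w, hw⟩)

/-- Demanded words are sorted by their first letter, and every child of the root, demanded or not,
must die out one generation earlier. The recursions for all tree probabilities rest on this. -/
theorem mem_gwEvent_succ {t : ℕ} {L : Finset (List (Fin M))}
    {ω : List (Fin M) → Finset (Fin M)} :
    ω ∈ gwEvent (t + 1) L ↔
      heads L ⊆ ω [] ∧ ∀ a ∈ ω [], subtreeAt ω a ∈ gwEvent t (tails L a) := by
  constructor
  · rintro ⟨h1, h2⟩
    refine ⟨fun a ha => ?_, fun a ha => ⟨fun w hw => ?_, fun w hw => ?_⟩⟩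
    · obtain ⟨w, hw⟩ := mem_heads.1 ha
      exact (cons_mem_gwTree.1 (h1 _ hw)).1
    · exact (cons_mem_gwTree.1 (h1 _ (mem_tails.1 hw))).2
    · have := h2 (a :: w) (cons_mem_gwTree.2 ⟨ha, hw⟩)
      simpa using this
  · rintro ⟨h1, h2⟩
    refine ⟨?_, ?_⟩
    · rintro (_ | ⟨a, w⟩) hw
      · exact nil_mem_gwTree ω
      · have ha := h1 (mem_heads.2 ⟨w, hw⟩)
        exact cons_mem_gwTree.2 ⟨ha, (h2 a ha).1 w (mem_tails.2 hw)⟩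
    · rintro (_ | ⟨a, w⟩) hw
      · simp
      · obtain ⟨ha, hw⟩ := cons_mem_gwTree.1 hw
        simpa using (h2 a ha).2 w hw

theorem gwLaw_event_succ (p : PMF ℕ) (t : ℕ) (L : Finset (List (Fin M))) :
    gwLaw M p (gwEvent (t + 1) L) = ∑ A : Finset (Fin M), offspringLaw M p A *
      if heads L ⊆ A then ∏ a ∈ A, gwLaw M p (gwEvent t (tails L a)) else 0 := by
  have h : gwEvent (t + 1) L = ⋃ A ∈ (Finset.univ : Finset (Finset (Fin M))),
      gwEvent (t + 1) L ∩ {ω | ω [] = A} := by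
    ext ω
    simp
  have hmA : ∀ A : Finset (Fin M),
      MeasurableSet {ω : List (Fin M) → Finset (Fin M) | ω [] = A} := fun A =>
    measurable_pi_apply (X := fun _ : List (Fin M) => Finset (Fin M)) []
      (MeasurableSet.of_discrete (s := {B : Finset (Fin M) | B = A}))
  rw [h, measure_biUnion_finset]
  · refine Finset.sum_congr rfl fun A _ => ?_
    by_cases hA : heads L ⊆ A
    · rw [if_pos hA, ← PMF.toMeasure_apply_singleton _ _ (measurableSet_singleton A)]
      rw [← infinitePi_subtrees _ _ (measurableSet_singleton A) _ _
        fun a => measurableSet_gwEvent t (tails L a)]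
      congr 1
      ext ω
      simp only [Set.mem_inter_iff, mem_gwEvent_succ, Set.mem_ofPred_eq, Set.mem_singleton_iff]
      constructor
      · rintro ⟨⟨-, h2⟩, rfl⟩
        exact ⟨rfl, h2⟩
      · rintro ⟨rfl, h2⟩
        exact ⟨⟨hA, h2⟩, rfl⟩
    · rw [if_neg hA, mul_zero]
      convert measure_empty (μ := gwLaw M p)
      ext ω
      simp only [Set.mem_inter_iff, mem_gwEvent_succ, Set.mem_ofPred_eq, Set.mem_empty_iff_false,
        iff_false]
      rintro ⟨⟨h1, -⟩, rfl⟩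
      exact hA h1
  · intro A _ B _ hAB
    refine Set.disjoint_left.2 ?_
    rintro ω ⟨-, h1⟩ ⟨-, h2⟩
    exact hAB (h1.symm.trans h2)
  · exact fun A _ => (measurableSet_gwEvent _ _).inter (hmA A)

theorem gwEvent_zero (L : Finset (List (Fin M))) : gwEvent 0 L = ∅ := by
  ext ω
  simp only [gwEvent, not_lt_zero, imp_false, Set.mem_ofPred_eq, Set.mem_empty_iff_false, iff_false,
    not_and, not_forall, not_not]
  exact fun _ => ⟨[], nil_mem_gwTree ω⟩

end GaltonWatson


/-! ### Derivatives of the offspring generating function. -/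

section GeneratingFunctions

variable {M : ℕ} {p : PMF ℕ}

/-- The derivative of order `c` of the generating function of `p`, a law on `{0, …, M}`. -/
noncomputable def genDeriv (p : PMF ℕ) (M c : ℕ) (x : ℝ) : ℝ :=
  ∑ m ∈ Finset.range (M + 1), (p (m + c)).toReal * ((m + c).descFactorial c : ℝ) * x ^ m

theorem genDeriv_nonneg (c : ℕ) {x : ℝ} (hx : 0 ≤ x) : 0 ≤ genDeriv p M c x :=
  Finset.sum_nonneg fun _ _ => by positivity

theorem genDeriv_mono (c : ℕ) {x y : ℝ} (hx : 0 ≤ x) (hxy : x ≤ y) :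
    genDeriv p M c x ≤ genDeriv p M c y := by
  refine Finset.sum_le_sum fun m _ => ?_
  gcongr

theorem tsum_toReal_shift (hM : ∀ k, M < k → p k = 0) (c : ℕ) (f : ℕ → ℝ) :
    ∑' k, (f (k + c) * (p (k + c)).toReal)
      = ∑ m ∈ Finset.range (M + 1), f (m + c) * (p (m + c)).toReal := by
  refine tsum_eq_sum fun k hk => ?_
  rw [hM _ (by simp at hk; omega)]
  simp

theorem genDeriv_zero_one (hM : ∀ k, M < k → p k = 0) : genDeriv p M 0 1 = 1 := by
  have h := tsum_toReal_shift hM 0 fun _ => 1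
  simp only [add_zero, one_mul] at h
  simp only [genDeriv, add_zero, Nat.descFactorial_zero, Nat.cast_one, mul_one, one_pow]
  rw [← h, ← ENNReal.tsum_toReal_eq fun k => p.apply_ne_top k, p.tsum_coe, ENNReal.toReal_one]

theorem tsum_eq_sum_range (hM : ∀ k, M < k → p k = 0) (f : ℕ → ℝ) :
    ∑' k, f k * (p k).toReal = ∑ k ∈ Finset.range (M + 1), f k * (p k).toReal := by
  simpa using tsum_toReal_shift hM 0 f

theorem genDeriv_eq_sum (hM : ∀ k, M < k → p k = 0) (c : ℕ) :
    genDeriv p M c 1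
      = ∑ k ∈ Finset.range (M + 1), (k.descFactorial c : ℝ) * (p k).toReal := by
  have h1 : ∑ m ∈ Finset.range (M + 1), ((m + c).descFactorial c : ℝ) * (p (m + c)).toReal
      = ∑ k ∈ Finset.range (M + 1 + c), (k.descFactorial c : ℝ) * (p k).toReal := by
    conv_rhs => rw [add_comm (M + 1) c, Finset.sum_range_add _ c (M + 1)]
    rw [Finset.sum_eq_zero (s := Finset.range c), zero_add]
    · exact Finset.sum_congr rfl fun m _ => by rw [add_comm]
    · intro k hk
      rw [Nat.descFactorial_eq_zero_iff_lt.2 (Finset.mem_range.1 hk)]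
      simp
  simp only [genDeriv, one_pow, mul_one]
  rw [← Finset.sum_subset (Finset.range_mono (show M + 1 ≤ M + 1 + c by omega))] at h1
  · rw [← h1]
    exact Finset.sum_congr rfl fun m _ => mul_comm _ _
  · intro k _ hk
    rw [hM k (by simp at hk; omega)]
    simp

theorem genDeriv_one_one (hM : ∀ k, M < k → p k = 0) (hp : IsCritical p) :
    genDeriv p M 1 1 = 1 := by
  rw [genDeriv_eq_sum hM]
  simp only [Nat.descFactorial_one]
  rw [← tsum_eq_sum_range hM fun k => (k : ℝ)]
  have := congrArg ENNReal.toReal hp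
  rw [ENNReal.tsum_toReal_eq fun k => ENNReal.mul_ne_top (by simp) (p.apply_ne_top k)] at this
  simpa [ENNReal.toReal_mul] using this

theorem descFactorial_two_cast (k : ℕ) : (k.descFactorial 2 : ℝ) = (k : ℝ) * (k - 1) := by
  rcases k with _ | k
  · simp
  · simp [Nat.descFactorial_succ]
    ring

theorem genDeriv_two_one (hM : ∀ k, M < k → p k = 0) : genDeriv p M 2 1 = sigma p ^ 2 := by
  rw [genDeriv_eq_sum hM, sigma, Real.sq_sqrt, tsum_eq_sum_range hM fun k => (k : ℝ) * (k - 1)]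
  · simp_rw [descFactorial_two_cast]
  · refine tsum_nonneg fun k => ?_
    rw [← descFactorial_two_cast]
    positivity

theorem thirdMoment_eq_sum (hM : ∀ k, M < k → p k = 0) :
    thirdMoment p = ∑ k ∈ Finset.range (M + 1), (k : ℝ) ^ 3 * (p k).toReal :=
  tsum_eq_sum_range hM fun k => (k : ℝ) ^ 3

theorem genDeriv_three_one_le (hM : ∀ k, M < k → p k = 0) :
    genDeriv p M 3 1 ≤ thirdMoment p := by
  rw [genDeriv_eq_sum hM, thirdMoment_eq_sum hM]
  refine Finset.sum_le_sum fun k _ => ?_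
  gcongr
  exact_mod_cast Nat.descFactorial_le_pow k 3

theorem sigma_sq_le (hM : ∀ k, M < k → p k = 0) : sigma p ^ 2 ≤ thirdMoment p := by
  rw [← genDeriv_two_one hM, genDeriv_eq_sum hM, thirdMoment_eq_sum hM]
  refine Finset.sum_le_sum fun k _ => ?_
  gcongr
  rcases k with _ | k
  · simp
  · exact_mod_cast (Nat.descFactorial_le_pow (k + 1) 2).trans
      (Nat.pow_le_pow_right (by omega) (by norm_num))

/-- Bernoulli's inequality in each term; the next derivative at `1` controls how far a derivative
drops below its value at `1`. -/
theorem genDeriv_sub_le (hM : ∀ k, M < k → p k = 0) (c : ℕ) {x : ℝ} (hx : 0 ≤ x) :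
    genDeriv p M c 1 - (1 - x) * genDeriv p M (c + 1) 1 ≤ genDeriv p M c x := by
  have h1 : genDeriv p M (c + 1) 1
      = ∑ m ∈ Finset.range (M + 1), (m : ℝ) * ((p (m + c)).toReal * (m + c).descFactorial c) := by
    rw [Finset.sum_range_succ']
    simp only [genDeriv, Nat.cast_zero, zero_mul, add_zero]
    rw [Finset.sum_range_succ, hM (M + (c + 1)) (by omega)]
    simp only [ENNReal.toReal_zero, zero_mul, add_zero]
    refine Finset.sum_congr rfl fun m _ => ?_
    rw [Nat.descFactorial_succ, show m + (c + 1) - c = m + 1 by omega,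
      show m + (c + 1) = m + 1 + c by omega]
    push_cast
    ring
  rw [h1, genDeriv, genDeriv, Finset.mul_sum, ← Finset.sum_sub_distrib]
  refine Finset.sum_le_sum fun m _ => ?_
  have h2 := one_add_mul_le_pow (a := x - 1) (by linarith) m
  rw [show 1 + (x - 1) = x by ring] at h2
  have h3 : 0 ≤ (p (m + c)).toReal * ((m + c).descFactorial c : ℝ) := by positivity
  rw [one_pow]
  linarith [mul_le_mul_of_nonneg_left h2 h3]

end GeneratingFunctions

/-! ### Random positions of the children. -/

section OffspringWeights

variable {M : ℕ} {p : PMF ℕ}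

theorem offspringLaw_apply (hM : ∀ k, M < k → p k = 0) (A : Finset (Fin M)) :
    (offspringLaw M p A).toReal = (p A.card).toReal / (M.choose A.card : ℝ) := by
  have hA : A.card ≤ M := by simpa using A.card_le_univ
  rw [offspringLaw, PMF.bind_apply, tsum_eq_single A.card]
  · rw [PMF.uniformOfFinset_apply_of_mem _ (by simp [Finset.mem_powersetCard, hA])]
    rw [Finset.card_powersetCard, Finset.card_univ, Fintype.card_fin, min_eq_left hA]
    simp [ENNReal.toReal_mul, div_eq_mul_inv]
  · intro k hk
    by_cases hkM : k ≤ M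
    · rw [PMF.uniformOfFinset_apply_of_notMem, mul_zero]
      simp only [Finset.mem_powersetCard, Finset.subset_univ, true_and, min_eq_left hkM]
      exact fun h => hk h.symm
    · rw [hM k (by omega), zero_mul]

/-- The expectation of `x ^ (|A| - |C|)` on the event that `C ⊆ A`. -/
noncomputable def offspringWeight (p : PMF ℕ) (C : Finset (Fin M)) (x : ℝ) : ℝ :=
  ∑ A : Finset (Fin M), (offspringLaw M p A).toReal *
    if C ⊆ A then x ^ (A.card - C.card) else 0

/-- A uniform set of `k` positions contains `c` given ones with probability `(k)_c / (M)_c`, in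
falling factorials. So the embedding only contributes the falling factorial of `M`, and what remains
is a derivative of the generating function. -/
theorem descFactorial_mul_offspringWeight (hM : ∀ k, M < k → p k = 0) (C : Finset (Fin M))
    (x : ℝ) :
    (M.descFactorial C.card : ℝ) * offspringWeight p C x = genDeriv p M C.card x := by
  have hC : C.card ≤ M := by simpa using C.card_le_univ
  set c := C.card with hc
  have h1 : offspringWeight p C x = ∑ B ∈ (Finset.univ \ C).powerset,
      (p (B.card + c)).toReal / (M.choose (B.card + c) : ℝ) * x ^ B.card := by
    rw [offspringWeight]
    simp_rw [mul_ite, mul_zero]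
    rw [← Finset.sum_filter]
    symm
    refine Finset.sum_bij (fun B _ => B ∪ C) ?_ ?_ ?_ ?_
    · intro B _
      simp
    · intro B hB B' hB' h
      simp only [Finset.mem_powerset, Finset.subset_sdiff] at hB hB'
      have := congrArg (· \ C) h
      simpa [Finset.union_sdiff_right, Finset.sdiff_eq_self_of_disjoint hB.2,
        Finset.sdiff_eq_self_of_disjoint hB'.2] using this
    · intro A hA
      simp only [Finset.mem_filter, Finset.mem_univ, true_and] at hA
      refine ⟨A \ C, ?_, Finset.sdiff_union_of_subset hA⟩
      simp only [Finset.mem_powerset]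
      exact Finset.sdiff_subset_sdiff (Finset.subset_univ _) le_rfl
    · intro B hB
      simp only [Finset.mem_powerset, Finset.subset_sdiff] at hB
      rw [offspringLaw_apply hM, Finset.card_union_of_disjoint hB.2, ← hc, Nat.add_sub_cancel]
  rw [h1, Finset.sum_powerset_apply_card (fun m => (p (m + c)).toReal /
    (M.choose (m + c) : ℝ) * x ^ m), genDeriv, Finset.mul_sum]
  have h2 : (Finset.univ \ C : Finset (Fin M)).card = M - c := by
    rw [Finset.card_sdiff_of_subset (Finset.subset_univ C)]
    simp [hc]
  rw [h2]
  refine Eq.trans ?_ (Finset.sum_subset (Finset.range_mono (show M - c + 1 ≤ M + 1 by omega)) ?_)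
  · refine Finset.sum_congr rfl fun m hm => ?_
    have hm' : m + c ≤ M := by simp at hm; omega
    have h3 := Nat.choose_mul (n := M) (k := m + c) (s := c) (by omega)
    rw [show m + c - c = m by omega] at h3
    have h4 : ((m + c).descFactorial c : ℝ) * (M.choose (m + c) : ℝ)
        = (M.descFactorial c : ℝ) * ((M - c).choose m : ℝ) := by
      rw [Nat.descFactorial_eq_factorial_mul_choose, Nat.descFactorial_eq_factorial_mul_choose]
      push_cast
      have h3' : (M.choose (m + c) : ℝ) * ((m + c).choose c : ℝ)
        = (M.choose c : ℝ) * ((M - c).choose m : ℝ) := by exact_mod_cast h3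
      linear_combination (c.factorial : ℝ) * h3'
    have h5 : (M.choose (m + c) : ℝ) ≠ 0 := by
      exact_mod_cast (Nat.choose_pos hm').ne'
    rw [nsmul_eq_mul]
    field_simp
    linear_combination -(p (m + c)).toReal * x ^ m * h4
  · intro m _ hm
    rw [hM _ (by simp at hm; omega)]
    simp

end OffspringWeights


/-! ### The cost of demanding one more vertex. -/

section Attach

variable {M : ℕ} {p : PMF ℕ}

/-- The probability that a tree with offspring law `p` contains the vertices in `L` and dies out by
time `t`. -/
noncomputable def gwProb (p : PMF ℕ) (t : ℕ) (L : Finset (List (Fin M))) : ℝ :=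
  (gwLaw M p).real (gwEvent t L)

theorem gwProb_nonneg (t : ℕ) (L : Finset (List (Fin M))) : 0 ≤ gwProb p t L := measureReal_nonneg

theorem gwProb_le_one (t : ℕ) (L : Finset (List (Fin M))) : gwProb p t L ≤ 1 := measureReal_le_one

theorem gwProb_zero (L : Finset (List (Fin M))) : gwProb p 0 L = 0 := by
  simp [gwProb, gwEvent_zero]

theorem ofReal_gwProb (t : ℕ) (L : Finset (List (Fin M))) :
    ENNReal.ofReal (gwProb p t L) = gwLaw M p (gwEvent t L) := by
  simp [gwProb, Measure.real]

/-- Children of the root that are not demanded contribute only their extinction probability; this is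
the argument of `offspringWeight`. -/
theorem gwProb_succ (t : ℕ) (L : Finset (List (Fin M))) :
    gwProb p (t + 1) L = offspringWeight p (heads L) (gwProb p t (∅ : Finset (List (Fin M)))) *
      ∏ a ∈ heads L, gwProb p t (tails L a) := by
  rw [gwProb, Measure.real, gwLaw_event_succ, ENNReal.toReal_sum, offspringWeight, Finset.sum_mul]
  · refine Finset.sum_congr rfl fun A _ => ?_
    rw [ENNReal.toReal_mul, mul_assoc]
    congr 1
    by_cases hA : heads L ⊆ A
    · rw [if_pos hA, if_pos hA, ENNReal.toReal_prod, ← Finset.prod_sdiff hA]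
      congr 1
      rw [← Finset.card_sdiff_of_subset hA, ← Finset.prod_const]
      refine Finset.prod_congr rfl fun a ha => ?_
      rw [tails_of_notMem_heads (Finset.mem_sdiff.1 ha).2]
      rfl
    · rw [if_neg hA, if_neg hA]
      simp
  · intro A _
    refine ENNReal.mul_ne_top ((offspringLaw M p).apply_ne_top A) ?_
    split_ifs
    · exact ENNReal.prod_ne_top fun a _ => measure_ne_top _ _
    · simp

/-- The words of length `n`. -/
noncomputable def words (M n : ℕ) : Finset (List (Fin M)) :=
  (List.finite_length_eq (Fin M) n).toFinset

@[simp] theorem mem_words {n : ℕ} {w : List (Fin M)} : w ∈ words M n ↔ w.length = n := by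
  simp [words]

theorem words_zero : words M 0 = {[]} := by
  ext w
  simp

theorem sum_words_succ {R : Type*} [AddCommMonoid R] (n : ℕ) (f : List (Fin M) → R) :
    ∑ w ∈ words M (n + 1), f w = ∑ a : Fin M, ∑ y ∈ words M n, f (a :: y) := by
  rw [Finset.sum_sigma']
  symm
  refine Finset.sum_bij (fun x _ => x.1 :: x.2) ?_ ?_ ?_ ?_
  · rintro ⟨a, u⟩ h
    simpa using h
  · rintro ⟨a, u⟩ - ⟨b, v⟩ - h
    simp only [List.cons.injEq] at h
    simp [h.1, h.2]
  · rintro (_ | ⟨a, u⟩) h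
    · simp at h
    · exact ⟨⟨a, u⟩, by simpa using h, rfl⟩
  · exact fun _ _ => rfl

/-- The letters which continue `v` to a prefix of a word in `L`. -/
def nextLetters (L : Finset (List (Fin M))) (v : List (Fin M)) : Finset (Fin M) :=
  Finset.univ.filter fun a => ∃ w ∈ L, (v ++ [a]) <+: w

theorem mem_nextLetters {L : Finset (List (Fin M))} {v : List (Fin M)} {a : Fin M} :
    a ∈ nextLetters L v ↔ ∃ w ∈ L, (v ++ [a]) <+: w := by
  simp [nextLetters]

theorem nextLetters_nil (L : Finset (List (Fin M))) : nextLetters L [] = heads L := by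
  ext a
  simp only [mem_nextLetters, mem_heads, List.nil_append]
  constructor
  · rintro ⟨w, hw, u, rfl⟩
    exact ⟨u, hw⟩
  · rintro ⟨u, hu⟩
    exact ⟨_, hu, u, rfl⟩

theorem nextLetters_cons (L : Finset (List (Fin M))) (b : Fin M) (v : List (Fin M)) :
    nextLetters L (b :: v) = nextLetters (tails L b) v := by
  ext a
  simp only [mem_nextLetters, mem_tails]
  constructor
  · rintro ⟨w, hw, u, rfl⟩
    exact ⟨v ++ [a] ++ u, by simpa using hw, by simp⟩
  · rintro ⟨w, hw, h⟩
    exact ⟨b :: w, hw, by simpa using h⟩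

theorem heads_insert_cons (L : Finset (List (Fin M))) (a : Fin M) (y : List (Fin M)) :
    heads (insert (a :: y) L) = insert a (heads L) := by
  ext b
  simp only [mem_heads, Finset.mem_insert, List.cons.injEq]
  constructor
  · rintro ⟨w, ⟨rfl, -⟩ | h⟩
    · exact Or.inl rfl
    · exact Or.inr ⟨w, h⟩
  · rintro (rfl | ⟨w, h⟩)
    · exact ⟨y, Or.inl ⟨rfl, rfl⟩⟩
    · exact ⟨w, Or.inr h⟩

theorem tails_insert_cons_self (L : Finset (List (Fin M))) (a : Fin M) (y : List (Fin M)) :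
    tails (insert (a :: y) L) a = insert y (tails L a) := by
  ext w
  simp [mem_tails]

theorem tails_insert_cons_of_ne (L : Finset (List (Fin M))) {a b : Fin M} (h : b ≠ a)
    (y : List (Fin M)) : tails (insert (a :: y) L) b = tails L b := by
  ext w
  simp [mem_tails, h]

/-- The free positions contribute equally, and their number is the extra factor of the next falling
factorial. If no position is free, both sides vanish. -/
theorem sum_offspringWeight_insert (hM : ∀ k, M < k → p k = 0) (C : Finset (Fin M)) (x : ℝ) :
    (M.descFactorial C.card : ℝ) * ∑ a ∈ Cᶜ, offspringWeight p (insert a C) x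
      = genDeriv p M (C.card + 1) x := by
  have hC : C.card ≤ M := by simpa using C.card_le_univ
  have h1 : ∀ a ∈ Cᶜ, ((M - C.card : ℕ) : ℝ) *
      ((M.descFactorial C.card : ℝ) * offspringWeight p (insert a C) x)
      = genDeriv p M (C.card + 1) x := by
    intro a ha
    have := descFactorial_mul_offspringWeight hM (insert a C) x
    rw [Finset.card_insert_of_notMem (Finset.mem_compl.1 ha), Nat.descFactorial_succ] at this
    rw [← this]
    push_cast
    ring
  rcases hC.eq_or_lt with h | h
  · have h2 : Cᶜ = ∅ := by
      rw [Finset.compl_eq_empty_iff, ← Finset.card_eq_iff_eq_univ]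
      simpa using h
    rw [h2, Finset.sum_empty, mul_zero, genDeriv, Finset.sum_eq_zero]
    intro m _
    rw [hM _ (by omega)]
    simp
  · have h3 : ((M - C.card : ℕ) : ℝ) ≠ 0 := by
      exact_mod_cast (Nat.sub_pos_of_lt h).ne'
    refine mul_left_cancel₀ h3 ?_
    rw [Finset.mul_sum, Finset.mul_sum, Finset.sum_congr rfl h1, Finset.sum_const,
      Finset.card_compl, Fintype.card_fin, nsmul_eq_mul]

/-- The expected number of vertices of generation `n` in a tree that dies out by time `t`. -/
noncomputable def generationMean (M : ℕ) (p : PMF ℕ) (t n : ℕ) : ℝ :=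
  ∑ y ∈ words M n, gwProb p t ({y} : Finset (List (Fin M)))

theorem gwProb_insert_cons_of_notMem {t : ℕ} {L : Finset (List (Fin M))} {a : Fin M}
    (ha : a ∉ heads L) (y : List (Fin M)) :
    gwProb p (t + 1) (insert (a :: y) L)
      = offspringWeight p (insert a (heads L)) (gwProb p t (∅ : Finset (List (Fin M)))) *
        (gwProb p t {y} * ∏ b ∈ heads L, gwProb p t (tails L b)) := by
  rw [gwProb_succ, heads_insert_cons, Finset.prod_insert ha, tails_insert_cons_self,
    tails_of_notMem_heads ha, insert_empty_eq]
  congr 2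
  refine Finset.prod_congr rfl fun b hb => ?_
  rw [tails_insert_cons_of_ne]
  rintro rfl
  exact ha hb

theorem gwProb_insert_cons_of_mem {t : ℕ} {L : Finset (List (Fin M))} {a : Fin M}
    (ha : a ∈ heads L) (y : List (Fin M)) :
    gwProb p (t + 1) (insert (a :: y) L)
      = offspringWeight p (heads L) (gwProb p t (∅ : Finset (List (Fin M)))) *
        (gwProb p t (insert y (tails L a)) *
          ∏ b ∈ (heads L).erase a, gwProb p t (tails L b)) := by
  rw [gwProb_succ, heads_insert_cons, Finset.insert_eq_of_mem ha,
    ← Finset.mul_prod_erase (heads L) _ ha, tails_insert_cons_self]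
  congr 2
  refine Finset.prod_congr rfl fun b hb => ?_
  rw [tails_insert_cons_of_ne L (Finset.ne_of_mem_erase hb)]

/-- Attaching a further branch of length `n + 1` at the vertex `v`. -/
theorem sum_gwProb_attach (hM : ∀ k, M < k → p k = 0) {T : ℕ} {L : Finset (List (Fin M))}
    {v : List (Fin M)} (n : ℕ) (hvT : v.length < T) (hv : v = [] ∨ ∃ w ∈ L, v <+: w) :
    genDeriv p M (nextLetters L v).card
        (gwProb p (T - v.length - 1) (∅ : Finset (List (Fin M)))) *
      ∑ a ∈ (nextLetters L v)ᶜ, ∑ y ∈ words M n, gwProb p T (insert (v ++ a :: y) L)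
      = genDeriv p M ((nextLetters L v).card + 1)
          (gwProb p (T - v.length - 1) (∅ : Finset (List (Fin M)))) *
        (generationMean M p (T - v.length - 1) n * gwProb p T L) := by
  induction v generalizing T L with
  -- At the root the old and new weights involve consecutive derivatives; cross-multiplication
  -- avoids dividing by one that might vanish.
  | nil =>
    obtain ⟨t, rfl⟩ : ∃ t, T = t + 1 := ⟨T - 1, by simp at hvT; omega⟩
    simp only [nextLetters_nil, List.nil_append, List.length_nil, Nat.sub_zero,
      Nat.add_sub_cancel]
    set C := heads L
    set x := gwProb p t (∅ : Finset (List (Fin M)))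
    have h1 : ∑ a ∈ Cᶜ, ∑ y ∈ words M n, gwProb p (t + 1) (insert (a :: y) L)
        = (∑ a ∈ Cᶜ, offspringWeight p (insert a C) x) *
          (generationMean M p t n * ∏ b ∈ C, gwProb p t (tails L b)) := by
      rw [Finset.sum_mul]
      refine Finset.sum_congr rfl fun a ha => ?_
      rw [generationMean, Finset.sum_mul, Finset.mul_sum]
      exact Finset.sum_congr rfl fun y _ =>
        gwProb_insert_cons_of_notMem (Finset.mem_compl.1 ha) y
    rw [h1, gwProb_succ, ← sum_offspringWeight_insert hM, ← descFactorial_mul_offspringWeight hM]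
    ring
  -- Only the subtree at `b` sees the new word; all other factors are common to both sides.
  | cons b v ih =>
    obtain ⟨t, rfl⟩ : ∃ t, T = t + 1 := ⟨T - 1, by simp at hvT; omega⟩
    obtain ⟨w, hwL, u, rfl⟩ := hv.resolve_left (by simp)
    have hb : b ∈ heads L := mem_heads.2 ⟨v ++ u, hwL⟩
    have h := ih (T := t) (L := tails L b) (by simpa using hvT)
      (Or.inr ⟨v ++ u, mem_tails.2 hwL, by simp⟩)
    rw [nextLetters_cons, List.length_cons, Nat.add_sub_add_right]
    simp only [List.cons_append, gwProb_insert_cons_of_mem hb, ← Finset.mul_sum, ← Finset.sum_mul]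
    rw [gwProb_succ t L, ← Finset.mul_prod_erase (heads L) _ hb]
    linear_combination (offspringWeight p (heads L) (gwProb p t (∅ : Finset (List (Fin M)))) *
      ∏ b ∈ (heads L).erase b, gwProb p t (tails L b)) * h

theorem gwProb_succ_empty (hM : ∀ k, M < k → p k = 0) (t : ℕ) :
    gwProb p (t + 1) (∅ : Finset (List (Fin M)))
      = genDeriv p M 0 (gwProb p t (∅ : Finset (List (Fin M)))) := by
  have h : heads (∅ : Finset (List (Fin M))) = ∅ := by
    ext a
    simp [mem_heads]
  rw [gwProb_succ, h, Finset.prod_empty, mul_one,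
    ← Finset.card_empty (α := Fin M), ← descFactorial_mul_offspringWeight hM]
  simp

theorem gwProb_singleton_nil (t : ℕ) :
    gwProb p t {([] : List (Fin M))} = gwProb p t (∅ : Finset (List (Fin M))) := by
  unfold gwProb
  congr 1
  ext ω
  simp [gwEvent, nil_mem_gwTree]

theorem generationMean_zero (t : ℕ) :
    generationMean M p t 0 = gwProb p t (∅ : Finset (List (Fin M))) := by
  rw [generationMean, words_zero, Finset.sum_singleton, gwProb_singleton_nil]

theorem generationMean_succ (hM : ∀ k, M < k → p k = 0) (t n : ℕ) :
    generationMean M p (t + 1) (n + 1)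
      = genDeriv p M 1 (gwProb p t (∅ : Finset (List (Fin M)))) * generationMean M p t n := by
  have h : heads (∅ : Finset (List (Fin M))) = ∅ := by
    ext a
    simp [mem_heads]
  have h1 := sum_offspringWeight_insert hM (∅ : Finset (Fin M))
    (gwProb p t (∅ : Finset (List (Fin M))))
  simp only [Finset.card_empty, Nat.descFactorial_zero, Nat.cast_one, one_mul,
    Finset.compl_empty, zero_add] at h1
  rw [generationMean, sum_words_succ, ← h1, Finset.sum_mul]
  refine Finset.sum_congr rfl fun a _ => ?_
  rw [generationMean, Finset.mul_sum]
  refine Finset.sum_congr rfl fun y _ => ?_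
  have := gwProb_insert_cons_of_notMem (p := p) (t := t) (L := ∅) (a := a) (by simp [h]) y
  rw [insert_empty_eq, h, Finset.prod_empty, mul_one] at this
  exact this

theorem generationMean_nonneg (t n : ℕ) : 0 ≤ generationMean M p t n :=
  Finset.sum_nonneg fun _ _ => gwProb_nonneg _ _

/-- Each generation multiplies by a value of the first derivative on `[0, 1]`, at most its value `1`
at the right end. -/
theorem generationMean_le_one (hM : ∀ k, M < k → p k = 0) (hp : IsCritical p) (t n : ℕ) :
    generationMean M p t n ≤ 1 := by
  induction n generalizing t with
  | zero =>
    rw [generationMean_zero]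
    exact gwProb_le_one _ _
  | succ n ih =>
    rcases t with _ | t
    · simp [generationMean, gwProb_zero]
    · rw [generationMean_succ hM]
      refine mul_le_one₀ ?_ (generationMean_nonneg _ _) (ih t)
      rw [← genDeriv_one_one hM hp]
      exact genDeriv_mono 1 (gwProb_nonneg _ _) (gwProb_le_one _ _)

theorem gwProb_empty_mono {s t : ℕ} (hst : s ≤ t) :
    gwProb p s (∅ : Finset (List (Fin M))) ≤ gwProb p t (∅ : Finset (List (Fin M))) := by
  refine measureReal_mono fun ω hω => ⟨by simp, fun w hw => (hω.2 w hw).trans_le hst⟩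

/-- By `genDeriv_sub_le` each generation loses at most `σ²` times the probability of surviving the
time that is left, and at least `t` is left throughout. -/
theorem le_generationMean (hM : ∀ k, M < k → p k = 0) (hp : IsCritical p) (t n : ℕ) :
    1 - (n + 1) * ((1 + sigma p ^ 2) * (1 - gwProb p t (∅ : Finset (List (Fin M)))))
      ≤ generationMean M p (t + n) n := by
  induction n with
  | zero =>
    rw [generationMean_zero]
    have := gwProb_le_one (p := p) t (∅ : Finset (List (Fin M)))
    simp only [Nat.cast_zero, zero_add, one_mul, add_zero]
    nlinarith [sq_nonneg (sigma p)]
  | succ n ih =>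
    rw [← add_assoc, generationMean_succ hM]
    have h1 := genDeriv_sub_le hM 1
      (gwProb_nonneg (p := p) (t + n) (∅ : Finset (List (Fin M))))
    rw [genDeriv_one_one hM hp, genDeriv_two_one hM] at h1
    have h2 := gwProb_empty_mono (M := M) (p := p) (show t ≤ t + n by omega)
    have h3 := generationMean_le_one hM hp (t + n) n
    have h4 := generationMean_nonneg (M := M) (p := p) (t + n) n
    have h5 := gwProb_le_one (p := p) (t + n) (∅ : Finset (List (Fin M)))
    set x := gwProb p (t + n) (∅ : Finset (List (Fin M)))
    set y := gwProb p t (∅ : Finset (List (Fin M)))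
    set S := generationMean M p (t + n) n
    push_cast
    have h6 : (1 - (1 - x) * sigma p ^ 2) * S ≤ genDeriv p M 1 x * S :=
      mul_le_mul_of_nonneg_right h1 h4
    have h7 : (1 - x) * sigma p ^ 2 * S ≤ (1 + sigma p ^ 2) * (1 - y) := by
      have h8 : (1 - x) * sigma p ^ 2 * S ≤ (1 - x) * sigma p ^ 2 :=
        mul_le_of_le_one_right (mul_nonneg (by linarith) (sq_nonneg _)) h3
      nlinarith [mul_le_mul_of_nonneg_right h2 (sq_nonneg (sigma p))]
    linarith

end Attach


/-! ### Decay of the survival probability. -/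

section Extinction

variable {M : ℕ} {p : PMF ℕ}

/-- Bernoulli to second order; the quadratic gain is what makes survival decay like `1/t`. -/
theorem one_sub_pow_ge {θ : ℝ} (h1 : θ ≤ 1) {m : ℕ} (hm : 2 ≤ m) :
    1 - m * θ + θ ^ 2 ≤ (1 - θ) ^ m := by
  induction m, hm using Nat.le_induction with
  | base => push_cast; nlinarith
  | succ m hm ih =>
    rw [pow_succ (1 - θ) m]
    have h2 := mul_le_mul_of_nonneg_right ih (show 0 ≤ 1 - θ by linarith)
    have h3 : (2 : ℝ) ≤ m := by exact_mod_cast hm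
    have h4 := mul_nonneg (sq_nonneg θ) (show 0 ≤ (m : ℝ) - θ by linarith)
    push_cast
    generalize (1 - θ) ^ m = Z at h2 ⊢
    nlinarith

/-- The probability of having at least two children. -/
noncomputable def splitProb (p : PMF ℕ) (M : ℕ) : ℝ :=
  ∑ m ∈ Finset.range (M + 1), if 2 ≤ m then (p m).toReal else 0

theorem genDeriv_zero_ge (hM : ∀ k, M < k → p k = 0) (hp : IsCritical p) {θ : ℝ}
    (h1 : θ ≤ 1) : 1 - θ + splitProb p M * θ ^ 2 ≤ genDeriv p M 0 (1 - θ) := by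
  have h2 := genDeriv_zero_one hM
  have h3 := genDeriv_one_one hM hp
  rw [genDeriv_eq_sum hM] at h2 h3
  simp only [Nat.descFactorial_zero, Nat.cast_one, one_mul, Nat.descFactorial_one] at h2 h3
  calc 1 - θ + splitProb p M * θ ^ 2
      = ∑ m ∈ Finset.range (M + 1), ((p m).toReal - θ * (m * (p m).toReal)
          + (if 2 ≤ m then (p m).toReal else 0) * θ ^ 2) := by
        rw [Finset.sum_add_distrib, Finset.sum_sub_distrib, ← Finset.mul_sum, ← Finset.sum_mul,
          h2, h3, splitProb]
        ring
    _ ≤ genDeriv p M 0 (1 - θ) := by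
        refine Finset.sum_le_sum fun m _ => ?_
        simp only [add_zero, Nat.descFactorial_zero, Nat.cast_one, mul_one]
        have hpm : 0 ≤ (p m).toReal := ENNReal.toReal_nonneg
        split_ifs with hm
        · nlinarith [mul_le_mul_of_nonneg_left (one_sub_pow_ge h1 hm) hpm]
        · interval_cases m
          · simp
          · simp
            nlinarith

/-- Truncate at `K = 2 C₃ / σ₀²`: offspring numbers above `K` account for at most `C₃ / K = σ₀² / 2`
of the second factorial moment, so the others carry the rest, with weight at most `K²` each. -/
theorem le_splitProb (hM : ∀ k, M < k → p k = 0) {σ₀ C₃ : ℝ} (hσ₀ : 0 < σ₀)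
    (hσ : σ₀ ≤ sigma p) (hC : thirdMoment p ≤ C₃) : σ₀ ^ 6 / (8 * C₃ ^ 2) ≤ splitProb p M := by
  have hσ2 : σ₀ ^ 2 ≤ sigma p ^ 2 := by gcongr
  have hC₃ : 0 < C₃ := by
    have := sigma_sq_le hM
    nlinarith [sq_pos_of_pos hσ₀]
  set K := 2 * C₃ / σ₀ ^ 2 with hK
  have hKpos : 0 < K := by positivity
  have h1 : sigma p ^ 2 ≤ K ^ 2 * splitProb p M + thirdMoment p / K := by
    rw [← genDeriv_two_one hM, genDeriv_eq_sum hM, thirdMoment_eq_sum hM, splitProb,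
      Finset.mul_sum, Finset.sum_div, ← Finset.sum_add_distrib]
    refine Finset.sum_le_sum fun k _ => ?_
    rw [descFactorial_two_cast]
    have hpk : 0 ≤ (p k).toReal := ENNReal.toReal_nonneg
    split_ifs with hk
    · have h2 : (k : ℝ) * (k - 1) ≤ K ^ 2 + (k : ℝ) ^ 3 / K := by
        have hk0 : (0 : ℝ) ≤ k := by positivity
        rcases le_total (k : ℝ) K with h | h
        · have : 0 ≤ (k : ℝ) ^ 3 / K := by positivity
          nlinarith
        · have : (k : ℝ) ^ 2 ≤ (k : ℝ) ^ 3 / K := by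
            rw [le_div_iff₀ hKpos]
            nlinarith [mul_le_mul_of_nonneg_left h (sq_nonneg (k : ℝ))]
          nlinarith [sq_nonneg K]
      calc (k : ℝ) * (k - 1) * (p k).toReal ≤ (K ^ 2 + (k : ℝ) ^ 3 / K) * (p k).toReal :=
            mul_le_mul_of_nonneg_right h2 hpk
        _ = _ := by ring
    · have h3 : (k : ℝ) * (k - 1) = 0 := by
        interval_cases k <;> simp
      rw [h3]
      simp only [zero_mul, mul_zero, zero_add]
      positivity
  have h2 : thirdMoment p / K ≤ σ₀ ^ 2 / 2 := by
    rw [div_le_iff₀ hKpos, hK]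
    have : σ₀ ^ 2 / 2 * (2 * C₃ / σ₀ ^ 2) = C₃ := by field_simp
    linarith
  have h3 : σ₀ ^ 2 / 2 ≤ K ^ 2 * splitProb p M := by linarith
  rw [show σ₀ ^ 6 / (8 * C₃ ^ 2) = σ₀ ^ 2 / 2 / K ^ 2 by rw [hK]; field_simp; ring]
  rw [div_le_iff₀ (by positivity)]
  linarith

/-- The survival probability satisfies `θ' ≤ θ - q θ²`, so its reciprocal grows by at least `q` per
generation. -/
theorem survival_mul_le (hM : ∀ k, M < k → p k = 0) (hp : IsCritical p) {q : ℝ} (hq0 : 0 ≤ q)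
    (hq : q ≤ splitProb p M) (t : ℕ) :
    (1 - gwProb p t (∅ : Finset (List (Fin M)))) * (1 + q * t) ≤ 1 := by
  induction t with
  | zero => simp [gwProb_zero]
  | succ t ih =>
    set θ := 1 - gwProb p t (∅ : Finset (List (Fin M))) with hθ
    have h0 : 0 ≤ θ := by
      have := gwProb_le_one (p := p) t (∅ : Finset (List (Fin M)))
      linarith
    have h1 : θ ≤ 1 := by
      have := gwProb_nonneg (p := p) t (∅ : Finset (List (Fin M)))
      linarith
    have h2 : 1 - gwProb p (t + 1) (∅ : Finset (List (Fin M))) ≤ θ - q * θ ^ 2 := by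
      rw [gwProb_succ_empty hM, show gwProb p t (∅ : Finset (List (Fin M))) = 1 - θ by
        rw [hθ]; ring]
      have := genDeriv_zero_ge hM hp h1
      nlinarith [mul_le_mul_of_nonneg_right hq (sq_nonneg θ)]
    have h3 : 0 ≤ q * t := by positivity
    push_cast
    refine (mul_le_mul_of_nonneg_right h2 (by nlinarith)).trans ?_
    have h5 : q * θ ≤ 1 := by
      have h6 : q ≤ 1 := hq.trans (by
        have h7 := genDeriv_zero_one hM
        rw [genDeriv_eq_sum hM] at h7
        rw [← h7]
        refine Finset.sum_le_sum fun m _ => ?_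
        split_ifs <;> simp)
      nlinarith
    nlinarith [mul_le_mul_of_nonneg_right ih (show 0 ≤ 1 - q * θ by linarith), sq_nonneg (q * θ)]

/-- Bounds for the ratios of successive derivatives of the generating function, at the
probabilities of dying out by the times from `t₀` on. -/
def HasWeightBounds (p : PMF ℕ) (M t₀ : ℕ) (A B : ℝ) : Prop :=
  ∀ t, t₀ ≤ t → ∀ x, x = gwProb p t (∅ : Finset (List (Fin M))) →
    (0 < genDeriv p M 0 x ∧ genDeriv p M 1 x ≤ B * genDeriv p M 0 x) ∧
    (0 < genDeriv p M 1 x ∧ genDeriv p M 2 x ≤ A * genDeriv p M 1 x) ∧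
    (0 < genDeriv p M 2 x ∧ genDeriv p M 3 x ≤ B * genDeriv p M 2 x)

/-- Near `1` the derivatives of orders `0, 1, 2` keep at least half of their values `1, 1, σ²`,
while those of orders `1, 2, 3` are at most `1, σ², C₃`. Only the middle ratio has to be
proportional to `σ²`: it belongs to forks at interior vertices of a path, which produce the main
term. -/
theorem hasWeightBounds (hM : ∀ k, M < k → p k = 0) (hp : IsCritical p) {σ₀ C₃ : ℝ}
    (hσ₀ : 0 < σ₀) (hσ : σ₀ ≤ sigma p) (hC : thirdMoment p ≤ C₃) {t₀ : ℕ}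
    (ht₀ : ∀ t, t₀ ≤ t → (1 - gwProb p t (∅ : Finset (List (Fin M)))) * (1 + C₃)
      ≤ min (1 / 2) (σ₀ ^ 2 / 2)) :
    HasWeightBounds p M t₀ (2 * sigma p ^ 2) (2 + 2 * C₃ / σ₀ ^ 2) ∧
    ∀ t, t₀ ≤ t → sigma p ^ 2 / 2 * genDeriv p M 1 (gwProb p t (∅ : Finset (List (Fin M))))
      ≤ genDeriv p M 2 (gwProb p t (∅ : Finset (List (Fin M)))) := by
  have hσ2 : σ₀ ^ 2 ≤ sigma p ^ 2 := by gcongr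
  have hσ0 : 0 < σ₀ ^ 2 := by positivity
  have hσC := sigma_sq_le hM
  have hC₃ : 0 < C₃ := by linarith
  have key : ∀ t, t₀ ≤ t → ∀ x, x = gwProb p t (∅ : Finset (List (Fin M))) →
      (1 / 2 ≤ genDeriv p M 0 x ∧ genDeriv p M 1 x ≤ 1) ∧
      (1 / 2 ≤ genDeriv p M 1 x ∧ genDeriv p M 2 x ≤ sigma p ^ 2) ∧
      (sigma p ^ 2 / 2 ≤ genDeriv p M 2 x ∧ genDeriv p M 3 x ≤ C₃) := by
    intro t ht x hx
    have h := ht₀ t ht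
    rw [← hx] at h
    have hx0 : 0 ≤ x := hx ▸ gwProb_nonneg _ _
    have hx1 : x ≤ 1 := hx ▸ gwProb_le_one _ _
    have a := h.trans (min_le_left _ _)
    have b := h.trans (min_le_right _ _)
    have g0 := genDeriv_sub_le hM 0 hx0
    have g1 := genDeriv_sub_le hM 1 hx0
    have g2 := genDeriv_sub_le hM 2 hx0
    have l1 := genDeriv_mono (p := p) (M := M) 1 hx0 hx1
    have l2 := genDeriv_mono (p := p) (M := M) 2 hx0 hx1
    have l3 := genDeriv_mono (p := p) (M := M) 3 hx0 hx1
    have l4 := genDeriv_three_one_le hM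
    rw [zero_add, genDeriv_zero_one hM, genDeriv_one_one hM hp] at g0
    rw [genDeriv_one_one hM hp, genDeriv_two_one hM] at g1
    rw [genDeriv_two_one hM] at g2 l2
    rw [genDeriv_one_one hM hp] at l1
    have hx' : 0 ≤ 1 - x := by linarith
    refine ⟨⟨?_, l1⟩, ⟨?_, l2⟩, ?_, by linarith⟩
    · nlinarith
    · nlinarith [mul_le_mul_of_nonneg_left (hσC.trans hC) hx']
    · nlinarith [mul_le_mul_of_nonneg_left (l4.trans hC) hx']
  refine ⟨fun t ht x hx => ?_, fun t ht => ?_⟩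
  · obtain ⟨⟨a0, a1⟩, ⟨b0, b1⟩, c0, c1⟩ := key t ht x hx
    have hq : 0 ≤ 2 * C₃ / σ₀ ^ 2 := by positivity
    refine ⟨⟨by linarith, by nlinarith⟩, ⟨by linarith, by nlinarith⟩, by linarith, ?_⟩
    have : C₃ = 2 * C₃ / σ₀ ^ 2 * (σ₀ ^ 2 / 2) := by field_simp
    nlinarith [mul_le_mul_of_nonneg_left (show σ₀ ^ 2 / 2 ≤ genDeriv p M 2 x by linarith) hq]
  · obtain ⟨⟨a0, a1⟩, ⟨b0, b1⟩, c0, c1⟩ := key t ht _ rfl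
    nlinarith

end Extinction

/-! ### Subtrees spanned by given vertices, and the edges outside them. -/

section Closure

variable {M : ℕ} {p : PMF ℕ}

/-- The prefixes of the words in `L`. -/
def prefixes (L : Finset (List (Fin M))) : Finset (List (Fin M)) :=
  L.biUnion fun w => w.inits.toFinset

theorem mem_prefixes {L : Finset (List (Fin M))} {v : List (Fin M)} :
    v ∈ prefixes L ↔ ∃ w ∈ L, v <+: w := by
  simp [prefixes]

/-- The edges of the path from the root to `y`, named by their upper ends. -/
def edges (y : List (Fin M)) : Finset (List (Fin M)) := y.inits.toFinset.erase []

theorem mem_edges {y e : List (Fin M)} : e ∈ edges y ↔ e ≠ [] ∧ e <+: y := by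
  simp [edges]

/-- The edges of the path to `y` which are not on the way to a vertex in `L`. -/
def freshEdges (L : Finset (List (Fin M))) (y : List (Fin M)) : Finset (List (Fin M)) :=
  edges y \ prefixes L

theorem append_cons_notMem_prefixes {L : Finset (List (Fin M))} {v y : List (Fin M)} {a : Fin M}
    (ha : a ∉ nextLetters L v) {e : List (Fin M)} (he : e <+: v ++ a :: y)
    (hv : v.length < e.length) : e ∉ prefixes L := by
  rw [mem_prefixes]
  rintro ⟨w, hw, hew⟩
  refine ha (mem_nextLetters.2 ⟨w, hw, List.IsPrefix.trans ?_ hew⟩)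
  refine List.prefix_of_prefix_length_le ?_ he (by simpa using hv)
  exact ⟨y, by simp⟩

theorem freshEdges_append_cons {L : Finset (List (Fin M))} {v y : List (Fin M)} {a : Fin M}
    (hv : v ∈ prefixes L) (ha : a ∉ nextLetters L v) :
    freshEdges L (v ++ a :: y)
      = (Finset.range (y.length + 1)).image fun j => (v ++ a :: y).take (v.length + j + 1) := by
  ext e
  simp only [freshEdges, Finset.mem_sdiff, mem_edges, Finset.mem_image, Finset.mem_range]
  constructor
  · rintro ⟨⟨-, h2⟩, h3⟩
    have h4 : v.length < e.length := by
      by_contra h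
      obtain ⟨w, hw, hvw⟩ := mem_prefixes.1 hv
      exact h3 (mem_prefixes.2 ⟨w, hw, (List.prefix_of_prefix_length_le h2
        (List.prefix_append v _) (not_lt.1 h)).trans hvw⟩)
    have h5 := h2.length_le
    rw [List.length_append, List.length_cons] at h5
    refine ⟨e.length - v.length - 1, by omega, ?_⟩
    rw [show v.length + (e.length - v.length - 1) + 1 = e.length by omega]
    exact (List.prefix_iff_eq_take.1 h2).symm
  · rintro ⟨j, hj, rfl⟩
    have hl : ((v ++ a :: y).take (v.length + j + 1)).length = v.length + j + 1 := by
      rw [List.length_take, List.length_append, List.length_cons]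
      omega
    refine ⟨⟨?_, List.take_prefix _ _⟩,
      append_cons_notMem_prefixes ha (List.take_prefix _ _) (by omega)⟩
    intro h0
    rw [h0] at hl
    simp at hl

theorem card_freshEdges_append_cons {L : Finset (List (Fin M))} {v y : List (Fin M)} {a : Fin M}
    (hv : v ∈ prefixes L) (ha : a ∉ nextLetters L v) :
    (freshEdges L (v ++ a :: y)).card = (v ++ a :: y).length - v.length := by
  rw [freshEdges_append_cons hv ha, Finset.card_image_of_injOn, Finset.card_range]
  · simp
  · intro i hi j hj hij
    simp only [Finset.coe_range, Set.mem_Iio] at hi hj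
    have := congrArg List.length hij
    simp only [List.length_take, List.length_append, List.length_cons] at this
    omega

/-- Follow `w` from the root, which belongs to the spanned subtree because `L` is nonempty, to the
vertex where it leaves this subtree. -/
theorem exists_append_cons {L : Finset (List (Fin M))} (hL : L.Nonempty) {w : List (Fin M)}
    (hw : w ∉ prefixes L) :
    ∃ v ∈ prefixes L, ∃ a ∉ nextLetters L v, ∃ y, w = v ++ a :: y := by
  induction w using List.reverseRecOn with
  | nil =>
    obtain ⟨u, hu⟩ := hL
    exact absurd (mem_prefixes.2 ⟨u, hu, List.nil_prefix⟩) hw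
  | append_singleton w b ih =>
    by_cases h : w ∈ prefixes L
    · exact ⟨w, h, b, fun hb => hw (mem_prefixes.2 (mem_nextLetters.1 hb)), [], rfl⟩
    · obtain ⟨v, hv, a, ha, y, rfl⟩ := ih h
      exact ⟨v, hv, a, ha, y ++ [b], by simp⟩

/-- One preimage for each index is enough for an upper bound, so the parametrisations used below
need not be injective. -/
theorem sum_le_sum_of_surj {α β : Type*} (s : Finset α) (t : Finset β)
    (φ : β → α) (h : ∀ a ∈ s, ∃ b ∈ t, φ b = a) (F : α → ℝ≥0∞) :
    ∑ a ∈ s, F a ≤ ∑ b ∈ t, F (φ b) := by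
  classical
  rcases isEmpty_or_nonempty β with hβ | hβ
  · rw [Finset.sum_eq_zero fun a ha => isEmptyElim (h a ha).choose]
    exact bot_le
  choose! ψ hψ hφ using h
  calc ∑ a ∈ s, F a = ∑ a ∈ s, F (φ (ψ a)) := Finset.sum_congr rfl fun a ha => by rw [hφ a ha]
    _ = ∑ b ∈ s.image ψ, F (φ b) :=
      (Finset.sum_image (f := fun b => F (φ b)) fun a ha b hb hab => by
        rw [← hφ a ha, ← hφ b hb, hab]).symm
    _ ≤ _ := Finset.sum_le_sum_of_subset (Finset.image_subset_iff.2 hψ)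

/-- Words are sorted by the vertex at which they leave the subtree spanned by `L`; those inside it
are listed separately. -/
theorem sum_words_le {L : Finset (List (Fin M))} (hL : L.Nonempty) (n : ℕ)
    (F : List (Fin M) → ℝ≥0∞) :
    ∑ w ∈ words M n, F w ≤ ∑ v ∈ prefixes L, ((if v.length = n then F v else 0) +
      if v.length < n then ∑ a ∈ (nextLetters L v)ᶜ, ∑ y ∈ words M (n - v.length - 1),
        F (v ++ a :: y) else 0) := by
  classical
  have h1 : ∑ w ∈ words M n, F w
      = ∑ w ∈ (words M n).filter (· ∈ prefixes L), F w
        + ∑ w ∈ (words M n).filter (· ∉ prefixes L), F w :=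
    (Finset.sum_filter_add_sum_filter_not _ _ _).symm
  rw [h1, Finset.sum_add_distrib]
  refine add_le_add ?_ ?_
  · rw [← Finset.sum_filter]
    refine Finset.sum_le_sum_of_subset fun w hw => ?_
    simp only [Finset.mem_filter, mem_words] at hw ⊢
    exact ⟨hw.2, hw.1⟩
  · have h2 : ∀ v ∈ prefixes L, (if v.length < n then ∑ a ∈ (nextLetters L v)ᶜ,
        ∑ y ∈ words M (n - v.length - 1), F (v ++ a :: y) else 0)
        = ∑ x ∈ (if v.length < n then (nextLetters L v)ᶜ ×ˢ words M (n - v.length - 1) else ∅),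
          F (v ++ x.1 :: x.2) := by
      intro v _
      split_ifs
      · rw [Finset.sum_product]
      · simp
    rw [Finset.sum_congr rfl h2, Finset.sum_sigma']
    refine sum_le_sum_of_surj _ _ 
      (fun x : (_ : List (Fin M)) × Fin M × List (Fin M) => x.1 ++ x.2.1 :: x.2.2) ?_ F
    intro w hw
    simp only [Finset.mem_filter, mem_words] at hw
    obtain ⟨v, hv, a, ha, y, rfl⟩ := exists_append_cons hL hw.2
    have hlen := hw.1
    rw [List.length_append, List.length_cons] at hlen
    refine ⟨⟨v, (a, y)⟩, ?_, rfl⟩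
    simp only [Finset.mem_sigma]
    refine ⟨hv, ?_⟩
    rw [if_pos (by omega)]
    simp only [Finset.mem_product, Finset.mem_compl, mem_words]
    exact ⟨ha, by omega⟩

end Closure


/-! ### Summation over branches leaving a spanned subtree. -/

section Branches

variable {M : ℕ} {p : PMF ℕ}

theorem card_nextLetters_le (L : Finset (List (Fin M))) (v : List (Fin M)) :
    (nextLetters L v).card ≤ L.card := by
  have h : ∀ a ∈ nextLetters L v, ∃ w ∈ L, (v ++ [a]) <+: w := fun a ha => mem_nextLetters.1 ha
  choose! f hf hf' using h
  refine Finset.card_le_card_of_injOn f hf fun a ha b hb hab => ?_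
  have h1 := hf' a ha
  rw [hab] at h1
  have h2 := (List.prefix_of_prefix_length_le h1 (hf' b hb) (by simp)).eq_of_length (by simp)
  simpa using h2

theorem mem_of_nextLetters_eq_empty {L : Finset (List (Fin M))} {v : List (Fin M)}
    (hv : v ∈ prefixes L) (h : nextLetters L v = ∅) : v ∈ L := by
  obtain ⟨w, hw, u, rfl⟩ := mem_prefixes.1 hv
  rcases u with _ | ⟨b, u⟩
  · simpa using hw
  · have : b ∈ nextLetters L v := mem_nextLetters.2 ⟨_, hw, u, by simp⟩
    rw [h] at this
    simp at this

/-- At such a vertex the two words of `L` separate, which happens only once. With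
`mem_of_nextLetters_eq_empty` this bounds by three the number of vertices of exceptional weight. -/
theorem eq_of_two_nextLetters {L : Finset (List (Fin M))} (hL : L.card ≤ 2)
    {v v' : List (Fin M)} (hv : 1 < (nextLetters L v).card)
    (hv' : 1 < (nextLetters L v').card) : v = v' := by
  have key : ∀ {v : List (Fin M)}, 1 < (nextLetters L v).card → ∃ a b w₁ w₂, a ≠ b ∧
      L = {w₁, w₂} ∧ (v ++ [a]) <+: w₁ ∧ (v ++ [b]) <+: w₂ := by
    intro v h
    obtain ⟨a, ha, b, hb, hab⟩ := Finset.one_lt_card.1 h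
    obtain ⟨w₁, h1, h1'⟩ := mem_nextLetters.1 ha
    obtain ⟨w₂, h2, h2'⟩ := mem_nextLetters.1 hb
    refine ⟨a, b, w₁, w₂, hab, ?_, h1', h2'⟩
    symm
    refine Finset.eq_of_subset_of_card_le (by simp [Finset.insert_subset_iff, h1, h2]) ?_
    rw [Finset.card_pair]
    · exact hL
    · rintro rfl
      have := (List.prefix_of_prefix_length_le h1' h2' (by simp)).eq_of_length (by simp)
      simp at this
      exact hab this
  have main : ∀ {v v' : List (Fin M)}, 1 < (nextLetters L v).card →
      1 < (nextLetters L v').card → ¬ v.length < v'.length := by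
    intro v v' hv hv' hlt
    obtain ⟨a, b, w₁, w₂, hab, hL₁, h1, h2⟩ := key hv
    obtain ⟨a', b', w₁', w₂', -, hL₂, h1', h2'⟩ := key hv'
    have hall : ∀ w ∈ L, v' <+: w := by
      intro w hw
      rw [hL₂] at hw
      rcases Finset.mem_insert.1 hw with rfl | hw
      · exact (List.prefix_append _ _).trans h1'
      · rw [Finset.mem_singleton.1 hw]
        exact (List.prefix_append _ _).trans h2'
    have e1 := List.prefix_of_prefix_length_le h1 (hall w₁ (by simp [hL₁])) (by simpa using hlt)
    have e2 := List.prefix_of_prefix_length_le h2 (hall w₂ (by simp [hL₁])) (by simpa using hlt)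
    have := (List.prefix_of_prefix_length_le e1 e2 (by simp)).eq_of_length (by simp)
    simp at this
    exact hab this
  obtain ⟨a, b, w₁, w₂, -, hL₁, h1, -⟩ := key hv
  obtain ⟨a', b', w₁', w₂', -, hL₂, h1', h2'⟩ := key hv'
  have hvw : v <+: w₁ := (List.prefix_append _ _).trans h1
  have hvw' : v' <+: w₁ := by
    have : w₁ ∈ L := by simp [hL₁]
    rw [hL₂] at this
    rcases Finset.mem_insert.1 this with h | h
    · rw [h]
      exact (List.prefix_append _ _).trans h1'
    · rw [Finset.mem_singleton.1 h]
      exact (List.prefix_append _ _).trans h2'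
  have hlen : v.length = v'.length := le_antisymm (not_lt.1 (main hv' hv)) (not_lt.1 (main hv hv'))
  exact (List.prefix_of_prefix_length_le hvw hvw' hlen.le).eq_of_length hlen

theorem gwLaw_event_anti {T : ℕ} {L L' : Finset (List (Fin M))} (h : L ⊆ L') :
    gwLaw M p (gwEvent T L') ≤ gwLaw M p (gwEvent T L) :=
  measure_mono fun _ hω => ⟨fun w hw => hω.1 w (h hw), hω.2⟩

theorem sum_ofReal_gwProb {α β : Type*} (s : Finset α) (t : Finset β) (T : ℕ)
    (f : α → β → Finset (List (Fin M))) :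
    ∑ a ∈ s, ∑ b ∈ t, gwLaw M p (gwEvent T (f a b))
      = ENNReal.ofReal (∑ a ∈ s, ∑ b ∈ t, gwProb p T (f a b)) := by
  rw [ENNReal.ofReal_sum_of_nonneg fun a _ => Finset.sum_nonneg fun b _ => gwProb_nonneg _ _]
  refine Finset.sum_congr rfl fun a _ => ?_
  rw [ENNReal.ofReal_sum_of_nonneg fun b _ => gwProb_nonneg _ _]
  exact Finset.sum_congr rfl fun b _ => (ofReal_gwProb _ _).symm

/-- `sum_gwProb_attach` divided by the derivative in front: the ratio is controlled by `A` at a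
vertex with one continuation and by `B` otherwise, and generation means are at most one. -/
theorem sum_attach_le (hM : ∀ k, M < k → p k = 0) (hp : IsCritical p) {t₀ : ℕ} {A B : ℝ}
    (hW : HasWeightBounds p M t₀ A B) {T : ℕ} {L : Finset (List (Fin M))}
    (hL : L.card ≤ 2) {v : List (Fin M)} (hv : v ∈ prefixes L) (n : ℕ)
    (hT : t₀ + v.length + 1 ≤ T) :
    ∑ a ∈ (nextLetters L v)ᶜ, ∑ y ∈ words M n, gwLaw M p (gwEvent T (insert (v ++ a :: y) L))
      ≤ ENNReal.ofReal (if (nextLetters L v).card = 1 then A else B) *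
        gwLaw M p (gwEvent T L) := by
  have h1 := sum_gwProb_attach (p := p) (L := L) hM n (show v.length < T by omega)
    (Or.inr (mem_prefixes.1 hv))
  obtain ⟨⟨a0, a1⟩, ⟨b0, b1⟩, c0, c1⟩ := hW (T - v.length - 1) (by omega) _ rfl
  have hc := (card_nextLetters_le L v).trans hL
  rw [sum_ofReal_gwProb, ← ofReal_gwProb, ← ENNReal.ofReal_mul']
  swap
  · exact gwProb_nonneg _ _
  refine ENNReal.ofReal_le_ofReal ?_
  have hS := generationMean_le_one hM hp (T - v.length - 1) n
  have hS0 := generationMean_nonneg (M := M) (p := p) (T - v.length - 1) n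
  have hQ := gwProb_nonneg (p := p) T L
  generalize hx : gwProb p (T - v.length - 1) (∅ : Finset (List (Fin M))) = x at *
  have hx0 : 0 ≤ x := hx ▸ gwProb_nonneg _ _
  have hSQ : generationMean M p (T - v.length - 1) n * gwProb p T L ≤ gwProb p T L :=
    mul_le_of_le_one_left hQ hS
  have main : ∀ (c : ℕ) (w : ℝ), 0 < genDeriv p M c x →
      genDeriv p M (c + 1) x ≤ w * genDeriv p M c x → ∀ S : ℝ,
      genDeriv p M c x * S = genDeriv p M (c + 1) x *
        (generationMean M p (T - v.length - 1) n * gwProb p T L) → S ≤ w * gwProb p T L := by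
    intro c w h0 h2 S hS
    refine le_of_mul_le_mul_left ?_ h0
    rw [hS]
    calc _ ≤ genDeriv p M (c + 1) x * gwProb p T L :=
          mul_le_mul_of_nonneg_left hSQ (genDeriv_nonneg _ hx0)
      _ ≤ w * genDeriv p M c x * gwProb p T L := mul_le_mul_of_nonneg_right h2 hQ
      _ = _ := by ring
  generalize (nextLetters L v).card = c at *
  interval_cases c
  · rw [if_neg (by norm_num)]
    exact main 0 B a0 a1 _ h1
  · rw [if_pos rfl]
    exact main 1 A b0 b1 _ h1
  · rw [if_neg (by norm_num)]
    exact main 2 B c0 c1 _ h1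

/-- Vertices with one continuation lie on the `L.card` paths, at most one per path and height, and
give the sum. Leaves and the branch point are at most three and are estimated with the shortest
fresh branch. -/
theorem sum_prefixes_le {L : Finset (List (Fin M))} (hL : L.card ≤ 2) {ℓ : ℕ}
    (hℓ : ∀ w ∈ L, w.length ≤ ℓ) {A B : ℝ} (k : ℕ) {g : ℕ → ℝ≥0∞}
    (hg : Antitone g) :
    ∑ v ∈ prefixes L, ENNReal.ofReal (if (nextLetters L v).card = 1 then A else B) *
        g (k + (ℓ - v.length))
      ≤ ENNReal.ofReal (L.card * A) * ∑ i ∈ Finset.range (ℓ + 1), g (k + i)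
        + ENNReal.ofReal (3 * B) * g k := by
  classical
  rw [← Finset.sum_filter_add_sum_filter_not (prefixes L) fun v => (nextLetters L v).card = 1]
  refine add_le_add ?_ ?_
  · calc _ ≤ ∑ v ∈ prefixes L, ENNReal.ofReal A * g (k + (ℓ - v.length)) := by
          rw [Finset.sum_filter]
          refine Finset.sum_le_sum fun v _ => ?_
          split_ifs
          · exact le_rfl
          · exact bot_le
      _ ≤ ∑ x ∈ L ×ˢ Finset.range (ℓ + 1), ENNReal.ofReal A *
            g (k + (ℓ - (x.1.take (ℓ - x.2)).length)) := by
          refine sum_le_sum_of_surj _ _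
            (fun x : List (Fin M) × ℕ => x.1.take (ℓ - x.2)) ?_
            fun v => ENNReal.ofReal A * g (k + (ℓ - v.length))
          intro v hv
          obtain ⟨w, hw, hvw⟩ := mem_prefixes.1 hv
          refine ⟨(w, ℓ - v.length), ?_, ?_⟩
          · simp only [Finset.mem_product, Finset.mem_range]
            exact ⟨hw, by omega⟩
          · have h1 := hvw.length_le.trans (hℓ w hw)
            simp only
            rw [show ℓ - (ℓ - v.length) = v.length by omega]
            exact (List.prefix_iff_eq_take.1 hvw).symm
      _ ≤ ∑ x ∈ L ×ˢ Finset.range (ℓ + 1), ENNReal.ofReal A * g (k + x.2) := by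
          refine Finset.sum_le_sum fun x hx => ?_
          gcongr
          refine hg ?_
          simp only [Finset.mem_product, Finset.mem_range] at hx
          have : (x.1.take (ℓ - x.2)).length ≤ ℓ - x.2 := List.length_take_le _ _
          omega
      _ = _ := by
          rw [Finset.sum_product]
          simp only
          rw [Finset.sum_const, nsmul_eq_mul, ← Finset.mul_sum,
            ENNReal.ofReal_mul (by positivity), ENNReal.ofReal_natCast]
          ring
  · have hcard : ((prefixes L).filter fun v => ¬ (nextLetters L v).card = 1).card ≤ 3 := by
      have hsub : ((prefixes L).filter fun v => ¬ (nextLetters L v).card = 1)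
          ⊆ L ∪ (prefixes L).filter fun v => 1 < (nextLetters L v).card := by
        intro v hv
        simp only [Finset.mem_filter, Finset.mem_union] at hv ⊢
        rcases Nat.eq_zero_or_pos (nextLetters L v).card with h | h
        · exact Or.inl (mem_of_nextLetters_eq_empty hv.1 (Finset.card_eq_zero.1 h))
        · exact Or.inr ⟨hv.1, by omega⟩
      refine (Finset.card_le_card hsub).trans ((Finset.card_union_le _ _).trans ?_)
      have : ((prefixes L).filter fun v => 1 < (nextLetters L v).card).card ≤ 1 := by
        refine Finset.card_le_one.2 fun v hv v' hv' => ?_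
        exact eq_of_two_nextLetters hL (Finset.mem_filter.1 hv).2 (Finset.mem_filter.1 hv').2
      omega
    calc _ ≤ ∑ v ∈ (prefixes L).filter fun v => ¬ (nextLetters L v).card = 1,
            ENNReal.ofReal B * g k := by
          refine Finset.sum_le_sum fun v hv => ?_
          rw [if_neg (Finset.mem_filter.1 hv).2]
          gcongr
          exact hg (by omega)
      _ ≤ _ := by
          rw [Finset.sum_const, nsmul_eq_mul, ENNReal.ofReal_mul (by norm_num), ← mul_assoc]
          gcongr
          rw [show ENNReal.ofReal 3 = ((3 : ℕ) : ℝ≥0∞) by simp]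
          exact_mod_cast hcard

/-- Summing over the further vertices in generation `ℓ + k`. -/
theorem sum_branch_le (hM : ∀ k, M < k → p k = 0) (hp : IsCritical p) {t₀ : ℕ} {A B : ℝ}
    (hW : HasWeightBounds p M t₀ A B) (hB : 1 ≤ B) {T : ℕ} {L : Finset (List (Fin M))}
    (hLn : L.Nonempty) (hL : L.card ≤ 2) {ℓ : ℕ} (hℓ : ∀ w ∈ L, w.length ≤ ℓ)
    (hT : t₀ + ℓ + 1 ≤ T) (k : ℕ) {g : ℕ → ℝ≥0∞} (hg : Antitone g) :
    ∑ w ∈ words M (ℓ + k), gwLaw M p (gwEvent T (insert w L)) * g (freshEdges L w).card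
      ≤ gwLaw M p (gwEvent T L) *
        (ENNReal.ofReal (L.card * A) * ∑ i ∈ Finset.range (ℓ + 1), g (k + i)
          + ENNReal.ofReal (3 * B) * g k) := by
  refine (sum_words_le hLn _ _).trans ?_
  refine le_trans ?_ (mul_le_mul_right (sum_prefixes_le hL hℓ (A := A) (B := B) k hg) _)
  rw [Finset.mul_sum]
  refine Finset.sum_le_sum fun v hv => ?_
  obtain ⟨w, hw, hvw⟩ := mem_prefixes.1 hv
  have hvℓ : v.length ≤ ℓ := hvw.length_le.trans (hℓ w hw)
  -- The new word itself lies in the spanned subtree. This happens only for `k = 0` and at a leaf,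
  -- and `1 ≤ B` pays for it.
  by_cases h : v.length = ℓ + k
  · have hk : k = 0 := by omega
    rw [if_pos h, if_neg (by omega), add_zero]
    have h0 : nextLetters L v = ∅ := by
      rw [Finset.eq_empty_iff_forall_notMem]
      intro a ha
      obtain ⟨w', hw', h'⟩ := mem_nextLetters.1 ha
      have h1 := h'.length_le
      have h2 := hℓ w' hw'
      simp at h1
      omega
    rw [h0, Finset.card_empty, if_neg (by norm_num)]
    refine mul_le_mul' (gwLaw_event_anti (Finset.subset_insert _ _)) ?_
    · calc g (freshEdges L v).card ≤ g (k + (ℓ - v.length)) := hg (by omega)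
        _ ≤ _ := le_mul_of_one_le_left' (by simpa using hB)
  · rw [if_neg h, zero_add, if_pos (by omega)]
    calc _ = (∑ a ∈ (nextLetters L v)ᶜ, ∑ y ∈ words M (ℓ + k - v.length - 1),
            gwLaw M p (gwEvent T (insert (v ++ a :: y) L))) * g (k + (ℓ - v.length)) := by
          rw [Finset.sum_mul]
          refine Finset.sum_congr rfl fun a ha => ?_
          rw [Finset.sum_mul]
          refine Finset.sum_congr rfl fun y hy => ?_
          rw [card_freshEdges_append_cons hv (Finset.mem_compl.1 ha), List.length_append,
            List.length_cons, mem_words.1 hy]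
          congr 2
          omega
      _ ≤ _ := by
          refine (mul_le_mul_left (sum_attach_le hM hp hW hL hv _ (by omega)) _).trans ?_
          exact le_of_eq (by ring)

/-- The words of length `n` whose common prefix with `u` has length `s`. -/
noncomputable def forks (u : List (Fin M)) (s n : ℕ) : Finset (List (Fin M)) :=
  (words M n).filter fun w => u.take s <+: w ∧ ¬ u.take (s + 1) <+: w

theorem nextLetters_singleton_take {u : List (Fin M)} {s : ℕ} (hs : s < u.length) :
    nextLetters {u} (u.take s) = {u[s]} := by
  ext a
  rw [mem_nextLetters]
  simp only [Finset.mem_singleton, exists_eq_left]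
  constructor
  · intro h
    have h1 : (u.take s ++ [a]) = u.take (s + 1) := by
      have := List.prefix_iff_eq_take.1 h
      rw [this]
      congr 1
      simp
      omega
    rw [← List.take_concat_get' u s hs, List.append_cancel_left_eq] at h1
    simpa using h1
  · rintro rfl
    rw [List.take_concat_get' u s hs]
    exact List.take_prefix _ _

/-- `sum_gwProb_attach` at an interior vertex of a single path, where one child is already demanded;
different continuations give different words, so the sum embeds in the sum over `forks`. -/
theorem le_sum_forks (hM : ∀ k, M < k → p k = 0) {T : ℕ} {u : List (Fin M)} {s n : ℕ}
    (hs : s < u.length) (hn : s < n) (hT : s < T) {A : ℝ}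
    (h1 : 0 < genDeriv p M 1 (gwProb p (T - s - 1) (∅ : Finset (List (Fin M)))))
    (h2 : A * genDeriv p M 1 (gwProb p (T - s - 1) (∅ : Finset (List (Fin M))))
      ≤ genDeriv p M 2 (gwProb p (T - s - 1) (∅ : Finset (List (Fin M))))) :
    ENNReal.ofReal (A * generationMean M p (T - s - 1) (n - s - 1)) *
        gwLaw M p (gwEvent T ({u} : Finset (List (Fin M))))
      ≤ ∑ w ∈ forks u s n, gwLaw M p (gwEvent T (insert w {u})) := by
  classical
  have hl : (u.take s).length = s := by simp; omega
  have h3 := sum_gwProb_attach (p := p) (L := {u}) (v := u.take s) (T := T) hM (n - s - 1)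
    (by omega) (Or.inr ⟨u, by simp, List.take_prefix _ _⟩)
  rw [hl, nextLetters_singleton_take hs, Finset.card_singleton] at h3
  have h4 : A * generationMean M p (T - s - 1) (n - s - 1) *
      gwProb p T ({u} : Finset (List (Fin M))) ≤ ∑ a ∈ ({u[s]} : Finset (Fin M))ᶜ,
        ∑ y ∈ words M (n - s - 1), gwProb p T (insert (u.take s ++ a :: y) {u}) := by
    refine le_of_mul_le_mul_left ?_ h1
    rw [h3]
    have := mul_le_mul_of_nonneg_right h2 (mul_nonneg
      (generationMean_nonneg (M := M) (p := p) (T - s - 1) (n - s - 1))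
      (gwProb_nonneg (p := p) T ({u} : Finset (List (Fin M)))))
    linarith
  rw [← ofReal_gwProb, ← ENNReal.ofReal_mul']
  swap
  · exact gwProb_nonneg _ _
  refine (ENNReal.ofReal_le_ofReal h4).trans ?_
  rw [← sum_ofReal_gwProb, Finset.sum_sigma']
  have hinj : Function.Injective fun x : (_ : Fin M) × List (Fin M) =>
      u.take s ++ x.1 :: x.2 := by
    rintro ⟨a, y⟩ ⟨b, z⟩ h
    simp only [List.append_cancel_left_eq, List.cons.injEq] at h
    simp [h.1, h.2]
  rw [← Finset.sum_image (f := fun w => gwLaw M p (gwEvent T (insert w {u}))) hinj.injOn]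
  refine Finset.sum_le_sum_of_subset ?_
  intro w hw
  obtain ⟨⟨a, y⟩, hx, rfl⟩ := Finset.mem_image.1 hw
  simp only [Finset.mem_sigma, Finset.mem_compl, Finset.mem_singleton, mem_words] at hx
  simp only [forks, Finset.mem_filter, mem_words]
  refine ⟨by simp [hx.2]; omega, List.prefix_append _ _, fun h => hx.1 ?_⟩
  rw [← List.take_concat_get' u s hs] at h
  rw [List.prefix_append_right_inj] at h
  simp at h
  exact h.symm

end Branches


/-! ### A single bush and the subtrees at its first generation. -/

section Bushes

variable {M : ℕ}

/-- The positions of the children of all vertices of a bush. -/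
def bushOffspring (b : BushSample M) (u : List (Fin M)) : Finset (Fin M) :=
  if u = [] then b.1.2 else b.2 u

theorem bush_eq_gwTree (b : BushSample M) : bush b = gwTree (bushOffspring b) := rfl

theorem subtreeAt_bushOffspring (b : BushSample M) (a : Fin M) :
    subtreeAt (bushOffspring b) a = subtreeAt b.2 a := by
  funext u
  simp [subtreeAt, bushOffspring]

theorem bushOffspring_nil (b : BushSample M) : bushOffspring b [] = b.1.2 := by
  simp [bushOffspring]

theorem measurable_bushOffspring : Measurable (bushOffspring (M := M)) := by
  rw [measurable_pi_iff]
  intro u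
  by_cases h : u = []
  · simp only [bushOffspring, h, if_true]
    exact measurable_snd.comp measurable_fst
  · simp only [bushOffspring, h, if_false]
    exact (measurable_pi_apply u).comp measurable_snd

theorem cons_mem_bush {b : BushSample M} {a : Fin M} {w : List (Fin M)} :
    a :: w ∈ bush b ↔ a ∈ b.1.2 ∧ w ∈ gwTree (subtreeAt b.2 a) := by
  rw [bush_eq_gwTree, cons_mem_gwTree, subtreeAt_bushOffspring, bushOffspring_nil]

theorem diesOutBy_eq (t : ℕ) : (diesOutBy t : Set (BushSample M))
    = bushOffspring ⁻¹' gwEvent t ∅ := by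
  ext b
  simp [diesOutBy, gwEvent, bush_eq_gwTree]

theorem measurableSet_diesOutBy (t : ℕ) : MeasurableSet (diesOutBy t : Set (BushSample M)) := by
  rw [diesOutBy_eq]
  exact measurable_bushOffspring (measurableSet_gwEvent t ∅)

variable [NeZero M] {p : PMF ℕ} (hp : IsCritical p)

/-- The other children are placed in the complement of the backbone position. Hence bushes do not
run into the backbone, and every vertex off the backbone belongs to one bush only. -/
theorem ae_bushLaw_notMem : ∀ᵐ b ∂bushLaw M p hp, b.1.1 ∉ b.1.2 := by
  have h : (backboneOffspringLaw M p hp).toMeasure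
      {q : Fin M × Finset (Fin M) | q.1 ∈ q.2} = 0 := by
    rw [PMF.toMeasure_apply_eq_zero_iff _ MeasurableSet.of_discrete, Set.disjoint_left]
    rintro ⟨c, A⟩ h1 h2
    simp only [backboneOffspringLaw, PMF.mem_support_bind_iff, PMF.support_map, Set.mem_image,
      PMF.mem_support_uniformOfFinset_iff, Finset.mem_powersetCard] at h1
    obtain ⟨a, -, k, -, A', ⟨hA', -⟩, h⟩ := h1
    simp only [Prod.mk.injEq] at h
    obtain ⟨rfl, rfl⟩ := h
    exact absurd (hA' h2) (by simp)
  have h' : bushLaw M p hp ({q : Fin M × Finset (Fin M) | q.1 ∈ q.2} ×ˢ Set.univ) = 0 := by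
    rw [bushLaw, Measure.prod_prod, h, zero_mul]
  rw [ae_iff]
  convert h' using 2
  ext b
  simp

/-- The bush contains `a :: y` for `y ∈ L`. -/
theorem bushLaw_event (c a : Fin M) (t : ℕ) : ∃ κ : ℝ≥0∞, ∀ L : Finset (List (Fin M)),
    L.Nonempty → bushLaw M p hp (diesOutBy (t + 1) ∩ {b | b.1.1 = c ∧ ∀ y ∈ L, a :: y ∈ bush b})
      = κ * gwLaw M p (gwEvent t L) := by
  classical
  -- Given the first generation `q`, only the subtree at `a` depends on `L`; its siblings just have
  -- to die out and are collected in the constant.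
  refine ⟨∑' q : Fin M × Finset (Fin M), backboneOffspringLaw M p hp q *
    if q.1 = c ∧ a ∈ q.2 then ∏ _e ∈ q.2.erase a, gwLaw M p (gwEvent t ∅) else 0,
    fun L hL => ?_⟩
  have hm : MeasurableSet
      (diesOutBy (t + 1) ∩ {b : BushSample M | b.1.1 = c ∧ ∀ y ∈ L, a :: y ∈ bush b}) := by
    refine (measurableSet_diesOutBy _).inter ?_
    have : {b : BushSample M | b.1.1 = c ∧ ∀ y ∈ L, a :: y ∈ bush b}
        = (fun b : BushSample M => b.1.1) ⁻¹' {c} ∩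
          ⋂ y ∈ L, bushOffspring ⁻¹' {ω | a :: y ∈ gwTree ω} := by
      ext b
      simp [bush_eq_gwTree]
    rw [this]
    exact ((measurable_fst.comp measurable_fst) (measurableSet_singleton c)).inter
      (Finset.measurableSet_biInter _ fun y _ =>
        measurable_bushOffspring (measurableSet_mem_gwTree _))
  rw [bushLaw, Measure.prod_apply hm, lintegral_toMeasure, ← ENNReal.tsum_mul_right]
  refine tsum_congr fun q => ?_
  rw [mul_assoc]
  congr 1
  have key : ∀ ω : List (Fin M) → Finset (Fin M),
      ((q, ω) : BushSample M) ∈ diesOutBy (t + 1) ∩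
        {b : BushSample M | b.1.1 = c ∧ ∀ y ∈ L, a :: y ∈ bush b} ↔
      (q.1 = c ∧ a ∈ q.2) ∧ ∀ e ∈ q.2, subtreeAt ω e ∈ gwEvent t (if e = a then L else ∅) := by
    intro ω
    rw [Set.mem_inter_iff, diesOutBy_eq, Set.mem_preimage, mem_gwEvent_succ]
    simp only [bushOffspring_nil, subtreeAt_bushOffspring, Set.mem_ofPred_eq, cons_mem_bush]
    have htails : ∀ e : Fin M, tails (∅ : Finset (List (Fin M))) e = ∅ := fun e => by simp [tails]
    simp only [htails]
    constructor
    · rintro ⟨⟨-, h1⟩, h2, h3⟩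
      obtain ⟨y, hy⟩ := hL
      refine ⟨⟨h2, (h3 y hy).1⟩, fun e he => ?_⟩
      by_cases hea : e = a
      · subst hea
        rw [if_pos rfl]
        exact ⟨fun w hw => (h3 w hw).2, (h1 e he).2⟩
      · rw [if_neg hea]
        exact h1 e he
    · rintro ⟨⟨h1, h2⟩, h3⟩
      refine ⟨⟨?_, fun e he => ⟨by simp, (h3 e he).2⟩⟩, h1, fun y hy => ⟨h2, ?_⟩⟩
      · intro e he
        simp [heads] at he
      · have := h3 a h2
        rw [if_pos rfl] at this
        exact this.1 y hy
  have hset : Prod.mk q ⁻¹' (diesOutBy (t + 1) ∩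
        {b : BushSample M | b.1.1 = c ∧ ∀ y ∈ L, a :: y ∈ bush b})
      = {ω | (q.1 = c ∧ a ∈ q.2) ∧
          ∀ e ∈ q.2, subtreeAt ω e ∈ gwEvent t (if e = a then L else ∅)} := by
    ext ω
    exact key ω
  rw [hset]
  by_cases hq : q.1 = c ∧ a ∈ q.2
  · rw [if_pos hq]
    have h1 := infinitePi_subtrees (offspringLaw M p).toMeasure Set.univ MeasurableSet.univ q.2
      (fun e => gwEvent t (if e = a then L else ∅)) fun e => measurableSet_gwEvent _ _
    simp only [Set.mem_univ, true_and, measure_univ, one_mul] at h1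
    simp only [hq, and_self, true_and]
    rw [h1, ← Finset.mul_prod_erase q.2 _ hq.2, if_pos rfl, mul_comm]
    congr 1
    exact Finset.prod_congr rfl fun e he => by rw [if_neg (Finset.ne_of_mem_erase he)]
  · rw [if_neg hq, zero_mul]
    simp [hq]

end Bushes

/-! ### The tree with its backbone. -/

section TreeLaw

variable {M : ℕ}

theorem length_backbone {N : ℕ} (s : TreeSample M N) {i : ℕ} (hi : i ≤ N) :
    (backbone s i).length = i := by
  simp [backbone]
  omega

theorem backbone_eq_take {N : ℕ} (s : TreeSample M N) {i : ℕ} (hi : i ≤ N) :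
    backbone s i = (backbone s N).take i := by
  rw [backbone, backbone, List.take_take, min_eq_left hi]

theorem getElem_backbone {N : ℕ} (s : TreeSample M N) {i : ℕ} (hi : i < N) :
    (backbone s N)[i]'(by rw [length_backbone s le_rfl]; exact hi)
      = (s ⟨i, by omega⟩).1.1 := by
  simp only [backbone, List.getElem_take, List.getElem_ofFn]

theorem backbone_eq_iff {N : ℕ} (s : TreeSample M N) {V : List (Fin M)} (hV : V.length = N) :
    backbone s N = V ↔ ∀ (i : ℕ) (hi : i < N), (s ⟨i, by omega⟩).1.1 = V[i] := by
  constructor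
  · intro h i hi
    rw [← getElem_backbone s hi]
    simp [h]
  · intro h
    refine List.ext_getElem (by rw [length_backbone s le_rfl, hV]) fun i h1 h2 => ?_
    rw [getElem_backbone s (by omega), h i (by omega)]

/-- The bush is determined by where the word leaves the backbone: a bush at a lower vertex would
contain a backbone child, against `hs`, and one at a higher vertex would make `a` the backbone
letter. -/
theorem mem_treeSet_iff {N : ℕ} {s : TreeSample M N} (hs : ∀ i, (s i).1.1 ∉ (s i).1.2) {z : ℕ}
    (hz : z < N) {V : List (Fin M)} (hV : backbone s N = V) {a : Fin M}
    (ha : a ≠ (s ⟨z, by omega⟩).1.1) (y : List (Fin M)) :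
    V.take z ++ a :: y ∈ treeSet s ↔ a :: y ∈ bush (s ⟨z, by omega⟩) := by
  have hVl : V.length = N := by rw [← hV, length_backbone s le_rfl]
  have hVi := (backbone_eq_iff s hVl).1 hV
  constructor
  · rintro ⟨i, w, hw, h⟩
    rw [backbone_eq_take s (by omega), hV] at h
    rcases lt_trichotomy (i : ℕ) z with hi | hi | hi
    · exfalso
      have h1 : V.take z = V.take i ++ V[(i : ℕ)] :: (V.take z).drop (i + 1) := by
        have h2 : (V.take z).drop i = V[(i : ℕ)] :: (V.take z).drop (i + 1) := by
          rw [List.drop_eq_getElem_cons (by simp; omega)]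
          simp
        rw [← h2]
        conv_lhs => rw [← List.take_append_drop i (V.take z)]
        rw [List.take_take, min_eq_left hi.le]
      rw [h1, List.append_assoc, List.append_cancel_left_eq, List.cons_append] at h
      rw [← h, cons_mem_bush, ← hVi i (by omega)] at hw
      exact hs i hw.1
    · have : i = ⟨z, by omega⟩ := Fin.ext hi
      rw [hi, List.append_cancel_left_eq] at h
      rwa [h, ← this]
    · exfalso
      have h1 : V.take i = V.take z ++ V[z] :: (V.take i).drop (z + 1) := by
        have h2 : (V.take i).drop z = V[z] :: (V.take i).drop (z + 1) := by
          rw [List.drop_eq_getElem_cons (by simp; omega)]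
          simp
        rw [← h2]
        conv_lhs => rw [← List.take_append_drop z (V.take i)]
        rw [List.take_take, min_eq_left hi.le]
      rw [h1, List.append_assoc, List.append_cancel_left_eq, List.cons_append,
        List.cons.injEq] at h
      exact ha (h.1.trans (hVi z hz).symm)
  · intro h
    refine ⟨⟨z, by omega⟩, a :: y, h, ?_⟩
    rw [backbone_eq_take s (by simp; omega), hV]

variable [NeZero M] {p : PMF ℕ} (hp : IsCritical p)

theorem ae_treeLaw_notMem (N m : ℕ) :
    ∀ᵐ s ∂treeLaw M p hp N m, ∀ i, (s i).1.1 ∉ (s i).1.2 := by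
  rw [ae_all_iff]
  intro i
  have h := (cond_absolutelyContinuous (s := diesOutBy (m - (i : ℕ)))).ae_le
    (ae_bushLaw_notMem (M := M) hp)
  exact (Measure.tendsto_eval_ae_ae (μ := fun i : Fin (N + 1) =>
    (bushLaw M p hp)[|diesOutBy (m - (i : ℕ))]) (i := i)).eventually h

/-- The probability that the tree has the backbone `V` and contains the vertices
`V.take z ++ a :: y` with `y ∈ L`. -/
theorem treeLaw_event {N z : ℕ} (hz : z < N) {V : List (Fin M)} (hV : V.length = N) {a : Fin M}
    (ha : a ≠ V[z]) : ∃ κ : ℝ≥0∞, ∀ L : Finset (List (Fin M)), L.Nonempty →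
      treeLaw M p hp N (2 * N) {s | backbone s N = V ∧ ∀ y ∈ L, V.take z ++ a :: y ∈ treeSet s}
        = κ * gwLaw M p (gwEvent (2 * N - z - 1) L) := by
  classical
  obtain ⟨κ, hκ⟩ := bushLaw_event hp V[z] a (2 * N - z - 1)
  set R : Finset (List (Fin M)) → Fin (N + 1) → Set (BushSample M) := fun L i =>
    if h : (i : ℕ) < N then
      (if (i : ℕ) = z then {b | b.1.1 = V[z] ∧ ∀ y ∈ L, a :: y ∈ bush b}
        else {b | b.1.1 = V[(i : ℕ)]})
    else Set.univ with hR
  set ζ : Fin (N + 1) := ⟨z, by omega⟩ with hζ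
  set μ : Fin (N + 1) → Measure (BushSample M) := fun i =>
    (bushLaw M p hp)[|diesOutBy (2 * N - (i : ℕ))] with hμ
  -- The constant collects the conditioning of the bush at `z` and the bushes at all other backbone
  -- vertices; none of them depends on `L`.
  refine ⟨(bushLaw M p hp (diesOutBy (2 * N - z)))⁻¹ * κ *
    ∏ i ∈ Finset.univ.erase ζ, μ i (R ∅ i), fun L hL => ?_⟩
  have h1 : treeLaw M p hp N (2 * N)
      {s | backbone s N = V ∧ ∀ y ∈ L, V.take z ++ a :: y ∈ treeSet s}
      = treeLaw M p hp N (2 * N) (Set.univ.pi (R L)) := by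
    refine measure_congr ?_
    filter_upwards [ae_treeLaw_notMem hp N (2 * N)] with s hs
    refine propext ?_
    change (backbone s N = V ∧ ∀ y ∈ L, V.take z ++ a :: y ∈ treeSet s) ↔ s ∈ Set.univ.pi (R L)
    simp only [Set.mem_pi, Set.mem_univ, forall_true_left]
    constructor
    · rintro ⟨h1, h2⟩ i
      have hVi := (backbone_eq_iff s hV).1 h1
      simp only [hR]
      split_ifs with h3 h4
      · have hi : i = ζ := Fin.ext h4
        rw [hi]
        refine ⟨hVi z hz, fun y hy => (mem_treeSet_iff hs hz h1 ?_ y).1 (h2 y hy)⟩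
        rwa [hVi z hz]
      · exact hVi i h3
      · trivial
    · intro h
      have h1 : backbone s N = V := by
        rw [backbone_eq_iff s hV]
        intro i hi
        have := h ⟨i, by omega⟩
        simp only [hR, hi, dite_true] at this
        split_ifs at this with h4
        · subst h4
          exact this.1
        · exact this
      refine ⟨h1, fun y hy => ?_⟩
      have h3 := h ζ
      simp only [hR, hζ, hz, dite_true, if_true] at h3
      refine (mem_treeSet_iff hs hz h1 ?_ y).2 (h3.2 y hy)
      rw [h3.1]
      exact ha
  have h2 : μ ζ (R L ζ) = (bushLaw M p hp (diesOutBy (2 * N - z)))⁻¹ *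
      (κ * gwLaw M p (gwEvent (2 * N - z - 1) L)) := by
    rw [← hκ L hL]
    simp only [hμ, hζ, hR, hz, dite_true, if_true]
    rw [cond_apply (measurableSet_diesOutBy _), show 2 * N - z - 1 + 1 = 2 * N - z by omega]
  have h3 : ∀ i ∈ Finset.univ.erase ζ, μ i (R L i) = μ i (R ∅ i) := by
    intro i hi
    have : (i : ℕ) ≠ z := fun h => (Finset.ne_of_mem_erase hi) (Fin.ext h)
    simp only [hR, this, if_false]
  rw [h1, treeLaw, Measure.pi_pi, ← Finset.mul_prod_erase Finset.univ _ (Finset.mem_univ ζ)]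
  change μ ζ (R L ζ) * ∏ i ∈ Finset.univ.erase ζ, μ i (R L i) = _
  rw [h2, Finset.prod_congr rfl h3]
  ring

end TreeLaw


/-! ### Locations as sums of displacements over edges. -/

section Locations

variable {M d : ℕ}

theorem edges_eq_image (v : List (Fin M)) :
    edges v = (Finset.range v.length).image fun j => v.take (j + 1) := by
  ext e
  simp only [mem_edges, Finset.mem_image, Finset.mem_range]
  constructor
  · rintro ⟨h0, h⟩
    have h1 := h.length_le
    have h2 : 0 < e.length := List.length_pos_iff.2 h0
    refine ⟨e.length - 1, by omega, ?_⟩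
    rw [show e.length - 1 + 1 = e.length by omega]
    exact (List.prefix_iff_eq_take.1 h).symm
  · rintro ⟨j, hj, rfl⟩
    refine ⟨?_, List.take_prefix _ _⟩
    intro h0
    have := congrArg List.length h0
    rw [List.length_take, List.length_nil] at this
    omega

theorem injOn_take_succ (v : List (Fin M)) :
    Set.InjOn (fun j => v.take (j + 1)) (Finset.range v.length : Set ℕ) := by
  intro i hi j hj hij
  simp only [Finset.coe_range, Set.mem_Iio] at hi hj
  have := congrArg List.length hij
  simp only [List.length_take] at this
  omega

theorem card_edges (v : List (Fin M)) : (edges v).card = v.length := by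
  rw [edges_eq_image, Finset.card_image_of_injOn (injOn_take_succ v), Finset.card_range]

theorem location_eq (x : Fin d → ℤ) (ξ : Displacements M d) (v : List (Fin M)) :
    location x ξ v = x + ∑ e ∈ edges v, ξ e := by
  rw [location, edges_eq_image, Finset.sum_image (injOn_take_succ v)]

theorem edges_subset {v w : List (Fin M)} (h : v <+: w) : edges v ⊆ edges w := by
  intro e he
  rw [mem_edges] at he ⊢
  exact ⟨he.1, he.2.trans h⟩

theorem edges_subset_prefixes {L : Finset (List (Fin M))} {v : List (Fin M)} (h : v ∈ L) :
    edges v ⊆ prefixes L :=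
  fun _ he => mem_prefixes.2 ⟨v, h, (mem_edges.1 he).2⟩

theorem card_edges_sdiff {v w : List (Fin M)} (h : v <+: w) :
    (edges w \ edges v).card = w.length - v.length := by
  rw [Finset.card_sdiff_of_subset (edges_subset h), card_edges, card_edges]

theorem location_sub (x : Fin d → ℤ) (ξ : Displacements M d) {v w : List (Fin M)} (h : v <+: w) :
    location x ξ w = location x ξ v + ∑ e ∈ edges w \ edges v, ξ e := by
  rw [location_eq, location_eq, ← Finset.sum_sdiff (edges_subset h)]
  abel

/-- As `L` is nonempty, the edges up to `Z` are already used, and beyond `Z` everything is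
translated. Displacement bounds can thus be read in the subtree where the tree probabilities are
computed. -/
theorem freshEdges_image_append (Z : List (Fin M)) {L : Finset (List (Fin M))} (hL : L.Nonempty)
    (y : List (Fin M)) :
    freshEdges (L.image (Z ++ ·)) (Z ++ y) = (freshEdges L y).image (Z ++ ·) := by
  ext e
  simp only [freshEdges, Finset.mem_sdiff, mem_edges, mem_prefixes, Finset.mem_image]
  constructor
  · rintro ⟨⟨h0, h1⟩, h2⟩
    rcases List.prefix_or_prefix_of_prefix h1 (List.prefix_append Z y) with h | ⟨f, rfl⟩
    · obtain ⟨w, hw⟩ := hL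
      exact absurd ⟨Z ++ w, ⟨w, hw, rfl⟩, h.trans (List.prefix_append _ _)⟩ h2
    · have hf := (List.prefix_append_right_inj Z).1 h1
      refine ⟨f, ⟨⟨?_, hf⟩, ?_⟩, rfl⟩
      · rintro rfl
        obtain ⟨w, hw⟩ := hL
        exact h2 ⟨Z ++ w, ⟨w, hw, rfl⟩, by simp⟩
      · rintro ⟨w, hw, hfw⟩
        exact h2 ⟨Z ++ w, ⟨w, hw, rfl⟩, by simpa using hfw⟩
  · rintro ⟨f, ⟨⟨h0, h1⟩, h2⟩, rfl⟩
    refine ⟨⟨by simp [h0], by simpa using h1⟩, ?_⟩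
    rintro ⟨_, ⟨w, hw, rfl⟩, h⟩
    exact h2 ⟨w, hw, by simpa using h⟩

theorem card_freshEdges_image_append (Z : List (Fin M)) {L : Finset (List (Fin M))}
    (hL : L.Nonempty) (y : List (Fin M)) :
    (freshEdges (L.image (Z ++ ·)) (Z ++ y)).card = (freshEdges L y).card := by
  rw [freshEdges_image_append Z hL, Finset.card_image_of_injective]
  exact List.append_right_injective Z

end Locations

/-! ### Events depending on finitely many displacements. -/

section Restriction

variable {ι : Type*} {d : ℕ}

/-- The displacements in `F`, extended by `0`. -/
noncomputable def extendZero (F : Finset ι) (β : F → Fin d → ℤ) : ι → Fin d → ℤ := by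
  classical exact fun e => if h : e ∈ F then β ⟨e, h⟩ else 0

/-- Whatever depends on finitely many edges factors through a countable space, the setting of
`meet_le` and `displacement_lower`. -/
theorem extendZero_restrict {B : Type*} {F : Finset ι} {f : (ι → Fin d → ℤ) → B}
    (hf : DependsOn f (F : Set ι)) (ξ : ι → Fin d → ℤ) :
    f (extendZero F fun e => ξ e) = f ξ := by
  refine hf fun e he => ?_
  rw [extendZero, dif_pos (Finset.mem_coe.1 he)]

theorem indepOf_restrict {E : Type*} {F S : Finset ι} (h : Disjoint S F) :
    IndepOf S fun (ξ : ι → E) (e : F) => ξ e :=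
  fun _ _ hξ => funext fun e => hξ e fun he => Finset.disjoint_left.1 h he e.2

theorem measurable_restrict_disp (F : Finset ι) :
    Measurable fun (ξ : ι → Fin d → ℤ) (e : F) => ξ e :=
  measurable_pi_iff.2 fun e => measurable_pi_apply (e : ι)

theorem meet_le_of_dependsOn [DecidableEq ι] {P : PMF (Fin d → ℤ)} (hs : ∀ x, P x = P (-x))
    {F S T : Finset ι} (hST : Disjoint S T) (hSF : Disjoint S F) (hTF : Disjoint T F)
    {R : (ι → Fin d → ℤ) → Prop} (hR : DependsOn R (F : Set ι))
    {c c' : (ι → Fin d → ℤ) → Fin d → ℤ} (hc : DependsOn c (F : Set ι))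
    (hc' : DependsOn c' (F : Set ι)) :
    dispLaw ι P {ξ | R ξ ∧ c ξ + ∑ e ∈ S, ξ e = c' ξ + ∑ e ∈ T, ξ e}
      ≤ maxProb P (S.card + T.card) * dispLaw ι P {ξ | R ξ} := by
  have h := meet_le hs hST (measurable_restrict_disp F)
    ((indepOf_restrict hSF).union (indepOf_restrict hTF))
    {β | R (extendZero F β)} (fun β => c (extendZero F β)) fun β => c' (extendZero F β)
  simpa only [Set.mem_ofPred_eq, extendZero_restrict hR, extendZero_restrict hc,
    extendZero_restrict hc'] using h

end Restriction

/-! ### Meetings of vertices of the two trees. -/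

section PathPairs

variable {M d : ℕ}

/-- The edges of a pair of trees. -/
abbrev EdgePair (M : ℕ) : Type := List (Fin M) ⊕ List (Fin M)

/-- Locations in the first tree. -/
def locFst (ξ : EdgePair M → Fin d → ℤ) (v : List (Fin M)) : Fin d → ℤ :=
  location 0 (fun e => ξ (Sum.inl e)) v

/-- Locations in the second tree, with root at `x`. -/
def locSnd (x : Fin d → ℤ) (ξ : EdgePair M → Fin d → ℤ) (v : List (Fin M)) : Fin d → ℤ :=
  location x (fun e => ξ (Sum.inr e)) v

/-- Edges in the first tree. -/
def toFst (S : Finset (List (Fin M))) : Finset (EdgePair M) := S.map Function.Embedding.inl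

/-- Edges in the second tree. -/
def toSnd (S : Finset (List (Fin M))) : Finset (EdgePair M) := S.map Function.Embedding.inr

theorem disjoint_toFst_toSnd (S T : Finset (List (Fin M))) : Disjoint (toFst S) (toSnd T) :=
  Finset.disjoint_map_inl_map_inr S T

theorem disjoint_toFst {S T : Finset (List (Fin M))} (h : Disjoint S T) :
    Disjoint (toFst S) (toFst T) :=
  (Finset.disjoint_map _).2 h

theorem disjoint_toSnd {S T : Finset (List (Fin M))} (h : Disjoint S T) :
    Disjoint (toSnd S) (toSnd T) :=
  (Finset.disjoint_map _).2 h

theorem dependsOn_locFst {v : List (Fin M)} {F : Finset (EdgePair M)} (h : toFst (edges v) ⊆ F) :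
    DependsOn (fun ξ : EdgePair M → Fin d → ℤ => locFst ξ v) (F : Set (EdgePair M)) := by
  intro ξ ξ' hξ
  simp only [locFst, location_eq]
  congr 1
  exact Finset.sum_congr rfl fun e he => hξ _ (h (Finset.mem_map_of_mem Function.Embedding.inl he))

theorem dependsOn_locSnd (x : Fin d → ℤ) {v : List (Fin M)} {F : Finset (EdgePair M)}
    (h : toSnd (edges v) ⊆ F) :
    DependsOn (fun ξ : EdgePair M → Fin d → ℤ => locSnd x ξ v) (F : Set (EdgePair M)) := by
  intro ξ ξ' hξ
  simp only [locSnd, location_eq]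
  congr 1
  exact Finset.sum_congr rfl fun e he => hξ _ (h (Finset.mem_map_of_mem Function.Embedding.inr he))

/-- The edges on the way to the vertices in `L₁` and `L₂`. -/
def pairPrefixes (L₁ L₂ : Finset (List (Fin M))) : Finset (EdgePair M) :=
  toFst (prefixes L₁) ∪ toSnd (prefixes L₂)

theorem toFst_edges_subset {L₁ L₂ : Finset (List (Fin M))} {v : List (Fin M)} (h : v ∈ L₁) :
    toFst (edges v) ⊆ pairPrefixes L₁ L₂ :=
  (Finset.map_subset_map.2 (edges_subset_prefixes h)).trans Finset.subset_union_left

theorem toSnd_edges_subset {L₁ L₂ : Finset (List (Fin M))} {v : List (Fin M)} (h : v ∈ L₂) :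
    toSnd (edges v) ⊆ pairPrefixes L₁ L₂ :=
  (Finset.map_subset_map.2 (edges_subset_prefixes h)).trans Finset.subset_union_right

/-- Two further vertices are at the same location with probability at most the maximal transition
probability for the number of new edges. -/
theorem meet_paths_le {P : PMF (Fin d → ℤ)} (hs : ∀ x, P x = P (-x)) (x : Fin d → ℤ)
    (L₁ L₂ : Finset (List (Fin M))) {R : (EdgePair M → Fin d → ℤ) → Prop}
    (hR : DependsOn R (pairPrefixes L₁ L₂ : Set (EdgePair M))) (Y₁ Y₂ : List (Fin M)) :
    dispLaw (EdgePair M) P {ξ | R ξ ∧ locFst ξ Y₁ = locSnd x ξ Y₂}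
      ≤ maxProb P ((freshEdges L₁ Y₁).card + (freshEdges L₂ Y₂).card)
        * dispLaw (EdgePair M) P {ξ | R ξ} := by
  classical
  have d₁ : Disjoint (freshEdges L₁ Y₁) (prefixes L₁) := Finset.sdiff_disjoint
  have d₂ : Disjoint (freshEdges L₂ Y₂) (prefixes L₂) := Finset.sdiff_disjoint
  -- The parts of both paths inside the spanned subtrees belong to the past; only the edges outside
  -- are fresh.
  have h := meet_le_of_dependsOn hs (F := pairPrefixes L₁ L₂) (S := toFst (freshEdges L₁ Y₁))
    (T := toSnd (freshEdges L₂ Y₂)) (disjoint_toFst_toSnd _ _)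
    (Finset.disjoint_union_right.2 ⟨disjoint_toFst d₁, disjoint_toFst_toSnd _ _⟩)
    (Finset.disjoint_union_right.2 ⟨(disjoint_toFst_toSnd _ _).symm, disjoint_toSnd d₂⟩) hR
    (c := fun ξ => ∑ e ∈ edges Y₁ ∩ prefixes L₁, ξ (Sum.inl e))
    (c' := fun ξ => x + ∑ e ∈ edges Y₂ ∩ prefixes L₂, ξ (Sum.inr e))
    (fun ξ ξ' hξ => Finset.sum_congr rfl fun e he => hξ _ (Finset.mem_union_left _
      (Finset.mem_map_of_mem Function.Embedding.inl (Finset.mem_inter.1 he).2)))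
    (fun ξ ξ' hξ => congrArg (x + ·) <| Finset.sum_congr rfl fun e he => hξ _
      (Finset.mem_union_right _
        (Finset.mem_map_of_mem Function.Embedding.inr (Finset.mem_inter.1 he).2)))
  have h1 : ∀ ξ : EdgePair M → Fin d → ℤ, ∑ e ∈ edges Y₁ ∩ prefixes L₁, ξ (Sum.inl e)
      + ∑ e ∈ toFst (freshEdges L₁ Y₁), ξ e = locFst ξ Y₁ := by
    intro ξ
    rw [toFst, Finset.sum_map, locFst, location_eq, zero_add, freshEdges]
    exact Finset.sum_inter_add_sum_sdiff _ _ _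
  have h2 : ∀ ξ : EdgePair M → Fin d → ℤ, x + ∑ e ∈ edges Y₂ ∩ prefixes L₂, ξ (Sum.inr e)
      + ∑ e ∈ toSnd (freshEdges L₂ Y₂), ξ e = locSnd x ξ Y₂ := by
    intro ξ
    rw [toSnd, Finset.sum_map, locSnd, location_eq, freshEdges, add_assoc]
    exact congrArg (x + ·) (Finset.sum_inter_add_sum_sdiff _ _ _)
  simp only [h1, h2] at h
  simpa only [toFst, toSnd, Finset.card_map] using h

/-- Beyond the fork every edge towards `Y` starts with a wrong letter for `U`, and no edge beyond
`Z⁺` leads to `Z⁺`. These are the disjointness requirements of `displacement_lower`. -/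
theorem fork_edges {Zp U Y : List (Fin M)} {r : ℕ} (hZU : Zp <+: U) (hr : Zp.length ≤ r)
    (hrU : r < U.length) (hY' : ¬ U.take (r + 1) <+: Y) :
    Zp <+: U.take r ∧
    Disjoint (edges U \ edges Zp) (edges Y \ edges (U.take r)) ∧
    Disjoint (edges U \ edges Zp) (prefixes {Zp}) ∧
    Disjoint (edges Y \ edges (U.take r)) (prefixes {Zp}) := by
  have h0 : Zp <+: U.take r := by
    refine List.prefix_of_prefix_length_le hZU (List.take_prefix _ _) ?_
    rw [List.length_take]
    omega
  refine ⟨h0, ?_, ?_, ?_⟩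
  · rw [Finset.disjoint_left]
    intro e he he'
    simp only [Finset.mem_sdiff, mem_edges, not_and] at he he'
    refine hY' (List.IsPrefix.trans ?_ he'.1.2)
    refine List.prefix_of_prefix_length_le (List.take_prefix _ _) he.1.2 ?_
    by_contra h
    refine he'.2 he.1.1 (List.prefix_of_prefix_length_le he.1.2 (List.take_prefix _ _) ?_)
    rw [List.length_take] at h ⊢
    omega
  · rw [Finset.disjoint_left]
    intro e he he'
    simp only [Finset.mem_sdiff, mem_edges, not_and, mem_prefixes, Finset.mem_singleton,
      exists_eq_left] at he he'
    exact he.2 he.1.1 he'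
  · rw [Finset.disjoint_left]
    intro e he he'
    simp only [Finset.mem_sdiff, mem_edges, not_and, mem_prefixes, Finset.mem_singleton,
      exists_eq_left] at he he'
    exact he.2 he.1.1 (he'.trans h0)

/-- Given that `U₁` and `U₂` are at the same location, so are two vertices which branch off shortly
before, at the expected cost. -/
theorem IsAdmissibleStep.paths_lower {P : PMF (Fin 6 → ℤ)}
    (hP : IsAdmissibleStep P) {n₀ : ℕ}
    (h₁ : IsUpperThreshold P n₀) (h₂ : IsLocalThreshold P (1 / 2) 1 n₀)
    (h₆ : IsLocalThreshold P (1 / 2) 6 n₀) {β₁ β₂ a₁ a₂ t : ℕ} (ha₁ : 0 < a₁)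
    (hn : n₀ ≤ a₁) (ha : a₁ ≤ a₂) (hβ₁ : 100 * a₁ ≤ β₁) (hβ₂ : 100 * a₂ ≤ β₂)
    {U₁ U₂ Z₁ Z₂ Y₁ Y₂ : List (Fin M)} (hZ₁ : Z₁ <+: U₁) (hZ₂ : Z₂ <+: U₂)
    (hU₁ : U₁.length = Z₁.length + β₁ + a₁) (hU₂ : U₂.length = Z₂.length + β₂ + a₂)
    (hY₁ : U₁.take (Z₁.length + β₁) <+: Y₁) (hY₁' : ¬ U₁.take (Z₁.length + β₁ + 1) <+: Y₁)
    (hY₂ : U₂.take (Z₂.length + β₂) <+: Y₂) (hY₂' : ¬ U₂.take (Z₂.length + β₂ + 1) <+: Y₂)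
    (hY₁l : Y₁.length = U₁.length + t) (hY₂l : Y₂.length = U₂.length + t)
    (x : Fin 6 → ℤ) {R : (EdgePair M → Fin 6 → ℤ) → Prop}
    (hR : DependsOn R (pairPrefixes {Z₁} {Z₂} : Set (EdgePair M))) {ρ₁ ρ₂ : ℝ}
    (hρ₁ : 1 / 2 * √((β₁ + a₁ : ℕ) : ℝ) + 4 * √((a₁ + t : ℕ) : ℝ) ≤ ρ₁)
    (hρ₂ : 1 / 2 * √((β₂ + a₂ : ℕ) : ℝ) + 4 * √((a₁ + t : ℕ) : ℝ) ≤ ρ₂) :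
    ENNReal.ofReal (spatialConst / (scaleD P ^ 6 * ((a₂ + t : ℕ) : ℝ) ^ 3)) *
        dispLaw (EdgePair M) P {ξ | R ξ ∧ locFst ξ U₁ = locSnd x ξ U₂ ∧
          wnorm P (locFst ξ U₁ - locFst ξ Z₁) ≤ 1 / 2 * √((β₁ + a₁ : ℕ) : ℝ) ∧
          wnorm P (locSnd x ξ U₂ - locSnd x ξ Z₂) ≤ 1 / 2 * √((β₂ + a₂ : ℕ) : ℝ)}
      ≤ dispLaw (EdgePair M) P {ξ | (R ξ ∧ locFst ξ U₁ = locSnd x ξ U₂ ∧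
          wnorm P (locFst ξ U₁ - locFst ξ Z₁) ≤ 1 / 2 * √((β₁ + a₁ : ℕ) : ℝ) ∧
          wnorm P (locSnd x ξ U₂ - locSnd x ξ Z₂) ≤ 1 / 2 * √((β₂ + a₂ : ℕ) : ℝ)) ∧
          locFst ξ Y₁ = locSnd x ξ Y₂ ∧ wnorm P (locFst ξ Y₁ - locFst ξ Z₁) ≤ ρ₁ ∧
          wnorm P (locSnd x ξ Y₂ - locSnd x ξ Z₂) ≤ ρ₂} := by
  classical
  -- The forks: from here on the old ends, of `a₁` and `a₂` edges, are replaced by the new branches.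
  set W₁ := U₁.take (Z₁.length + β₁) with hW₁
  set W₂ := U₂.take (Z₂.length + β₂) with hW₂
  have hW₁l : W₁.length = Z₁.length + β₁ := by rw [hW₁, List.length_take]; omega
  have hW₂l : W₂.length = Z₂.length + β₂ := by rw [hW₂, List.length_take]; omega
  have ha₂ : 0 < a₂ := by omega
  obtain ⟨f₁, g₁, i₁, j₁⟩ := fork_edges hZ₁ (show Z₁.length ≤ Z₁.length + β₁ by omega)
    (by omega) hY₁'
  obtain ⟨f₂, g₂, i₂, j₂⟩ := fork_edges hZ₂ (show Z₂.length ≤ Z₂.length + β₂ by omega)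
    (by omega) hY₂'
  rw [← hW₁] at f₁ g₁ j₁
  rw [← hW₂] at f₂ g₂ j₂
  have hWU₁ : W₁ <+: U₁ := List.take_prefix _ _
  have hWU₂ : W₂ <+: U₂ := List.take_prefix _ _
  have hF₁ : ∀ S, Disjoint S (prefixes {Z₁}) → Disjoint (toFst S) (pairPrefixes {Z₁} {Z₂}) :=
    fun S h => Finset.disjoint_union_right.2 ⟨disjoint_toFst h, disjoint_toFst_toSnd _ _⟩
  have hF₂ : ∀ S, Disjoint S (prefixes {Z₂}) → Disjoint (toSnd S) (pairPrefixes {Z₁} {Z₂}) :=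
    fun S h => Finset.disjoint_union_right.2 ⟨(disjoint_toFst_toSnd _ _).symm, disjoint_toSnd h⟩
  have hsd₁ : toFst (edges U₁ \ edges Z₁) \ toFst (edges U₁ \ edges W₁)
      = toFst (edges W₁ \ edges Z₁) := by
    rw [toFst, toFst, toFst, ← Finset.map_sdiff]
    congr 1
    ext e
    have h1 : e ∈ edges Z₁ → e ∈ edges W₁ := fun h => edges_subset f₁ h
    have h2 : e ∈ edges W₁ → e ∈ edges U₁ := fun h => edges_subset hWU₁ h
    simp only [Finset.mem_sdiff]
    tauto
  have hsd₂ : toSnd (edges U₂ \ edges Z₂) \ toSnd (edges U₂ \ edges W₂)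
      = toSnd (edges W₂ \ edges Z₂) := by
    rw [toSnd, toSnd, toSnd, ← Finset.map_sdiff]
    congr 1
    ext e
    have h1 : e ∈ edges Z₂ → e ∈ edges W₂ := fun h => edges_subset f₂ h
    have h2 : e ∈ edges W₂ → e ∈ edges U₂ := fun h => edges_subset hWU₂ h
    simp only [Finset.mem_sdiff]
    tauto
  have sum₁ : ∀ (S : Finset (List (Fin M))) (ξ : EdgePair M → Fin 6 → ℤ),
      ∑ e ∈ toFst S, ξ e = ∑ e ∈ S, ξ (Sum.inl e) := fun S ξ => Finset.sum_map _ _ _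
  have sum₂ : ∀ (S : Finset (List (Fin M))) (ξ : EdgePair M → Fin 6 → ℤ),
      ∑ e ∈ toSnd S, ξ e = ∑ e ∈ S, ξ (Sum.inr e) := fun S ξ => Finset.sum_map _ _ _
  have h := hP.displacement_lower h₁ h₂ h₆ (t := t) ha₁ hn ha hβ₁ hβ₂
    (S₁ := toFst (edges U₁ \ edges Z₁)) (s₁ := toFst (edges U₁ \ edges W₁))
    (S₂ := toSnd (edges U₂ \ edges Z₂)) (s₂ := toSnd (edges U₂ \ edges W₂))
    (T₁ := toFst (edges Y₁ \ edges W₁)) (T₂ := toSnd (edges Y₂ \ edges W₂))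
    (Finset.map_subset_map.2 (Finset.sdiff_subset_sdiff le_rfl (edges_subset f₁)))
    (Finset.map_subset_map.2 (Finset.sdiff_subset_sdiff le_rfl (edges_subset f₂)))
    (by rw [toFst, Finset.card_map, card_edges_sdiff hZ₁]; omega)
    (by rw [toSnd, Finset.card_map, card_edges_sdiff hZ₂]; omega)
    (by rw [toFst, Finset.card_map, card_edges_sdiff hWU₁]; omega)
    (by rw [toSnd, Finset.card_map, card_edges_sdiff hWU₂]; omega)
    (by rw [toFst, Finset.card_map, card_edges_sdiff hY₁]; omega)
    (by rw [toSnd, Finset.card_map, card_edges_sdiff hY₂]; omega)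
    (disjoint_toFst_toSnd _ _) (disjoint_toFst g₁) (disjoint_toFst_toSnd _ _)
    (disjoint_toFst_toSnd _ _).symm (disjoint_toSnd g₂) (disjoint_toFst_toSnd _ _)
    (measurable_restrict_disp (pairPrefixes {Z₁} {Z₂})) (indepOf_restrict (hF₁ _ i₁))
    (indepOf_restrict (hF₂ _ i₂)) (indepOf_restrict (hF₁ _ j₁)) (indepOf_restrict (hF₂ _ j₂))
    {β | R (extendZero _ β)} (fun β => locFst (extendZero _ β) Z₁)
    (fun β => locSnd x (extendZero _ β) Z₂) hρ₁ hρ₂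
  have e₁ : ∀ ξ : EdgePair M → Fin 6 → ℤ, ∑ e ∈ toFst (edges U₁ \ edges Z₁), ξ e
      = locFst ξ U₁ - locFst ξ Z₁ := fun ξ => by
    rw [sum₁, locFst, locFst, location_sub _ _ hZ₁, add_sub_cancel_left]
  have e₂ : ∀ ξ : EdgePair M → Fin 6 → ℤ, ∑ e ∈ toSnd (edges U₂ \ edges Z₂), ξ e
      = locSnd x ξ U₂ - locSnd x ξ Z₂ := fun ξ => by
    rw [sum₂, locSnd, locSnd, location_sub _ _ hZ₂, add_sub_cancel_left]
  have e₃ : ∀ ξ : EdgePair M → Fin 6 → ℤ, ∑ e ∈ toFst (edges W₁ \ edges Z₁), ξ e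
      + ∑ e ∈ toFst (edges Y₁ \ edges W₁), ξ e = locFst ξ Y₁ - locFst ξ Z₁ := fun ξ => by
    rw [sum₁, sum₁, locFst, locFst, location_sub _ _ hY₁, location_sub _ _ f₁]
    abel
  have e₄ : ∀ ξ : EdgePair M → Fin 6 → ℤ, ∑ e ∈ toSnd (edges W₂ \ edges Z₂), ξ e
      + ∑ e ∈ toSnd (edges Y₂ \ edges W₂), ξ e = locSnd x ξ Y₂ - locSnd x ξ Z₂ := fun ξ => by
    rw [sum₂, sum₂, locSnd, locSnd, location_sub _ _ hY₂, location_sub _ _ f₂]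
    abel
  have r₁ := fun ξ => extendZero_restrict (dependsOn_locFst (d := 6)
    (toFst_edges_subset (L₂ := {Z₂}) (Finset.mem_singleton_self Z₁))) ξ
  have r₂ := fun ξ => extendZero_restrict (dependsOn_locSnd (d := 6) x
    (toSnd_edges_subset (L₁ := {Z₁}) (Finset.mem_singleton_self Z₂))) ξ
  simpa only [Set.mem_ofPred_eq, extendZero_restrict hR, r₁, r₂, hsd₁, hsd₂, e₁, e₂, e₃, e₄,
    add_sub_cancel] using h

end PathPairs


/-! ### Sums of the kernel `n⁻³`. -/

section Sums

/-- Comparison with a telescoping sum. -/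
theorem sum_inv_cube_le (s n : ℕ) :
    ∑ j ∈ Finset.range n, 1 / ((s + j : ℕ) + 1 : ℝ) ^ 3 ≤ 2 / ((s : ℝ) + 1) ^ 2 := by
  have key : ∀ n : ℕ, ∑ j ∈ Finset.range n, 1 / ((s + j : ℕ) + 1 : ℝ) ^ 3
      ≤ 2 / ((s : ℝ) + 1) ^ 2 - 2 / ((s + n : ℕ) + 1 : ℝ) ^ 2 := by
    intro n
    induction n with
    | zero => simp
    | succ n ih =>
      rw [Finset.sum_range_succ]
      have h : 1 / ((s + n : ℕ) + 1 : ℝ) ^ 3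
          ≤ 2 / ((s + n : ℕ) + 1 : ℝ) ^ 2 - 2 / ((s + (n + 1) : ℕ) + 1 : ℝ) ^ 2 := by
        have h0 : (0 : ℝ) ≤ ((s + n : ℕ) : ℝ) := by positivity
        rw [show ((s + (n + 1) : ℕ) : ℝ) = ((s + n : ℕ) : ℝ) + 1 by push_cast; ring]
        generalize ((s + n : ℕ) : ℝ) = m at *
        rw [div_sub_div _ _ (by positivity) (by positivity), div_le_div_iff₀ (by positivity)
          (by positivity)]
        nlinarith [pow_nonneg h0 3, pow_nonneg h0 2, pow_nonneg h0 4, pow_nonneg h0 5]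
      linarith
  refine (key n).trans ?_
  have : 0 ≤ 2 / ((s + n : ℕ) + 1 : ℝ) ^ 2 := by positivity
  linarith

theorem sum_inv_sq_le (s n : ℕ) :
    ∑ j ∈ Finset.range n, 2 / ((s + j : ℕ) + 1 : ℝ) ^ 2 ≤ 4 / ((s : ℝ) + 1) := by
  have key : ∀ n : ℕ, ∑ j ∈ Finset.range n, 2 / ((s + j : ℕ) + 1 : ℝ) ^ 2
      ≤ 4 / ((s : ℝ) + 1) - 4 / ((s + n : ℕ) + 1 : ℝ) := by
    intro n
    induction n with
    | zero => simp
    | succ n ih =>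
      rw [Finset.sum_range_succ]
      have h : 2 / ((s + n : ℕ) + 1 : ℝ) ^ 2
          ≤ 4 / ((s + n : ℕ) + 1 : ℝ) - 4 / ((s + (n + 1) : ℕ) + 1 : ℝ) := by
        have h0 : (0 : ℝ) ≤ ((s + n : ℕ) : ℝ) := by positivity
        rw [show ((s + (n + 1) : ℕ) : ℝ) = ((s + n : ℕ) : ℝ) + 1 by push_cast; ring]
        generalize ((s + n : ℕ) : ℝ) = m at *
        rw [div_sub_div _ _ (by positivity) (by positivity), div_le_div_iff₀ (by positivity)
          (by positivity)]
        nlinarith [pow_nonneg h0 3, pow_nonneg h0 2]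
      linarith
  refine (key n).trans ?_
  have : 0 ≤ 4 / ((s + n : ℕ) + 1 : ℝ) := by positivity
  linarith

theorem sum_inv_le_log (n : ℕ) :
    ∑ k ∈ Finset.range n, 4 / ((k : ℝ) + 1) ≤ 4 * (1 + Real.log n) := by
  have h := harmonic_le_one_add_log n
  rw [harmonic] at h
  push_cast at h
  simp_rw [div_eq_mul_inv, ← Finset.mul_sum]
  linarith

theorem sum_ite_lt_le (ν n : ℕ) :
    ∑ j ∈ Finset.range n, (if j < ν then (1 : ℝ) else 0) ≤ ν := by
  rw [Finset.sum_ite, Finset.sum_const_zero, add_zero, Finset.sum_const, nsmul_eq_mul, mul_one]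
  have : ((Finset.range n).filter (· < ν)).card ≤ ν := by
    refine (Finset.card_le_card (t := Finset.range ν) fun x hx => ?_).trans (by simp)
    simpa using (Finset.mem_filter.1 hx).2
  exact_mod_cast this

/-- A majorant of the maximal transition probabilities. -/
noncomputable def kernelMajorant (ν : ℕ) (K : ℝ) (n : ℕ) : ℝ :=
  (if n < ν then 1 else 0) + 8 * K * (1 / ((n : ℝ) + 1) ^ 3)

theorem kernelMajorant_nonneg (ν : ℕ) {K : ℝ} (hK : 0 ≤ K) (n : ℕ) : 0 ≤ kernelMajorant ν K n := by
  unfold kernelMajorant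
  split_ifs <;> positivity

theorem IsAdmissibleStep.maxProb_le_majorant {P : PMF (Fin 6 → ℤ)} (hP : IsAdmissibleStep P)
    {nstar : ℕ} (hns : leastNStar P ≤ nstar) (n : ℕ) :
    maxProb P n ≤ ENNReal.ofReal (kernelMajorant nstar (1 / scaleD P ^ 6) n) := by
  have hD := hP.scaleD_pos
  by_cases hn : n < nstar
  · refine (maxProb_le_one P n).trans ?_
    rw [← ENNReal.ofReal_one]
    refine ENNReal.ofReal_le_ofReal ?_
    rw [kernelMajorant, if_pos hn]
    have : 0 ≤ 8 * (1 / scaleD P ^ 6) * (1 / ((n : ℝ) + 1) ^ 3) := by positivity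
    linarith
  · have hn' : nstar ≤ n := not_lt.1 hn
    refine (hP.maxProb_le hns hn').trans (ENNReal.ofReal_le_ofReal ?_)
    rw [kernelMajorant, if_neg hn, zero_add]
    have h0 : 0 < n := (hP.nStar_pos (by norm_num) hns).trans_le hn'
    have h1 : (1 : ℝ) ≤ n := by exact_mod_cast h0
    rw [show 8 * (1 / scaleD P ^ 6) * (1 / ((n : ℝ) + 1) ^ 3)
      = 8 / (scaleD P ^ 6 * ((n : ℝ) + 1) ^ 3) by field_simp]
    rw [div_le_div_iff₀ (by positivity) (by positivity), one_mul]
    have h2 : ((n : ℝ) + 1) ^ 3 ≤ (2 * n) ^ 3 := by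
      gcongr
      linarith
    calc scaleD P ^ 6 * ((n : ℝ) + 1) ^ 3 ≤ scaleD P ^ 6 * (2 * n) ^ 3 := by gcongr
      _ = _ := by ring

theorem sum_majorant_one_le (ν : ℕ) {K : ℝ} (hK : 0 ≤ K) (n : ℕ) :
    ∑ k ∈ Finset.range n, kernelMajorant ν K (2 * k) ≤ ν + 32 * K := by
  simp_rw [kernelMajorant, Finset.sum_add_distrib, ← Finset.mul_sum]
  have h1 : ∑ k ∈ Finset.range n, (if 2 * k < ν then (1 : ℝ) else 0) ≤ ν := by
    refine le_trans (Finset.sum_le_sum fun k _ => ?_) (sum_ite_lt_le ν n)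
    split_ifs <;> first | omega | norm_num
  have h2 : ∑ k ∈ Finset.range n, 1 / (((2 * k : ℕ) : ℝ) + 1) ^ 3 ≤ 2 := by
    refine le_trans (Finset.sum_le_sum fun k _ => ?_) ((sum_inv_cube_le 0 n).trans ?_)
    · rw [zero_add]
      gcongr
      omega
    · norm_num
  nlinarith

theorem sum_majorant_two_le (ν : ℕ) {K : ℝ} (hK : 0 ≤ K) (n n' : ℕ) :
    ∑ k ∈ Finset.range n, ∑ i ∈ Finset.range n', kernelMajorant ν K (2 * k + i)
      ≤ ν ^ 2 + 32 * K := by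
  simp_rw [kernelMajorant, Finset.sum_add_distrib, ← Finset.mul_sum]
  have h1 : ∑ k ∈ Finset.range n, ∑ i ∈ Finset.range n',
      (if 2 * k + i < ν then (1 : ℝ) else 0) ≤ ν ^ 2 := by
    calc _ ≤ ∑ k ∈ Finset.range n, ∑ i ∈ Finset.range n',
          (if k < ν then (1 : ℝ) else 0) * (if i < ν then (1 : ℝ) else 0) := by
          refine Finset.sum_le_sum fun k _ => Finset.sum_le_sum fun i _ => ?_
          split_ifs <;> first | omega | norm_num
      _ ≤ _ := by
          rw [← Finset.sum_mul_sum, sq]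
          exact mul_le_mul (sum_ite_lt_le ν n) (sum_ite_lt_le ν n')
            (Finset.sum_nonneg fun _ _ => by split_ifs <;> norm_num) (by positivity)
  have h2 : ∑ k ∈ Finset.range n, ∑ i ∈ Finset.range n',
      1 / (((2 * k + i : ℕ) : ℝ) + 1) ^ 3 ≤ 4 := by
    refine le_trans (Finset.sum_le_sum fun k _ => (sum_inv_cube_le (2 * k) n').trans ?_)
      ((sum_inv_sq_le 0 n).trans ?_)
    · rw [zero_add]
      gcongr
      omega
    · norm_num
  nlinarith

/-- Two summations turn the cube into a harmonic term, the third into a logarithm; with an index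
fewer, as at exceptional vertices, the sum is bounded. Times below `ν`, where only the trivial bound
is available, contribute a constant. -/
theorem sum_majorant_three_le (ν : ℕ) {K : ℝ} (hK : 0 ≤ K) (n n' n'' : ℕ) :
    ∑ k ∈ Finset.range n, ∑ i ∈ Finset.range n', ∑ j ∈ Finset.range n'',
      kernelMajorant ν K (2 * k + i + j) ≤ ν ^ 3 + 32 * K * (1 + Real.log n) := by
  simp_rw [kernelMajorant, Finset.sum_add_distrib, ← Finset.mul_sum]
  have h1 : ∑ k ∈ Finset.range n, ∑ i ∈ Finset.range n', ∑ j ∈ Finset.range n'',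
      (if 2 * k + i + j < ν then (1 : ℝ) else 0) ≤ ν ^ 3 := by
    calc _ ≤ ∑ k ∈ Finset.range n, ∑ i ∈ Finset.range n', ∑ j ∈ Finset.range n'',
          (if k < ν then (1 : ℝ) else 0) * ((if i < ν then (1 : ℝ) else 0) *
            (if j < ν then (1 : ℝ) else 0)) := by
          refine Finset.sum_le_sum fun k _ => Finset.sum_le_sum fun i _ =>
            Finset.sum_le_sum fun j _ => ?_
          split_ifs <;> first | omega | norm_num
      _ = (∑ k ∈ Finset.range n, (if k < ν then (1 : ℝ) else 0)) *
          ((∑ i ∈ Finset.range n', (if i < ν then (1 : ℝ) else 0)) *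
            ∑ j ∈ Finset.range n'', (if j < ν then (1 : ℝ) else 0)) := by
          simp_rw [← Finset.mul_sum, ← Finset.sum_mul]
      _ ≤ ν * (ν * ν) := by
          have p : ∀ m : ℕ, 0 ≤ ∑ k ∈ Finset.range m, (if k < ν then (1 : ℝ) else 0) := fun m =>
            Finset.sum_nonneg fun _ _ => by split_ifs <;> norm_num
          exact mul_le_mul (sum_ite_lt_le ν n) (mul_le_mul (sum_ite_lt_le ν n')
            (sum_ite_lt_le ν n'') (p _) (by positivity)) (mul_nonneg (p _) (p _)) (by positivity)
      _ = _ := by ring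
  have h2 : ∑ k ∈ Finset.range n, ∑ i ∈ Finset.range n', ∑ j ∈ Finset.range n'',
      1 / (((2 * k + i + j : ℕ) : ℝ) + 1) ^ 3 ≤ 4 * (1 + Real.log n) := by
    refine le_trans (Finset.sum_le_sum fun k _ => ?_) (sum_inv_le_log n)
    refine (Finset.sum_le_sum fun i _ => sum_inv_cube_le (2 * k + i) n'').trans ?_
    refine (sum_inv_sq_le (2 * k) n').trans ?_
    gcongr
    omega
  nlinarith

theorem IsAdmissibleStep.sum_maxProb_one_le {P : PMF (Fin 6 → ℤ)} (hP : IsAdmissibleStep P)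
    {nstar : ℕ} (hns : leastNStar P ≤ nstar) (n : ℕ) :
    ∑ k ∈ Finset.range n, maxProb P (2 * k)
      ≤ ENNReal.ofReal (nstar + 32 * (1 / scaleD P ^ 6)) := by
  have hD := hP.scaleD_pos
  have hK : 0 ≤ 1 / scaleD P ^ 6 := by positivity
  refine le_trans (Finset.sum_le_sum fun k _ => hP.maxProb_le_majorant hns _) ?_
  rw [← ENNReal.ofReal_sum_of_nonneg fun k _ => kernelMajorant_nonneg _ hK _]
  exact ENNReal.ofReal_le_ofReal (sum_majorant_one_le _ hK n)

theorem IsAdmissibleStep.sum_maxProb_two_le {P : PMF (Fin 6 → ℤ)} (hP : IsAdmissibleStep P)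
    {nstar : ℕ} (hns : leastNStar P ≤ nstar) (n n' : ℕ) :
    ∑ k ∈ Finset.range n, ∑ i ∈ Finset.range n', maxProb P (2 * k + i)
      ≤ ENNReal.ofReal (nstar ^ 2 + 32 * (1 / scaleD P ^ 6)) := by
  have hD := hP.scaleD_pos
  have hK : 0 ≤ 1 / scaleD P ^ 6 := by positivity
  refine le_trans (Finset.sum_le_sum fun k _ => Finset.sum_le_sum fun i _ =>
    hP.maxProb_le_majorant hns _) ?_
  refine le_trans (le_of_eq ?_) (ENNReal.ofReal_le_ofReal (sum_majorant_two_le nstar hK n n'))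
  rw [ENNReal.ofReal_sum_of_nonneg fun k _ => Finset.sum_nonneg fun i _ =>
    kernelMajorant_nonneg _ hK _]
  refine Finset.sum_congr rfl fun k _ => ?_
  rw [ENNReal.ofReal_sum_of_nonneg fun i _ => kernelMajorant_nonneg _ hK _]

theorem IsAdmissibleStep.sum_maxProb_three_le {P : PMF (Fin 6 → ℤ)} (hP : IsAdmissibleStep P)
    {nstar : ℕ} (hns : leastNStar P ≤ nstar) (n n' n'' : ℕ) :
    ∑ k ∈ Finset.range n, ∑ i ∈ Finset.range n', ∑ j ∈ Finset.range n'',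
        maxProb P (2 * k + i + j)
      ≤ ENNReal.ofReal (nstar ^ 3 + 32 * (1 / scaleD P ^ 6) * (1 + Real.log n)) := by
  have hD := hP.scaleD_pos
  have hK : 0 ≤ 1 / scaleD P ^ 6 := by positivity
  refine le_trans (Finset.sum_le_sum fun k _ => Finset.sum_le_sum fun i _ =>
    Finset.sum_le_sum fun j _ => hP.maxProb_le_majorant hns _) ?_
  refine le_trans (le_of_eq ?_)
    (ENNReal.ofReal_le_ofReal (sum_majorant_three_le nstar hK n n' n''))
  rw [ENNReal.ofReal_sum_of_nonneg fun k _ => Finset.sum_nonneg fun i _ =>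
    Finset.sum_nonneg fun j _ => kernelMajorant_nonneg _ hK _]
  refine Finset.sum_congr rfl fun k _ => ?_
  rw [ENNReal.ofReal_sum_of_nonneg fun i _ => Finset.sum_nonneg fun j _ =>
    kernelMajorant_nonneg _ hK _]
  refine Finset.sum_congr rfl fun i _ => ?_
  rw [ENNReal.ofReal_sum_of_nonneg fun j _ => kernelMajorant_nonneg _ hK _]

/-- For `a ≥ 2A` there are at least `a/2` indices `b` and exactly `a` indices `t`, with terms at
least `1 / (2a)³`: together at least `1 / (16 a)`. In the application `a`, `b` are the fork
distances in the two trees and `t` counts the generations beyond `U`. -/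
theorem log_le_sum_cubes {A S : ℕ} (hA : 0 < A) :
    (1 / 16) * (Real.log ((S + 1 : ℕ) : ℝ) - 1 - Real.log (2 * A))
      ≤ ∑ a ∈ Finset.Icc A S, ∑ _b ∈ Finset.Icc A a, ∑ t ∈ Finset.range a,
        1 / ((a + t : ℕ) : ℝ) ^ 3 := by
  have h1 : ∀ a ∈ Finset.Icc (2 * A) S, (1 / 16 : ℝ) * (a : ℝ)⁻¹
      ≤ ∑ _b ∈ Finset.Icc A a, ∑ t ∈ Finset.range a, 1 / ((a + t : ℕ) : ℝ) ^ 3 := by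
    intro a ha
    rw [Finset.mem_Icc] at ha
    have ha0 : (0 : ℝ) < a := by exact_mod_cast (show 0 < a by omega)
    have h2 : ∀ t ∈ Finset.range a, 1 / (8 * (a : ℝ) ^ 3) ≤ 1 / ((a + t : ℕ) : ℝ) ^ 3 := by
      intro t ht
      have h3 : ((a + t : ℕ) : ℝ) ≤ 2 * a := by
        have : a + t ≤ 2 * a := by have := Finset.mem_range.1 ht; omega
        exact_mod_cast this
      rw [show 8 * (a : ℝ) ^ 3 = (2 * a) ^ 3 by ring]
      have : (0 : ℝ) < ((a + t : ℕ) : ℝ) := by exact_mod_cast (show 0 < a + t by omega)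
      gcongr
    have h4 := Finset.sum_le_sum h2
    rw [Finset.sum_const, Finset.card_range, nsmul_eq_mul] at h4
    rw [Finset.sum_const, Nat.card_Icc, nsmul_eq_mul]
    have h5 : (a : ℝ) / 2 ≤ ((a + 1 - A : ℕ) : ℝ) := by
      rw [div_le_iff₀ (by norm_num)]
      have : a ≤ (a + 1 - A) * 2 := by omega
      exact_mod_cast this
    calc (1 / 16 : ℝ) * (a : ℝ)⁻¹ = (a : ℝ) / 2 * (a * (1 / (8 * (a : ℝ) ^ 3))) := by
          field_simp
          norm_num
      _ ≤ _ := mul_le_mul h5 h4 (by positivity) (by positivity)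
  have h6 : (1 / 16 : ℝ) * ∑ a ∈ Finset.Icc (2 * A) S, (a : ℝ)⁻¹
      ≤ ∑ a ∈ Finset.Icc A S, ∑ _b ∈ Finset.Icc A a, ∑ t ∈ Finset.range a,
        1 / ((a + t : ℕ) : ℝ) ^ 3 := by
    rw [Finset.mul_sum]
    refine (Finset.sum_le_sum h1).trans (Finset.sum_le_sum_of_subset_of_nonneg ?_ ?_)
    · exact Finset.Icc_subset_Icc (by omega) le_rfl
    · intro a _ _
      positivity
  refine le_trans ?_ h6
  have h7 := log_add_one_le_harmonic S
  have h8 := harmonic_le_one_add_log (2 * A)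
  rw [harmonic_eq_sum_Icc] at h7 h8
  push_cast at h7 h8 ⊢
  have h9 : ∑ a ∈ Finset.Icc 1 S, (a : ℝ)⁻¹
      ≤ ∑ a ∈ Finset.Icc 1 (2 * A), (a : ℝ)⁻¹ + ∑ a ∈ Finset.Icc (2 * A) S, (a : ℝ)⁻¹ := by
    rw [← Finset.sum_union_inter]
    refine le_add_of_le_of_nonneg (Finset.sum_le_sum_of_subset_of_nonneg ?_ ?_)
      (Finset.sum_nonneg fun _ _ => by positivity)
    · intro a
      simp only [Finset.mem_Icc, Finset.mem_union]
      omega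
    · intro a _ _
      positivity
  linarith

end Sums


/-! ### Separation of two words. -/

section CommonAncestors

variable {M : ℕ}

theorem hca_append (Z u v : List (Fin M)) : hca (Z ++ u) (Z ++ v) = Z ++ hca u v := by
  induction Z with
  | nil => rfl
  | cons c Z ih => simp [hca, ih]

theorem hca_cons_of_ne {a b : Fin M} (hab : a ≠ b) (u v : List (Fin M)) :
    hca (a :: u) (b :: v) = [] := by
  simp [hca, hab]

theorem hca_fork {a b : Fin M} (hab : a ≠ b) (Z y v : List (Fin M)) :
    hca (Z ++ [a] ++ y) (Z ++ b :: v) = Z := by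
  rw [List.append_assoc, hca_append, List.singleton_append, hca_cons_of_ne hab, List.append_nil]

theorem hcaPlus_fork {a b : Fin M} (hab : a ≠ b) (Z y v : List (Fin M)) :
    hcaPlus (Z ++ [a] ++ y) (Z ++ b :: v) = Z ++ [a] := by
  rw [hcaPlus, hca_fork hab, List.take_append_of_le_length (by simp), List.take_of_length_le]
  simp

theorem exists_fork {U V : List (Fin M)} (hU : (hca U V).length < U.length)
    (hV : (hca U V).length < V.length) :
    ∃ Z a u b v, a ≠ b ∧ U = Z ++ [a] ++ u ∧ V = Z ++ b :: v := by
  induction U generalizing V with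
  | nil => simp at hU
  | cons a u ih =>
    rcases V with _ | ⟨b, v⟩
    · simp at hV
    · by_cases hab : a = b
      · subst hab
        simp only [hca, if_true, List.length_cons, Nat.add_lt_add_iff_right] at hU hV
        obtain ⟨Z, c, u', d, v', h, rfl, rfl⟩ := ih hU hV
        exact ⟨a :: Z, c, u', d, v', h, by simp, by simp⟩
      · exact ⟨[], a, u, b, v, hab, rfl, rfl⟩

end CommonAncestors

/-! ### The events in coordinates relative to `Z⁺`. -/

section Events

variable {M d N : ℕ}

/-- The tree has the backbone `V` and contains the vertices `Z ++ y`, for `y ∈ L`. -/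
def treeEvent (N : ℕ) (V Z : List (Fin M)) (L : Finset (List (Fin M))) : Set (TreeSample M N) :=
  {s | backbone s N = V ∧ ∀ y ∈ L, Z ++ y ∈ treeSet s}

/-- The displacements of both trees. -/
def jointDisp (ω : WalkSample M d N × WalkSample M d N) : EdgePair M → Fin d → ℤ :=
  Sum.elim ω.1.2 ω.2.2

/-- The roots and the vertices `Z₁`, `Z₂` are typically spaced. -/
def Anchored (P : PMF (Fin d → ℤ)) (x : Fin d → ℤ) (Z₁ Z₂ : List (Fin M))
    (ξ : EdgePair M → Fin d → ℤ) : Prop :=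
  wnorm P (locFst ξ Z₁ - 0) ≤ √(Z₁.length : ℝ) ∧ wnorm P (locSnd x ξ Z₂ - x) ≤ √(Z₂.length : ℝ)

/-- The vertices `Z₁ ++ y₁` and `Z₂ ++ y₂` are at the same location, and spaced from `Z₁` and `Z₂`
as required with the factor `r`. -/
def MeetsFrom (P : PMF (Fin d → ℤ)) (x : Fin d → ℤ) (r : ℝ) (Z₁ Z₂ y₁ y₂ : List (Fin M))
    (ξ : EdgePair M → Fin d → ℤ) : Prop :=
  locFst ξ (Z₁ ++ y₁) = locSnd x ξ (Z₂ ++ y₂) ∧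
  wnorm P (locFst ξ (Z₁ ++ y₁) - locFst ξ Z₁) ≤ r * √(y₁.length : ℝ) ∧
  wnorm P (locSnd x ξ (Z₂ ++ y₂) - locSnd x ξ Z₂) ≤ r * √(y₂.length : ℝ)

/-- Once the separating letters are fixed, `Z` and `Z⁺` are deterministic, and the condition splits
into one on the tree, one on heights only, and one on displacements. -/
theorem spacedWell_iff {P : PMF (Fin d → ℤ)} {x : Fin d → ℤ} {r : ℝ} {s : WalkSample M d N}
    {Z v : List (Fin M)} {a b : Fin M} (hab : a ≠ b) (hV : backbone s.1 N = Z ++ b :: v)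
    (y : List (Fin M)) :
    SpacedWell P x r s (Z ++ [a] ++ y) ↔ Z ++ [a] ++ y ∈ treeSet s.1 ∧
      ((5 / 6 : ℝ) * N ≤ (Z ++ [a] ++ y).length ∧ (Z ++ [a] ++ y).length ≤ N ∧
      (1 / 2 : ℝ) * N ≤ Z.length ∧ (Z.length : ℝ) ≤ (4 / 6) * N) ∧
      wnorm P (location x s.2 Z - x) ≤ √(Z.length : ℝ) ∧
      wnorm P (location x s.2 (Z ++ [a] ++ y) - location x s.2 (Z ++ [a]))
        ≤ r * √(y.length : ℝ) := by
  have hl : (((Z ++ [a] ++ y).length : ℕ) : ℝ) - ((Z ++ [a]).length : ℕ) = (y.length : ℝ) := by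
    rw [List.length_append (as := Z ++ [a])]
    push_cast
    ring
  simp only [SpacedWell, hV, hca_fork hab, hcaPlus_fork hab, hl]
  tauto

theorem mem_eventIW_iff {P : PMF (Fin d → ℤ)} {x : Fin d → ℤ} {Z₁ Z₂ v₁ v₂ u₁ u₂ : List (Fin M)}
    {a₁ b₁ a₂ b₂ : Fin M} (h₁ : a₁ ≠ b₁) (h₂ : a₂ ≠ b₂)
    (ω : WalkSample M d N × WalkSample M d N) :
    ω ∈ eventIW N P x (Z₁ ++ b₁ :: v₁) (Z₂ ++ b₂ :: v₂) (Z₁ ++ [a₁] ++ u₁) (Z₂ ++ [a₂] ++ u₂) ↔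
      (ω.1.1 ∈ treeEvent N (Z₁ ++ b₁ :: v₁) (Z₁ ++ [a₁]) {u₁} ∧
        ω.2.1 ∈ treeEvent N (Z₂ ++ b₂ :: v₂) (Z₂ ++ [a₂]) {u₂} ∧
        Anchored P x Z₁ Z₂ (jointDisp ω) ∧
        MeetsFrom P x (1 / 2) (Z₁ ++ [a₁]) (Z₂ ++ [a₂]) u₁ u₂ (jointDisp ω)) ∧
      ((5 / 6 : ℝ) * N ≤ (Z₁ ++ [a₁] ++ u₁).length ∧
        ((Z₁ ++ [a₁] ++ u₁).length : ℝ) ≤ (11 / 12) * N ∧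
        (Z₁ ++ [a₁] ++ u₁).length = (Z₂ ++ [a₂] ++ u₂).length ∧
        ((1 / 2 : ℝ) * N ≤ Z₁.length ∧ (Z₁.length : ℝ) ≤ (4 / 6) * N) ∧
        ((1 / 2 : ℝ) * N ≤ Z₂.length ∧ (Z₂.length : ℝ) ≤ (4 / 6) * N)) := by
  have hN : (0 : ℝ) ≤ N := by positivity
  constructor
  · rintro ⟨hV₁, hV₂, ⟨⟨hs₁, hs₂, hl, he⟩, hm, hs₁', hs₂'⟩⟩
    rw [spacedWell_iff h₁ hV₁] at hs₁ hs₁'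
    rw [spacedWell_iff h₂ hV₂] at hs₂ hs₂'
    refine ⟨⟨⟨hV₁, by simpa using hs₁.1⟩, ⟨hV₂, by simpa using hs₂.1⟩, ⟨hs₁.2.2.1, hs₂.2.2.1⟩,
      he, hs₁'.2.2.2, hs₂'.2.2.2⟩, hs₁.2.1.1, hm, hl, hs₁.2.1.2.2, hs₂.2.1.2.2⟩
  · rintro ⟨⟨⟨hV₁, ht₁⟩, ⟨hV₂, ht₂⟩, ⟨ha₁, ha₂⟩, he, hd₁, hd₂⟩, n1, n2, n3, n4, n5⟩
    have ht₁' : Z₁ ++ [a₁] ++ u₁ ∈ treeSet ω.1.1 := ht₁ u₁ (by simp)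
    have ht₂' : Z₂ ++ [a₂] ++ u₂ ∈ treeSet ω.2.1 := ht₂ u₂ (by simp)
    have hn : (Z₁ ++ [a₁] ++ u₁).length ≤ N := by
      have : ((Z₁ ++ [a₁] ++ u₁).length : ℝ) ≤ N := by linarith
      exact_mod_cast this
    have hd₁' : wnorm P (location 0 ω.1.2 (Z₁ ++ [a₁] ++ u₁) - location 0 ω.1.2 (Z₁ ++ [a₁]))
        ≤ 1 * √(u₁.length : ℝ) := hd₁.trans (by gcongr; norm_num)
    have hd₂' : wnorm P (location x ω.2.2 (Z₂ ++ [a₂] ++ u₂) - location x ω.2.2 (Z₂ ++ [a₂]))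
        ≤ 1 * √(u₂.length : ℝ) := hd₂.trans (by gcongr; norm_num)
    refine ⟨hV₁, hV₂, ⟨⟨?_, ?_, n3, he⟩, n2, ?_, ?_⟩⟩
    · exact (spacedWell_iff h₁ hV₁ u₁).2 ⟨ht₁', ⟨n1, hn, n4⟩, ha₁, hd₁'⟩
    · exact (spacedWell_iff h₂ hV₂ u₂).2 ⟨ht₂', ⟨n3 ▸ n1, n3 ▸ hn, n5⟩, ha₂, hd₂'⟩
    · exact (spacedWell_iff h₁ hV₁ u₁).2 ⟨ht₁', ⟨n1, hn, n4⟩, ha₁, hd₁⟩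
    · exact (spacedWell_iff h₂ hV₂ u₂).2 ⟨ht₂', ⟨n3 ▸ n1, n3 ▸ hn, n5⟩, ha₂, hd₂⟩

/-- The part of the definition of a good branch that does not depend on the randomness. -/
def BranchesWell (N nstar : ℕ) (Z u y : List (Fin M)) : Prop :=
  (Z ++ u <+: Z ++ y → y = u) ∧
  (∃ r : ℕ, (9 / 12 : ℝ) * N ≤ r ∧ r + nstar ≤ (Z ++ u).length ∧
    (Z ++ u).take r <+: Z ++ y ∧ ¬ (Z ++ u).take (r + 1) <+: Z ++ y) ∧
  (Z ++ u).length ≤ (Z ++ y).length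

theorem goodBranch_iff {nstar : ℕ} {s : TreeSample M N} {Z u v Y : List (Fin M)} {a b : Fin M}
    (hab : a ≠ b) :
    GoodBranch N nstar s (Z ++ b :: v) (Z ++ [a] ++ u) Y ↔ ∃ y, Y = Z ++ [a] ++ y ∧
      Z ++ [a] ++ y ∈ treeSet s ∧ BranchesWell N nstar (Z ++ [a]) u y := by
  rw [GoodBranch, hcaPlus_fork hab]
  constructor
  · rintro ⟨h1, ⟨y, rfl⟩, h3, h4, h5⟩
    exact ⟨y, rfl, h1, fun h => List.append_cancel_left (h3 h), h4, h5⟩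
  · rintro ⟨y, rfl, h1, h3, h4, h5⟩
    exact ⟨h1, List.prefix_append _ _, fun h => by rw [h3 h], h4, h5⟩

/-- The requirements on the root and `Z` are shared with `U`, and the lower height bound follows
from that of `U`; only the meeting, the spacing from `Z⁺` and the upper height bound are new. -/
theorem mem_goodExtra_iff {nstar : ℕ} {P : PMF (Fin d → ℤ)} {x : Fin d → ℤ}
    {Z₁ Z₂ v₁ v₂ u₁ u₂ : List (Fin M)}
    {a₁ b₁ a₂ b₂ : Fin M} (h₁ : a₁ ≠ b₁) (h₂ : a₂ ≠ b₂)
    (ω : WalkSample M d N × WalkSample M d N) (Y : List (Fin M) × List (Fin M)) :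
    Y ∈ goodExtra nstar P x (Z₁ ++ b₁ :: v₁) (Z₂ ++ b₂ :: v₂) (Z₁ ++ [a₁] ++ u₁)
        (Z₂ ++ [a₂] ++ u₂) ω ↔
      ∃ y₁ y₂, Y = (Z₁ ++ [a₁] ++ y₁, Z₂ ++ [a₂] ++ y₂) ∧
        (ω ∈ eventIW N P x (Z₁ ++ b₁ :: v₁) (Z₂ ++ b₂ :: v₂) (Z₁ ++ [a₁] ++ u₁)
          (Z₂ ++ [a₂] ++ u₂) ∧
        ω.1.1 ∈ treeEvent N (Z₁ ++ b₁ :: v₁) (Z₁ ++ [a₁]) {y₁} ∧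
        ω.2.1 ∈ treeEvent N (Z₂ ++ b₂ :: v₂) (Z₂ ++ [a₂]) {y₂} ∧
        MeetsFrom P x 1 (Z₁ ++ [a₁]) (Z₂ ++ [a₂]) y₁ y₂ (jointDisp ω)) ∧
        (BranchesWell N nstar (Z₁ ++ [a₁]) u₁ y₁ ∧ BranchesWell N nstar (Z₂ ++ [a₂]) u₂ y₂ ∧
        (Z₁ ++ [a₁] ++ y₁).length = (Z₂ ++ [a₂] ++ y₂).length ∧
        (Z₁ ++ [a₁] ++ y₁).length ≤ N) := by
  constructor
  · rintro ⟨hω, hg₁, hg₂, hI⟩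
    obtain ⟨y₁, hY₁, ht₁, hb₁⟩ := (goodBranch_iff h₁).1 hg₁
    obtain ⟨y₂, hY₂, ht₂, hb₂⟩ := (goodBranch_iff h₂).1 hg₂
    rw [hY₁, hY₂] at hI
    obtain ⟨hs₁, hs₂, hl, he⟩ := hI
    rw [spacedWell_iff h₁ hω.1] at hs₁
    rw [spacedWell_iff h₂ hω.2.1] at hs₂
    exact ⟨y₁, y₂, Prod.ext hY₁ hY₂, ⟨hω, ⟨hω.1, by simpa using ht₁⟩, ⟨hω.2.1, by simpa using ht₂⟩,
      he, hs₁.2.2.2, hs₂.2.2.2⟩, hb₁, hb₂, hl, hs₁.2.1.2.1⟩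
  · rintro ⟨y₁, y₂, rfl, ⟨hω, ⟨hV₁, ht₁⟩, ⟨hV₂, ht₂⟩, he, hd₁, hd₂⟩, hb₁, hb₂, hl, hlN⟩
    have ht₁' : Z₁ ++ [a₁] ++ y₁ ∈ treeSet ω.1.1 := ht₁ y₁ (by simp)
    have ht₂' : Z₂ ++ [a₂] ++ y₂ ∈ treeSet ω.2.1 := ht₂ y₂ (by simp)
    obtain ⟨⟨-, -, ⟨ha₁, ha₂⟩, -⟩, n1, n2, n3, n4, n5⟩ := (mem_eventIW_iff h₁ h₂ ω).1 hω
    have hb₁' : (Z₁ ++ [a₁] ++ u₁).length ≤ (Z₁ ++ [a₁] ++ y₁).length := hb₁.2.2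
    have m1 : (5 / 6 : ℝ) * N ≤ (Z₁ ++ [a₁] ++ y₁).length :=
      n1.trans (by exact_mod_cast hb₁')
    refine ⟨hω, (goodBranch_iff h₁).2 ⟨y₁, rfl, ht₁', hb₁⟩,
      (goodBranch_iff h₂).2 ⟨y₂, rfl, ht₂', hb₂⟩, ?_, ?_, hl, he⟩
    · exact (spacedWell_iff h₁ hV₁ y₁).2 ⟨ht₁', ⟨m1, hlN, n4⟩, ha₁, hd₁⟩
    · exact (spacedWell_iff h₂ hV₂ y₂).2 ⟨ht₂', ⟨hl ▸ m1, hl ▸ hlN, n5⟩, ha₂, hd₂⟩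

end Events

/-! ### Measurability, and independence of trees and displacements. -/

section Measurability

variable {M d N : ℕ}

theorem measurableSet_of_dependsOn {ι : Type*} {F : Finset ι} {R : (ι → Fin d → ℤ) → Prop}
    (hR : DependsOn R (F : Set ι)) : MeasurableSet {ξ | R ξ} := by
  have h := measurableSet_preimage_countable (measurable_restrict_disp (d := d) F)
    {β | R (extendZero F β)}
  simpa only [Set.mem_ofPred_eq, extendZero_restrict hR] using h

theorem measurableSet_backbone_eq (i : ℕ) (l : List (Fin M)) :
    MeasurableSet {s : TreeSample M N | backbone s i = l} := by
  have h : Measurable fun (s : TreeSample M N) (j : Fin (N + 1)) => (s j).1.1 :=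
    measurable_pi_iff.2 fun j => measurable_fst.comp (measurable_fst.comp (measurable_pi_apply j))
  exact h (MeasurableSet.of_discrete (s := {f : Fin (N + 1) → Fin M | (List.ofFn f).take i = l}))

theorem measurableSet_mem_treeSet (v : List (Fin M)) :
    MeasurableSet {s : TreeSample M N | v ∈ treeSet s} := by
  have : {s : TreeSample M N | v ∈ treeSet s} = ⋃ i : Fin (N + 1), ⋃ w : List (Fin M),
      ⋃ l : List (Fin M), ⋃ _ : v = l ++ w,
        {s : TreeSample M N | w ∈ bush (s i)} ∩ {s | backbone s i = l} := by
    ext s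
    simp only [treeSet, Set.mem_ofPred_eq, Set.mem_iUnion, Set.mem_inter_iff, exists_prop]
    constructor
    · rintro ⟨i, w, hw, h⟩
      exact ⟨i, w, _, h, hw, rfl⟩
    · rintro ⟨i, w, l, h, hw, rfl⟩
      exact ⟨i, w, hw, h⟩
  rw [this]
  refine MeasurableSet.iUnion fun i => MeasurableSet.iUnion fun w => MeasurableSet.iUnion fun l =>
    MeasurableSet.iUnion fun _ => MeasurableSet.inter ?_ (measurableSet_backbone_eq _ _)
  exact (measurable_bushOffspring.comp (measurable_pi_apply i)) (measurableSet_mem_gwTree w)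

theorem measurableSet_treeEvent (V Z : List (Fin M)) (L : Finset (List (Fin M))) :
    MeasurableSet (treeEvent N V Z L) := by
  have : treeEvent N V Z L = {s | backbone s N = V} ∩ ⋂ y ∈ L, {s | Z ++ y ∈ treeSet s} := by
    ext s
    simp [treeEvent]
  rw [this]
  exact (measurableSet_backbone_eq _ _).inter
    (Finset.measurableSet_biInter _ fun y _ => measurableSet_mem_treeSet _)

theorem measurable_jointDisp : Measurable (jointDisp (M := M) (d := d) (N := N)) := by
  rw [measurable_pi_iff]
  rintro (e | e)
  · exact (measurable_pi_apply e).comp (measurable_snd.comp measurable_fst)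
  · exact (measurable_pi_apply e).comp (measurable_snd.comp measurable_snd)

variable [NeZero M] {p : PMF ℕ} (hp : IsCritical p) (P : PMF (Fin d → ℤ))

instance (N m : ℕ) : IsFiniteMeasure (treeLaw M p hp N m) := by
  unfold treeLaw
  infer_instance

instance (N : ℕ) : IsFiniteMeasure (walkLaw M p hp P N) := by
  unfold walkLaw
  infer_instance

/-- The two trees and the pair of displacements are independent. -/
theorem pairLaw_rect {T₁ T₂ : Set (TreeSample M N)} (hT₁ : MeasurableSet T₁)
    (hT₂ : MeasurableSet T₂) {E : (EdgePair M → Fin d → ℤ) → Prop}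
    (hE : MeasurableSet {ξ | E ξ}) :
    pairLaw M p hp P N {ω | ω.1.1 ∈ T₁ ∧ ω.2.1 ∈ T₂ ∧ E (jointDisp ω)}
      = treeLaw M p hp N (2 * N) T₁ * treeLaw M p hp N (2 * N) T₂
        * dispLaw (EdgePair M) P {ξ | E ξ} := by
  have hm : MeasurableSet {ω : WalkSample M d N × WalkSample M d N |
      ω.1.1 ∈ T₁ ∧ ω.2.1 ∈ T₂ ∧ E (jointDisp ω)} :=
    (measurable_fst.comp measurable_fst hT₁).inter
      ((measurable_fst.comp measurable_snd hT₂).inter (measurable_jointDisp hE))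
  have hsum : Measurable fun q : Displacements M d × Displacements M d =>
      (Sum.elim q.1 q.2 : EdgePair M → Fin d → ℤ) := by
    rw [measurable_pi_iff]
    rintro (e | e)
    · exact (measurable_pi_apply e).comp measurable_fst
    · exact (measurable_pi_apply e).comp measurable_snd
  have hE' : MeasurableSet {q : Displacements M d × Displacements M d | E (Sum.elim q.1 q.2)} :=
    hsum hE
  set δ : Measure (Displacements M d) := Measure.infinitePi fun _ : List (Fin M) => P.toMeasure
  have hsec : ∀ w : WalkSample M d N, walkLaw M p hp P N (Prod.mk w ⁻¹'
      {ω : WalkSample M d N × WalkSample M d N | ω.1.1 ∈ T₁ ∧ ω.2.1 ∈ T₂ ∧ E (jointDisp ω)})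
      = T₁.indicator 1 w.1 * (treeLaw M p hp N (2 * N) T₂ *
        δ (Prod.mk w.2 ⁻¹'
          {q : Displacements M d × Displacements M d | E (Sum.elim q.1 q.2)})) := by
    intro w
    by_cases hw : w.1 ∈ T₁
    · rw [Set.indicator_of_mem hw, Pi.one_apply, one_mul, walkLaw, ← Measure.prod_prod]
      congr 1
      ext w'
      simp [hw, jointDisp]
    · rw [Set.indicator_of_notMem hw, zero_mul]
      convert measure_empty (μ := walkLaw M p hp P N)
      ext w'
      simp [hw]
  have hf : Measurable fun ξ : Displacements M d => treeLaw M p hp N (2 * N) T₂ *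
      δ (Prod.mk ξ ⁻¹' {q : Displacements M d × Displacements M d | E (Sum.elim q.1 q.2)}) :=
    (measurable_measure_prodMk_left hE').const_mul _
  have h1 : Measurable (T₁.indicator (1 : TreeSample M N → ℝ≥0∞)) := measurable_one.indicator hT₁
  rw [pairLaw, Measure.prod_apply hm]
  simp_rw [hsec]
  refine (lintegral_prod_mul (μ := treeLaw M p hp N (2 * N)) (ν := δ) h1.aemeasurable
    hf.aemeasurable).trans ?_
  rw [lintegral_indicator_one hT₁, lintegral_const_mul _ (measurable_measure_prodMk_left hE'),
    ← Measure.prod_apply hE', mul_assoc]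
  congr 2
  rw [dispLaw, ← map_sumElim_infinitePi, Measure.map_apply hsum hE]
  rfl

end Measurability


/-! ### Summation over a further pair of vertices. -/

section UpperBound

variable {M d N : ℕ}

/-- The upper bound for summing over pairs of further vertices in the same generation, in terms of
sums of the kernel `g`. -/
noncomputable def branchBound (a b : ℝ≥0∞) (g : ℕ → ℝ≥0∞) (n : ℕ) : ℝ≥0∞ :=
  a ^ 2 * (∑ k ∈ Finset.range n, ∑ i ∈ Finset.range n, ∑ j ∈ Finset.range n, g (2 * k + i + j))
    + 2 * a * b * (∑ k ∈ Finset.range n, ∑ i ∈ Finset.range n, g (2 * k + i))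
    + b ^ 2 * ∑ k ∈ Finset.range n, g (2 * k)

variable {p : PMF ℕ}

/-- `sum_branch_le` is applied in one tree with the fresh edges of the other frozen; antitonicity
survives the partial summation. Multiplying out the two bounds gives `branchBound`, in which only
the `a ^ 2` term has three free indices. -/
theorem sum_pair_branch_le (hM : ∀ k, M < k → p k = 0) (hp : IsCritical p) {t₀ : ℕ} {A B : ℝ}
    (hW : HasWeightBounds p M t₀ A B) (hA : 0 ≤ A) (hB : 1 ≤ B) {T₁ T₂ c : ℕ}
    {L₁ L₂ : Finset (List (Fin M))} (hL₁ : L₁.Nonempty) (hL₂ : L₂.Nonempty) (hc : c ≤ 2)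
    (hc₁ : L₁.card ≤ c) (hc₂ : L₂.card ≤ c) {ℓ₁ ℓ₂ n : ℕ} (hℓ₁ : ∀ w ∈ L₁, w.length ≤ ℓ₁)
    (hℓ₂ : ∀ w ∈ L₂, w.length ≤ ℓ₂) (hT₁ : t₀ + ℓ₁ + 1 ≤ T₁) (hT₂ : t₀ + ℓ₂ + 1 ≤ T₂)
    (hn₁ : ℓ₁ < n) (hn₂ : ℓ₂ < n) {r : ℕ} (hr : r ≤ n) {g : ℕ → ℝ≥0∞} (hg : Antitone g) :
    ∑ k ∈ Finset.range r, ∑ w₁ ∈ words M (ℓ₁ + k), ∑ w₂ ∈ words M (ℓ₂ + k),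
        gwLaw M p (gwEvent T₁ (insert w₁ L₁)) * gwLaw M p (gwEvent T₂ (insert w₂ L₂)) *
          g ((freshEdges L₁ w₁).card + (freshEdges L₂ w₂).card)
      ≤ gwLaw M p (gwEvent T₁ L₁) * gwLaw M p (gwEvent T₂ L₂) *
        branchBound (ENNReal.ofReal (c * A)) (ENNReal.ofReal (3 * B)) g n := by
  set a := ENNReal.ofReal (c * A) with ha
  set b := ENNReal.ofReal (3 * B) with hb
  have one : ∀ {T ℓ : ℕ} {L : Finset (List (Fin M))}, L.Nonempty → L.card ≤ c →
      (∀ w ∈ L, w.length ≤ ℓ) → t₀ + ℓ + 1 ≤ T → ℓ < n → ∀ (k : ℕ) {f : ℕ → ℝ≥0∞}, Antitone f →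
      ∑ w ∈ words M (ℓ + k), gwLaw M p (gwEvent T (insert w L)) * f (freshEdges L w).card
      ≤ gwLaw M p (gwEvent T L) * (a * ∑ i ∈ Finset.range n, f (k + i) + b * f k) := by
    intro T ℓ L hL hLc hℓ hT hn k f hf
    refine (sum_branch_le hM hp hW hB hL (hLc.trans hc) hℓ hT k hf).trans ?_
    refine mul_le_mul_right (add_le_add (mul_le_mul' ?_ ?_) le_rfl) _
    · refine ENNReal.ofReal_le_ofReal (mul_le_mul_of_nonneg_right ?_ hA)
      exact_mod_cast hLc
    · exact Finset.sum_le_sum_of_subset (Finset.range_mono (by omega))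
  have inner : ∀ k, ∑ w₁ ∈ words M (ℓ₁ + k), ∑ w₂ ∈ words M (ℓ₂ + k),
        gwLaw M p (gwEvent T₁ (insert w₁ L₁)) * gwLaw M p (gwEvent T₂ (insert w₂ L₂)) *
          g ((freshEdges L₁ w₁).card + (freshEdges L₂ w₂).card)
      ≤ gwLaw M p (gwEvent T₁ L₁) * gwLaw M p (gwEvent T₂ L₂) *
        (a * ∑ i ∈ Finset.range n, (a * ∑ j ∈ Finset.range n, g (k + i + (k + j)) +
          b * g (k + i + k)) +
        b * (a * ∑ j ∈ Finset.range n, g (k + (k + j)) + b * g (k + k))) := by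
    intro k
    calc _ ≤ ∑ w₁ ∈ words M (ℓ₁ + k), gwLaw M p (gwEvent T₁ (insert w₁ L₁)) *
          (gwLaw M p (gwEvent T₂ L₂) * (a * ∑ j ∈ Finset.range n,
            g ((freshEdges L₁ w₁).card + (k + j)) + b * g ((freshEdges L₁ w₁).card + k))) := by
          refine Finset.sum_le_sum fun w₁ _ => ?_
          simp_rw [mul_assoc]
          rw [← Finset.mul_sum]
          refine mul_le_mul_right ?_ _
          exact one hL₂ hc₂ hℓ₂ hT₂ hn₂ k (f := fun m => g ((freshEdges L₁ w₁).card + m))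
            fun m m' h => hg (by omega)
      _ = gwLaw M p (gwEvent T₂ L₂) * ∑ w₁ ∈ words M (ℓ₁ + k),
          gwLaw M p (gwEvent T₁ (insert w₁ L₁)) * (a * ∑ j ∈ Finset.range n,
            g ((freshEdges L₁ w₁).card + (k + j)) + b * g ((freshEdges L₁ w₁).card + k)) := by
          rw [Finset.mul_sum]
          refine Finset.sum_congr rfl fun w₁ _ => ?_
          ring
      _ ≤ _ := by
          refine (mul_le_mul_right (one hL₁ hc₁ hℓ₁ hT₁ hn₁ k
            (f := fun m => a * ∑ j ∈ Finset.range n, g (m + (k + j)) + b * g (m + k)) ?_)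
            _).trans ?_
          · intro m m' h
            have h1 : ∀ j, g (m' + (k + j)) ≤ g (m + (k + j)) := fun j => hg (by omega)
            have h2 : g (m' + k) ≤ g (m + k) := hg (by omega)
            exact add_le_add (mul_le_mul_right (Finset.sum_le_sum fun j _ => h1 j) _)
              (mul_le_mul_right h2 _)
          · exact le_of_eq (by ring)
  calc _ ≤ ∑ k ∈ Finset.range n, _ :=
        (Finset.sum_le_sum_of_subset (Finset.range_mono hr)).trans
          (Finset.sum_le_sum fun k _ => inner k)
    _ = _ := by
        rw [← Finset.mul_sum]
        congr 1
        simp only [branchBound, Finset.mul_sum, mul_add, Finset.sum_add_distrib]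
        have e1 : ∀ k i j : ℕ, k + i + (k + j) = 2 * k + i + j := by intros; ring
        have e2 : ∀ k i : ℕ, k + i + k = 2 * k + i := by intros; ring
        have e3 : ∀ k j : ℕ, k + (k + j) = 2 * k + j := by intros; ring
        have e4 : ∀ k : ℕ, k + k = 2 * k := by intros; ring
        simp only [e1, e2, e3, e4]
        simp only [← Finset.mul_sum]
        ring

end UpperBound

/-! ### Joint events for the two trees. -/

section PairEvents

variable {M d N : ℕ}

/-- The event that both trees have the given backbones and contain the given vertices, while the
displacements satisfy `E`. -/
def pairEvent (V₁ V₂ W₁ W₂ : List (Fin M)) (L₁ L₂ : Finset (List (Fin M)))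
    (E : (EdgePair M → Fin d → ℤ) → Prop) : Set (WalkSample M d N × WalkSample M d N) :=
  {ω | ω.1.1 ∈ treeEvent N V₁ W₁ L₁ ∧ ω.2.1 ∈ treeEvent N V₂ W₂ L₂ ∧ E (jointDisp ω)}

theorem measurableSet_pairEvent (V₁ V₂ W₁ W₂ : List (Fin M)) (L₁ L₂ : Finset (List (Fin M)))
    {E : (EdgePair M → Fin d → ℤ) → Prop} (hE : MeasurableSet {ξ | E ξ}) :
    MeasurableSet (pairEvent (N := N) V₁ V₂ W₁ W₂ L₁ L₂ E) :=
  (measurable_fst.comp measurable_fst (measurableSet_treeEvent V₁ W₁ L₁)).inter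
    ((measurable_fst.comp measurable_snd (measurableSet_treeEvent V₂ W₂ L₂)).inter
      (measurable_jointDisp hE))

theorem dependsOn_anchored {P : PMF (Fin d → ℤ)} {x : Fin d → ℤ} (Z₁ Z₂ : List (Fin M)) :
    DependsOn (Anchored P x Z₁ Z₂) (pairPrefixes {Z₁} {Z₂} : Set (EdgePair M)) := by
  intro ξ ξ' h
  have e1 := dependsOn_locFst (toFst_edges_subset (L₂ := {Z₂}) (Finset.mem_singleton_self Z₁)) h
  have e2 := dependsOn_locSnd x (toSnd_edges_subset (L₁ := {Z₁}) (Finset.mem_singleton_self Z₂)) h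
  simp only [Anchored, e1, e2]

theorem pairPrefixes_mono {L₁ L₂ L₁' L₂' : Finset (List (Fin M))}
    (h₁ : ∀ v ∈ L₁, ∃ w ∈ L₁', v <+: w) (h₂ : ∀ v ∈ L₂, ∃ w ∈ L₂', v <+: w) :
    pairPrefixes L₁ L₂ ⊆ pairPrefixes L₁' L₂' := by
  have key : ∀ {L L' : Finset (List (Fin M))}, (∀ v ∈ L, ∃ w ∈ L', v <+: w) →
      prefixes L ⊆ prefixes L' := by
    intro L L' h e he
    obtain ⟨v, hv, hev⟩ := mem_prefixes.1 he
    obtain ⟨w, hw, hvw⟩ := h v hv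
    exact mem_prefixes.2 ⟨w, hw, hev.trans hvw⟩
  exact Finset.union_subset_union (Finset.map_subset_map.2 (key h₁))
    (Finset.map_subset_map.2 (key h₂))

theorem dependsOn_meetsFrom {P : PMF (Fin d → ℤ)} {x : Fin d → ℤ} (r : ℝ)
    (Z₁ Z₂ y₁ y₂ : List (Fin M)) : DependsOn (MeetsFrom P x r Z₁ Z₂ y₁ y₂)
      (pairPrefixes {Z₁ ++ y₁} {Z₂ ++ y₂} : Set (EdgePair M)) := by
  intro ξ ξ' h
  have hm : pairPrefixes {Z₁} {Z₂} ⊆ pairPrefixes {Z₁ ++ y₁} {Z₂ ++ y₂} :=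
    pairPrefixes_mono (by simp) (by simp)
  have h' : ∀ i ∈ (pairPrefixes {Z₁} {Z₂} : Set (EdgePair M)), ξ i = ξ' i := fun i hi => h i (hm hi)
  have e1 := dependsOn_locFst (toFst_edges_subset (L₂ := {Z₂}) (Finset.mem_singleton_self Z₁)) h'
  have e2 := dependsOn_locSnd x (toSnd_edges_subset (L₁ := {Z₁}) (Finset.mem_singleton_self Z₂)) h'
  have e3 := dependsOn_locFst
    (toFst_edges_subset (L₂ := {Z₂ ++ y₂}) (Finset.mem_singleton_self (Z₁ ++ y₁))) h
  have e4 := dependsOn_locSnd x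
    (toSnd_edges_subset (L₁ := {Z₁ ++ y₁}) (Finset.mem_singleton_self (Z₂ ++ y₂))) h
  simp only [MeetsFrom, e1, e2, e3, e4]

theorem measurableSet_meetsFrom (P : PMF (Fin d → ℤ)) (x : Fin d → ℤ) (r : ℝ)
    (Z₁ Z₂ y₁ y₂ : List (Fin M)) : MeasurableSet {ξ | MeetsFrom P x r Z₁ Z₂ y₁ y₂ ξ} :=
  measurableSet_of_dependsOn (dependsOn_meetsFrom r _ _ _ _)

end PairEvents


/-- Used to order two further pairs by generation, so that the pair attached last is never the lower
one. -/
theorem sum_sum_le_two_mul {F : ℕ → ℕ → ℝ≥0∞} (hF : ∀ s t, F s t = F t s) (r : ℕ) :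
    ∑ s ∈ Finset.range r, ∑ t ∈ Finset.range r, F s t
      ≤ 2 * ∑ s ∈ Finset.range r, ∑ k ∈ Finset.range (r - s), F s (s + k) := by
  have h1 : ∀ s, ∑ k ∈ Finset.range (r - s), F s (s + k)
      = ∑ t ∈ Finset.range r, if s ≤ t then F s t else 0 := by
    intro s
    rw [← Finset.sum_filter, ← Finset.sum_Ico_eq_sum_range]
    refine Finset.sum_congr ?_ fun _ _ => rfl
    ext t
    simp
    omega
  simp_rw [h1]
  rw [two_mul]
  conv_rhs => rw [add_comm]; arg 1; rw [Finset.sum_comm]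
  rw [← Finset.sum_add_distrib]
  refine Finset.sum_le_sum fun s _ => ?_
  rw [← Finset.sum_add_distrib]
  refine Finset.sum_le_sum fun t _ => ?_
  rcases le_total s t with h | h
  · rw [if_pos h]
    exact le_add_self
  · rw [if_pos h, hF s t]
    exact le_self_add

/-! ### Pairs of extra intersections. -/

section SecondMoment

variable {M d N : ℕ} [NeZero M] {p : PMF ℕ} (hp : IsCritical p)

/-- Up to the factor `κ`, the probability of `treeEvent N V W L` is that of the branching tree to
contain `L` and to die out by time `T`. -/
def HasTreeFactor (N T : ℕ) (V W : List (Fin M)) (κ : ℝ≥0∞) : Prop :=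
  ∀ L : Finset (List (Fin M)), L.Nonempty →
    treeLaw M p hp N (2 * N) (treeEvent N V W L) = κ * gwLaw M p (gwEvent T L)

variable {hp}

theorem pairLaw_pairEvent (P : PMF (Fin d → ℤ)) {V₁ V₂ W₁ W₂ : List (Fin M)} {T₁ T₂ : ℕ}
    {κ₁ κ₂ : ℝ≥0∞} (hκ₁ : HasTreeFactor hp N T₁ V₁ W₁ κ₁) (hκ₂ : HasTreeFactor hp N T₂ V₂ W₂ κ₂)
    {L₁ L₂ : Finset (List (Fin M))} (hL₁ : L₁.Nonempty) (hL₂ : L₂.Nonempty)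
    {E : (EdgePair M → Fin d → ℤ) → Prop} (hE : MeasurableSet {ξ | E ξ}) :
    pairLaw M p hp P N (pairEvent V₁ V₂ W₁ W₂ L₁ L₂ E)
      = κ₁ * κ₂ * (gwLaw M p (gwEvent T₁ L₁) * gwLaw M p (gwEvent T₂ L₂))
        * dispLaw (EdgePair M) P {ξ | E ξ} := by
  rw [pairEvent, pairLaw_rect hp P (measurableSet_treeEvent V₁ W₁ L₁)
    (measurableSet_treeEvent V₂ W₂ L₂) hE, hκ₁ L₁ hL₁, hκ₂ L₂ hL₂]
  ring

/-- The event that both trees contain a further pair of vertices, at the same location. -/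
def extraEvent (P : PMF (Fin d → ℤ)) (x : Fin d → ℤ) (V₁ V₂ W₁ W₂ u₁ u₂ : List (Fin M))
    (R : (EdgePair M → Fin d → ℤ) → Prop) (y₁ y₂ : List (Fin M)) :
    Set (WalkSample M d N × WalkSample M d N) :=
  pairEvent V₁ V₂ W₁ W₂ (insert y₁ {u₁}) (insert y₂ {u₂})
    fun ξ => R ξ ∧ MeetsFrom P x 1 W₁ W₂ y₁ y₂ ξ

/-- Only the meetings are kept. The second is tested with everything up to the first as past, so
each costs a maximal transition probability over its own fresh edges. -/
theorem pairLaw_extraEvent_inter_le {P : PMF (Fin d → ℤ)} (hs : ∀ x, P x = P (-x)) (x : Fin d → ℤ)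
    {V₁ V₂ W₁ W₂ u₁ u₂ : List (Fin M)} {T₁ T₂ : ℕ}
    {κ₁ κ₂ : ℝ≥0∞} (hκ₁ : HasTreeFactor hp N T₁ V₁ W₁ κ₁) (hκ₂ : HasTreeFactor hp N T₂ V₂ W₂ κ₂)
    {R : (EdgePair M → Fin d → ℤ) → Prop}
    (hR : DependsOn R (pairPrefixes {W₁ ++ u₁} {W₂ ++ u₂} : Set (EdgePair M)))
    (y₁ y₂ w₁ w₂ : List (Fin M)) :
    pairLaw M p hp P N (extraEvent P x V₁ V₂ W₁ W₂ u₁ u₂ R y₁ y₂ ∩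
        extraEvent P x V₁ V₂ W₁ W₂ u₁ u₂ R w₁ w₂)
      ≤ κ₁ * κ₂ * (gwLaw M p (gwEvent T₁ (insert w₁ (insert y₁ {u₁}))) *
          gwLaw M p (gwEvent T₂ (insert w₂ (insert y₂ {u₂})))) *
        (maxProb P ((freshEdges (insert y₁ {u₁}) w₁).card + (freshEdges (insert y₂ {u₂}) w₂).card) *
          (maxProb P ((freshEdges {u₁} y₁).card + (freshEdges {u₂} y₂).card) *
            dispLaw (EdgePair M) P {ξ | R ξ})) := by
  set E₁ : (EdgePair M → Fin d → ℤ) → Prop :=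
    fun ξ => R ξ ∧ locFst ξ (W₁ ++ y₁) = locSnd x ξ (W₂ ++ y₂) with hE₁
  set E₂ : (EdgePair M → Fin d → ℤ) → Prop :=
    fun ξ => E₁ ξ ∧ locFst ξ (W₁ ++ w₁) = locSnd x ξ (W₂ ++ w₂) with hE₂
  have ext : ∀ {F : (EdgePair M → Fin d → ℤ) → Prop} {L₁ L₂ L₁' L₂' : Finset (List (Fin M))}
      (v₁ v₂ : List (Fin M)), DependsOn F (pairPrefixes L₁ L₂ : Set (EdgePair M)) →
      L₁ ⊆ L₁' → L₂ ⊆ L₂' → v₁ ∈ L₁' → v₂ ∈ L₂' →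
      DependsOn (fun ξ => F ξ ∧ locFst ξ v₁ = locSnd x ξ v₂)
        (pairPrefixes L₁' L₂' : Set (EdgePair M)) := by
    intro F L₁ L₂ L₁' L₂' v₁ v₂ hF h₁ h₂ hv₁ hv₂ ξ ξ' h
    have e0 := hF (x := ξ) (y := ξ') fun i hi => h i (pairPrefixes_mono
      (fun v hv => ⟨v, h₁ hv, List.prefix_rfl⟩) (fun v hv => ⟨v, h₂ hv, List.prefix_rfl⟩) hi)
    have e1 := dependsOn_locFst (toFst_edges_subset (L₂ := L₂') hv₁) h
    have e2 := dependsOn_locSnd x (toSnd_edges_subset (L₁ := L₁') hv₂) h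
    simp only [e0, e1, e2]
  have im : ∀ W u y : List (Fin M), (insert y {u} : Finset (List (Fin M))).image (W ++ ·)
      = insert (W ++ y) {W ++ u} := by
    intro W u y
    rw [Finset.image_insert, Finset.image_singleton]
  have dE₁ : DependsOn E₁ (pairPrefixes (insert (W₁ ++ y₁) {W₁ ++ u₁})
      (insert (W₂ ++ y₂) {W₂ ++ u₂}) : Set (EdgePair M)) :=
    ext _ _ hR (Finset.subset_insert _ _) (Finset.subset_insert _ _)
      (Finset.mem_insert_self _ _) (Finset.mem_insert_self _ _)
  have dE₂ : DependsOn E₂ (pairPrefixes (insert (W₁ ++ w₁) (insert (W₁ ++ y₁) {W₁ ++ u₁}))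
      (insert (W₂ ++ w₂) (insert (W₂ ++ y₂) {W₂ ++ u₂})) : Set (EdgePair M)) :=
    ext _ _ dE₁ (Finset.subset_insert _ _) (Finset.subset_insert _ _)
      (Finset.mem_insert_self _ _) (Finset.mem_insert_self _ _)
  have sub : extraEvent (N := N) P x V₁ V₂ W₁ W₂ u₁ u₂ R y₁ y₂ ∩
      extraEvent P x V₁ V₂ W₁ W₂ u₁ u₂ R w₁ w₂ ⊆
      pairEvent V₁ V₂ W₁ W₂ (insert w₁ (insert y₁ {u₁})) (insert w₂ (insert y₂ {u₂})) E₂ := by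
    rintro ω ⟨⟨⟨hb₁, hy₁⟩, ⟨hb₂, hy₂⟩, hR, hm⟩, ⟨⟨-, hw₁⟩, ⟨-, hw₂⟩, -, hm'⟩⟩
    refine ⟨⟨hb₁, Finset.forall_mem_insert _ _ _ |>.2 ⟨hw₁ _ (Finset.mem_insert_self _ _), hy₁⟩⟩,
      ⟨hb₂, Finset.forall_mem_insert _ _ _ |>.2 ⟨hw₂ _ (Finset.mem_insert_self _ _), hy₂⟩⟩,
      ⟨hR, hm.1⟩, hm'.1⟩
  refine (measure_mono sub).trans ?_
  rw [pairLaw_pairEvent P hκ₁ hκ₂ (Finset.insert_nonempty _ _) (Finset.insert_nonempty _ _)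
    (measurableSet_of_dependsOn dE₂)]
  refine mul_le_mul_right ?_ _
  refine (meet_paths_le hs x _ _ dE₁ _ _).trans ?_
  rw [← im, ← im, card_freshEdges_image_append _ (Finset.insert_nonempty _ _),
    card_freshEdges_image_append _ (Finset.insert_nonempty _ _)]
  refine mul_le_mul_right ?_ _
  refine (meet_paths_le hs x _ _ hR _ _).trans (le_of_eq ?_)
  rw [← Finset.image_singleton (W₁ ++ ·), ← Finset.image_singleton (W₂ ++ ·),
    card_freshEdges_image_append _ (Finset.singleton_nonempty _),
    card_freshEdges_image_append _ (Finset.singleton_nonempty _)]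

/-- The pairs of words, where the words are `t` longer than `u₁` and `u₂`. -/
noncomputable def levelPairs (u₁ u₂ : List (Fin M)) (t : ℕ) :
    Finset (List (Fin M) × List (Fin M)) :=
  words M (u₁.length + t) ×ˢ words M (u₂.length + t)

/-- Two passes of `sum_pair_branch_le`: the later pair leaves a subtree spanned by two words, the
earlier one a single path, whence the factors `2` and `1` at `A`. The extinction time lies at least
`N` generations beyond all words, so the weight bounds apply. -/
theorem sum_pairLaw_extraEvent_inter_le (hM : ∀ k, M < k → p k = 0) {t₀ : ℕ} {A B : ℝ}
    (hW : HasWeightBounds p M t₀ A B) (hA : 0 ≤ A) (hB : 1 ≤ B) (ht₀ : t₀ < N)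
    {P : PMF (Fin d → ℤ)} (hs : ∀ x, P x = P (-x)) (x : Fin d → ℤ)
    {V₁ V₂ W₁ W₂ u₁ u₂ : List (Fin M)} {κ₁ κ₂ : ℝ≥0∞}
    (hκ₁ : HasTreeFactor hp N (2 * N - W₁.length) V₁ W₁ κ₁)
    (hκ₂ : HasTreeFactor hp N (2 * N - W₂.length) V₂ W₂ κ₂)
    (hW₁ : 0 < W₁.length) (hW₂ : 0 < W₂.length) {m : ℕ} (hm₁ : W₁.length + u₁.length = m)
    (hm₂ : W₂.length + u₂.length = m) (hmN : m ≤ N)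
    {R : (EdgePair M → Fin d → ℤ) → Prop}
    (hR : DependsOn R (pairPrefixes {W₁ ++ u₁} {W₂ ++ u₂} : Set (EdgePair M))) :
    ∑ s ∈ Finset.range (N + 1 - m), ∑ t ∈ Finset.range (N + 1 - m),
      ∑ y ∈ levelPairs u₁ u₂ s, ∑ w ∈ levelPairs u₁ u₂ t,
        pairLaw M p hp P N (extraEvent P x V₁ V₂ W₁ W₂ u₁ u₂ R y.1 y.2 ∩
          extraEvent P x V₁ V₂ W₁ W₂ u₁ u₂ R w.1 w.2)
      ≤ 2 * (pairLaw M p hp P N (pairEvent V₁ V₂ W₁ W₂ {u₁} {u₂} R) *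
        (branchBound (ENNReal.ofReal ((1 : ℕ) * A)) (ENNReal.ofReal (3 * B)) (maxProb P) N *
        branchBound (ENNReal.ofReal ((2 : ℕ) * A)) (ENNReal.ofReal (3 * B)) (maxProb P) N)) := by
  set T₁ := 2 * N - W₁.length with hT₁
  set T₂ := 2 * N - W₂.length with hT₂
  set B₁ := branchBound (ENNReal.ofReal ((1 : ℕ) * A)) (ENNReal.ofReal (3 * B)) (maxProb P) N
  set B₂ := branchBound (ENNReal.ofReal ((2 : ℕ) * A)) (ENNReal.ofReal (3 * B)) (maxProb P) N
  set μR := dispLaw (EdgePair M) P {ξ | R ξ} with hμR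
  refine (sum_sum_le_two_mul (fun s t => ?_) _).trans ?_
  · rw [Finset.sum_comm]
    simp_rw [Set.inter_comm]
  refine mul_le_mul_right ?_ _
  have hc : ∀ u y : List (Fin M), (insert y {u} : Finset (List (Fin M))).card ≤ 2 := fun u y =>
    (Finset.card_insert_le _ _).trans (by simp)
  have step : ∀ s ∈ Finset.range (N + 1 - m), ∑ k ∈ Finset.range (N + 1 - m - s),
      ∑ y ∈ levelPairs u₁ u₂ s, ∑ w ∈ levelPairs u₁ u₂ (s + k),
        pairLaw M p hp P N (extraEvent P x V₁ V₂ W₁ W₂ u₁ u₂ R y.1 y.2 ∩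
          extraEvent P x V₁ V₂ W₁ W₂ u₁ u₂ R w.1 w.2)
      ≤ κ₁ * κ₂ * μR * B₂ * ∑ y ∈ levelPairs u₁ u₂ s,
        gwLaw M p (gwEvent T₁ (insert y.1 {u₁})) * gwLaw M p (gwEvent T₂ (insert y.2 {u₂})) *
          maxProb P ((freshEdges {u₁} y.1).card + (freshEdges {u₂} y.2).card) := by
    intro s hsr
    rw [Finset.mem_range] at hsr
    rw [Finset.sum_comm, Finset.mul_sum]
    refine Finset.sum_le_sum fun y hy => ?_
    rw [levelPairs, Finset.mem_product, mem_words, mem_words] at hy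
    have h := sum_pair_branch_le hM hp hW hA hB (T₁ := T₁) (T₂ := T₂) (c := 2)
      (L₁ := insert y.1 {u₁}) (L₂ := insert y.2 {u₂}) (Finset.insert_nonempty _ _)
      (Finset.insert_nonempty _ _) le_rfl (hc _ _) (hc _ _) (ℓ₁ := u₁.length + s)
      (ℓ₂ := u₂.length + s) (n := N) (r := N + 1 - m - s)
      (by simp [hy.1]) (by simp [hy.2]) (by omega) (by omega) (by omega) (by omega) (by omega)
      (maxProb_antitone P)
    calc _ ≤ ∑ k ∈ Finset.range (N + 1 - m - s), ∑ w₁ ∈ words M (u₁.length + s + k),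
          ∑ w₂ ∈ words M (u₂.length + s + k), κ₁ * κ₂ *
            (maxProb P ((freshEdges {u₁} y.1).card + (freshEdges {u₂} y.2).card) * μR) *
            (gwLaw M p (gwEvent T₁ (insert w₁ (insert y.1 {u₁}))) *
              gwLaw M p (gwEvent T₂ (insert w₂ (insert y.2 {u₂}))) *
              maxProb P ((freshEdges (insert y.1 {u₁}) w₁).card +
                (freshEdges (insert y.2 {u₂}) w₂).card)) := by
          refine Finset.sum_le_sum fun k _ => ?_
          rw [levelPairs, Finset.sum_product, add_assoc, add_assoc]
          refine Finset.sum_le_sum fun w₁ _ => Finset.sum_le_sum fun w₂ _ => ?_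
          refine (pairLaw_extraEvent_inter_le hs x hκ₁ hκ₂ hR _ _ _ _).trans (le_of_eq ?_)
          ring
      _ ≤ κ₁ * κ₂ * (maxProb P ((freshEdges {u₁} y.1).card + (freshEdges {u₂} y.2).card) * μR) *
          (gwLaw M p (gwEvent T₁ (insert y.1 {u₁})) * gwLaw M p (gwEvent T₂ (insert y.2 {u₂})) *
            B₂) := by
          simp_rw [← Finset.mul_sum]
          exact mul_le_mul_right h _
      _ = _ := by ring
  refine (Finset.sum_le_sum step).trans ?_
  rw [← Finset.mul_sum, pairLaw_pairEvent P hκ₁ hκ₂ (Finset.singleton_nonempty _)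
    (Finset.singleton_nonempty _) (measurableSet_of_dependsOn hR)]
  have h := sum_pair_branch_le hM hp hW hA hB (T₁ := T₁) (T₂ := T₂) (c := 1)
      (L₁ := {u₁}) (L₂ := {u₂}) (Finset.singleton_nonempty _)
      (Finset.singleton_nonempty _) (by norm_num) (by simp) (by simp) (ℓ₁ := u₁.length)
      (ℓ₂ := u₂.length) (n := N) (r := N + 1 - m)
      (by simp) (by simp) (by omega) (by omega) (by omega) (by omega) (by omega)
      (maxProb_antitone P)
  simp_rw [levelPairs, Finset.sum_product]
  refine (mul_le_mul_right h _).trans (le_of_eq ?_)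
  ring

end SecondMoment


/-! ### Forks off a single path. -/

section Forks

variable {M : ℕ}

theorem mem_forks {u y : List (Fin M)} {s n : ℕ} :
    y ∈ forks u s n ↔ y.length = n ∧ u.take s <+: y ∧ ¬ u.take (s + 1) <+: y := by
  rw [forks, Finset.mem_filter, mem_words]

theorem eq_of_mem_forks {u y : List (Fin M)} {s s' n n' : ℕ} (h : y ∈ forks u s n)
    (h' : y ∈ forks u s' n') : s = s' ∧ n = n' := by
  rw [mem_forks] at h h'
  have key : ∀ {i j : ℕ}, u.take j <+: y → ¬ u.take (i + 1) <+: y → j ≤ i := by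
    intro i j h1 h2
    by_contra hij
    exact h2 ((List.take_prefix_take_left (by omega)).trans h1)
  exact ⟨le_antisymm (key h.2.1 h'.2.2) (key h'.2.1 h.2.2), h.1.symm.trans h'.1⟩

/-- The pairs of vertices branching off `a₁` and `a₂` before `u₁` and `u₂`, and `t` generations
further than `u₁` and `u₂`. -/
noncomputable def forkPairs (u₁ u₂ : List (Fin M)) (a₁ a₂ t : ℕ) :
    Finset (List (Fin M) × List (Fin M)) :=
  forks u₁ (u₁.length - a₁) (u₁.length + t) ×ˢ forks u₂ (u₂.length - a₂) (u₂.length + t)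

/-- The fork heights and the word length determine `a₁`, `a₂` and `t`, so no pair is counted twice.
-/
theorem sum_forkPairs_le {u₁ u₂ : List (Fin M)} {A S : ℕ} (h₁ : S ≤ u₁.length)
    (h₂ : S ≤ u₂.length) {I : Finset (List (Fin M) × List (Fin M))}
    (hI : ∀ a₂ ∈ Finset.Icc A S, ∀ a₁ ∈ Finset.Icc A a₂, ∀ t ∈ Finset.range a₂,
      forkPairs u₁ u₂ a₁ a₂ t ⊆ I) (f : List (Fin M) × List (Fin M) → ℝ≥0∞) :
    ∑ a₂ ∈ Finset.Icc A S, ∑ a₁ ∈ Finset.Icc A a₂, ∑ t ∈ Finset.range a₂,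
      ∑ y ∈ forkPairs u₁ u₂ a₁ a₂ t, f y ≤ ∑ y ∈ I, f y := by
  classical
  set Q : Finset ((_ : ℕ) × (ℕ × ℕ)) :=
    (Finset.Icc A S).sigma fun a₂ => Finset.Icc A a₂ ×ˢ Finset.range a₂ with hQ
  have e : ∑ a₂ ∈ Finset.Icc A S, ∑ a₁ ∈ Finset.Icc A a₂, ∑ t ∈ Finset.range a₂,
      ∑ y ∈ forkPairs u₁ u₂ a₁ a₂ t, f y
      = ∑ q ∈ Q, ∑ y ∈ forkPairs u₁ u₂ q.2.1 q.1 q.2.2, f y := by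
    rw [hQ, Finset.sum_sigma]
    refine Finset.sum_congr rfl fun a₂ _ => ?_
    rw [Finset.sum_product]
  have hd : (Q : Set ((_ : ℕ) × (ℕ × ℕ))).PairwiseDisjoint
      fun q => forkPairs u₁ u₂ q.2.1 q.1 q.2.2 := by
    rintro ⟨a₂, a₁, t⟩ hq ⟨a₂', a₁', t'⟩ hq' hne
    rw [Function.onFun, Finset.disjoint_left]
    intro y hy hy'
    simp only [forkPairs, Finset.mem_product] at hy hy'
    simp only [hQ, Finset.coe_sigma, Set.mem_sigma_iff, Finset.mem_coe, Finset.mem_product,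
      Finset.mem_Icc, Finset.mem_range] at hq hq'
    have e1 := eq_of_mem_forks hy.1 hy'.1
    have e2 := eq_of_mem_forks hy.2 hy'.2
    obtain rfl : a₁ = a₁' := by omega
    obtain rfl : a₂ = a₂' := by omega
    obtain rfl : t = t' := by omega
    exact hne rfl
  rw [e, ← Finset.sum_biUnion hd]
  refine Finset.sum_le_sum_of_subset (Finset.biUnion_subset.2 ?_)
  rintro ⟨a₂, a₁, t⟩ hq
  simp only [hQ, Finset.mem_sigma, Finset.mem_product] at hq
  exact hI _ hq.1 _ hq.2.1 _ hq.2.2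

/-- The weight ratio is at least `σ²/2`, and `hg` keeps the generation mean above `1/2`. -/
theorem sigma_sq_le_sum_forks {p : PMF ℕ} (hM : ∀ k, M < k → p k = 0) (hp : IsCritical p) {t₀ : ℕ}
    {A B : ℝ} (hW : HasWeightBounds p M t₀ A B)
    (hσ : ∀ t, t₀ ≤ t → sigma p ^ 2 / 2 * genDeriv p M 1 (gwProb p t (∅ : Finset (List (Fin M))))
      ≤ genDeriv p M 2 (gwProb p t (∅ : Finset (List (Fin M)))))
    {T a t : ℕ} {u : List (Fin M)} (ha : 0 < a) (hau : a ≤ u.length)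
    (hT : t₀ + u.length + t ≤ T)
    (hg : ((a + t : ℕ) : ℝ) * ((1 + sigma p ^ 2) *
      (1 - gwProb p (T - u.length - t) (∅ : Finset (List (Fin M))))) ≤ 1 / 2) :
    ENNReal.ofReal (sigma p ^ 2 / 4) * gwLaw M p (gwEvent T ({u} : Finset (List (Fin M))))
      ≤ ∑ w ∈ forks u (u.length - a) (u.length + t), gwLaw M p (gwEvent T (insert w {u})) := by
  have hge : t₀ ≤ T - (u.length - a) - 1 := by omega
  have h := le_sum_forks (p := p) hM (T := T) (u := u) (s := u.length - a) (n := u.length + t)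
    (by omega) (by omega) (by omega) (A := sigma p ^ 2 / 2) (hW _ hge _ rfl).2.1.1 (hσ _ hge)
  refine le_trans (mul_le_mul_left (ENNReal.ofReal_le_ofReal ?_) _) h
  have h1 := le_generationMean (p := p) hM hp (T - u.length - t)
    (u.length + t - (u.length - a) - 1)
  rw [show T - u.length - t + (u.length + t - (u.length - a) - 1) = T - (u.length - a) - 1 by omega,
    show ((u.length + t - (u.length - a) - 1 : ℕ) : ℝ) + 1 = ((a + t : ℕ) : ℝ) by
      rw [show a + t = u.length + t - (u.length - a) - 1 + 1 by omega]
      push_cast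
      ring] at h1
  nlinarith [sq_nonneg (sigma p)]

end Forks

/-! ### The contribution of one choice of fork distances. -/

section FirstMoment

variable {M N : ℕ} [NeZero M] {p : PMF ℕ} {hp : IsCritical p}

/-- The spatial cost is the same for all pairs with these fork distances, so it factors out and each
tree contributes its weight `w`. -/
theorem le_sum_pairLaw_extraEvent {P : PMF (Fin 6 → ℤ)} (hP : IsAdmissibleStep P) {n₀ : ℕ}
    (h₁ : IsUpperThreshold P n₀) (h₂ : IsLocalThreshold P (1 / 2) 1 n₀)
    (h₆ : IsLocalThreshold P (1 / 2) 6 n₀) (x : Fin 6 → ℤ) {V₁ V₂ W₁ W₂ u₁ u₂ : List (Fin M)}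
    {T₁ T₂ : ℕ} {κ₁ κ₂ : ℝ≥0∞} (hκ₁ : HasTreeFactor hp N T₁ V₁ W₁ κ₁)
    (hκ₂ : HasTreeFactor hp N T₂ V₂ W₂ κ₂) {R : (EdgePair M → Fin 6 → ℤ) → Prop}
    (hR : DependsOn R (pairPrefixes {W₁} {W₂} : Set (EdgePair M)))
    {a₁ a₂ t : ℕ} (ha₁ : 0 < a₁) (hn : n₀ ≤ a₁) (ha : a₁ ≤ a₂) (hta : t < a₂)
    (hu₁ : 128 * a₂ ≤ u₁.length) (hu₂ : 128 * a₂ ≤ u₂.length) {w : ℝ} (hw : 0 ≤ w)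
    (hw₁ : ENNReal.ofReal w * gwLaw M p (gwEvent T₁ ({u₁} : Finset (List (Fin M))))
      ≤ ∑ y ∈ forks u₁ (u₁.length - a₁) (u₁.length + t), gwLaw M p (gwEvent T₁ (insert y {u₁})))
    (hw₂ : ENNReal.ofReal w * gwLaw M p (gwEvent T₂ ({u₂} : Finset (List (Fin M))))
      ≤ ∑ y ∈ forks u₂ (u₂.length - a₂) (u₂.length + t), gwLaw M p (gwEvent T₂ (insert y {u₂}))) :
    ENNReal.ofReal (w ^ 2 * (spatialConst / scaleD P ^ 6) * (1 / ((a₂ + t : ℕ) : ℝ) ^ 3)) *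
        pairLaw M p hp P N (pairEvent V₁ V₂ W₁ W₂ {u₁} {u₂}
          fun ξ => R ξ ∧ MeetsFrom P x (1 / 2) W₁ W₂ u₁ u₂ ξ)
      ≤ ∑ y ∈ forkPairs u₁ u₂ a₁ a₂ t, pairLaw M p hp P N
          (extraEvent P x V₁ V₂ W₁ W₂ u₁ u₂
            (fun ξ => R ξ ∧ MeetsFrom P x (1 / 2) W₁ W₂ u₁ u₂ ξ) y.1 y.2) := by
  set E : (EdgePair M → Fin 6 → ℤ) → Prop :=
    fun ξ => R ξ ∧ MeetsFrom P x (1 / 2) W₁ W₂ u₁ u₂ ξ with hE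
  have mE : MeasurableSet {ξ | E ξ} :=
    (measurableSet_of_dependsOn hR).inter (measurableSet_meetsFrom P x _ _ _ _ _)
  set c := spatialConst / (scaleD P ^ 6 * ((a₂ + t : ℕ) : ℝ) ^ 3) with hc
  have hc0 : 0 ≤ c := div_nonneg spatialConst_pos.le (by have := hP.scaleD_pos; positivity)
  -- Since `a₁ + t ≤ 2 a₂ ≤ u.length / 64`, the new piece costs at most `4 · (1/8)√u.length`. Added
  -- to the `1/2` required in `ℐ'` this is exactly the factor `1` of intersecting well, which is why
  -- `ℐ'` asks for half the distance.
  have hsqrt : ∀ {u y : List (Fin M)}, 128 * a₂ ≤ u.length → y.length = u.length + t →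
      1 / 2 * √(u.length : ℝ) + 4 * √((a₁ + t : ℕ) : ℝ) ≤ 1 * √(y.length : ℝ) := by
    intro u y hu hy
    have h1 : √(u.length : ℝ) ≤ √(y.length : ℝ) := Real.sqrt_le_sqrt (by exact_mod_cast (by omega))
    have h2 : √((a₁ + t : ℕ) : ℝ) ≤ 1 / 8 * √(u.length : ℝ) := by
      rw [← Real.sqrt_sq (show (0 : ℝ) ≤ 1 / 8 by norm_num), ← Real.sqrt_mul (by norm_num)]
      refine Real.sqrt_le_sqrt ?_
      have : 64 * ((a₁ + t : ℕ) : ℝ) ≤ (u.length : ℝ) := by exact_mod_cast (by omega)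
      linarith
    linarith
  have spatial : ∀ y ∈ forkPairs u₁ u₂ a₁ a₂ t,
      ENNReal.ofReal c * dispLaw (EdgePair M) P {ξ | E ξ}
        ≤ dispLaw (EdgePair M) P {ξ | E ξ ∧ MeetsFrom P x 1 W₁ W₂ y.1 y.2 ξ} := by
    intro y hy
    obtain ⟨hy₁, hy₂⟩ := Finset.mem_product.1 hy
    obtain ⟨l₁, f₁, g₁⟩ := mem_forks.1 hy₁
    obtain ⟨l₂, f₂, g₂⟩ := mem_forks.1 hy₂
    have e₁ : u₁.length - a₁ + a₁ = u₁.length := by omega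
    have e₂ : u₂.length - a₂ + a₂ = u₂.length := by omega
    have tk : ∀ (W u : List (Fin M)) (s : ℕ), (W ++ u).take (W.length + s) = W ++ u.take s :=
      fun W u s => by rw [List.take_length_add_append]
    have h := hP.paths_lower h₁ h₂ h₆ (β₁ := u₁.length - a₁) (β₂ := u₂.length - a₂) (t := t)
      ha₁ hn ha
      (by omega) (by omega) (U₁ := W₁ ++ u₁) (U₂ := W₂ ++ u₂) (Z₁ := W₁) (Z₂ := W₂)
      (Y₁ := W₁ ++ y.1) (Y₂ := W₂ ++ y.2) (List.prefix_append _ _) (List.prefix_append _ _)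
      (by rw [List.length_append]; omega) (by rw [List.length_append]; omega)
      (by rw [tk]; exact (List.prefix_append_right_inj _).2 f₁)
      (by rw [add_assoc, tk]; exact fun h => g₁ ((List.prefix_append_right_inj _).1 h))
      (by rw [tk]; exact (List.prefix_append_right_inj _).2 f₂)
      (by rw [add_assoc, tk]; exact fun h => g₂ ((List.prefix_append_right_inj _).1 h))
      (by rw [List.length_append, List.length_append, l₁, add_assoc])
      (by rw [List.length_append, List.length_append, l₂, add_assoc]) x hR
      (ρ₁ := 1 * √(y.1.length : ℝ)) (ρ₂ := 1 * √(y.2.length : ℝ))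
      (by rw [e₁]; exact hsqrt hu₁ l₁) (by rw [e₂]; exact hsqrt hu₂ l₂)
    rw [e₁, e₂] at h
    exact h
  rw [pairLaw_pairEvent P hκ₁ hκ₂ (Finset.singleton_nonempty _) (Finset.singleton_nonempty _) mE]
  have hterm : ∀ y ∈ forkPairs u₁ u₂ a₁ a₂ t,
      κ₁ * κ₂ * (ENNReal.ofReal c * dispLaw (EdgePair M) P {ξ | E ξ}) *
        (gwLaw M p (gwEvent T₁ (insert y.1 {u₁})) * gwLaw M p (gwEvent T₂ (insert y.2 {u₂})))
      ≤ pairLaw M p hp P N (extraEvent P x V₁ V₂ W₁ W₂ u₁ u₂ E y.1 y.2) := by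
    intro y hy
    have mE' : MeasurableSet {ξ | E ξ ∧ MeetsFrom P x 1 W₁ W₂ y.1 y.2 ξ} :=
      mE.inter (measurableSet_meetsFrom P x _ _ _ _ _)
    rw [extraEvent, pairLaw_pairEvent P hκ₁ hκ₂ (Finset.insert_nonempty _ _)
      (Finset.insert_nonempty _ _) mE']
    refine le_trans (le_of_eq ?_) (mul_le_mul_right (spatial y hy) _)
    ring
  refine le_trans ?_ (Finset.sum_le_sum hterm)
  rw [← Finset.mul_sum, forkPairs, Finset.sum_product]
  simp_rw [← Finset.mul_sum]
  rw [← Finset.sum_mul]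
  refine le_trans (le_of_eq ?_) (mul_le_mul_right (mul_le_mul' hw₁ hw₂) _)
  rw [show w ^ 2 * (spatialConst / scaleD P ^ 6) * (1 / ((a₂ + t : ℕ) : ℝ) ^ 3) = w * w * c by
    rw [hc]
    ring,
    ENNReal.ofReal_mul (by positivity), ENNReal.ofReal_mul hw]
  ring

end FirstMoment


/-- A second moment bound for the probability that a random number is at least half of its
expectation. -/
theorem half_le_of_moments {Ω : Type*} [MeasurableSpace Ω] (μ : Measure Ω) [IsProbabilityMeasure μ]
    {Y : Ω → ℕ} (hY : Measurable fun ω => (Y ω : ℝ≥0∞)) {θ S : ℝ} (hθ : 0 < θ) (hS : 0 < S)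
    (h₁ : ENNReal.ofReal θ ≤ ∫⁻ ω, (Y ω : ℝ≥0∞) ∂μ)
    (h₂ : ∫⁻ ω, (Y ω : ℝ≥0∞) ^ 2 ∂μ ≤ ENNReal.ofReal S) :
    ENNReal.ofReal (θ ^ 2 / (4 * S)) ≤ μ {ω | θ / 2 ≤ (Y ω : ℝ)} := by
  set A := {ω | θ / 2 ≤ (Y ω : ℝ)} with hA
  have hAe : A = {ω | ENNReal.ofReal (θ / 2) ≤ (Y ω : ℝ≥0∞)} := by
    ext ω
    rw [hA, Set.mem_ofPred_eq, Set.mem_ofPred_eq, ← ENNReal.ofReal_natCast,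
      ENNReal.ofReal_le_ofReal_iff (by positivity)]
  have hAm : MeasurableSet A := hAe ▸ measurableSet_le measurable_const hY
  -- Off `A` the first term suffices; on `A` the other two do, by completing a square. Integrated,
  -- this reads `θ ≤ θ/2 + θ/4 + (S/θ) μ A`.
  have pt : ∀ ω, (Y ω : ℝ≥0∞) ≤ ENNReal.ofReal (θ / 2) + ENNReal.ofReal (θ / (4 * S)) * (Y ω) ^ 2
      + ENNReal.ofReal (S / θ) * A.indicator 1 ω := by
    intro ω
    rw [← ENNReal.ofReal_natCast, ← ENNReal.ofReal_pow (by positivity),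
      ← ENNReal.ofReal_mul (by positivity), ← ENNReal.ofReal_add (by positivity) (by positivity)]
    by_cases hω : ω ∈ A
    · rw [Set.indicator_of_mem hω, Pi.one_apply, mul_one,
        ← ENNReal.ofReal_add (by positivity) (by positivity)]
      refine ENNReal.ofReal_le_ofReal ?_
      have e : θ / (4 * S) * (Y ω : ℝ) ^ 2 + S / θ - Y ω
          = (θ * Y ω - 2 * S) ^ 2 / (4 * S * θ) := by
        field_simp
        ring
      have : 0 ≤ (θ * Y ω - 2 * S) ^ 2 / (4 * S * θ) := by positivity
      linarith
    · rw [Set.indicator_of_notMem hω, mul_zero, add_zero]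
      refine ENNReal.ofReal_le_ofReal ?_
      have : (Y ω : ℝ) < θ / 2 := not_le.1 hω
      have : 0 ≤ θ / (4 * S) * (Y ω : ℝ) ^ 2 := by positivity
      linarith
  have h3 : ENNReal.ofReal θ ≤ ENNReal.ofReal (θ / 2) + ENNReal.ofReal (θ / (4 * S)) *
      ENNReal.ofReal S + ENNReal.ofReal (S / θ) * μ A := by
    refine h₁.trans ((lintegral_mono pt).trans ?_)
    rw [lintegral_add_right _ ((measurable_one.indicator hAm).const_mul _),
      lintegral_add_left measurable_const, lintegral_const_mul _ (hY.pow_const 2),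
      lintegral_const_mul _ (measurable_one.indicator hAm), lintegral_indicator_one hAm,
      lintegral_const, measure_univ, mul_one]
    gcongr
  have hμ : μ A = ENNReal.ofReal (μ.real A) := (ofReal_measureReal (measure_ne_top μ A)).symm
  rw [hμ] at h3 ⊢
  have hr : 0 ≤ μ.real A := measureReal_nonneg
  rw [← ENNReal.ofReal_mul (by positivity), ← ENNReal.ofReal_mul (by positivity),
    ← ENNReal.ofReal_add (by positivity) (by positivity),
    ← ENNReal.ofReal_add (by positivity) (by positivity),
    ENNReal.ofReal_le_ofReal_iff (by positivity)] at h3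
  refine ENNReal.ofReal_le_ofReal ?_
  have e1 : θ / (4 * S) * S = θ / 4 := by field_simp
  rw [e1] at h3
  have h4 : θ / 4 ≤ S / θ * μ.real A := by linarith
  have h5 : θ / S * (θ / 4) ≤ θ / S * (S / θ * μ.real A) :=
    mul_le_mul_of_nonneg_left h4 (by positivity)
  have e2 : θ / S * (S / θ * μ.real A) = μ.real A := by field_simp
  have e3 : θ / S * (θ / 4) = θ ^ 2 / (4 * S) := by field_simp
  linarith

/-! ### The number of good extra intersections as a finite sum of indicators. -/

section Counting

variable {M d N : ℕ}

open Classical in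
/-- The pairs of words that satisfy the deterministic requirements on good extra intersections. -/
noncomputable def goodPairs (N nstar : ℕ) (W₁ W₂ u₁ u₂ : List (Fin M)) :
    Finset (List (Fin M) × List (Fin M)) :=
  ((Finset.range (N + 1 - (W₁ ++ u₁).length)).biUnion (levelPairs u₁ u₂)).filter fun y =>
    BranchesWell N nstar W₁ u₁ y.1 ∧ BranchesWell N nstar W₂ u₂ y.2 ∧
      (W₁ ++ y.1).length = (W₂ ++ y.2).length ∧ (W₁ ++ y.1).length ≤ N

theorem mem_goodPairs {nstar : ℕ} {W₁ W₂ u₁ u₂ : List (Fin M)}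
    (h : (W₁ ++ u₁).length = (W₂ ++ u₂).length) {y : List (Fin M) × List (Fin M)} :
    y ∈ goodPairs N nstar W₁ W₂ u₁ u₂ ↔ BranchesWell N nstar W₁ u₁ y.1 ∧
      BranchesWell N nstar W₂ u₂ y.2 ∧ (W₁ ++ y.1).length = (W₂ ++ y.2).length ∧
      (W₁ ++ y.1).length ≤ N := by
  classical
  rw [goodPairs, Finset.mem_filter, and_iff_right_iff_imp]
  rintro ⟨⟨-, -, h1⟩, ⟨-, -, h2⟩, h3, h4⟩
  simp only [List.length_append] at h h1 h2 h3 h4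
  refine Finset.mem_biUnion.2 ⟨y.1.length - u₁.length, ?_, ?_⟩
  · rw [Finset.mem_range, List.length_append]
    omega
  · rw [levelPairs, Finset.mem_product, mem_words, mem_words]
    omega

theorem sum_goodPairs_le (nstar : ℕ) (W₁ W₂ u₁ u₂ : List (Fin M))
    (f : List (Fin M) × List (Fin M) → ℝ≥0∞) :
    ∑ y ∈ goodPairs N nstar W₁ W₂ u₁ u₂, f y
      ≤ ∑ t ∈ Finset.range (N + 1 - (W₁ ++ u₁).length), ∑ y ∈ levelPairs u₁ u₂ t, f y := by
  classical
  rw [← Finset.sum_biUnion]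
  · refine Finset.sum_le_sum_of_subset ?_
    rw [goodPairs]
    exact Finset.filter_subset _ _
  · intro s _ t _ hst
    rw [Function.onFun, Finset.disjoint_left]
    intro y hy hy'
    rw [levelPairs, Finset.mem_product, mem_words, mem_words] at hy hy'
    omega

theorem forkPairs_subset_goodPairs {nstar : ℕ} {W₁ W₂ u₁ u₂ : List (Fin M)}
    (h : (W₁ ++ u₁).length = (W₂ ++ u₂).length) {a₁ a₂ t : ℕ} (h₁ : nstar ≤ a₁) (h₂ : nstar ≤ a₂)
    (ha₁ : 0 < a₁) (ha₂ : 0 < a₂) (hu₁ : a₁ ≤ u₁.length) (hu₂ : a₂ ≤ u₂.length)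
    (hN₁ : (9 / 12 : ℝ) * N + a₁ ≤ (W₁ ++ u₁).length)
    (hN₂ : (9 / 12 : ℝ) * N + a₂ ≤ (W₂ ++ u₂).length) (ht : (W₁ ++ u₁).length + t ≤ N) :
    forkPairs u₁ u₂ a₁ a₂ t ⊆ goodPairs N nstar W₁ W₂ u₁ u₂ := by
  have key : ∀ {W u y : List (Fin M)} {a : ℕ}, nstar ≤ a → 0 < a → a ≤ u.length →
      (9 / 12 : ℝ) * N + a ≤ (W ++ u).length → y ∈ forks u (u.length - a) (u.length + t) →
      BranchesWell N nstar W u y := by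
    intro W u y a hna ha hau hN hy
    obtain ⟨hl, h1, h2⟩ := mem_forks.1 hy
    have tk : ∀ s : ℕ, (W ++ u).take (W.length + s) = W ++ u.take s := fun s => by
      rw [List.take_length_add_append]
    -- A word that forks off `u` before its end cannot extend `u`, so this condition is vacuous.
    refine ⟨fun h => absurd ((List.take_prefix _ _).trans ((List.prefix_append_right_inj _).1 h))
      h2,
      ⟨W.length + (u.length - a), ?_, ?_, ?_, ?_⟩, ?_⟩
    · rw [List.length_append] at hN
      push_cast [Nat.cast_sub hau] at hN ⊢
      linarith
    · rw [List.length_append]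
      omega
    · rw [tk]
      exact (List.prefix_append_right_inj _).2 h1
    · rw [add_assoc, tk]
      exact fun h => h2 ((List.prefix_append_right_inj _).1 h)
    · rw [List.length_append, List.length_append]
      omega
  intro y hy
  obtain ⟨hy₁, hy₂⟩ := Finset.mem_product.1 hy
  rw [mem_goodPairs h]
  refine ⟨key h₁ ha₁ hu₁ hN₁ hy₁, key h₂ ha₂ hu₂ hN₂ hy₂, ?_, ?_⟩
  · have e₁ := (mem_forks.1 hy₁).1
    have e₂ := (mem_forks.1 hy₂).1
    simp only [List.length_append] at h ⊢
    omega
  · have e₁ := (mem_forks.1 hy₁).1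
    simp only [List.length_append] at ht ⊢
    omega

/-- The deterministic requirements in the definition of `eventIW`. -/
def HeightsGood (N : ℕ) (Z₁ Z₂ U₁ U₂ : List (Fin M)) : Prop :=
  (5 / 6 : ℝ) * N ≤ U₁.length ∧ (U₁.length : ℝ) ≤ (11 / 12) * N ∧ U₁.length = U₂.length ∧
    ((1 / 2 : ℝ) * N ≤ Z₁.length ∧ (Z₁.length : ℝ) ≤ (4 / 6) * N) ∧
    ((1 / 2 : ℝ) * N ≤ Z₂.length ∧ (Z₂.length : ℝ) ≤ (4 / 6) * N)

variable {P : PMF (Fin d → ℤ)} {x : Fin d → ℤ} {Z₁ Z₂ v₁ v₂ u₁ u₂ : List (Fin M)}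
  {a₁ b₁ a₂ b₂ : Fin M}

theorem eventIW_eq (h₁ : a₁ ≠ b₁) (h₂ : a₂ ≠ b₂)
    (hh : HeightsGood N Z₁ Z₂ (Z₁ ++ [a₁] ++ u₁) (Z₂ ++ [a₂] ++ u₂)) :
    eventIW N P x (Z₁ ++ b₁ :: v₁) (Z₂ ++ b₂ :: v₂) (Z₁ ++ [a₁] ++ u₁) (Z₂ ++ [a₂] ++ u₂)
      = pairEvent (Z₁ ++ b₁ :: v₁) (Z₂ ++ b₂ :: v₂) (Z₁ ++ [a₁]) (Z₂ ++ [a₂]) {u₁} {u₂}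
        fun ξ => Anchored P x Z₁ Z₂ ξ ∧
          MeetsFrom P x (1 / 2) (Z₁ ++ [a₁]) (Z₂ ++ [a₂]) u₁ u₂ ξ := by
  ext ω
  rw [mem_eventIW_iff h₁ h₂]
  exact and_iff_left hh

/-- All random conditions are gathered in `extraEvent` and all deterministic ones in the finite
index set; words relative to `Z⁺` parametrise the pairs injectively. -/
theorem ncard_goodExtra {nstar : ℕ} (h₁ : a₁ ≠ b₁) (h₂ : a₂ ≠ b₂)
    (hh : HeightsGood N Z₁ Z₂ (Z₁ ++ [a₁] ++ u₁) (Z₂ ++ [a₂] ++ u₂))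
    (ω : WalkSample M d N × WalkSample M d N) :
    ((goodExtra nstar P x (Z₁ ++ b₁ :: v₁) (Z₂ ++ b₂ :: v₂) (Z₁ ++ [a₁] ++ u₁)
        (Z₂ ++ [a₂] ++ u₂) ω).ncard : ℝ≥0∞)
      = ∑ y ∈ goodPairs N nstar (Z₁ ++ [a₁]) (Z₂ ++ [a₂]) u₁ u₂,
        (extraEvent (N := N) P x (Z₁ ++ b₁ :: v₁) (Z₂ ++ b₂ :: v₂) (Z₁ ++ [a₁]) (Z₂ ++ [a₂]) u₁ u₂
          (fun ξ => Anchored P x Z₁ Z₂ ξ ∧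
            MeetsFrom P x (1 / 2) (Z₁ ++ [a₁]) (Z₂ ++ [a₂]) u₁ u₂ ξ) y.1 y.2).indicator 1 ω := by
  classical
  set G : List (Fin M) × List (Fin M) → Set (WalkSample M d N × WalkSample M d N) := fun y =>
    extraEvent P x (Z₁ ++ b₁ :: v₁) (Z₂ ++ b₂ :: v₂) (Z₁ ++ [a₁]) (Z₂ ++ [a₂]) u₁ u₂
      (fun ξ => Anchored P x Z₁ Z₂ ξ ∧
        MeetsFrom P x (1 / 2) (Z₁ ++ [a₁]) (Z₂ ++ [a₂]) u₁ u₂ ξ) y.1 y.2 with hG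
  set φ : List (Fin M) × List (Fin M) → List (Fin M) × List (Fin M) := fun y =>
    (Z₁ ++ [a₁] ++ y.1, Z₂ ++ [a₂] ++ y.2) with hφ
  have hφi : Function.Injective φ := fun y w h => Prod.ext
    (List.append_cancel_left (Prod.ext_iff.1 h).1) (List.append_cancel_left (Prod.ext_iff.1 h).2)
  have hmem : ∀ y : List (Fin M) × List (Fin M), ω ∈ G y ↔
      ω ∈ eventIW N P x (Z₁ ++ b₁ :: v₁) (Z₂ ++ b₂ :: v₂) (Z₁ ++ [a₁] ++ u₁) (Z₂ ++ [a₂] ++ u₂) ∧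
        ω.1.1 ∈ treeEvent N (Z₁ ++ b₁ :: v₁) (Z₁ ++ [a₁]) {y.1} ∧
        ω.2.1 ∈ treeEvent N (Z₂ ++ b₂ :: v₂) (Z₂ ++ [a₂]) {y.2} ∧
        MeetsFrom P x 1 (Z₁ ++ [a₁]) (Z₂ ++ [a₂]) y.1 y.2 (jointDisp ω) := by
    intro y
    rw [eventIW_eq h₁ h₂ hh]
    simp only [hG, extraEvent, pairEvent, treeEvent, Set.mem_ofPred_eq, Finset.forall_mem_insert,
      Finset.mem_singleton, forall_eq]
    tauto
  have hset : goodExtra nstar P x (Z₁ ++ b₁ :: v₁) (Z₂ ++ b₂ :: v₂) (Z₁ ++ [a₁] ++ u₁)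
      (Z₂ ++ [a₂] ++ u₂) ω = (((goodPairs N nstar (Z₁ ++ [a₁]) (Z₂ ++ [a₂]) u₁ u₂).filter
        fun y => ω ∈ G y).image φ : Finset _) := by
    ext Y
    rw [mem_goodExtra_iff h₁ h₂, Finset.mem_coe, Finset.mem_image]
    constructor
    · rintro ⟨y₁, y₂, rfl, hω, hb⟩
      exact ⟨(y₁, y₂), Finset.mem_filter.2 ⟨(mem_goodPairs hh.2.2.1).2 hb, (hmem _).2 hω⟩, rfl⟩
    · rintro ⟨y, hy, rfl⟩
      rw [Finset.mem_filter, mem_goodPairs hh.2.2.1, hmem] at hy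
      exact ⟨y.1, y.2, rfl, hy.2, hy.1⟩
  rw [hset, Set.ncard_coe_finset, Finset.card_image_of_injective _ hφi, Finset.card_filter]
  push_cast
  refine Finset.sum_congr rfl fun y _ => ?_
  rw [Set.indicator_apply]
  split_ifs <;> simp

end Counting

/-! ### Moments of sums of indicators under conditioning. -/

section Conditional

/-- Moments of a sum of indicators of events contained in the event we condition on. -/
theorem lintegral_cond_sum_indicator {Ω ι : Type*} [MeasurableSpace Ω] (μ : Measure Ω) {s : Set Ω}
    (hs : MeasurableSet s) (I : Finset ι) {G : ι → Set Ω} (hG : ∀ i, MeasurableSet (G i))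
    (hGs : ∀ i, G i ⊆ s) :
    ∫⁻ ω, ∑ i ∈ I, (G i).indicator 1 ω ∂μ[|s] = (μ s)⁻¹ * ∑ i ∈ I, μ (G i) := by
  rw [lintegral_finsetSum _ fun i _ => measurable_one.indicator (hG i), Finset.mul_sum]
  refine Finset.sum_congr rfl fun i _ => ?_
  rw [lintegral_indicator_one (hG i), cond_apply hs, Set.inter_eq_self_of_subset_right (hGs i)]

theorem lintegral_cond_sum_indicator_sq {Ω ι : Type*} [MeasurableSpace Ω] (μ : Measure Ω)
    {s : Set Ω} (hs : MeasurableSet s) (I : Finset ι) {G : ι → Set Ω}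
    (hG : ∀ i, MeasurableSet (G i)) (hGs : ∀ i, G i ⊆ s) :
    ∫⁻ ω, (∑ i ∈ I, (G i).indicator (1 : Ω → ℝ≥0∞) ω) ^ 2 ∂μ[|s]
      = (μ s)⁻¹ * ∑ i ∈ I, ∑ j ∈ I, μ (G i ∩ G j) := by
  have h : ∀ ω, (∑ i ∈ I, (G i).indicator (1 : Ω → ℝ≥0∞) ω) ^ 2
      = ∑ q ∈ I ×ˢ I, (G q.1 ∩ G q.2).indicator 1 ω := by
    intro ω
    rw [sq, Finset.sum_mul_sum, Finset.sum_product]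
    refine Finset.sum_congr rfl fun i _ => Finset.sum_congr rfl fun j _ => ?_
    rw [Set.inter_indicator_one, Pi.mul_apply]
  simp_rw [h]
  rw [lintegral_cond_sum_indicator μ hs (I ×ˢ I) (G := fun q : ι × ι => G q.1 ∩ G q.2)
    (fun q => (hG q.1).inter (hG q.2)) fun q => Set.inter_subset_left.trans (hGs q.1),
    Finset.sum_product]

variable {M : ℕ} [NeZero M] {p : PMF ℕ} (hp : IsCritical p)

instance {d : ℕ} (P : PMF (Fin d → ℤ)) (N : ℕ) : IsFiniteMeasure (pairLaw M p hp P N) := by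
  unfold pairLaw
  infer_instance

end Conditional


/-! ### Numerical bounds for the kernel sums. -/

section NumericBounds

variable {P : PMF (Fin 6 → ℤ)}

theorem branchBound_maxProb_le (hP : IsAdmissibleStep P) {nstar : ℕ} (hns : leastNStar P ≤ nstar)
    {α b : ℝ} (hα : 0 ≤ α) (hb : 0 ≤ b) (n : ℕ) :
    branchBound (ENNReal.ofReal α) (ENNReal.ofReal b) (maxProb P) n
      ≤ ENNReal.ofReal (α ^ 2 * (nstar ^ 3 + 32 * (1 / scaleD P ^ 6) * (1 + Real.log n))
        + 2 * α * b * (nstar ^ 2 + 32 * (1 / scaleD P ^ 6))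
        + b ^ 2 * (nstar + 32 * (1 / scaleD P ^ 6))) := by
  have hD := hP.scaleD_pos
  have hK : 0 ≤ 1 / scaleD P ^ 6 := by positivity
  have hl : 0 ≤ Real.log n := Real.log_natCast_nonneg n
  rw [ENNReal.ofReal_add (by positivity) (by positivity),
    ENNReal.ofReal_add (by positivity) (by positivity), ENNReal.ofReal_mul (by positivity),
    ENNReal.ofReal_mul (p := 2 * α * b) (by positivity),
    ENNReal.ofReal_mul (p := b ^ 2) (by positivity),
    ENNReal.ofReal_pow hα, ENNReal.ofReal_pow hb, ENNReal.ofReal_mul (p := 2 * α) (by positivity),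
    ENNReal.ofReal_mul (p := 2) (by positivity), ENNReal.ofReal_ofNat, branchBound]
  exact add_le_add (add_le_add (mul_le_mul_right (hP.sum_maxProb_three_le hns n n n) _)
    (mul_le_mul_right (hP.sum_maxProb_two_le hns n n) _))
    (mul_le_mul_right (hP.sum_maxProb_one_le hns n) _)

/-- Here `s` stands for `σ²` and `l` for `log N`. For large `l` the first bracket is at most `65 K
l` and `α² ≤ 16 s²`, while the two other terms are at most `s² K l` each; `1042 = 16 · 65 + 2`. -/
theorem branchBound_value_le {s s₀ α b K ν l : ℝ} (hs₀ : 0 < s₀) (hs : s₀ ≤ s) (hα : 0 ≤ α)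
    (hαs : α ≤ 4 * s) (hb : 0 ≤ b) (hK : 0 ≤ K) (hν : 0 ≤ ν) (hl : 1 ≤ l) (h₁ : ν ^ 3 ≤ K * l)
    (h₂ : 8 * b * (ν ^ 2 + 32 * K) / s₀ ≤ K * l) (h₃ : b ^ 2 * (ν + 32 * K) / s₀ ^ 2 ≤ K * l) :
    α ^ 2 * (ν ^ 3 + 32 * K * (1 + l)) + 2 * α * b * (ν ^ 2 + 32 * K) + b ^ 2 * (ν + 32 * K)
      ≤ 1042 * s ^ 2 * K * l := by
  have hs0 : 0 < s := hs₀.trans_le hs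
  have hKl : 0 ≤ K * l := by positivity
  have e1 : α ^ 2 * (ν ^ 3 + 32 * K * (1 + l)) ≤ (4 * s) ^ 2 * (65 * (K * l)) := by
    have h : 32 * K * (1 + l) ≤ 64 * (K * l) := by nlinarith
    gcongr
    linarith
  have e2 : 2 * α * b * (ν ^ 2 + 32 * K) ≤ s ^ 2 * (K * l) := by
    calc 2 * α * b * (ν ^ 2 + 32 * K) ≤ 2 * (4 * s) * b * (ν ^ 2 + 32 * K) := by gcongr
      _ = s * s₀ * (8 * b * (ν ^ 2 + 32 * K) / s₀) := by field_simp; ring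
      _ ≤ s * s * (K * l) := by gcongr
      _ = _ := by ring
  have e3 : b ^ 2 * (ν + 32 * K) ≤ s ^ 2 * (K * l) := by
    calc b ^ 2 * (ν + 32 * K) = s₀ ^ 2 * (b ^ 2 * (ν + 32 * K) / s₀ ^ 2) := by field_simp
      _ ≤ s ^ 2 * (K * l) := by gcongr
  calc _ ≤ (4 * s) ^ 2 * (65 * (K * l)) + s ^ 2 * (K * l) + s ^ 2 * (K * l) := by linarith
    _ = _ := by ring

end NumericBounds

/-! ### Arithmetic of heights and measurability of the events. -/

section Requirements

variable {M N : ℕ}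

theorem HeightsGood.nat_bounds {Z₁ Z₂ U₁ U₂ : List (Fin M)} (hh : HeightsGood N Z₁ Z₂ U₁ U₂) :
    5 * N ≤ 6 * U₁.length ∧ 12 * U₁.length ≤ 11 * N ∧ 3 * Z₁.length ≤ 2 * N ∧
      3 * Z₂.length ≤ 2 * N := by
  obtain ⟨h1, h2, -, ⟨-, h3⟩, -, h4⟩ := hh
  refine ⟨?_, ?_, ?_, ?_⟩
  · have : (5 : ℝ) * N ≤ 6 * U₁.length := by linarith
    exact_mod_cast this
  · have : (12 : ℝ) * U₁.length ≤ 11 * N := by linarith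
    exact_mod_cast this
  · have : (3 : ℝ) * Z₁.length ≤ 2 * N := by linarith
    exact_mod_cast this
  · have : (3 : ℝ) * Z₂.length ≤ 2 * N := by linarith
    exact_mod_cast this

theorem dependsOn_anchored_meetsFrom {d : ℕ} (P : PMF (Fin d → ℤ)) (x : Fin d → ℤ)
    (Z₁ Z₂ W₁ W₂ u₁ u₂ : List (Fin M)) (h₁ : Z₁ <+: W₁) (h₂ : Z₂ <+: W₂) :
    DependsOn (fun ξ => Anchored P x Z₁ Z₂ ξ ∧ MeetsFrom P x (1 / 2) W₁ W₂ u₁ u₂ ξ)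
      (pairPrefixes {W₁ ++ u₁} {W₂ ++ u₂} : Set (EdgePair M)) := by
  intro ξ ξ' h
  have hm : pairPrefixes {Z₁} {Z₂} ⊆ pairPrefixes {W₁ ++ u₁} {W₂ ++ u₂} :=
    pairPrefixes_mono (by simpa using h₁.trans (List.prefix_append _ _))
      (by simpa using h₂.trans (List.prefix_append _ _))
  have e1 : Anchored P x Z₁ Z₂ ξ = Anchored P x Z₁ Z₂ ξ' :=
    dependsOn_anchored Z₁ Z₂ fun i hi => h i (hm hi)
  have e2 : MeetsFrom P x (1 / 2) W₁ W₂ u₁ u₂ ξ = MeetsFrom P x (1 / 2) W₁ W₂ u₁ u₂ ξ' :=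
    dependsOn_meetsFrom (1 / 2) W₁ W₂ u₁ u₂ h
  simp only [e1, e2]

theorem measurableSet_extraEvent {d : ℕ} (P : PMF (Fin d → ℤ)) (x : Fin d → ℤ)
    (V₁ V₂ W₁ W₂ u₁ u₂ : List (Fin M)) {R : (EdgePair M → Fin d → ℤ) → Prop}
    (hR : MeasurableSet {ξ | R ξ}) (y₁ y₂ : List (Fin M)) :
    MeasurableSet (extraEvent (N := N) P x V₁ V₂ W₁ W₂ u₁ u₂ R y₁ y₂) :=
  measurableSet_pairEvent _ _ _ _ _ _ (hR.inter (measurableSet_meetsFrom P x _ _ _ _ _))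

theorem extraEvent_subset {d : ℕ} (P : PMF (Fin d → ℤ)) (x : Fin d → ℤ)
    (V₁ V₂ W₁ W₂ u₁ u₂ : List (Fin M)) (R : (EdgePair M → Fin d → ℤ) → Prop)
    (y₁ y₂ : List (Fin M)) : extraEvent (N := N) P x V₁ V₂ W₁ W₂ u₁ u₂ R y₁ y₂
      ⊆ pairEvent V₁ V₂ W₁ W₂ {u₁} {u₂} R := by
  rintro ω ⟨⟨hb₁, h₁⟩, ⟨hb₂, h₂⟩, hR, -⟩
  exact ⟨⟨hb₁, fun y hy => h₁ y (Finset.mem_insert_of_mem hy)⟩,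
    ⟨hb₂, fun y hy => h₂ y (Finset.mem_insert_of_mem hy)⟩, hR⟩

end Requirements

/-! ### Conditional moments of the count. -/

section Moments

variable {M N : ℕ} [NeZero M] {p : PMF ℕ} (hp : IsCritical p)

theorem exists_hasTreeFactor {Z v : List (Fin M)} {a b : Fin M} (hab : a ≠ b)
    (hV : (Z ++ b :: v).length = N) : ∃ κ : ℝ≥0∞,
      HasTreeFactor hp N (2 * N - (Z ++ [a]).length) (Z ++ b :: v) (Z ++ [a]) κ := by
  have hz : Z.length < N := by
    rw [← hV]
    simp
  have hget : (Z ++ b :: v)[Z.length]'(hV ▸ hz) = b := by simp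
  obtain ⟨κ, hκ⟩ := treeLaw_event hp hz hV (a := a) (by rw [hget]; exact hab)
  refine ⟨κ, fun L hL => ?_⟩
  have h := hκ L hL
  rw [List.take_left] at h
  rw [List.length_append, List.length_singleton, ← Nat.sub_sub, ← h]
  congr 1
  ext s
  simp [treeEvent]

variable {hp}

variable {Z₁ Z₂ v₁ v₂ u₁ u₂ : List (Fin M)} {a₁ b₁ a₂ b₂ : Fin M}

theorem lintegral_ncard_goodExtra_sq_le (hM : ∀ k, M < k → p k = 0) {t₀ : ℕ} {A B : ℝ}
    (hW : HasWeightBounds p M t₀ A B) (hA : 0 ≤ A) (hB : 1 ≤ B) (ht₀ : t₀ < N) (nstar : ℕ)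
    {d : ℕ} {P : PMF (Fin d → ℤ)} (hs : ∀ x, P x = P (-x)) (x : Fin d → ℤ)
    (h₁ : a₁ ≠ b₁) (h₂ : a₂ ≠ b₂)
    (hV₁ : (Z₁ ++ b₁ :: v₁).length = N) (hV₂ : (Z₂ ++ b₂ :: v₂).length = N)
    (hh : HeightsGood N Z₁ Z₂ (Z₁ ++ [a₁] ++ u₁) (Z₂ ++ [a₂] ++ u₂))
    (h0 : pairLaw M p hp P N (eventIW N P x (Z₁ ++ b₁ :: v₁) (Z₂ ++ b₂ :: v₂)
      (Z₁ ++ [a₁] ++ u₁) (Z₂ ++ [a₂] ++ u₂)) ≠ 0) :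
    ∫⁻ ω, ((goodExtra nstar P x (Z₁ ++ b₁ :: v₁) (Z₂ ++ b₂ :: v₂) (Z₁ ++ [a₁] ++ u₁)
        (Z₂ ++ [a₂] ++ u₂) ω).ncard : ℝ≥0∞) ^ 2 ∂(pairLaw M p hp P N)[|eventIW N P x
          (Z₁ ++ b₁ :: v₁) (Z₂ ++ b₂ :: v₂) (Z₁ ++ [a₁] ++ u₁) (Z₂ ++ [a₂] ++ u₂)]
      ≤ 2 * (branchBound (ENNReal.ofReal ((1 : ℕ) * A)) (ENNReal.ofReal (3 * B)) (maxProb P) N *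
        branchBound (ENNReal.ofReal ((2 : ℕ) * A)) (ENNReal.ofReal (3 * B)) (maxProb P) N) := by
  obtain ⟨κ₁, hκ₁⟩ := exists_hasTreeFactor hp h₁ hV₁
  obtain ⟨κ₂, hκ₂⟩ := exists_hasTreeFactor hp h₂ hV₂
  have hR := dependsOn_anchored_meetsFrom P x Z₁ Z₂ (Z₁ ++ [a₁]) (Z₂ ++ [a₂]) u₁ u₂
    (List.prefix_append _ _) (List.prefix_append _ _)
  have mR := measurableSet_of_dependsOn hR
  simp_rw [ncard_goodExtra h₁ h₂ hh]
  rw [eventIW_eq h₁ h₂ hh] at h0 ⊢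
  rw [lintegral_cond_sum_indicator_sq (pairLaw M p hp P N)
    (measurableSet_pairEvent _ _ _ _ _ _ mR) _
    (fun y : List (Fin M) × List (Fin M) => measurableSet_extraEvent P x _ _ _ _ _ _ mR y.1 y.2)
    (fun y => extraEvent_subset P x _ _ _ _ _ _ _ y.1 y.2)]
  have hlen := hh.2.2.1
  have hnat := hh.nat_bounds
  simp only [List.length_append] at hlen hnat
  have h := sum_pairLaw_extraEvent_inter_le (hp := hp) hM hW hA hB ht₀ hs x hκ₁ hκ₂
    (by simp) (by simp) (m := (Z₁ ++ [a₁] ++ u₁).length)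
    (by simp only [List.length_append]) (by simp only [List.length_append, hlen])
    (by simp only [List.length_append]; omega) hR
  refine (mul_le_mul_right (((sum_goodPairs_le _ _ _ _ _ _).trans (Finset.sum_le_sum fun s _ =>
    Finset.sum_le_sum fun y _ => sum_goodPairs_le _ _ _ _ _ _)).trans ?_) _).trans
    (le_of_eq ?_) (b := _ * (2 * (pairLaw M p hp P N (pairEvent (Z₁ ++ b₁ :: v₁)
      (Z₂ ++ b₂ :: v₂) (Z₁ ++ [a₁]) (Z₂ ++ [a₂]) {u₁} {u₂} fun ξ => Anchored P x Z₁ Z₂ ξ ∧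
          MeetsFrom P x (1 / 2) (Z₁ ++ [a₁]) (Z₂ ++ [a₂]) u₁ u₂ ξ) *
        (branchBound (ENNReal.ofReal ((1 : ℕ) * A)) (ENNReal.ofReal (3 * B)) (maxProb P) N *
        branchBound (ENNReal.ofReal ((2 : ℕ) * A)) (ENNReal.ofReal (3 * B)) (maxProb P) N))))
  · refine le_trans (le_of_eq ?_) h
    refine Finset.sum_congr rfl fun s _ => ?_
    rw [Finset.sum_comm]
  · rw [mul_left_comm, ← mul_assoc _ (pairLaw _ _ _ _ _ _),
      ENNReal.inv_mul_cancel h0 (measure_ne_top _ _), one_mul]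

/-- Fork distances range over `[A, S]`. The bound `1000 S ≤ N` makes `u`, of length about `N/6` at
least, longer than `128 S`, keeps the forks above `9N/12` because `5/6 - 9/12 = 1/12`, and keeps the
new vertices below height `N` because `U` is at most at `11N/12`. -/
theorem le_lintegral_ncard_goodExtra {P : PMF (Fin 6 → ℤ)} (hP : IsAdmissibleStep P) {A nstar : ℕ}
    (hA0 : 0 < A) (hA : nstar ≤ A) (t₁ : IsUpperThreshold P A) (t₂ : IsLocalThreshold P (1 / 2) 1 A)
    (t₆ : IsLocalThreshold P (1 / 2) 6 A) (x : Fin 6 → ℤ) {S : ℕ} (hS : 1000 * S ≤ N) {w : ℝ}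
    (hw : 0 ≤ w) (hw' : ∀ (T a t : ℕ) (u : List (Fin M)), 0 < a → a ≤ u.length → a ≤ S → t ≤ S →
      N + u.length + t ≤ T →
      ENNReal.ofReal w * gwLaw M p (gwEvent T ({u} : Finset (List (Fin M))))
        ≤ ∑ y ∈ forks u (u.length - a) (u.length + t), gwLaw M p (gwEvent T (insert y {u})))
    (h₁ : a₁ ≠ b₁) (h₂ : a₂ ≠ b₂)
    (hV₁ : (Z₁ ++ b₁ :: v₁).length = N) (hV₂ : (Z₂ ++ b₂ :: v₂).length = N)
    (hh : HeightsGood N Z₁ Z₂ (Z₁ ++ [a₁] ++ u₁) (Z₂ ++ [a₂] ++ u₂))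
    (h0 : pairLaw M p hp P N (eventIW N P x (Z₁ ++ b₁ :: v₁) (Z₂ ++ b₂ :: v₂)
      (Z₁ ++ [a₁] ++ u₁) (Z₂ ++ [a₂] ++ u₂)) ≠ 0) :
    ENNReal.ofReal (w ^ 2 * (spatialConst / scaleD P ^ 6) *
        ((1 / 16) * (Real.log ((S + 1 : ℕ) : ℝ) - 1 - Real.log (2 * A))))
      ≤ ∫⁻ ω, ((goodExtra nstar P x (Z₁ ++ b₁ :: v₁) (Z₂ ++ b₂ :: v₂) (Z₁ ++ [a₁] ++ u₁)
        (Z₂ ++ [a₂] ++ u₂) ω).ncard : ℝ≥0∞) ∂(pairLaw M p hp P N)[|eventIW N P x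
          (Z₁ ++ b₁ :: v₁) (Z₂ ++ b₂ :: v₂) (Z₁ ++ [a₁] ++ u₁) (Z₂ ++ [a₂] ++ u₂)] := by
  obtain ⟨κ₁, hκ₁⟩ := exists_hasTreeFactor hp h₁ hV₁
  obtain ⟨κ₂, hκ₂⟩ := exists_hasTreeFactor hp h₂ hV₂
  have hR := dependsOn_anchored_meetsFrom P x Z₁ Z₂ (Z₁ ++ [a₁]) (Z₂ ++ [a₂]) u₁ u₂
    (List.prefix_append _ _) (List.prefix_append _ _)
  have hR' : DependsOn (Anchored P x Z₁ Z₂)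
      (pairPrefixes {Z₁ ++ [a₁]} {Z₂ ++ [a₂]} : Set (EdgePair M)) := fun ξ ξ' h =>
    dependsOn_anchored Z₁ Z₂ fun i hi => h i (pairPrefixes_mono (by simp) (by simp) hi)
  have mR := measurableSet_of_dependsOn hR
  have hlen := hh.2.2.1
  have hnat := hh.nat_bounds
  have hU₁ := hh.1
  have hU₂ := hh.1
  rw [hlen] at hU₂
  simp_rw [ncard_goodExtra h₁ h₂ hh]
  rw [eventIW_eq h₁ h₂ hh] at h0 ⊢
  rw [lintegral_cond_sum_indicator (pairLaw M p hp P N)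
    (measurableSet_pairEvent _ _ _ _ _ _ mR) _
    (fun y : List (Fin M) × List (Fin M) => measurableSet_extraEvent P x _ _ _ _ _ _ mR y.1 y.2)
    (fun y => extraEvent_subset P x _ _ _ _ _ _ _ y.1 y.2)]
  set Q := pairLaw M p hp P N (pairEvent (Z₁ ++ b₁ :: v₁) (Z₂ ++ b₂ :: v₂) (Z₁ ++ [a₁])
    (Z₂ ++ [a₂]) {u₁} {u₂} fun ξ => Anchored P x Z₁ Z₂ ξ ∧
      MeetsFrom P x (1 / 2) (Z₁ ++ [a₁]) (Z₂ ++ [a₂]) u₁ u₂ ξ) with hQ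
  have hlen' := hlen
  have hnat' := hnat
  simp only [List.length_append, List.length_singleton] at hlen' hnat'
  have hSN : ∀ a : ℕ, a ≤ S → 12 * (a : ℝ) ≤ N := by
    intro a ha
    exact_mod_cast (show 12 * a ≤ N by omega)
  have hc0 : 0 ≤ w ^ 2 * (spatialConst / scaleD P ^ 6) := by
    have := hP.scaleD_pos
    have := spatialConst_pos
    positivity
  have hsum := sum_forkPairs_le (u₁ := u₁) (u₂ := u₂) (A := A) (S := S) (by omega) (by omega)
    (I := goodPairs N nstar (Z₁ ++ [a₁]) (Z₂ ++ [a₂]) u₁ u₂)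
    (fun α₂ h₂ α₁ h₁ t ht => by
      rw [Finset.mem_Icc] at h₁ h₂
      rw [Finset.mem_range] at ht
      have i1 := hSN α₁ (by omega)
      have i2 := hSN α₂ (by omega)
      refine forkPairs_subset_goodPairs hlen (by omega) (by omega) (by omega) (by omega)
        (by omega) (by omega) (by linarith) (by linarith) ?_
      simp only [List.length_append, List.length_singleton]
      omega)
    (fun y => pairLaw M p hp P N (extraEvent P x (Z₁ ++ b₁ :: v₁) (Z₂ ++ b₂ :: v₂) (Z₁ ++ [a₁])
      (Z₂ ++ [a₂]) u₁ u₂ (fun ξ => Anchored P x Z₁ Z₂ ξ ∧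
        MeetsFrom P x (1 / 2) (Z₁ ++ [a₁]) (Z₂ ++ [a₂]) u₁ u₂ ξ) y.1 y.2))
  refine le_trans ?_ (mul_le_mul_right hsum _)
  have hterm : ∀ α₂ ∈ Finset.Icc A S, ∀ α₁ ∈ Finset.Icc A α₂, ∀ t ∈ Finset.range α₂, _ :=
    fun α₂ h₂ α₁ h₁ t ht => by
      rw [Finset.mem_Icc] at h₁ h₂
      rw [Finset.mem_range] at ht
      exact le_sum_pairLaw_extraEvent (hp := hp) hP t₁ t₂ t₆ x hκ₁ hκ₂ hR' (a₁ := α₁) (a₂ := α₂)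
        (t := t) (u₁ := u₁) (u₂ := u₂) (by omega) h₁.1 h₁.2 ht (by omega) (by omega) hw
        (hw' _ _ _ _ (by omega) (by omega) (by omega) (by omega)
          (by simp only [List.length_append, List.length_singleton]; omega))
        (hw' _ _ _ _ (by omega) (by omega) (by omega) (by omega)
          (by simp only [List.length_append, List.length_singleton]; omega))
  refine le_trans ?_ (mul_le_mul_right (Finset.sum_le_sum fun α₂ h₂ => Finset.sum_le_sum
    fun α₁ h₁ => Finset.sum_le_sum fun t ht => hterm α₂ h₂ α₁ h₁ t ht) _)
  simp_rw [← Finset.sum_mul]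
  rw [← hQ, mul_left_comm Q⁻¹, ENNReal.inv_mul_cancel h0 (measure_ne_top _ _), mul_one]
  have hnn : ∀ α t : ℕ, 0 ≤ w ^ 2 * (spatialConst / scaleD P ^ 6) * (1 / ((α + t : ℕ) : ℝ) ^ 3) :=
    fun α t => mul_nonneg hc0 (by positivity)
  refine (ENNReal.ofReal_le_ofReal (mul_le_mul_of_nonneg_left (log_le_sum_cubes (S := S) hA0)
    hc0)).trans (le_of_eq ?_)
  simp_rw [Finset.mul_sum]
  rw [ENNReal.ofReal_sum_of_nonneg fun α _ => Finset.sum_nonneg fun _ _ => Finset.sum_nonneg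
    fun t _ => hnn α t]
  refine Finset.sum_congr rfl fun α _ => ?_
  rw [ENNReal.ofReal_sum_of_nonneg fun _ _ => Finset.sum_nonneg fun t _ => hnn α t]
  refine Finset.sum_congr rfl fun _ _ => ?_
  rw [ENNReal.ofReal_sum_of_nonneg fun t _ => hnn α t]

end Moments


/-! ### Thresholds uniform over the offspring laws. -/

section Thresholds

theorem survival_le_inv {M : ℕ} {p : PMF ℕ} (hM : ∀ k, M < k → p k = 0) (hp : IsCritical p)
    {σ₀ C₃ : ℝ} (hσ₀ : 0 < σ₀) (hC₃ : 0 < C₃) (hσ : σ₀ ≤ sigma p) (hC : thirdMoment p ≤ C₃) {t : ℕ}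
    (ht : 0 < t) :
    1 - gwProb p t (∅ : Finset (List (Fin M))) ≤ 1 / (σ₀ ^ 6 / (8 * C₃ ^ 2) * t) := by
  have hq : 0 < σ₀ ^ 6 / (8 * C₃ ^ 2) := by positivity
  have h := survival_mul_le hM hp hq.le (le_splitProb hM hσ₀ hσ hC) t
  have h0 := gwProb_le_one (p := p) t (∅ : Finset (List (Fin M)))
  have ht' : (0 : ℝ) < t := by exact_mod_cast ht
  rw [le_div_iff₀ (by positivity)]
  nlinarith

/-- The constant in the `1/t` decay of survival depends only on `σ₀` and `C₃`, hence so does `t₀`.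
-/
theorem exists_hasWeightBounds {σ₀ C₃ : ℝ} (hσ₀ : 0 < σ₀) (hC₃ : 0 < C₃) :
    ∃ t₀ : ℕ, ∀ (M : ℕ) (p : PMF ℕ), (∀ k, M < k → p k = 0) → IsCritical p → σ₀ ≤ sigma p →
      thirdMoment p ≤ C₃ → HasWeightBounds p M t₀ (2 * sigma p ^ 2) (2 + 2 * C₃ / σ₀ ^ 2) ∧
      ∀ t, t₀ ≤ t → sigma p ^ 2 / 2 * genDeriv p M 1 (gwProb p t (∅ : Finset (List (Fin M))))
        ≤ genDeriv p M 2 (gwProb p t (∅ : Finset (List (Fin M)))) := by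
  set q := σ₀ ^ 6 / (8 * C₃ ^ 2) with hq
  have hq0 : 0 < q := by positivity
  set δ := min (1 / 2) (σ₀ ^ 2 / 2) with hδ
  have hδ0 : 0 < δ := by positivity
  obtain ⟨n, hn⟩ := exists_nat_ge ((1 + C₃) / (δ * q))
  refine ⟨n + 1, fun M p hM hp hσ hC => hasWeightBounds hM hp hσ₀ hσ hC fun t ht => ?_⟩
  have h := survival_le_inv hM hp hσ₀ hC₃ hσ hC (t := t) (by omega)
  have ht' : (0 : ℝ) < t := by exact_mod_cast (show 0 < t by omega)
  refine (mul_le_mul_of_nonneg_right h (by positivity)).trans ?_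
  have h1 : (1 + C₃) / (δ * q) ≤ t := hn.trans (by exact_mod_cast (by omega))
  rw [div_le_iff₀ (by positivity)] at h1
  rw [← hq, div_mul_eq_mul_div, div_le_iff₀ (by positivity)]
  linarith

/-- Fork distances are kept below `S ≤ √N`, while survival over the at least `N ≥ S²` remaining
generations has probability at most `1 / (q S²)`. The loss in the generation mean is therefore of
order `1 / (q S)`, however small `q` is. Restricting to `√N` only halves the logarithm. -/
theorem exists_forks_bound {σ₀ C₃ : ℝ} (hσ₀ : 0 < σ₀) (hC₃ : 0 < C₃) :
    ∃ n : ℕ, ∀ (M : ℕ) (p : PMF ℕ), (∀ k, M < k → p k = 0) → IsCritical p → σ₀ ≤ sigma p →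
      thirdMoment p ≤ C₃ → ∀ N S : ℕ, n ≤ S → S * S ≤ N → ∀ (T a t : ℕ) (u : List (Fin M)), 0 < a →
      a ≤ u.length → a ≤ S → t ≤ S → N + u.length + t ≤ T →
      ENNReal.ofReal (sigma p ^ 2 / 4) * gwLaw M p (gwEvent T ({u} : Finset (List (Fin M))))
        ≤ ∑ y ∈ forks u (u.length - a) (u.length + t), gwLaw M p (gwEvent T (insert y {u})) := by
  obtain ⟨t₀, ht₀⟩ := exists_hasWeightBounds hσ₀ hC₃
  set q := σ₀ ^ 6 / (8 * C₃ ^ 2) with hq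
  have hq0 : 0 < q := by positivity
  obtain ⟨n, hn⟩ := exists_nat_ge (4 * (1 + C₃) / q)
  refine ⟨max t₀ (n + 1), fun M p hM hp hσ hC N S hnS hSN T a t u ha hau haS htS hT => ?_⟩
  obtain ⟨hW, hW'⟩ := ht₀ M p hM hp hσ hC
  have hS0 : 0 < S := by omega
  have hSN' : S ≤ N := (Nat.le_mul_of_pos_left S hS0).trans hSN
  refine sigma_sq_le_sum_forks hM hp hW hW' ha hau (by omega) ?_
  have h := survival_le_inv hM hp hσ₀ hC₃ hσ hC (t := T - u.length - t) (by omega)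
  have hs : 0 ≤ 1 - gwProb p (T - u.length - t) (∅ : Finset (List (Fin M))) :=
    sub_nonneg.2 (gwProb_le_one _ _)
  have hτ : (S : ℝ) * S ≤ ((T - u.length - t : ℕ) : ℝ) := by
    exact_mod_cast hSN.trans (by omega)
  have hSr : (0 : ℝ) < S := by exact_mod_cast hS0
  have hqS : 4 * (1 + C₃) ≤ q * S := by
    rw [← div_le_iff₀' hq0]
    exact hn.trans (by exact_mod_cast (by omega))
  have hσC : sigma p ^ 2 ≤ C₃ := (sigma_sq_le hM).trans hC
  calc ((a + t : ℕ) : ℝ) * ((1 + sigma p ^ 2) *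
        (1 - gwProb p (T - u.length - t) (∅ : Finset (List (Fin M)))))
      ≤ (2 * S) * ((1 + C₃) * (1 / (q * (S * S)))) := by
        gcongr
        · exact_mod_cast (by omega)
        · exact h.trans (by gcongr)
    _ = 2 * (1 + C₃) / (q * S) := by field_simp
    _ ≤ 1 / 2 := by
        rw [div_le_iff₀ (by positivity)]
        linarith

end Thresholds

/-! ### Assembly. -/

section Conclusion

/-- A single outcome in the event fixes all deterministic data. Heights force `U` and `V` to
continue beyond their common ancestor, where their letters differ. -/
theorem exists_fork_data {M N d : ℕ} {P : PMF (Fin d → ℤ)} {x : Fin d → ℤ}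
    {V₁ V₂ U₁ U₂ : List (Fin M)} (hN : 0 < N)
    (h : (eventIW N P x V₁ V₂ U₁ U₂).Nonempty) :
    ∃ Z₁ a₁ u₁ b₁ v₁ Z₂ a₂ u₂ b₂ v₂, a₁ ≠ b₁ ∧ a₂ ≠ b₂ ∧ U₁ = Z₁ ++ [a₁] ++ u₁ ∧
      V₁ = Z₁ ++ b₁ :: v₁ ∧ U₂ = Z₂ ++ [a₂] ++ u₂ ∧ V₂ = Z₂ ++ b₂ :: v₂ ∧ V₁.length = N ∧
      V₂.length = N ∧ HeightsGood N Z₁ Z₂ U₁ U₂ := by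
  obtain ⟨ω, hω⟩ := h
  have hN' : (0 : ℝ) < N := by exact_mod_cast hN
  have hback : ∀ s : TreeSample M N, (backbone s N).length = N := fun s => by
    rw [length_backbone]
    simp
  have hV₁ : V₁.length = N := hω.1 ▸ hback _
  have hV₂ : V₂.length = N := hω.2.1 ▸ hback _
  have key : ∀ {U V : List (Fin M)}, V.length = N → ((hca U V).length : ℝ) ≤ (4 / 6) * N →
      (5 / 6 : ℝ) * N ≤ U.length → ∃ Z a u b v, a ≠ b ∧ U = Z ++ [a] ++ u ∧ V = Z ++ b :: v := by
    intro U V hV h1 h2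
    refine exists_fork ?_ ?_
    · have : ((hca U V).length : ℝ) < U.length := by linarith
      exact_mod_cast this
    · have : ((hca U V).length : ℝ) < V.length := by rw [hV]; linarith
      exact_mod_cast this
  obtain ⟨e₁, e₂, ⟨⟨hs₁, hs₂, hl, he⟩, hm, hs₁', hs₂'⟩⟩ := id hω
  obtain ⟨-, i1, -, -, i2, -⟩ := hs₁
  obtain ⟨-, j1, -, -, j2, -⟩ := hs₂
  rw [e₁] at i2
  rw [e₂] at j2
  obtain ⟨Z₁, a₁, u₁, b₁, v₁, h₁, rfl, rfl⟩ := key hV₁ i2 i1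
  obtain ⟨Z₂, a₂, u₂, b₂, v₂, h₂, rfl, rfl⟩ := key hV₂ j2 j1
  exact ⟨Z₁, a₁, u₁, b₁, v₁, Z₂, a₂, u₂, b₂, v₂, h₁, h₂, rfl, rfl, rfl, rfl, hV₁, hV₂,
    ((mem_eventIW_iff h₁ h₂ ω).1 hω).2⟩

theorem measurable_ncard_goodExtra {M N d nstar : ℕ} {P : PMF (Fin d → ℤ)} {x : Fin d → ℤ}
    {Z₁ Z₂ v₁ v₂ u₁ u₂ : List (Fin M)} {a₁ b₁ a₂ b₂ : Fin M} (h₁ : a₁ ≠ b₁) (h₂ : a₂ ≠ b₂)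
    (hh : HeightsGood N Z₁ Z₂ (Z₁ ++ [a₁] ++ u₁) (Z₂ ++ [a₂] ++ u₂)) :
    Measurable fun ω : WalkSample M d N × WalkSample M d N =>
      ((goodExtra nstar P x (Z₁ ++ b₁ :: v₁) (Z₂ ++ b₂ :: v₂) (Z₁ ++ [a₁] ++ u₁)
        (Z₂ ++ [a₂] ++ u₂) ω).ncard : ℝ≥0∞) := by
  simp_rw [ncard_goodExtra h₁ h₂ hh]
  refine Finset.measurable_fun_sum _ fun y _ => measurable_one.indicator ?_
  exact measurableSet_extraEvent P x _ _ _ _ _ _ (measurableSet_of_dependsOn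
    (dependsOn_anchored_meetsFrom P x Z₁ Z₂ _ _ u₁ u₂ (List.prefix_append _ _)
      (List.prefix_append _ _))) _ _

end Conclusion

end BRW

open BRW in
theorem theorem3p3 :
    ∃ c' C' : ℝ, 0 < c' ∧ 0 < C' ∧
      ∀ P : PMF (Fin 6 → ℤ), BRW.IsAdmissibleStep P →
      ∀ nstar : ℕ, BRW.leastNStar P ≤ nstar →
      ∀ σ₀ C₃ : ℝ, 0 < σ₀ →
      ∃ n₉ : ℕ,
        ∀ (M : ℕ) [NeZero M] (p : PMF ℕ) (hp : BRW.IsCritical p),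
        (∀ k, M < k → p k = 0) → σ₀ ≤ BRW.sigma p → BRW.thirdMoment p ≤ C₃ →
        ∀ N : ℕ, n₉ ≤ N →
        ∀ x : Fin 6 → ℤ, BRW.wnorm P x ≤ √(N : ℝ) →
        ∀ V₁ V₂ U₁ U₂ : List (Fin M),
        BRW.pairLaw M p hp P N (BRW.eventIW N P x V₁ V₂ U₁ U₂) ≠ 0 →
        -- first moment
        ENNReal.ofReal (c' * BRW.sigma p ^ 4 / BRW.scaleD P ^ 6 * Real.log N)
          ≤ ∫⁻ ω, ((BRW.goodExtra nstar P x V₁ V₂ U₁ U₂ ω).ncard : ℝ≥0∞)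
              ∂(BRW.pairLaw M p hp P N)[|BRW.eventIW N P x V₁ V₂ U₁ U₂] ∧
        -- second moment
        ∫⁻ ω, ((BRW.goodExtra nstar P x V₁ V₂ U₁ U₂ ω).ncard : ℝ≥0∞) ^ 2
              ∂(BRW.pairLaw M p hp P N)[|BRW.eventIW N P x V₁ V₂ U₁ U₂]
          ≤ ENNReal.ofReal (C' * BRW.sigma p ^ 8 / BRW.scaleD P ^ 12 * Real.log N ^ 2) ∧
        -- lower bound on the conditional probability, with `c'₀ = c' / 2`
        ENNReal.ofReal (4 * c' ^ 2 / C')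
          ≤ (BRW.pairLaw M p hp P N)[|BRW.eventIW N P x V₁ V₂ U₁ U₂]
              {ω | c' / 2 * BRW.sigma p ^ 4 / BRW.scaleD P ^ 6 * Real.log N
                ≤ ((BRW.goodExtra nstar P x V₁ V₂ U₁ U₂ ω).ncard : ℝ)} := by
  have hsc := spatialConst_pos
  -- `1024 = 16 · 16 · 4`: from `(σ²/4)²`, from the `1/16` in `log_le_sum_cubes`, and from the
  -- remaining logarithm being at least `log N / 4`. The second moment is bounded with `2 · 1042²`
  -- already; the factor `16` turns the bound `θ² / (4 S)` of `half_le_of_moments` into the required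
  -- `4 c'² / C'`.
  refine ⟨spatialConst / 1024, 16 * (2 * 1042 ^ 2), by positivity, by norm_num, ?_⟩
  intro P hP nstar hns σ₀ C₃ hσ₀
  -- For `C₃ ≤ 0` no law qualifies, since `0 < σ² ≤ ∑ k³ p(k)`.
  rcases le_or_gt C₃ 0 with hC₃ | hC₃
  · refine ⟨0, fun M _ p hp hM hσ hC => absurd ((sigma_sq_le hM).trans (hC.trans hC₃)) ?_⟩
    have : 0 < sigma p := hσ₀.trans_le hσ
    exact not_le.2 (by positivity)
  obtain ⟨t₀, ht₀⟩ := exists_hasWeightBounds hσ₀ hC₃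
  obtain ⟨n, hn⟩ := exists_forks_bound hσ₀ hC₃
  obtain ⟨m₁, hm₁⟩ := hP.exists_isLocalThreshold (by norm_num) (ε := 1 / 2) (by norm_num) 1
  obtain ⟨m₆, hm₆⟩ := hP.exists_isLocalThreshold (by norm_num) (ε := 1 / 2) (by norm_num) 6
  -- The smallest fork distance: at least `n*`, as good branches require, and beyond both local
  -- thresholds. It costs only `log (2A)`.
  set A := max nstar (max m₁ m₆) with hA
  have hA0 : 0 < A := (hP.nStar_pos (by norm_num) hns).trans_le (le_max_left _ _)
  have k₁ : IsLocalThreshold P (1 / 2) 1 A := fun n hn => hm₁ n (by omega)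
  have k₆ : IsLocalThreshold P (1 / 2) 6 A := fun n hn => hm₆ n (by omega)
  have k₀ : IsUpperThreshold P A :=
    hP.isUpperThreshold (by norm_num) (hns.trans (le_max_left _ _))
  have hD := hP.scaleD_pos
  set K := 1 / scaleD P ^ 6 with hK
  have hK0 : 0 < K := by positivity
  set B := 2 + 2 * C₃ / σ₀ ^ 2 with hB
  have hB1 : 1 ≤ B := by
    have : 0 ≤ 2 * C₃ / σ₀ ^ 2 := by positivity
    linarith
  have hlog : Filter.Tendsto (fun N : ℕ => Real.log N) Filter.atTop Filter.atTop :=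
    Real.tendsto_log_atTop.comp tendsto_natCast_atTop_atTop
  -- The logarithm must dominate the lower-order kernel sums and `log (2A)`; `N ≥ 1000²` ensures
  -- `1000 √N ≤ N`, and the last two conditions serve `exists_forks_bound` and the weight bounds.
  obtain ⟨n₉, hn₉⟩ := Filter.eventually_atTop.1
    ((((hlog.eventually_ge_atTop 1).and (hlog.eventually_ge_atTop (nstar ^ 3 / K))).and
      ((hlog.eventually_ge_atTop (8 * (3 * B) * (nstar ^ 2 + 32 * K) / σ₀ ^ 2 / K)).and
      (hlog.eventually_ge_atTop ((3 * B) ^ 2 * (nstar + 32 * K) / (σ₀ ^ 2) ^ 2 / K)))).and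
      ((hlog.eventually_ge_atTop (4 * (1 + Real.log (2 * A)))).and
      ((Filter.eventually_ge_atTop (1000 * 1000)).and
        ((Filter.eventually_ge_atTop (n * n)).and (Filter.eventually_ge_atTop (t₀ + 1))))))
  refine ⟨n₉, fun M _ p hp hM hσ hC N hN x _ V₁ V₂ U₁ U₂ h0 => ?_⟩
  obtain ⟨⟨⟨l1, l2⟩, l3, l4⟩, l5, l6, l7, l8⟩ := hn₉ N hN
  set l := Real.log N with hl
  obtain ⟨Z₁, a₁, u₁, b₁, v₁, Z₂, a₂, u₂, b₂, v₂, h₁, h₂, rfl, rfl, rfl, rfl, hV₁, hV₂, hh⟩ :=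
    exists_fork_data (by omega) (nonempty_of_measure_ne_zero h0)
  have hs : 0 < sigma p := hσ₀.trans_le hσ
  have hs2 : σ₀ ^ 2 ≤ sigma p ^ 2 := by gcongr
  -- the first moment
  have hSn : n ≤ Nat.sqrt N := Nat.le_sqrt.2 l7
  have hSN : Nat.sqrt N * Nat.sqrt N ≤ N := Nat.sqrt_le N
  have hS3 : 1000 ≤ Nat.sqrt N := Nat.le_sqrt.2 l6
  have hlogS : l ≤ 2 * Real.log ((Nat.sqrt N + 1 : ℕ) : ℝ) := by
    rw [hl, ← Real.log_rpow (by positivity)]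
    refine Real.log_le_log (by exact_mod_cast (by omega)) ?_
    have : N ≤ (Nat.sqrt N + 1) ^ 2 := (Nat.lt_succ_sqrt' N).le
    rw [Real.rpow_two]
    exact_mod_cast this
  have first := le_lintegral_ncard_goodExtra (hp := hp) hP hA0 (le_max_left _ _) k₀ k₁ k₆ x
    ((Nat.mul_le_mul_right _ hS3).trans hSN) (w := sigma p ^ 2 / 4) (by positivity)
    (hn M p hM hp hσ hC N _ hSn hSN) h₁ h₂ hV₁ hV₂ hh h0
  have hθ : spatialConst / 1024 * sigma p ^ 4 / scaleD P ^ 6 * l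
      ≤ (sigma p ^ 2 / 4) ^ 2 * (spatialConst / scaleD P ^ 6) *
        (1 / 16 * (Real.log ((Nat.sqrt N + 1 : ℕ) : ℝ) - 1 - Real.log (2 * A))) := by
    have e : spatialConst / 1024 * sigma p ^ 4 / scaleD P ^ 6 * l
        = (sigma p ^ 2 / 4) ^ 2 * (spatialConst / scaleD P ^ 6) * (1 / 16 * (l / 4)) := by
      ring
    rw [e]
    refine mul_le_mul_of_nonneg_left ?_ (by positivity)
    linarith
  have first' := (ENNReal.ofReal_le_ofReal hθ).trans first
  -- the second moment
  obtain ⟨hW, -⟩ := ht₀ M p hM hp hσ hC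
  have bound : ∀ c : ℕ, c ≤ 2 → branchBound (ENNReal.ofReal (c * (2 * sigma p ^ 2)))
      (ENNReal.ofReal (3 * B)) (maxProb P) N
      ≤ ENNReal.ofReal (1042 * (sigma p ^ 2) ^ 2 * K * l) := by
    intro c hc
    have hc' : (c : ℝ) ≤ 2 := by exact_mod_cast hc
    refine (branchBound_maxProb_le hP hns (by positivity) (by linarith) N).trans
      (ENNReal.ofReal_le_ofReal ?_)
    refine branchBound_value_le (s₀ := σ₀ ^ 2) (by positivity) hs2 (by positivity) ?_
      (by linarith) hK0.le (by positivity) l1 ?_ ?_ ?_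
    · nlinarith [sq_nonneg (sigma p)]
    · exact (div_le_iff₀' hK0).1 l2
    · exact (div_le_iff₀' hK0).1 l3
    · exact (div_le_iff₀' hK0).1 l4
  have second := lintegral_ncard_goodExtra_sq_le (hp := hp) hM hW (by positivity) hB1
    (show t₀ < N by omega) nstar hP.symm x h₁ h₂ hV₁ hV₂ hh h0
  have hB₁₂ : 2 * (ENNReal.ofReal (1042 * (sigma p ^ 2) ^ 2 * K * l) *
      ENNReal.ofReal (1042 * (sigma p ^ 2) ^ 2 * K * l))
      = ENNReal.ofReal (2 * 1042 ^ 2 * sigma p ^ 8 / scaleD P ^ 12 * l ^ 2) := by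
    rw [← ENNReal.ofReal_mul (by positivity), show (2 : ℝ≥0∞) = ENNReal.ofReal 2 by simp,
      ← ENNReal.ofReal_mul (by norm_num)]
    congr 1
    rw [hK]
    ring
  have second' := second.trans ((mul_le_mul_right (mul_le_mul' (bound 1 (by norm_num))
    (bound 2 le_rfl)) _).trans (le_of_eq hB₁₂))
  refine ⟨first', second'.trans (ENNReal.ofReal_le_ofReal ?_), ?_⟩
  · have : 0 ≤ 2 * 1042 ^ 2 * sigma p ^ 8 / scaleD P ^ 12 * l ^ 2 := by positivity
    have e : 16 * (2 * 1042 ^ 2) * sigma p ^ 8 / scaleD P ^ 12 * l ^ 2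
      = 16 * (2 * 1042 ^ 2 * sigma p ^ 8 / scaleD P ^ 12 * l ^ 2) := by ring
    rw [e]
    linarith
  have := cond_isProbabilityMeasure h0
  have third := half_le_of_moments _ (measurable_ncard_goodExtra (nstar := nstar) (P := P) (x := x)
    h₁ h₂ hh) (by positivity) (by positivity) first' second'
  refine le_trans (le_of_eq ?_) (third.trans (le_of_eq ?_))
  · congr 1
    field_simp
    norm_num
  · congr 1
    ext ω
    rw [Set.mem_ofPred_eq, Set.mem_ofPred_eq]
    have e : spatialConst / 1024 * sigma p ^ 4 / scaleD P ^ 6 * l / 2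
      = spatialConst / 1024 / 2 * sigma p ^ 4 / scaleD P ^ 6 * l := by ring
    rw [e]
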